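/- **Conventions.** Let $R=\bigoplus_{k\in\mathbb Z}R^k$ be a graded commutative ring containing $\mathbb Q$. All modules are graded $R$-modules, all elements are homogeneous, $V[1]^k=V^{k+1}$ with $r\cdot sv=(-1)^{|r|}s(rv)$, and $|x|'=|x|-1$. For a variable $z$ of degree $2$, $V[[z]]$ is the graded $R[[z]]$-module whose degree $d$ part consists of the series $\sum_n v_nz^n$ with $v_n\in V^{d-2n}$. Maps are extended $z$-linearly without change of notation, and $[\cdot,\cdot]$ between operators is the graded commutator. **Hochschild complexes.** Let $\mathscr A$ be a set of objects with a graded $R$-module $\mathrm{Hom}(X,Y)$ for each pair of objects and a unit $\mathbb 1\in\mathrm{Hom}(X,X)^0$ for each object $X$. Put $\mathscr A(X_0,\dots,X_k)=\mathrm{Hom}(X_0,X_1)[1]\otimes_R\cdots\otimes_R\mathrm{Hom}(X_{k-1},X_k)[1]$. Let $CC^\bullet(\mathscr A)[1]$ be the graded module whose degree $p$ part is $\prod_{k\ge0,\,X_0,\dots,X_k}\mathrm{Hom}^p_R(\mathscr A(X_0,\dots,X_k),\mathrm{Hom}(X_0,X_k)[1])$; the degree of $\varphi$ in it is written $|\varphi|'$.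 Let $CC_\bullet(\mathscr A)[1]=\bigoplus_{k\ge 0,\,X_0,\dots,X_k}\mathscr A(X_0,\dots,X_k,X_0)$. The reduced cochains $\overline{CC}^\bullet(\mathscr A)[1]$ are those $\varphi$ with $\varphi(\dots,\mathbb 1,\dots)=0$. The reduced chains $\overline{CC}_\bullet(\mathscr A)[1]$ are the quotient by all $x_0\otimes\cdots\otimes x_k$ with $x_i=\mathbb 1$ for some $i\ge1$. Put $$(\varphi\circ\psi)(x_1,\dots,x_k)=\sum_{0\le i\le j\le k}(-1)^{|\psi|'(|x_1|'+\cdots+|x_i|')}\varphi(x_1,\dots,x_i,\psi(x_{i+1},\dots,x_j),x_{j+1},\dots,x_k),$$ $$[\varphi,\psi]=\varphi\circ\psi-(-1)^{|\varphi|'|\psi|'}\psi\circ\varphi .$$ A strictly unital curved $A_\infty$ structure on $\mathscr A$ is an element $m\in CC^\bullet(\mathscr A)[1]$ of degree $1$, with length $k$ components $m_k$, $k\ge0$, such that $[m,m]=0$, $m_2(\mathbb 1,x)=x=(-1)^{|x|}m_2(x,\mathbb 1)$, and $m_k(\dots,\mathbb 1,\dots)=0$ for $k\ne2$. Fix such an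 $m$. For $\mathbb X=x_0\otimes\cdots\otimes x_k$ write $\sigma_{a,b}=|x_a|'+\cdots+|x_b|'$ (zero if $a>b$) and define $$\mathcal L_\varphi(\mathbb X)=\sum_{0\le i\le j\le k}(-1)^{|\varphi|'\sigma_{0,i}}x_0\otimes\cdots\otimes x_i\otimes\varphi(x_{i+1},\dots,x_j)\otimes x_{j+1}\otimes\cdots\otimes x_k+\sum_{0\le i\le j\le k}(-1)^{\sigma_{0,j}\sigma_{j+1,k}}\varphi(x_{j+1},\dots,x_k,x_0,\dots,x_i)\otimes x_{i+1}\otimes\cdots\otimes x_j,$$ $$\rho_{\varphi,\psi}(\mathbb X)=\sum_{0\le i\le j\le s\le t\le k}(-1)^{|\psi|'\sigma_{j+1,s}+\sigma_{0,j}\sigma_{j+1,k}}\varphi(x_{j+1},\dots,x_s,\psi(x_{s+1},\dots,x_t),x_{t+1},\dots,x_k,x_0,\dots,x_i)\otimes x_{i+1}\otimes\cdots\otimes x_j,$$ $$B(\mathbb X)=\sum_{0\le i\le k}(-1)^{\sigma_{0,i}\sigma_{i+1,k}}\mathbb 1\otimes x_{i+1}\otimes\cdots\otimes x_k\otimes x_0\otimes\cdots\otimes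 x_i,$$ $$B^1_\varphi(\mathbb X)=\sum_{0\le i\le j\le s\le k}(-1)^{\sigma_{0,i}\sigma_{i+1,k}+|\varphi|'\sigma_{i+1,j}}\mathbb 1\otimes x_{i+1}\otimes\cdots\otimes x_j\otimes\varphi(x_{j+1},\dots,x_s)\otimes x_{s+1}\otimes\cdots\otimes x_k\otimes x_0\otimes\cdots\otimes x_i,$$ $$b=\mathcal L_m,\qquad b^1_\varphi=\rho_{m,\varphi},\qquad \delta=[m,\cdot\,],\qquad d=b+zB,\qquad I_\varphi=b^1_\varphi+zB^1_\varphi .$$ **CH structures.** For a graded module $L$ over a graded commutative ring $S$, set $EL=\bigoplus_{k\ge0}L[1]^{\odot k}$. A family $\ell_k:L[1]^{\odot k}\to L[1]$ ($k\ge1$) of $S$-linear maps of degree $1$ makes $L$ an $L_\infty$ algebra if the corresponding coderivation $\widehat\ell$ of $EL$ squares to zero. A DGLA is viewed as an $L_\infty$ algebra by $\ell_1(y)=-\delta y$, $\ell_2(y_1,y_2)=(-1)^{|y_1|}[y_1,y_2]$ and $\ell_k=0$ for $k\ge3$. Let $L$ be an $L_\infty$ algebra over $R$ and let $\epsilon$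 be a variable of degree $1$. The cone $\widetilde L=L[[z]]\oplus\epsilon L[[z]]$ carries the operations on $\widetilde L[1]=L[1][[z]]\oplus\epsilon L[1][[z]]$ $$\widetilde\ell_k(y_1+\epsilon y_1',\dots,y_k+\epsilon y_k')=\ell_k(y_1,\dots,y_k)-\epsilon\sum_{i=1}^k(-1)^{|y_1|'+\cdots+|y_{i-1}|'}\ell_k(y_1,\dots,y_i',\dots,y_k)+\begin{cases}zy_1'&k=1\\0&k\ge2.\end{cases}$$ Let $\widetilde M$ be a graded $R[[z]]$-module and let $\ell_k^{\widetilde M}:\widetilde L[1]^{\odot k}\otimes\widetilde M[1]\to\widetilde M[1]$ ($k\ge0$) be $R[[z]]$-linear maps of degree $1$. Let $\widehat\ell^{\widetilde M}$ be the coderivation of $E\widetilde L\otimes\widetilde M[1]$ determined by $\widetilde\ell$ and $\ell^{\widetilde M}$: $$\widehat\ell^{\widetilde M}(y_1,\dots,y_k|x)=\sum_{p\ge1,\,\sigma}\epsilon(\sigma)\,\widetilde\ell_p(y_{\sigma(1)},\dots,y_{\sigma(p)})\odot\cdots\odot y_{\sigma(k)}\otimes x+\sum_{p\ge0,\,\sigma}(-1)^{|y_{\sigma(1)}|'+\cdots+|y_{\sigma(p)}|'}\epsilon(\sigma)\,y_{\sigma(1)}\odot\cdots\odot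 y_{\sigma(p)}\otimes\ell^{\widetilde M}_{k-p}(y_{\sigma(p+1)},\dots,y_{\sigma(k)}|x),$$ where $\sigma$ runs over the $(p,k-p)$-shuffles and $\epsilon(\sigma)$ is the Koszul sign. Give $E\widetilde L\otimes\widetilde M[1]$ the decreasing filtration $F^\bullet$ induced by $F^a\widetilde L[1]=\widetilde L[1]$ for $a\le-1$, $F^0\widetilde L[1]=L[1][[z]]$, $F^a\widetilde L[1]=0$ for $a\ge1$, and by $F^a\widetilde M[1]=\widetilde M[1]$ for $a\le0$, $F^a\widetilde M[1]=0$ for $a\ge1$. A CH structure on $\widetilde M$ over $L$ is a family $\{\ell_k^{\widetilde M}\}$ which is an $L_\infty$ module structure over $\widetilde L$ modulo $\epsilon^2$, i.e. $(\widehat\ell^{\widetilde M}\circ\widehat\ell^{\widetilde M})(F^a)\subset F^{a+2}$ for all $a\in\mathbb Z$. **Theorem.** Let $m$ be a strictly unital curved $A_\infty$ structure on $\mathscr A$, and put $L=\overline{CC}^\bullet(\mathscr A)[1]$ and $\widetilde M=\overline{CC}_\bullet(\mathscr A)[1][[z]]$. Then $(L,\delta,[\cdot,\cdot])$ is a DGLA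 over $R$; the operators $b$, $B$ and, for $\varphi,\psi\in L$, the operators $\mathcal L_\varphi$, $\rho_{\varphi,\psi}$, $b^1_\varphi$, $B^1_\varphi$ are well defined on the reduced chains; and the graded symmetric family of operations given by $$\ell_0^{\widetilde M}=-d,\qquad \ell_1^{\widetilde M}(y|\cdot)=(-1)^{|y|}\mathcal L_y,\qquad \ell_1^{\widetilde M}(\epsilon y|\cdot)=(-1)^{|y|+1}I_y,\qquad \ell_2^{\widetilde M}(y_1,\epsilon y_2|\cdot)=(-1)^{|y_1|+|y_2|}\rho_{y_1,y_2}\qquad(y,y_1,y_2\in L[[z]]),$$ where $|\cdot|$ is the degree in $L[[z]]$, together with $\ell_2^{\widetilde M}(y_1,y_2|\cdot)=\ell_2^{\widetilde M}(\epsilon y_1,\epsilon y_2|\cdot)=0$ and $\ell_k^{\widetilde M}=0$ for $k\ge3$, is a CH structure on $\widetilde M$ over the DGLA $L$. -/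

import Mathlib

open Finset.HasAntidiagonal (antidiagonal mem_antidiagonal)

universe u v w

noncomputable section

namespace CHStruct

/-! ## Graded commutative rings and graded modules

Only homogeneous elements matter.  A graded object `⊕ V^d` is given by its homogeneous parts
`deg d`, realised as subgroups of some abelian group which merely serves as a container. -/

/-- A (ℤ-)graded ring that is graded commutative, given by its homogeneous parts. -/
structure GrRing where
  carrier : Type u
  [ring : Ring carrier]
  deg : ℤ → AddSubgroup carrier
  one_mem : (1 : carrier) ∈ deg 0
  mul_mem : ∀ {i j : ℤ} {r s : carrier}, r ∈ deg i → s ∈ deg j → r * s ∈ deg (i + j)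
  graded_comm : ∀ {i j : ℤ} {r s : carrier}, r ∈ deg i → s ∈ deg j →
    r * s = (i * j).negOnePow • (s * r)

attribute [instance] GrRing.ring

/-- A graded (left) module over a graded commutative ring `S`, given by its homogeneous parts
`deg d`; `act i r` is multiplication by the homogeneous scalar `r` of degree `i`. -/
structure GrMod (S : GrRing.{u}) where
  carrier : Type w
  [grp : AddCommGroup carrier]
  deg : ℤ → AddSubgroup carrier
  act : ∀ i : ℤ, S.deg i →+ (carrier →+ carrier)
  act_mem : ∀ {i j : ℤ} (r : S.deg i) {x : carrier}, x ∈ deg j → act i r x ∈ deg (i + j)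
  one_act : ∀ x : carrier, act 0 ⟨1, S.one_mem⟩ x = x
  mul_act : ∀ {i j : ℤ} (r : S.deg i) (s : S.deg j) (x : carrier),
    act (i + j) ⟨(r : S.carrier) * s, S.mul_mem r.2 s.2⟩ x = act i r (act j s x)

attribute [instance] GrMod.grp

namespace GrMod

variable {S : GrRing.{u}}

/-- Homogeneous elements, together with their degree. -/
abbrev Homog (V : GrMod.{u, w} S) : Type w := Σ d : ℤ, V.deg d

/-- Multiplication of a homogeneous element by a homogeneous scalar. -/
def smul (V : GrMod.{u, w} S) {i j : ℤ} (r : S.deg i) (x : V.deg j) : V.deg (i + j) :=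
  ⟨V.act i r x, V.act_mem r x.2⟩

/-- The graded ring `S` as a graded module over itself. -/
def self (S : GrRing.{u}) : GrMod.{u, u} S where
  carrier := S.carrier
  deg := S.deg
  act i := AddMonoidHom.mul.comp (S.deg i).subtype
  act_mem r _ hx := S.mul_mem r.2 hx
  one_act x := by simp
  mul_act r s x := by simp [mul_assoc]

/-- The one-fold shift `V[1]`, `V[1]^k = V^{k+1}`, with `r · s v = (-1)^{|r|} s (r v)`. -/
def shift (V : GrMod.{u, w} S) : GrMod.{u, w} S where
  carrier := V.carrier
  deg d := V.deg (d + 1)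
  act i := i.negOnePow • V.act i
  act_mem {i j} r x hx := by
    have h := V.act_mem r hx
    rw [← add_assoc] at h
    rcases Int.even_or_odd i with hi | hi
    · simpa [Int.negOnePow_even i hi] using h
    · simpa [Int.negOnePow_odd i hi] using h
  one_act x := by simpa using V.one_act x
  mul_act {i j} r s x := by
    have h := V.mul_act r s x
    rcases Int.even_or_odd i with hi | hi <;> rcases Int.even_or_odd j with hj | hj <;>
      simp [Int.negOnePow_add, Int.negOnePow_even, Int.negOnePow_odd, hi, hj, h]

theorem act_congr (V : GrMod.{u, w} S) {i j : ℤ} (h : i = j) (r : S.deg i) (s : S.deg j)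
    (hrs : (r : S.carrier) = s) : V.act i r = V.act j s := by
  subst h
  rw [Subtype.ext hrs]

end GrMod

/-! ## Formal power series in a variable `z` of degree `2` -/

/-- `S[[z]]` with `|z| = 2`: an element of degree `d` is a series `∑ rₙ zⁿ` with
`rₙ ∈ S^{d - 2n}`. -/
def psRing (S : GrRing.{u}) : GrRing.{u} where
  carrier := PowerSeries S.carrier
  deg d :=
    { carrier := {f | ∀ n : ℕ, PowerSeries.coeff n f ∈ S.deg (d - 2 * n)}
      zero_mem' := fun n => by simp
      add_mem' := fun hf hg n => by simpa using add_mem (hf n) (hg n)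
      neg_mem' := fun hf n => by simpa using hf n }
  one_mem := fun n => by
    rw [PowerSeries.coeff_one]
    split_ifs with h
    · subst h; simpa using S.one_mem
    · exact zero_mem _
  mul_mem {i j f g} hf hg := fun n => by
    rw [PowerSeries.coeff_mul]
    refine sum_mem fun p hp => ?_
    have h := S.mul_mem (hf p.1) (hg p.2)
    have hn : n = p.1 + p.2 := (mem_antidiagonal.1 hp).symm
    rwa [show i - 2 * (p.1 : ℤ) + (j - 2 * (p.2 : ℤ)) = i + j - 2 * (n : ℤ) by
      rw [hn]; push_cast; ring] at h
  graded_comm {i j f g} hf hg := by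
    have key : ∀ a b : ℕ, ((i - 2 * (a : ℤ)) * (j - 2 * (b : ℤ))).negOnePow
        = (i * j).negOnePow := by
      intro a b
      rw [Int.negOnePow_eq_iff]
      exact ⟨-(a * j) - b * i + 2 * a * b, by ring⟩
    ext n
    rw [Units.smul_def, map_zsmul, PowerSeries.coeff_mul, PowerSeries.coeff_mul,
      ← Finset.Nat.sum_antidiagonal_swap, Finset.smul_sum]
    refine Finset.sum_congr rfl fun p _ => ?_
    have h := S.graded_comm (hf p.2) (hg p.1)
    rw [key, Units.smul_def] at h
    exact h

/-- The coefficient of `zⁿ` of a homogeneous series, as a homogeneous scalar. -/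
def psRingCoeff {S : GrRing.{u}} (d : ℤ) (n : ℕ) : (psRing S).deg d →+ S.deg (d - 2 * n) where
  toFun f := ⟨PowerSeries.coeff (R := S.carrier) n f.1, f.2 n⟩
  map_zero' := Subtype.ext (map_zero (PowerSeries.coeff (R := S.carrier) n))
  map_add' f g := Subtype.ext (map_add (PowerSeries.coeff (R := S.carrier) n) f.1 g.1)

theorem psRing_act_mul {S : GrRing.{u}} (V : GrMod.{u, w} S) {i j : ℤ}
    (f : (psRing S).deg i) (g : (psRing S).deg j) (a : ℕ) (x : V.carrier) :
    V.act (i + j - 2 * a) (psRingCoeff (i + j) a ⟨f.1 * g.1, (psRing S).mul_mem f.2 g.2⟩) x =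
      ∑ p ∈ antidiagonal a,
        V.act (i - 2 * p.1) (psRingCoeff i p.1 f) (V.act (j - 2 * p.2) (psRingCoeff j p.2 g) x) := by
  have hd : ∀ p ∈ antidiagonal a,
      i - 2 * (p.1 : ℤ) + (j - 2 * (p.2 : ℤ)) = i + j - 2 * (a : ℤ) := by
    intro p hp
    rw [← mem_antidiagonal.1 hp]; push_cast; ring
  have hm : ∀ p ∈ antidiagonal a, (psRingCoeff i p.1 f).1 * (psRingCoeff j p.2 g).1
      ∈ S.deg (i + j - 2 * (a : ℤ)) := by
    intro p hp
    have h := S.mul_mem (psRingCoeff i p.1 f).2 (psRingCoeff j p.2 g).2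
    rwa [hd p hp] at h
  have hs : psRingCoeff (i + j) a ⟨f.1 * g.1, (psRing S).mul_mem f.2 g.2⟩ =
      ∑ p ∈ (antidiagonal a).attach,
        (⟨(psRingCoeff i p.1.1 f).1 * (psRingCoeff j p.1.2 g).1, hm p.1 p.2⟩ :
          S.deg (i + j - 2 * (a : ℤ))) := by
    apply Subtype.ext
    rw [AddSubgroup.val_finsetSum]
    refine (PowerSeries.coeff_mul (R := S.carrier) a f.1 g.1).trans ?_
    exact (Finset.sum_attach (antidiagonal a)
      (fun p => (psRingCoeff i p.1 f).1 * (psRingCoeff j p.2 g).1)).symm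
  rw [hs, map_sum, AddMonoidHom.finsetSum_apply, ← Finset.sum_attach (antidiagonal a)]
  refine Finset.sum_congr rfl fun p _ => ?_
  rw [← V.mul_act]
  exact DFunLike.congr_fun (V.act_congr (hd p.1 p.2).symm _ _ rfl) x

/-- `V[[z]]` with `|z| = 2`, as a graded module over `S[[z]]`; the sequence `x : ℕ → V`
stands for `∑ xₙ zⁿ`. -/
def psMod {S : GrRing.{u}} (V : GrMod.{u, w} S) : GrMod.{u, w} (psRing S) where
  carrier := ℕ → V.carrier
  deg d :=
    { carrier := {x | ∀ n : ℕ, x n ∈ V.deg (d - 2 * n)}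
      zero_mem' := fun n => zero_mem _
      add_mem' := fun hf hg n => add_mem (hf n) (hg n)
      neg_mem' := fun hf n => neg_mem (hf n) }
  act i := AddMonoidHom.mk' (fun f => AddMonoidHom.mk'
      (fun x n => ∑ p ∈ antidiagonal n, V.act (i - 2 * p.1) (psRingCoeff i p.1 f) (x p.2))
      (fun x y => by funext n; simp [Finset.sum_add_distrib]))
      (fun f g => by ext x n; simp [Finset.sum_add_distrib])
  act_mem {i j} f x hx := fun n => by
    change ∑ p ∈ antidiagonal n, V.act (i - 2 * p.1) (psRingCoeff i p.1 f) (x p.2) ∈ V.deg _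
    refine sum_mem fun p hp => ?_
    have h := V.act_mem (psRingCoeff i p.1 f) (hx p.2)
    have hn : n = p.1 + p.2 := (mem_antidiagonal.1 hp).symm
    rwa [show i - 2 * (p.1 : ℤ) + (j - 2 * (p.2 : ℤ)) = i + j - 2 * (n : ℤ) by
      rw [hn]; push_cast; ring] at h
  one_act x := by
    funext n
    change ∑ p ∈ antidiagonal n, V.act (0 - 2 * p.1) (psRingCoeff 0 p.1 _) (x p.2) = x n
    rw [Finset.sum_eq_single (0, n)]
    · refine Eq.trans (DFunLike.congr_fun (V.act_congr (by simp) _ ⟨1, S.one_mem⟩ ?_) _)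
        (V.one_act _)
      exact (PowerSeries.coeff_one (R := S.carrier) 0).trans (if_pos rfl)
    · rintro ⟨a, b⟩ hab hne
      have ha : a ≠ 0 := by
        rintro rfl
        exact hne (by simpa using mem_antidiagonal.1 hab)
      have h0 : psRingCoeff (S := S) 0 a ⟨1, (psRing S).one_mem⟩ = 0 :=
        Subtype.ext ((PowerSeries.coeff_one (R := S.carrier) a).trans (if_neg ha))
      change V.act _ (psRingCoeff (S := S) 0 a ⟨1, (psRing S).one_mem⟩) _ = 0
      rw [h0, map_zero, AddMonoidHom.zero_apply]
    · intro h
      exact absurd (mem_antidiagonal.2 (by simp)) h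
  mul_act {i j} f g x := by
    funext n
    change ∑ p ∈ antidiagonal n, V.act (i + j - 2 * p.1) (psRingCoeff (i + j) p.1
        ⟨f.1 * g.1, (psRing S).mul_mem f.2 g.2⟩) (x p.2) =
      ∑ p ∈ antidiagonal n, V.act (i - 2 * p.1) (psRingCoeff i p.1 f)
        (∑ q ∈ antidiagonal p.2, V.act (j - 2 * q.1) (psRingCoeff j q.1 g) (x q.2))
    simp only [psRing_act_mul, map_sum, Finset.sum_sigma']
    apply Finset.sum_nbij' (fun ⟨⟨_i, j⟩, ⟨k, l⟩⟩ => ⟨(k, l + j), (l, j)⟩)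
      (fun ⟨⟨i, _j⟩, ⟨k, l⟩⟩ => ⟨(i + k, l), (i, k)⟩)
    · rintro ⟨⟨a, b⟩, ⟨c, d⟩⟩ h
      simp only [Finset.mem_sigma, mem_antidiagonal] at h ⊢
      obtain ⟨rfl, rfl⟩ := h
      exact ⟨by ring, trivial⟩
    · rintro ⟨⟨a, b⟩, ⟨c, d⟩⟩ h
      simp only [Finset.mem_sigma, mem_antidiagonal] at h ⊢
      obtain ⟨rfl, rfl⟩ := h
      exact ⟨by ring, trivial⟩
    · rintro ⟨⟨a, b⟩, ⟨c, d⟩⟩ h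
      simp only [Finset.mem_sigma, mem_antidiagonal] at h
      obtain ⟨rfl, rfl⟩ := h
      rfl
    · rintro ⟨⟨a, b⟩, ⟨c, d⟩⟩ h
      simp only [Finset.mem_sigma, mem_antidiagonal] at h
      obtain ⟨rfl, rfl⟩ := h
      rfl
    · rintro ⟨⟨a, b⟩, ⟨c, d⟩⟩ h
      rfl

/-- The coefficient of `zⁿ` of a homogeneous element of `V[[z]]`. -/
def psCoeff {S : GrRing.{u}} {V : GrMod.{u, w} S} (y : (psMod V).Homog) (n : ℕ) : V.Homog :=
  ⟨y.1 - 2 * n, y.2.1 n, y.2.2 n⟩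

/-- Multiplication by `z` on sequences of coefficients. -/
def zmul {X : Type w} [Zero X] (x : ℕ → X) : ℕ → X
  | 0 => 0
  | n + 1 => x n

/-! ## Graded symmetric tensors, coderivations, `L_∞` algebras and modules

Below `V` plays the role of `L[1]` and `W` that of `M[1]`. -/

section Coalgebra

variable {S : GrRing.{u}} {V W : GrMod.{u, w} S}

/-- Total degree of a tuple of homogeneous elements. -/
def sdeg (l : List V.Homog) : ℤ := (l.map Sigma.fst).sum

/-- A family of maps of degree `1`, `ℓ_k : V^{⊙ k} → V`, `1 ≤ k`, as a function of tuples of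
homogeneous elements; the (non-existing) member `k = 0` is set to `0`.
Multilinearity and symmetry are `Op.IsHom`. -/
structure Op (V : GrMod.{u, w} S) where
  toFun : List V.Homog → V.carrier
  nil : toFun [] = 0
  mem : ∀ l, toFun l ∈ V.deg (sdeg l + 1)

/-- A family of maps of degree `1`, `ℓ^W_k : V^{⊙ k} ⊗ W → W`, `0 ≤ k`, as a function of tuples
of homogeneous elements. Multilinearity and symmetry are `ModOp.IsHom`. -/
structure ModOp (V : GrMod.{u, w} S) (W : GrMod.{u, v} S) where
  toFun : List V.Homog → W.Homog → W.carrier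
  mem : ∀ l x, toFun l x ∈ W.deg (sdeg l + x.1 + 1)

/-- `{ℓ_k}` is an element of `∏_{1 ≤ k} Hom¹_S(V^{⊙ k}, V)`. -/
structure Op.IsHom (ℓ : Op V) : Prop where
  add : ∀ (l l' : List V.Homog) (d : ℤ) (y y' : V.deg d),
    ℓ.toFun (l ++ ⟨d, y + y'⟩ :: l') = ℓ.toFun (l ++ ⟨d, y⟩ :: l') + ℓ.toFun (l ++ ⟨d, y'⟩ :: l')
  smul : ∀ (l l' : List V.Homog) (i d : ℤ) (r : S.deg i) (y : V.deg d),
    ℓ.toFun (l ++ ⟨i + d, V.smul r y⟩ :: l') =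
      (i * (1 + sdeg l)).negOnePow • V.act i r (ℓ.toFun (l ++ ⟨d, y⟩ :: l'))
  swap : ∀ (l l' : List V.Homog) (y y' : V.Homog),
    ℓ.toFun (l ++ y :: y' :: l') = (y.1 * y'.1).negOnePow • ℓ.toFun (l ++ y' :: y :: l')

/-- `{ℓ^W_k}` is an element of `∏_{0 ≤ k} Hom¹_S(V^{⊙ k} ⊗ W, W)`. -/
structure ModOp.IsHom {W : GrMod.{u, v} S} (ℓW : ModOp V W) : Prop where
  add : ∀ (l l' : List V.Homog) (d : ℤ) (y y' : V.deg d) (x : W.Homog),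
    ℓW.toFun (l ++ ⟨d, y + y'⟩ :: l') x =
      ℓW.toFun (l ++ ⟨d, y⟩ :: l') x + ℓW.toFun (l ++ ⟨d, y'⟩ :: l') x
  add_right : ∀ (l : List V.Homog) (d : ℤ) (x x' : W.deg d),
    ℓW.toFun l ⟨d, x + x'⟩ = ℓW.toFun l ⟨d, x⟩ + ℓW.toFun l ⟨d, x'⟩
  smul : ∀ (l l' : List V.Homog) (i d : ℤ) (r : S.deg i) (y : V.deg d) (x : W.Homog),
    ℓW.toFun (l ++ ⟨i + d, V.smul r y⟩ :: l') x =
      (i * (1 + sdeg l)).negOnePow • W.act i r (ℓW.toFun (l ++ ⟨d, y⟩ :: l') x)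
  smul_right : ∀ (l : List V.Homog) (i d : ℤ) (r : S.deg i) (x : W.deg d),
    ℓW.toFun l ⟨i + d, W.smul r x⟩ =
      (i * (1 + sdeg l)).negOnePow • W.act i r (ℓW.toFun l ⟨d, x⟩)
  swap : ∀ (l l' : List V.Homog) (y y' : V.Homog) (x : W.Homog),
    ℓW.toFun (l ++ y :: y' :: l') x =
      (y.1 * y'.1).negOnePow • ℓW.toFun (l ++ y' :: y :: l') x

/-- The zero family. -/
def ModOp.zero (V : GrMod.{u, w} S) (W : GrMod.{u, v} S) : ModOp V W :=
  ⟨fun _ _ => 0, fun _ _ => zero_mem _⟩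

/-- The value of `ℓ_k`, with its degree. -/
def Op.homog (ℓ : Op V) (l : List V.Homog) : V.Homog := ⟨sdeg l + 1, ℓ.toFun l, ℓ.mem l⟩

/-- The value of `ℓ^W_k`, with its degree. -/
def ModOp.homog {W : GrMod.{u, v} S} (ℓW : ModOp V W) (l : List V.Homog) (x : W.Homog) :
    W.Homog := ⟨sdeg l + x.1 + 1, ℓW.toFun l x, ℓW.mem l x⟩

/-- Defining relations of `⊕_k V^{⊙ k} ⊗_S W` on the generators `y₁ ⊙ ⋯ ⊙ y_k ⊗ x`
(homogeneous entries): additivity in each entry, graded symmetry, and `S`-balancedness,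
the latter in the form that a scalar in any entry may be moved to the last one. -/
inductive TensorRel (V : GrMod.{u, w} S) (W : GrMod.{u, v} S) :
    FreeAbelianGroup (List V.Homog × W.Homog) → Prop
  | add (l l' : List V.Homog) (d : ℤ) (y y' : V.deg d) (x : W.Homog) :
      TensorRel V W (.of (l ++ ⟨d, y + y'⟩ :: l', x) -
        (.of (l ++ ⟨d, y⟩ :: l', x) + .of (l ++ ⟨d, y'⟩ :: l', x)))
  | add_right (l : List V.Homog) (d : ℤ) (x x' : W.deg d) :
      TensorRel V W (.of (l, ⟨d, x + x'⟩) - (.of (l, ⟨d, x⟩) + .of (l, ⟨d, x'⟩)))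
  | balanced (l l' : List V.Homog) (i d e : ℤ) (r : S.deg i) (y : V.deg d) (x : W.deg e) :
      TensorRel V W (.of (l ++ ⟨i + d, V.smul r y⟩ :: l', ⟨e, x⟩) -
        (i * (d + sdeg l')).negOnePow • .of (l ++ ⟨d, y⟩ :: l', ⟨i + e, W.smul r x⟩))
  | swap (l l' : List V.Homog) (y y' : V.Homog) (x : W.Homog) :
      TensorRel V W (.of (l ++ y :: y' :: l', x) -
        (y.1 * y'.1).negOnePow • .of (l ++ y' :: y :: l', x))

/-- `EL ⊗ M[1] = ⊕_k L[1]^{⊙ k} ⊗ M[1]`, for `V = L[1]`, `W = M[1]`. -/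
abbrev SymTensor (V : GrMod.{u, w} S) (W : GrMod.{u, v} S) : Type (max w v) :=
  FreeAbelianGroup (List V.Homog × W.Homog) ⧸ AddSubgroup.closure {t | TensorRel V W t}

/-- The class of an integral combination of generators. -/
def SymTensor.mk (V : GrMod.{u, w} S) (W : GrMod.{u, v} S) :
    FreeAbelianGroup (List V.Homog × W.Homog) →+ SymTensor V W :=
  QuotientAddGroup.mk' _

/-- All ways `(ε(σ), (y_{σ(1)}, …, y_{σ(p)}), (y_{σ(p+1)}, …, y_{σ(k)}))` to split a tuple by a
`(p, q)`-shuffle `σ`, over all `p + q = k`, together with the Koszul sign. -/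
def unshuffles : List V.Homog → List (ℤˣ × List V.Homog × List V.Homog)
  | [] => [(1, [], [])]
  | y :: l =>
    (unshuffles l).map (fun t => (t.1, y :: t.2.1, t.2.2)) ++
    (unshuffles l).map (fun t => ((y.1 * sdeg t.2.1).negOnePow * t.1, t.2.1, y :: t.2.2))

/-- The value on `y₁ ⊙ ⋯ ⊙ y_k ⊗ x` of the coderivation determined by `ℓ` and `ℓ^W`:
`∑ ε(σ) ℓ_p(y_{σ(1)}, …, y_{σ(p)}) ⊙ ⋯ ⊙ y_{σ(k)} ⊗ x`
`+ ∑ ε'(σ) y_{σ(1)} ⊙ ⋯ ⊙ y_{σ(p)} ⊗ ℓ^W_q(y_{σ(p+1)}, …, y_{σ(k)} | x)`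
with `ε'(σ) = (-1)^{|y_{σ(1)}|' + ⋯ + |y_{σ(p)}|'} ε(σ)`; the first sum is over `p ≥ 1`. -/
def coderivFormula {W : GrMod.{u, v} S} (ℓ : Op V) (ℓW : ModOp V W) (l : List V.Homog)
    (x : W.Homog) : FreeAbelianGroup (List V.Homog × W.Homog) :=
  (((unshuffles l).filter (fun t => !t.2.1.isEmpty)).map (fun t =>
    t.1 • FreeAbelianGroup.of (ℓ.homog t.2.1 :: t.2.2, x))).sum +
  ((unshuffles l).map (fun t =>
    ((sdeg t.2.1).negOnePow * t.1) • FreeAbelianGroup.of (t.2.1, ℓW.homog t.2.2 x))).sum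

/-- `D` is the coderivation of `EL ⊗ M[1]` corresponding to `ℓ` and `ℓ^W`
(the generators span, so `D` is unique). -/
def IsCoderivationOf {W : GrMod.{u, v} S} (ℓ : Op V) (ℓW : ModOp V W)
    (D : SymTensor V W →+ SymTensor V W) : Prop :=
  ∀ (l : List V.Homog) (x : W.Homog),
    D (SymTensor.mk V W (.of (l, x))) = SymTensor.mk V W (coderivFormula ℓ ℓW l x)

/-- For `V = L[1]`: `(L, {ℓ_k})` is an `L_∞` algebra, i.e. `ℓ̂ ∘ ℓ̂ = 0` on
`EL = EL ⊗_S S`. -/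
def IsLInfinityAlgebra (ℓ : Op V) : Prop :=
  ℓ.IsHom ∧ ∃ D : SymTensor V (GrMod.self S) →+ SymTensor V (GrMod.self S),
    IsCoderivationOf ℓ (ModOp.zero V (GrMod.self S)) D ∧ ∀ t, D (D t) = 0

/-- The filtration on `EL ⊗ M[1]` induced by decreasing filtrations `FV`, `FW` of the factors. -/
def tensorFiltration {W : GrMod.{u, v} S} (FV : ℤ → AddSubgroup V.carrier)
    (FW : ℤ → AddSubgroup W.carrier) (a : ℤ) : AddSubgroup (SymTensor V W) :=
  AddSubgroup.closure {t | ∃ (l : List V.Homog) (x : W.Homog) (c : List ℤ) (b : ℤ),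
    List.Forall₂ (fun y e => (y.2 : V.carrier) ∈ FV e) l c ∧ (x.2 : W.carrier) ∈ FW b ∧
    c.sum + b = a ∧ t = SymTensor.mk V W (.of (l, x))}

end Coalgebra

/-! ## The cone `L̃ = L[[z]] ⊕ ε L[[z]]`, `|z| = 2`, `|ε| = 1` -/

section Cone

variable {S : GrRing.{u}} {V : GrMod.{u, w} S}

/-- For `V = L[1]`, the graded `S[[z]]`-module `L̃[1] = L[1][[z]] ⊕ ε L[1][[z]]`; the pair
`(y, y')` stands for `y + ε y'`. -/
def cone (V : GrMod.{u, w} S) : GrMod.{u, w} (psRing S) where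
  carrier := (psMod V).carrier × (psMod V).carrier
  deg d := ((psMod V).deg d).prod ((psMod V).deg (d - 1))
  act i := AddMonoidHom.mk' (fun r => AddMonoidHom.prodMap ((psMod V).act i r)
      (i.negOnePow • (psMod V).act i r))
    (fun r s => AddMonoidHom.ext fun x => Prod.ext (by simp) (by simp))
  act_mem {i j} r x hx := by
    refine ⟨(psMod V).act_mem r hx.1, ?_⟩
    have h := (psMod V).act_mem r hx.2
    rw [← add_sub_assoc] at h
    rcases Int.even_or_odd i with hi | hi
    · simpa [Int.negOnePow_even i hi] using h
    · simpa [Int.negOnePow_odd i hi] using h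
  one_act x := by
    ext1 <;> simp [(psMod V).one_act]
  mul_act {i j} r s x := by
    have h := (psMod V).mul_act r s
    rcases Int.even_or_odd i with hi | hi <;> rcases Int.even_or_odd j with hj | hj <;>
      ext1 <;> simp [Int.negOnePow_add, Int.negOnePow_even, Int.negOnePow_odd, hi, hj, h]

/-- The component `y` of `y + ε y'`. -/
def cone.fst (y : (cone V).Homog) : (psMod V).Homog := ⟨y.1, y.2.1.1, y.2.2.1⟩

/-- The component `y'` of `y + ε y'`. -/
def cone.snd (y : (cone V).Homog) : (psMod V).Homog := ⟨y.1 - 1, y.2.1.2, y.2.2.2⟩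

/-- The `z`-multilinear extension of a multilinear function `F` of tuples: the coefficient of `zⁿ`
is `∑_{n₁ + ⋯ + n_k = n} F(y_{1, n₁}, …, y_{k, n_k})`. -/
def psEval {X : Type v} [AddCommMonoid X] :
    (List V.Homog → X) → List (psMod V).Homog → ℕ → X
  | F, [], n => if n = 0 then F [] else 0
  | F, y :: l, n => ∑ p ∈ antidiagonal n, psEval (fun t => F (psCoeff y p.1 :: t)) l p.2

/-- The terms `((-1)^#, (y₁, …, y_i', …, y_k))`, `# = |y₁|' + ⋯ + |y_{i-1}|'`, `1 ≤ i ≤ k`. -/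
def epsTerms : List (cone V).Homog → List (ℤˣ × List (psMod V).Homog)
  | [] => []
  | y :: l => (1, cone.snd y :: l.map cone.fst) ::
      (epsTerms l).map (fun t => (y.1.negOnePow * t.1, cone.fst y :: t.2))

theorem psEval_mem {X : Type v} [AddCommGroup X] (D : AddSubgroup X) :
    ∀ (l : List (psMod V).Homog) (n : ℕ) (F : List V.Homog → X),
      (∀ t, sdeg t = sdeg l - 2 * n → F t ∈ D) → psEval F l n ∈ D
  | [], n, F, h => by
    rw [psEval]
    split_ifs with hn
    · exact h [] (by subst hn; simp [sdeg])
    · exact zero_mem _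
  | y :: l, n, F, h => by
    rw [psEval]
    refine sum_mem fun p hp => psEval_mem D l p.2 _ fun t ht => h _ ?_
    have hn := mem_antidiagonal.1 hp
    simp only [sdeg, List.map_cons, List.sum_cons, psCoeff] at ht ⊢
    rw [ht, ← hn]; push_cast; ring

theorem sdeg_map_fst (l : List (cone V).Homog) : sdeg (l.map cone.fst) = sdeg l := by
  simp [sdeg, Function.comp_def, cone.fst]

theorem sdeg_epsTerms : ∀ (l : List (cone V).Homog), ∀ t ∈ epsTerms l, sdeg t.2 = sdeg l - 1
  | [], t, ht => by simp [epsTerms] at ht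
  | y :: l, t, ht => by
    rw [epsTerms, List.mem_cons, List.mem_map] at ht
    rcases ht with rfl | ⟨s, hs, rfl⟩
    · have := sdeg_map_fst l
      simp only [sdeg, List.map_cons, List.sum_cons] at this ⊢
      rw [this]; simp [cone.snd]; ring
    · have := sdeg_epsTerms l s hs
      simp only [sdeg, List.map_cons, List.sum_cons] at this ⊢
      rw [this]; simp [cone.fst]; ring

/-- The `z`-multilinear extension of `ℓ_k` to `L[1][[z]]`. -/
def Op.ps (ℓ : Op V) (t : List (psMod V).Homog) : (psMod V).carrier := psEval ℓ.toFun t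

/-- `z y'`, for the homogeneous element `y + ε y'`. -/
def zsnd (y : (cone V).Homog) : (psMod V).carrier := zmul (X := V.carrier) (cone.snd y).2.1

/-- The term `z y₁'` of `ℓ̃₁(y₁ + ε y₁')`. -/
def coneZ : List (cone V).Homog → (psMod V).carrier
  | [y] => zsnd y
  | _ => 0

/-- `ℓ_k(y₁, …, y_k)`, plus `z y₁'` if `k = 1`. -/
def coneOpFst (ℓ : Op V) (l : List (cone V).Homog) : (psMod V).carrier :=
  ℓ.ps (l.map cone.fst) + coneZ l

/-- `-∑_i (-1)^# ℓ_k(y₁, …, y_i', …, y_k)`. -/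
def coneOpSnd (ℓ : Op V) (l : List (cone V).Homog) : (psMod V).carrier :=
  -((epsTerms l).map (fun t => t.1 • ℓ.ps t.2)).sum

/-- The operations `ℓ̃_k` on `L̃[1]`:
`ℓ̃_k(y₁ + ε y₁', …) = ℓ_k(y₁, …, y_k) - ε ∑_i (-1)^# ℓ_k(y₁, …, y_i', …, y_k)`,
plus `z y₁'` if `k = 1`. -/
def coneOp (ℓ : Op V) : Op (cone V) where
  toFun l := (coneOpFst ℓ l, coneOpSnd ℓ l)
  nil := by
    have h : ℓ.ps ([] : List (psMod V).Homog) = 0 := by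
      funext n
      simp [Op.ps, psEval, ℓ.nil]
      rfl
    refine Prod.ext ?_ ?_
    · change ℓ.ps [] + 0 = 0
      rw [h, add_zero]
    · exact neg_zero (G := (psMod V).carrier)
  mem l := by
    have h1 : ∀ (t : List (psMod V).Homog), ℓ.ps t ∈ (psMod V).deg (sdeg t + 1) :=
      fun t n => psEval_mem _ _ _ _ fun t' ht' => by
        have := ℓ.mem t'
        rwa [ht', show sdeg t - 2 * (n : ℤ) + 1 = sdeg t + 1 - 2 * n by ring] at this
    refine ⟨add_mem (s := (psMod V).deg (sdeg l + 1)) ?_ ?_,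
      neg_mem (s := (psMod V).deg (sdeg l + 1 - 1)) (list_sum_mem ?_)⟩
    · have := h1 (l.map cone.fst)
      rwa [sdeg_map_fst] at this
    · match l with
      | [] => exact zero_mem _
      | _ :: _ :: _ => exact zero_mem _
      | [y] =>
        intro n
        cases n with
        | zero => exact zero_mem _
        | succ n =>
          have := (cone.snd y).2.2 n
          change (cone.snd y).2.1 n ∈ V.deg _
          convert this using 2
          simp [sdeg, cone.snd]; ring
    · intro x hx
      obtain ⟨t, ht, rfl⟩ := List.mem_map.1 hx
      have := h1 t.2
      rw [sdeg_epsTerms l t ht] at this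
      rw [show sdeg l + 1 - 1 = sdeg l - 1 + 1 by ring]
      rcases Int.units_eq_one_or t.1 with h | h <;> rw [h]
      · simpa using this
      · simpa using this

/-- The filtration of `L̃[1]` by the number of `ε`. -/
def coneFiltration (V : GrMod.{u, w} S) (a : ℤ) : AddSubgroup (cone V).carrier :=
  if a ≤ -1 then ⊤
  else if a = 0 then (⊤ : AddSubgroup (psMod V).carrier).prod ⊥
  else ⊥

/-- The filtration of `M̃[1]`: everything in degrees `≤ 0`, zero in degrees `≥ 1`. -/
def trivialFiltration (W : GrMod.{u, v} (psRing S)) (a : ℤ) : AddSubgroup W.carrier :=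
  if a ≤ 0 then ⊤ else ⊥

/-- For `V = L[1]` and `W = M̃[1]`: `{ℓ^M̃_k}` is an `L_∞` module structure on `M̃` over
`L̃` modulo `ε^n`, i.e. `(ℓ̂^M̃ ∘ ℓ̂^M̃)(F^a) ⊆ F^{a+n}` for all `a`. -/
def IsLInfinityModuleMod (n : ℕ) (ℓ : Op V) {W : GrMod.{u, v} (psRing S)}
    (ℓW : ModOp (cone V) W) : Prop :=
  ℓW.IsHom ∧ ∃ D : SymTensor (cone V) W →+ SymTensor (cone V) W,
    IsCoderivationOf (coneOp ℓ) ℓW D ∧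
    ∀ a : ℤ, ∀ t ∈ tensorFiltration (coneFiltration V) (trivialFiltration W) a,
      D (D t) ∈ tensorFiltration (coneFiltration V) (trivialFiltration W) (a + n)

/-- For `V = L[1]` and `W = M̃[1]`: `(L, {ℓ_k})` is an `L_∞` algebra and `{ℓ^M̃_k}` is a
CH structure on `M̃` over `L`. -/
def IsCHStructure (ℓ : Op V) {W : GrMod.{u, v} (psRing S)} (ℓW : ModOp (cone V) W) : Prop :=
  IsLInfinityAlgebra ℓ ∧ IsLInfinityModuleMod 2 ℓ ℓW

end Cone

/-! ## Differential graded Lie algebras -/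

section DGLA

variable {S : GrRing.{u}}

/-- A differential graded Lie algebra structure on a graded `S`-module `L`. -/
structure DGLA (L : GrMod.{u, w} S) where
  diff : ∀ p : ℤ, L.deg p →+ L.deg (p + 1)
  br : ∀ p q : ℤ, L.deg p →+ L.deg q →+ L.deg (p + q)
  diff_smul : ∀ {i p : ℤ} (r : S.deg i) (x : L.deg p),
    (diff (i + p) (L.smul r x) : L.carrier) = i.negOnePow • L.act i r (diff p x)
  br_smul : ∀ {i p q : ℤ} (r : S.deg i) (x : L.deg p) (y : L.deg q),
    (br (i + p) q (L.smul r x) y : L.carrier) = L.act i r (br p q x y)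
  antisymm : ∀ {p q : ℤ} (x : L.deg p) (y : L.deg q),
    (br p q x y : L.carrier) = -((p * q).negOnePow • (br q p y x : L.carrier))
  jacobi : ∀ {p q r : ℤ} (x : L.deg p) (y : L.deg q) (t : L.deg r),
    (br p (q + r) x (br q r y t) : L.carrier) =
      br (p + q) r (br p q x y) t + (p * q).negOnePow • (br q (p + r) y (br p r x t) : L.carrier)
  diff_diff : ∀ {p : ℤ} (x : L.deg p), (diff (p + 1) (diff p x) : L.carrier) = 0
  leibniz : ∀ {p q : ℤ} (x : L.deg p) (y : L.deg q),
    (diff (p + q) (br p q x y) : L.carrier) =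
      br (p + 1) q (diff p x) y + p.negOnePow • (br p (q + 1) x (diff q y) : L.carrier)

/-- A homogeneous element of `L[1]` as a homogeneous element of `L` (of degree one more). -/
def unshift {L : GrMod.{u, w} S} (y : L.shift.Homog) : L.Homog := ⟨y.1 + 1, y.2⟩

/-- A DGLA as an `L_∞` algebra: `ℓ₁(y) = -δ y`, `ℓ₂(y₁, y₂) = (-1)^{|y₁|} [y₁, y₂]`,
`ℓ_k = 0` for `k ≥ 3`. -/
def DGLA.toOp {L : GrMod.{u, w} S} (G : DGLA L) : Op L.shift where
  toFun
    | [y] => -(G.diff _ (unshift y).2 : L.carrier)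
    | [y₁, y₂] => (unshift y₁).1.negOnePow • (G.br _ _ (unshift y₁).2 (unshift y₂).2 : L.carrier)
    | _ => (0 : L.carrier)
  nil := rfl
  mem
    | [] => zero_mem (L.deg _)
    | [y] => by
      have h := neg_mem (G.diff _ (unshift y).2).2
      change _ ∈ L.deg (sdeg [y] + 1 + 1)
      rwa [show sdeg [y] + 1 + 1 = (unshift y).1 + 1 by simp [sdeg, unshift]]
    | [y₁, y₂] => by
      have h := (G.br _ _ (unshift y₁).2 (unshift y₂).2).2
      change _ ∈ L.deg (sdeg [y₁, y₂] + 1 + 1)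
      rw [show sdeg [y₁, y₂] + 1 + 1 = (unshift y₁).1 + (unshift y₂).1 by
        simp [sdeg, unshift]; ring]
      rcases Int.units_eq_one_or (unshift y₁).1.negOnePow with hs | hs <;> simp [hs]
    | _ :: _ :: _ :: _ => zero_mem (L.deg _)

end DGLA

/-! ## Graded categories without composition, Hochschild cochains and chains -/

/-- Graded commutativity of a ℤ-graded ring. -/
class IsGradedComm {R : Type u} [Ring R] (𝓡 : ℤ → AddSubgroup R) : Prop where
  comm : ∀ {i j : ℤ} {r s : R}, r ∈ 𝓡 i → s ∈ 𝓡 j → r * s = (i * j).negOnePow • (s * r)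

/-- A graded commutative ring in the sense of `GradedRing`, as a `GrRing`. -/
def GrRing.ofGraded {R : Type u} [Ring R] (𝓡 : ℤ → AddSubgroup R) [GradedRing 𝓡]
    [IsGradedComm 𝓡] : GrRing.{u} where
  carrier := R
  deg := 𝓡
  one_mem := SetLike.one_mem_graded 𝓡
  mul_mem := fun hr hs => SetLike.mul_mem_graded hr hs
  graded_comm := fun hr hs => IsGradedComm.comm hr hs

/-- A set of objects with graded `R`-modules `Hom(X, Y)` and units `𝟙_X ∈ Hom(X, X)⁰`
(equivalently degree preserving `R`-linear maps `R → Hom(X, X)`). -/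
structure UnitalGradedQuiver {R : Type u} [Ring R] (𝓡 : ℤ → AddSubgroup R) [GradedRing 𝓡] where
  Ob : Type v
  Hom : Ob → Ob → Type w
  [grp : ∀ X Y, AddCommGroup (Hom X Y)]
  [mod : ∀ X Y, Module R (Hom X Y)]
  gr : ∀ X Y, ℤ → AddSubgroup (Hom X Y)
  [decomp : ∀ X Y, DirectSum.Decomposition (gr X Y)]
  [gradedSMul : ∀ X Y, SetLike.GradedSMul 𝓡 (gr X Y)]
  one : ∀ X, Hom X X
  one_mem : ∀ X, one X ∈ gr X X 0

attribute [instance] UnitalGradedQuiver.grp UnitalGradedQuiver.mod UnitalGradedQuiver.decomp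
  UnitalGradedQuiver.gradedSMul

/-- Composable sequences `x₁, …, x_k`, `x_i ∈ Q (X_{i-1}) (X_i)`, from `X₀` to `X_k`. -/
inductive Word {Ob : Type v} (Q : Ob → Ob → Type w) : Ob → Ob → Type (max v w)
  | nil (X : Ob) : Word Q X X
  | cons {X Y Z : Ob} (x : Q X Y) (t : Word Q Y Z) : Word Q X Z

namespace Word

variable {Ob : Type v} {Q : Ob → Ob → Type w}

/-- Concatenation. -/
def append : ∀ {X Y Z : Ob}, Word Q X Y → Word Q Y Z → Word Q X Z
  | _, _, _, nil _, t => t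
  | _, _, _, cons x s, t => cons x (append s t)

/-- Number of entries. -/
def length : ∀ {X Y : Ob}, Word Q X Y → ℕ
  | _, _, nil _ => 0
  | _, _, cons _ t => length t + 1

/-- All ways to cut a word into two consecutive pieces. -/
def splits : ∀ {X Y : Ob}, Word Q X Y → List (Σ Z : Ob, Word Q X Z × Word Q Z Y)
  | _, _, nil X => [⟨X, nil X, nil X⟩]
  | X, _, cons x t => ⟨X, nil X, cons x t⟩ ::
      (splits t).map (fun s => ⟨s.1, cons x s.2.1, s.2.2⟩)

/-- `∑ f(u, v)` over all ways to write `t = u v`. -/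
def sum₂ {A : Type*} [AddCommMonoid A] {X Y : Ob} (t : Word Q X Y)
    (f : ∀ {Z : Ob}, Word Q X Z → Word Q Z Y → A) : A :=
  ((splits t).map (fun s => f s.2.1 s.2.2)).sum

end Word

namespace UnitalGradedQuiver

section Basic

variable {R : Type u} [Ring R] {𝓡 : ℤ → AddSubgroup R} [GradedRing 𝓡]
  (A : UnitalGradedQuiver.{u, v, w} 𝓡)

/-- Homogeneous morphisms, together with their (unshifted) degree `|x|`. -/
def Arr (X Y : A.Ob) : Type w := Σ d : ℤ, A.gr X Y d

/-- Composable sequences of homogeneous morphisms: the generators `x₁ ⊗ ⋯ ⊗ x_k` of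
`𝒜(X₀, …, X_k) = Hom(X₀, X₁)[1] ⊗ ⋯ ⊗ Hom(X_{k-1}, X_k)[1]`. -/
abbrev Path (X Y : A.Ob) : Type (max v w) := Word A.Arr X Y

/-- The unit as a homogeneous morphism of degree `0`. -/
def unit (X : A.Ob) : A.Arr X X := ⟨0, A.one X, A.one_mem X⟩

variable {A}

/-- The product `r x` of a homogeneous morphism with a homogeneous scalar. -/
def smulGr {X Y : A.Ob} {i d : ℤ} (r : 𝓡 i) (x : A.gr X Y d) : A.gr X Y (i + d) :=
  ⟨(r : R) • (x : A.Hom X Y), SetLike.GradedSMul.smul_mem r.2 x.2⟩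

/-- The product `r x`, together with its degree. -/
def smulArr {X Y : A.Ob} {i d : ℤ} (r : 𝓡 i) (x : A.gr X Y d) : A.Arr X Y := ⟨i + d, smulGr r x⟩

/-- The shifted degree `|x|' = |x| - 1`. -/
def sdeg₁ {X Y : A.Ob} (x : A.Arr X Y) : ℤ := x.1 - 1

/-- The shifted degree `|x₁|' + ⋯ + |x_k|'`. -/
def pdeg : ∀ {X Y : A.Ob}, A.Path X Y → ℤ
  | _, _, .nil _ => 0
  | _, _, .cons x t => sdeg₁ x + pdeg t

/-- The sequence `s, x, t`. -/
def ins {X Y Z T : A.Ob} (s : A.Path X Y) (x : A.Arr Y Z) (t : A.Path Z T) : A.Path X T :=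
  s.append (.cons x t)

variable (A)

/-- Container for Hochschild cochains: families of functions on composable sequences. -/
abbrev CochainFun : Type (max v w) := ∀ X Y : A.Ob, A.Path X Y → A.Hom X Y

/-- `CC^•(𝒜)[1]^p`: for all `X₀, …, X_k`, `k ≥ 0`, an `R`-linear map of degree `p`
`Hom(X₀, X₁)[1] ⊗ ⋯ ⊗ Hom(X_{k-1}, X_k)[1] → Hom(X₀, X_k)[1]`, written as a function of
homogeneous entries. With respect to the unshifted scalar multiplication the Koszul rule reads
`φ(…, r x_i, …) = (-1)^{|r| (p + |x₁|' + ⋯ + |x_{i-1}|')} r φ(…, x_i, …)`. -/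
def cochains (p : ℤ) : AddSubgroup A.CochainFun where
  carrier := {φ |
    (∀ (X Y : A.Ob) (t : A.Path X Y), φ X Y t ∈ A.gr X Y (p + pdeg t + 1)) ∧
    (∀ (X Y Z T : A.Ob) (s : A.Path X Y) (t : A.Path Z T) (d : ℤ) (x y : A.gr Y Z d),
      φ X T (ins s ⟨d, x + y⟩ t) = φ X T (ins s ⟨d, x⟩ t) + φ X T (ins s ⟨d, y⟩ t)) ∧
    (∀ (X Y Z T : A.Ob) (s : A.Path X Y) (t : A.Path Z T) (i d : ℤ) (r : 𝓡 i) (x : A.gr Y Z d),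
      φ X T (ins s (smulArr r x) t) =
        (i * (p + pdeg s)).negOnePow • ((r : R) • φ X T (ins s ⟨d, x⟩ t)))}
  zero_mem' := ⟨fun _ _ _ => zero_mem _, by intros; simp, by intros; simp⟩
  add_mem' := fun {f g} hf hg => ⟨fun X Y t => add_mem (hf.1 X Y t) (hg.1 X Y t),
    fun X Y Z T s t d x y => by
      simp only [Pi.add_apply, hf.2.1, hg.2.1]; abel,
    fun X Y Z T s t i d r x => by
      simp only [Pi.add_apply, hf.2.2, hg.2.2, smul_add]⟩
  neg_mem' := fun {f} hf => ⟨fun X Y t => neg_mem (hf.1 X Y t),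
    fun X Y Z T s t d x y => by
      simp only [Pi.neg_apply, hf.2.1]; abel,
    fun X Y Z T s t i d r x => by
      simp only [Pi.neg_apply, hf.2.2, smul_neg]⟩

/-- Reduced cochains: `φ(…, 𝟙, …) = 0`. -/
def reducedFun : AddSubgroup A.CochainFun where
  carrier := {φ | ∀ (X Y Z : A.Ob) (s : A.Path X Y) (t : A.Path Y Z),
    φ X Z (ins s (A.unit Y) t) = 0}
  zero_mem' := by intros _ _ _ _ _; rfl
  add_mem' := fun hf hg X Y Z s t => by simp [hf X Y Z s t, hg X Y Z s t]
  neg_mem' := fun hf X Y Z s t => by simp [hf X Y Z s t]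

variable {A}

/-- The value `ψ(t)` of a homogeneous cochain as a homogeneous morphism;
`|ψ(t)|' = |ψ|' + |t|'`. -/
def value {q : ℤ} (ψ : A.cochains q) {X Y : A.Ob} (t : A.Path X Y) : A.Arr X Y :=
  ⟨q + pdeg t + 1, ψ.1 X Y t, ψ.2.1 X Y t⟩

/-- `φ ∘ ψ (x₁, …, x_k) = ∑ (-1)^# φ(x₁, …, x_i, ψ(x_{i+1}, …, x_j), x_{j+1}, …, x_k)`,
`# = |ψ|' (|x₁|' + ⋯ + |x_i|')`. -/
def circ {p q : ℤ} (φ : A.cochains p) (ψ : A.cochains q) : A.CochainFun := fun X Y t =>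
  t.sum₂ fun a t' => t'.sum₂ fun b c =>
    (q * pdeg a).negOnePow • φ.1 X Y (ins a (value ψ b) c)

/-- The Gerstenhaber bracket `[φ, ψ] = φ ∘ ψ - (-1)^{|φ|'|ψ|'} ψ ∘ φ`. -/
def bracket {p q : ℤ} (φ : A.cochains p) (ψ : A.cochains q) : A.CochainFun :=
  circ φ ψ - (p * q).negOnePow • circ ψ φ

/-- Strictly unital curved `A_∞` structures `m ∈ CC^•(𝒜)[1]¹`: `[m, m] = 0`,
`m₂(𝟙, x) = x = (-1)^{|x|} m₂(x, 𝟙)`, and `m_k(…, 𝟙, …) = 0` for `k ≠ 2`. -/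
structure IsStrictlyUnitalCurved (m : A.cochains 1) : Prop where
  bracket_self : bracket m m = 0
  unit_left : ∀ (X Y : A.Ob) (x : A.Arr X Y),
    m.1 X Y (.cons (A.unit X) (.cons x (.nil Y))) = x.2
  unit_right : ∀ (X Y : A.Ob) (x : A.Arr X Y),
    x.1.negOnePow • m.1 X Y (.cons x (.cons (A.unit Y) (.nil Y))) = x.2
  unit_other : ∀ (X Y Z : A.Ob) (s : A.Path X Y) (t : A.Path Y Z),
    s.length + 1 + t.length ≠ 2 → m.1 X Z (ins s (A.unit Y) t) = 0

variable (A)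

/-- Generators `x₀ ⊗ x₁ ⊗ ⋯ ⊗ x_k`, `x_i ∈ Hom(X_i, X_{i+1})`, `X_{k+1} = X₀`, of the Hochschild
chains; `head = x₀` and `tail = (x₁, …, x_k)`. -/
structure CyclicWord where
  {X Y : A.Ob}
  head : A.Arr X Y
  tail : A.Path Y X

/-- The degree `|x₀|' + ⋯ + |x_k|'` of a generator in `CC_•(𝒜)[1]`. -/
def CyclicWord.deg {A : UnitalGradedQuiver.{u, v, w} 𝓡} (g : A.CyclicWord) : ℤ :=
  sdeg₁ g.head + pdeg g.tail

/-- Defining relations of the reduced Hochschild chains: additivity in each entry,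
`R`-balancedness (in the form that a scalar in any entry may be moved to the first one), and
vanishing of generators with a unit in a place `≥ 1`. -/
inductive ChainRel : FreeAbelianGroup A.CyclicWord → Prop
  | add_head {X Y : A.Ob} (d : ℤ) (x y : A.gr X Y d) (t : A.Path Y X) :
      ChainRel (.of ⟨⟨d, x + y⟩, t⟩ - (.of ⟨⟨d, x⟩, t⟩ + .of ⟨⟨d, y⟩, t⟩))
  | add_tail {X Y Z T : A.Ob} (x₀ : A.Arr X Y) (s : A.Path Y Z) (d : ℤ) (x y : A.gr Z T d)
      (t : A.Path T X) :
      ChainRel (.of ⟨x₀, ins s ⟨d, x + y⟩ t⟩ -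
        (.of ⟨x₀, ins s ⟨d, x⟩ t⟩ + .of ⟨x₀, ins s ⟨d, y⟩ t⟩))
  | balanced {X Y Z T : A.Ob} (d₀ : ℤ) (x₀ : A.gr X Y d₀) (s : A.Path Y Z) (i d : ℤ) (r : 𝓡 i)
      (x : A.gr Z T d) (t : A.Path T X) :
      ChainRel (.of ⟨⟨d₀, x₀⟩, ins s (smulArr r x) t⟩ -
        (i * (d₀ - 1 + pdeg s)).negOnePow • .of ⟨smulArr r x₀, ins s ⟨d, x⟩ t⟩)
  | unit {X Y Z : A.Ob} (x₀ : A.Arr X Y) (s : A.Path Y Z) (t : A.Path Z X) :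
      ChainRel (.of ⟨x₀, ins s (A.unit Z) t⟩)

/-- The underlying group of the reduced Hochschild chains. -/
abbrev ChainGroup : Type (max v w) :=
  FreeAbelianGroup A.CyclicWord ⧸ AddSubgroup.closure {c | A.ChainRel c}

/-- The class of an integral combination of generators. -/
def chainMk : FreeAbelianGroup A.CyclicWord →+ A.ChainGroup := QuotientAddGroup.mk' _

theorem chainMk_rel {c : FreeAbelianGroup A.CyclicWord} (h : A.ChainRel c) : A.chainMk c = 0 :=
  (QuotientAddGroup.eq_zero_iff c).2 (AddSubgroup.subset_closure h)

variable {A}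

theorem arr_ext {X Y : A.Ob} {d e : ℤ} (h : d = e) {x : A.gr X Y d} {y : A.gr X Y e}
    (hxy : (x : A.Hom X Y) = y) : (⟨d, x⟩ : A.Arr X Y) = ⟨e, y⟩ := by
  subst h
  rw [Subtype.ext hxy]

/-- `x₀ ⊗ t` as an additive function of `x₀`. -/
def headHom {X Y : A.Ob} (d : ℤ) (t : A.Path Y X) : A.gr X Y d →+ A.ChainGroup :=
  AddMonoidHom.mk' (fun x => A.chainMk (.of ⟨⟨d, x⟩, t⟩)) fun x y => by
    have h := A.chainMk_rel (.add_head d x y t)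
    rwa [map_sub, map_add, sub_eq_zero] at h

/-- `r · (x₀ ⊗ ⋯ ⊗ x_k) = (-1)^{|r|} (r x₀) ⊗ x₁ ⊗ ⋯ ⊗ x_k` in `CC_•(𝒜)[1]`, on generators. -/
def chainActGen {i : ℤ} (r : 𝓡 i) (g : A.CyclicWord) : A.ChainGroup :=
  i.negOnePow • A.chainMk (.of ⟨smulArr r g.head.2, g.tail⟩)

theorem chainMk_smulArr {X Y : A.Ob} {i d : ℤ} (r : 𝓡 i) (x : A.gr X Y d) (t : A.Path Y X) :
    A.chainMk (.of ⟨smulArr r x, t⟩) = headHom (i + d) t (smulGr r x) := rfl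

theorem smulGr_add {X Y : A.Ob} {i d : ℤ} (r : 𝓡 i) (x y : A.gr X Y d) :
    smulGr r (x + y) = smulGr r x + smulGr r y := Subtype.ext (smul_add _ _ _)

theorem add_smulGr {X Y : A.Ob} {i d : ℤ} (r s : 𝓡 i) (x : A.gr X Y d) :
    smulGr (r + s) x = smulGr r x + smulGr s x := Subtype.ext (add_smul _ _ _)

theorem headHom_smul_comm [IsGradedComm 𝓡] {X Y : A.Ob} {i j d : ℤ} (r : 𝓡 i) (s : 𝓡 j)
    (x : A.gr X Y d) (t : A.Path Y X) :
    headHom (j + (i + d)) t (smulGr s (smulGr r x)) =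
      (i * j).negOnePow • headHom (i + (j + d)) t (smulGr r (smulGr s x)) := by
  have h : (smulGr s (smulGr r x) : A.Hom X Y) =
      ((i * j).negOnePow : ℤ) • (smulGr r (smulGr s x) : A.Hom X Y) := by
    have h' := IsGradedComm.comm s.2 r.2
    rw [mul_comm j i, Units.smul_def] at h'
    simp only [smulGr, smul_smul, h', smul_assoc]
  rw [Units.smul_def, ← map_zsmul]
  refine congrArg (fun y => A.chainMk (.of ⟨y, t⟩)) (arr_ext (by ring) ?_)
  simpa using h

theorem chainActGen_rel [IsGradedComm 𝓡] {i : ℤ} (r : 𝓡 i)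
    {c : FreeAbelianGroup A.CyclicWord} (h : A.ChainRel c) :
    FreeAbelianGroup.lift (chainActGen r) c = 0 := by
  cases h with
  | add_head d x y t =>
    simp only [map_sub, map_add, FreeAbelianGroup.lift_apply_of, chainActGen, chainMk_smulArr,
      smulGr_add, smul_add, sub_self]
  | add_tail x₀ s d x y t =>
    have h := A.chainMk_rel (.add_tail (smulArr r x₀.2) s d x y t)
    simp only [map_sub, map_add, FreeAbelianGroup.lift_apply_of, chainActGen, ← smul_add,
      ← smul_sub] at h ⊢
    rw [h, smul_zero]
  | balanced d₀ x₀ s j d r' x t =>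
    have h := A.chainMk_rel (.balanced (i + d₀) (smulGr r x₀) s j d r' x t)
    simp only [map_sub, Units.smul_def, map_zsmul, FreeAbelianGroup.lift_apply_of, chainActGen,
      sub_eq_zero] at h ⊢
    change _ • A.chainMk (.of ⟨⟨i + d₀, smulGr r x₀⟩, _⟩) = _ • _ • headHom (i + (j + d₀)) _
      (smulGr r (smulGr r' x₀))
    rw [h, chainMk_smulArr, headHom_smul_comm, Units.smul_def, smul_smul, smul_smul, smul_smul]
    congr 1
    simp only [← Units.val_mul, ← Int.negOnePow_add]
    congr 1
    rw [Int.negOnePow_eq_iff]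
    exact ⟨i * j, by ring⟩
  | unit x₀ s t =>
    have h := A.chainMk_rel (.unit (smulArr r x₀.2) s t)
    simp only [FreeAbelianGroup.lift_apply_of, chainActGen, h, smul_zero]

/-- Multiplication by a homogeneous scalar on `CC_•(𝒜)[1]`. -/
def chainAct [IsGradedComm 𝓡] {i : ℤ} (r : 𝓡 i) : A.ChainGroup →+ A.ChainGroup :=
  QuotientAddGroup.lift _ (FreeAbelianGroup.lift (chainActGen r))
    ((AddSubgroup.closure_le _).2 fun _ hc => chainActGen_rel r hc)

theorem chainAct_of [IsGradedComm 𝓡] {i : ℤ} (r : 𝓡 i) (g : A.CyclicWord) :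
    chainAct r (A.chainMk (.of g)) =
      i.negOnePow • A.chainMk (.of ⟨smulArr r g.head.2, g.tail⟩) :=
  FreeAbelianGroup.lift_apply_of _ _

theorem chain_hom_ext {G : Type*} [AddCommGroup G] {f g : A.ChainGroup →+ G}
    (h : ∀ c : A.CyclicWord, f (A.chainMk (.of c)) = g (A.chainMk (.of c))) : f = g :=
  QuotientAddGroup.addMonoidHom_ext _ (FreeAbelianGroup.lift_ext _ _ h)

/-- Multiplication by a homogeneous scalar on `CC^•(𝒜)[1]`: `r · φ = (-1)^{|r|} r φ(⋯)`. -/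
def cochainAct {i : ℤ} (r : 𝓡 i) : A.CochainFun →+ A.CochainFun :=
  AddMonoidHom.mk' (fun φ X Y t => i.negOnePow • ((r : R) • φ X Y t))
    (fun φ ψ => by funext X Y t; simp only [Pi.add_apply, smul_add])

theorem cochainAct_apply {i : ℤ} (r : 𝓡 i) (φ : A.CochainFun) (X Y : A.Ob) (t : A.Path X Y) :
    cochainAct r φ X Y t = i.negOnePow • ((r : R) • φ X Y t) := rfl

theorem cochainAct_add {i : ℤ} (r s : 𝓡 i) :
    cochainAct (A := A) (r + s) = cochainAct r + cochainAct s := by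
  ext φ X Y t
  change i.negOnePow • (((r : R) + s) • φ X Y t) =
    i.negOnePow • ((r : R) • φ X Y t) + i.negOnePow • ((s : R) • φ X Y t)
  rw [add_smul, smul_add]

theorem cochainAct_mem [IsGradedComm 𝓡] {i p : ℤ} (r : 𝓡 i) {φ : A.CochainFun}
    (hφ : φ ∈ A.cochains p ⊓ A.reducedFun) :
    cochainAct r φ ∈ A.cochains (i + p) ⊓ A.reducedFun := by
  have hsm : ∀ {X Y : A.Ob} {d : ℤ} {x : A.Hom X Y}, x ∈ A.gr X Y d →
      ((i.negOnePow : ℤˣ) : ℤ) • ((r : R) • x) ∈ A.gr X Y (i + d) :=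
    fun hx => zsmul_mem (SetLike.GradedSMul.smul_mem r.2 hx) _
  refine ⟨⟨fun X Y t => ?_, fun X Y Z T s t d x y => ?_, fun X Y Z T s t j d r' x => ?_⟩,
    fun X Y Z s t => ?_⟩
  · have h := hsm (hφ.1.1 X Y t)
    rwa [show i + (p + pdeg t + 1) = i + p + pdeg t + 1 by ring] at h
  · simp only [cochainAct_apply, hφ.1.2.1, smul_add]
  · have hc : (r : R) * r' = (i * j).negOnePow • ((r' : R) * r) :=
      IsGradedComm.comm r.2 r'.2
    simp only [cochainAct_apply, hφ.1.2.2]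
    simp only [Units.smul_def, smul_comm (_ : R) (_ : ℤ), smul_smul (_ : R) (_ : R)] at hc ⊢
    rw [hc]
    simp only [smul_assoc, smul_smul]
    congr 1
    simp only [← Units.val_mul, ← Int.negOnePow_add]
    congr 1
    rw [Int.negOnePow_eq_iff]
    exact ⟨0, by ring⟩
  · rw [cochainAct_apply, hφ.2, smul_zero, smul_zero]

/-- The unit of `R` in degree `0`. -/
def oneDeg (𝓡 : ℤ → AddSubgroup R) [GradedRing 𝓡] : 𝓡 0 := ⟨1, SetLike.one_mem_graded 𝓡⟩

/-- The product of homogeneous scalars. -/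
def mulDeg {i j : ℤ} (r : 𝓡 i) (s : 𝓡 j) : 𝓡 (i + j) :=
  ⟨(r : R) * s, SetLike.mul_mem_graded r.2 s.2⟩

theorem one_cochainAct (r : 𝓡 0) (hr : (r : R) = 1) (φ : A.CochainFun) :
    cochainAct r φ = φ := by
  funext X Y t
  change (0 : ℤ).negOnePow • ((r : R) • φ X Y t) = φ X Y t
  simp [hr]

theorem mul_cochainAct {i j : ℤ} (r : 𝓡 i) (s : 𝓡 j) (q : 𝓡 (i + j)) (hq : (q : R) = r * s)
    (φ : A.CochainFun) : cochainAct q φ = cochainAct r (cochainAct s φ) := by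
  funext X Y t
  change (i + j).negOnePow • ((q : R) • φ X Y t) =
    i.negOnePow • ((r : R) • (j.negOnePow • ((s : R) • φ X Y t)))
  simp only [hq, Units.smul_def, smul_comm (_ : R) (_ : ℤ), smul_smul, Int.negOnePow_add, Units.val_mul]

variable (A)

/-- The homogeneous parts of `CC_•(𝒜)[1]`, reduced. -/
def chainDeg (d : ℤ) : AddSubgroup A.ChainGroup :=
  (AddSubgroup.closure {c | ∃ g : A.CyclicWord, g.deg = d ∧ c = .of g}).map A.chainMk

variable {A}

theorem chainAct_add [IsGradedComm 𝓡] {i : ℤ} (r s : 𝓡 i) :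
    chainAct (A := A) (r + s) = chainAct r + chainAct s := chain_hom_ext fun g => by
  rw [AddMonoidHom.add_apply, chainAct_of, chainAct_of, chainAct_of, chainMk_smulArr,
    add_smulGr, map_add, smul_add]
  rfl

theorem chainAct_mem [IsGradedComm 𝓡] {i j : ℤ} (r : 𝓡 i) {x : A.ChainGroup}
    (hx : x ∈ A.chainDeg j) : chainAct r x ∈ A.chainDeg (i + j) := by
  obtain ⟨c, hc, rfl⟩ := hx
  induction hc using AddSubgroup.closure_induction with
  | mem c hc =>
    obtain ⟨g, rfl, rfl⟩ := hc
    rw [chainAct_of, Units.smul_def]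
    refine zsmul_mem (AddSubgroup.mem_map_of_mem A.chainMk (AddSubgroup.subset_closure
      (Exists.intro (CyclicWord.mk (smulArr r g.head.2) g.tail) (And.intro ?_ rfl)))) _
    simp only [CyclicWord.deg, sdeg₁, smulArr]
    ring
  | zero => rw [map_zero, map_zero]; exact zero_mem _
  | add c c' _ _ h h' => rw [map_add, map_add]; exact add_mem h h'
  | neg c _ h => rw [map_neg, map_neg]; exact neg_mem h

theorem one_chainAct [IsGradedComm 𝓡] (r : 𝓡 0) (hr : (r : R) = 1) (x : A.ChainGroup) :
    chainAct r x = x := by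
  refine DFunLike.congr_fun (f := chainAct r) (g := AddMonoidHom.id _)
    (chain_hom_ext fun g => ?_) x
  rw [chainAct_of, Int.negOnePow_zero, one_smul, AddMonoidHom.id_apply]
  obtain ⟨⟨d, x⟩, t⟩ := g
  exact congrArg (fun y => A.chainMk (.of ⟨y, t⟩)) (arr_ext (by simp) (by simp [smulGr, hr]))

theorem mul_chainAct [IsGradedComm 𝓡] {i j : ℤ} (r : 𝓡 i) (s : 𝓡 j) (q : 𝓡 (i + j))
    (hq : (q : R) = r * s) (x : A.ChainGroup) : chainAct q x = chainAct r (chainAct s x) := by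
  refine DFunLike.congr_fun (f := chainAct q) (g := (chainAct r).comp (chainAct s))
    (chain_hom_ext fun g => ?_) x
  rw [AddMonoidHom.comp_apply, chainAct_of, chainAct_of, Units.smul_def j.negOnePow, map_zsmul,
    chainAct_of, ← Units.smul_def, smul_smul, Int.negOnePow_add, mul_comm]
  congr 1
  obtain ⟨⟨d, x⟩, t⟩ := g
  refine congrArg (fun y => A.chainMk (.of ⟨y, t⟩)) (arr_ext (add_assoc _ _ _) ?_)
  change (q : R) • x.1 = (r : R) • ((s : R) • x.1)
  rw [hq, mul_smul]

variable (A) [IsGradedComm 𝓡]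

/-- `L = CC^•(𝒜)[1]`, reduced, as a graded `R`-module. -/
def redCochains : GrMod.{u, max v w} (GrRing.ofGraded 𝓡) where
  carrier := A.CochainFun
  deg p := A.cochains p ⊓ A.reducedFun
  act i := AddMonoidHom.mk' (fun r : 𝓡 i => cochainAct r) (cochainAct_add (𝓡 := 𝓡))
  act_mem r _ hφ := cochainAct_mem (𝓡 := 𝓡) r hφ
  one_act φ := one_cochainAct (oneDeg 𝓡) rfl φ
  mul_act r s φ := mul_cochainAct (𝓡 := 𝓡) r s (mulDeg (𝓡 := 𝓡) r s) rfl φ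

/-- `CC_•(𝒜)[1]`, reduced, as a graded `R`-module. -/
def redChains : GrMod.{u, max v w} (GrRing.ofGraded 𝓡) where
  carrier := A.ChainGroup
  deg := A.chainDeg
  act i := AddMonoidHom.mk' (fun r : 𝓡 i => chainAct r) (chainAct_add (𝓡 := 𝓡))
  act_mem r _ hx := chainAct_mem (𝓡 := 𝓡) r hx
  one_act x := one_chainAct (oneDeg 𝓡) rfl x
  mul_act r s x := mul_chainAct (𝓡 := 𝓡) r s (mulDeg (𝓡 := 𝓡) r s) rfl x

/-- A reduced homogeneous cochain as a cochain. -/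
def incl {A : UnitalGradedQuiver.{u, v, w} 𝓡} {p : ℤ} (φ : A.redCochains.deg p) : A.cochains p :=
  ⟨φ.1, φ.2.1⟩

end Basic

/-! ## The operators on chains -/

section Operators

variable {R : Type u} [Ring R] {𝓡 : ℤ → AddSubgroup R} [GradedRing 𝓡]
  {A : UnitalGradedQuiver.{u, v, w} 𝓡}

/-- `ℒ_φ(x₀ ⊗ ⋯ ⊗ x_k)`. In the first sum `tail = a b c` with `a = (x₁, …, x_i)`,
`b = (x_{i+1}, …, x_j)`; in the second one `c = (x_{j+1}, …, x_k)`. -/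
def lieFormula {p : ℤ} (φ : A.cochains p) (g : A.CyclicWord) : FreeAbelianGroup A.CyclicWord :=
  (g.tail.sum₂ fun a t => t.sum₂ fun b c =>
    (p * (sdeg₁ g.head + pdeg a)).negOnePow • .of ⟨g.head, ins a (value φ b) c⟩) +
  (g.tail.sum₂ fun a t => t.sum₂ fun b c =>
    ((sdeg₁ g.head + pdeg a + pdeg b) * pdeg c).negOnePow •
      .of ⟨value φ (ins c g.head a), b⟩)

/-- `ρ_{φ,ψ}(x₀ ⊗ ⋯ ⊗ x_k)`, with `tail = a b c e f`, `a = (x₁, …, x_i)`,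
`b = (x_{i+1}, …, x_j)`, `c = (x_{j+1}, …, x_s)`, `e = (x_{s+1}, …, x_t)`,
`f = (x_{t+1}, …, x_k)`. -/
def rhoFormula {p q : ℤ} (φ : A.cochains p) (ψ : A.cochains q) (g : A.CyclicWord) :
    FreeAbelianGroup A.CyclicWord :=
  g.tail.sum₂ fun a t₁ => t₁.sum₂ fun b t₂ => t₂.sum₂ fun c t₃ => t₃.sum₂ fun e f =>
    (q * pdeg c + (sdeg₁ g.head + pdeg a + pdeg b) * (pdeg c + pdeg e + pdeg f)).negOnePow •
      .of ⟨value φ (ins c (value ψ e) (ins f g.head a)), b⟩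

/-- Connes' operator `B(x₀ ⊗ ⋯ ⊗ x_k)`, with `tail = a c`, `a = (x₁, …, x_i)`. -/
def connesFormula (g : A.CyclicWord) : FreeAbelianGroup A.CyclicWord :=
  g.tail.sum₂ fun {Z} a c =>
    ((sdeg₁ g.head + pdeg a) * pdeg c).negOnePow • .of ⟨A.unit Z, ins c g.head a⟩

/-- `B¹_φ(x₀ ⊗ ⋯ ⊗ x_k)`, with `tail = a b e c`, `a = (x₁, …, x_i)`,
`b = (x_{i+1}, …, x_j)`, `e = (x_{j+1}, …, x_s)`, `c = (x_{s+1}, …, x_k)`. -/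
def connesOneFormula {p : ℤ} (φ : A.cochains p) (g : A.CyclicWord) :
    FreeAbelianGroup A.CyclicWord :=
  g.tail.sum₂ fun {Z} a t₁ => t₁.sum₂ fun b t₂ => t₂.sum₂ fun e c =>
    ((sdeg₁ g.head + pdeg a) * (pdeg b + pdeg e + pdeg c) + p * pdeg b).negOnePow •
      .of ⟨A.unit Z, ins b (value φ e) (ins c g.head a)⟩

/-- `f` is the endomorphism of the reduced chains which is given by `F` on generators. -/
def IsInducedBy (f : A.ChainGroup →+ A.ChainGroup)
    (F : A.CyclicWord → FreeAbelianGroup A.CyclicWord) : Prop :=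
  ∀ g : A.CyclicWord, f (A.chainMk (.of g)) = A.chainMk (F g)

variable [IsGradedComm 𝓡]

/-- The operators on the reduced Hochschild chains induced by the formulas above, for reduced
cochains `φ, ψ` and an `A_∞` structure `m`; they are unique if they exist. -/
structure ReducedOperators (A : UnitalGradedQuiver.{u, v, w} 𝓡) (m : A.cochains 1) where
  /-- `ℒ_φ` -/
  lie : A.redCochains.Homog → A.ChainGroup →+ A.ChainGroup
  lie_induced : ∀ φ, IsInducedBy (lie φ) (lieFormula (incl φ.2))
  /-- `ρ_{φ,ψ}` -/
  rho : A.redCochains.Homog → A.redCochains.Homog → A.ChainGroup →+ A.ChainGroup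
  rho_induced : ∀ φ ψ, IsInducedBy (rho φ ψ) (rhoFormula (incl φ.2) (incl ψ.2))
  /-- `b = ℒ_m` -/
  b : A.ChainGroup →+ A.ChainGroup
  b_induced : IsInducedBy b (lieFormula m)
  /-- `b¹_φ = ρ_{m,φ}` -/
  b₁ : A.redCochains.Homog → A.ChainGroup →+ A.ChainGroup
  b₁_induced : ∀ φ, IsInducedBy (b₁ φ) (rhoFormula m (incl φ.2))
  /-- `B` -/
  B : A.ChainGroup →+ A.ChainGroup
  B_induced : IsInducedBy B connesFormula
  /-- `B¹_φ` -/
  B₁ : A.redCochains.Homog → A.ChainGroup →+ A.ChainGroup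
  B₁_induced : ∀ φ, IsInducedBy (B₁ φ) (connesOneFormula (incl φ.2))

namespace ReducedOperators

variable {m : A.cochains 1} (T : ReducedOperators A m)

/-- `L[1][[z]]`. -/
abbrev LPs (A : UnitalGradedQuiver.{u, v, w} 𝓡) : GrMod.{u, max v w} (psRing (GrRing.ofGraded 𝓡)) :=
  psMod A.redCochains.shift

/-- The coefficient `y_n ∈ L` of `y = ∑ y_n zⁿ ∈ L[[z]]`. -/
def lCoeff (y : (LPs A).Homog) (n : ℕ) : A.redCochains.Homog := unshift (psCoeff y n)

/-- The degree `|y|` in `L[[z]]` (not in `L[1][[z]]`). -/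
def ldeg (y : (LPs A).Homog) : ℤ := y.1 + 1

/-- `d = b + z B` on `M̃ = M[[z]]`. -/
def d (x : ℕ → A.ChainGroup) : ℕ → A.ChainGroup :=
  (fun n => T.b (x n)) + zmul (fun n => T.B (x n))

/-- The `z`-bilinear extension of an action of `L` on `M` to `L[[z]]` and `M[[z]]`. -/
def ext (f : A.redCochains.Homog → A.ChainGroup →+ A.ChainGroup) (y : (LPs A).Homog)
    (x : ℕ → A.ChainGroup) : ℕ → A.ChainGroup :=
  fun n => ∑ p ∈ antidiagonal n, f (lCoeff y p.1) (x p.2)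

/-- `ℒ_y` for `y ∈ L[[z]]`. -/
def lieZ (y : (LPs A).Homog) (x : ℕ → A.ChainGroup) : ℕ → A.ChainGroup := ext T.lie y x

/-- `I_y = b¹_y + z B¹_y` for `y ∈ L[[z]]`. -/
def I (y : (LPs A).Homog) (x : ℕ → A.ChainGroup) : ℕ → A.ChainGroup :=
  ext T.b₁ y x + zmul (ext T.B₁ y x)

/-- `ρ_{y₁,y₂}` for `y₁, y₂ ∈ L[[z]]`. -/
def rhoZ (y₁ y₂ : (LPs A).Homog) (x : ℕ → A.ChainGroup) : ℕ → A.ChainGroup :=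
  fun n => ∑ p ∈ antidiagonal n, ext (T.rho (lCoeff y₁ p.1)) y₂ x p.2

/-- The operations `ℓ^M̃_k` determined by `d`, `ℒ`, `I`, `ρ`:
`ℓ₀ = -d`, `ℓ₁(y | ·) = (-1)^{|y|} ℒ_y`, `ℓ₁(ε y | ·) = (-1)^{|y|+1} I_y`,
`ℓ₂(y₁, ε y₂ | ·) = (-1)^{|y₁|+|y₂|} ρ_{y₁,y₂}`, graded symmetry determining
`ℓ₂(ε y₁, y₂ | ·)`, and `ℓ₂(y₁, y₂ | ·) = ℓ₂(ε y₁, ε y₂ | ·) = 0`, `ℓ_k = 0` for `k ≥ 3`. -/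
def chOp : List (cone A.redCochains.shift).Homog → (ℕ → A.ChainGroup) → ℕ → A.ChainGroup
  | [], x => -T.d x
  | [y], x =>
      (ldeg (cone.fst y)).negOnePow • T.lieZ (cone.fst y) x +
      (ldeg (cone.snd y) + 1).negOnePow • T.I (cone.snd y) x
  | [y₁, y₂], x =>
      (ldeg (cone.fst y₁) + ldeg (cone.snd y₂)).negOnePow •
        T.rhoZ (cone.fst y₁) (cone.snd y₂) x +
      (y₁.1 * y₂.1).negOnePow • (ldeg (cone.fst y₂) + ldeg (cone.snd y₁)).negOnePow •
        T.rhoZ (cone.fst y₂) (cone.snd y₁) x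
  | _, _ => 0

end ReducedOperators

end Operators

end UnitalGradedQuiver

end CHStruct

end

open CHStruct

/-!
The square of the coderivation attached to a family of operations is itself a coderivation, attached
to an explicit family built from compositions of the operations: this is proved for graded
commutators of coderivations (`GOp.br`, `IsHom.coderHom_comm`) and deduced for squares
(`sqV`, `sqW`, `IsHom.coderHom_sq`). Therefore an `L_∞` structure modulo `ε²` amounts to the vanishing
of the components of this family on tuples of which at most one entry involves `ε`
(`isLInfinityModuleMod_two`). Since all operations have at most two inputs from the cone, and `ℓ_2`
vanishes in the absence of `ε`, only the components with at most three inputs have to be examined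
(`IsHom.sqW_one`, `IsHom.sqW_two`, `IsHom.sqW_three`, `IsHom.sqW_eq_zero_of_four_le`).

On the algebraic side, the insertion product of Hochschild cochains satisfies the pre-Lie identity
(`circ_circ`), so the bracket satisfies the Jacobi identity; with `[m, m] = 0` this makes the cochains
a DGLA. The differential preserves reduced cochains because a unit inserted in `m` only acts through
`m_2`, and the resulting terms cancel (`IsStrictlyUnitalCurved.isReduced_bracket`, `redDGLA`). The same
cancellation shows that `b` is well defined on the reduced chains (`IsStrictlyUnitalCurved.lieCh_unit`,
`redOps`).

The remaining components are Cartan-type identities for operators on chains, stated in the ring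
`ChainEnd` of additive endomorphisms. For each composition, the terms are sorted according to the
relative position of the two cochains and of `x₀` in the cyclic word (`lie_lieCh`, `lie_rhoCh`,
`rho_lieCh`, `lie_connesCh`, `lie_connesOneCh`). Most terms match up to signs by reindexing sums over
splittings of a word. What is left are nested terms, which assemble into brackets of cochains, and
terms in which `m` multiplies the unit produced by `B` or `B¹` with a neighbour. By strict unitality
the latter cancel in `bB + Bb` (`IsStrictlyUnitalCurved.sum_lieHead_unit`) and leave `-ℒ_φ` in
`[b, B¹_φ] + [B, b¹_φ]` (`IsStrictlyUnitalCurved.sum_lieHead_unit_value`). The outcome is `eb_eb`,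
`eb_eB`, `eB_eB`, `eLie_eLie`, `eb_eLie`, `eb_eb₁`, `eb_eB₁`, `eLie_eb₁`, `eLie_eB₁` and `eLie_eRho`: the
square of `d = b + zB` is zero, `ℒ` is a representation, `[d, I_φ] = -I_{δφ} - zℒ_φ`, and `ρ` is a
homotopy for the compatibility of `I` with the bracket, itself compatible with the bracket.

These identities are extended `z`-linearly by viewing the operators as power series with coefficients
in `ChainEnd` (`hat`, `serD`, `serLie`, `serI`, `serRho`), and they are exactly the components of the
square (`chS_sq_one`, `chS_sq_two`, `chS_sq_three`).
-/

noncomputable section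

namespace CHStruct

/-! ### Signs -/

/-- Signs only depend on parities, and equality of parities is checked in `ZMod 2`, where polynomial
identities between degrees become identities of a commutative ring of characteristic two. -/
theorem negOnePow_eq_of_zmod {m n : ℤ} (h : (m : ZMod 2) = n) : m.negOnePow = n.negOnePow := by
  rw [Int.negOnePow_eq_iff, even_iff_two_dvd]
  have := (ZMod.intCast_eq_intCast_iff_dvd_sub n m 2).1 h.symm
  exact_mod_cast this

theorem negOnePow_smul_congr {G : Type*} [AddCommGroup G] {m n : ℤ} {x y : G}
    (h : (m : ZMod 2) = n) (hxy : x = y) : m.negOnePow • x = n.negOnePow • y := by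
  rw [negOnePow_eq_of_zmod h, hxy]

theorem negOnePow_smul_smul {G : Type*} [AddCommGroup G] (m n : ℤ) (x : G) :
    m.negOnePow • n.negOnePow • x = (m + n).negOnePow • x := by
  rw [smul_smul, Int.negOnePow_add]

theorem negOnePow_smul_self {G : Type*} [AddCommGroup G] (m : ℤ) (x : G) :
    m.negOnePow • m.negOnePow • x = x := by
  rw [smul_smul, ← sq, Int.units_sq, one_smul]

theorem map_negOnePow_smul {G H F : Type*} [AddCommGroup G] [AddCommGroup H] [FunLike F G H]
    [AddMonoidHomClass F G H] (f : F) (u : ℤˣ) (x : G) : f (u • x) = u • f x := by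
  rw [Units.smul_def, Units.smul_def, map_zsmul]

theorem units_smul_mem {G : Type*} [AddCommGroup G] {H : AddSubgroup G} {x : G} (u : ℤˣ)
    (hx : x ∈ H) : u • x ∈ H := by
  rw [Units.smul_def]; exact zsmul_mem hx _

theorem smul_units_smul {G : Type*} [AddCommGroup G] (m : ℤ) (u : ℤˣ) (x : G) :
    m • u • x = u • m • x := by
  rw [Units.smul_def, Units.smul_def, smul_comm]

/-! ### Homogeneous elements and symmetric tensors -/

section Coalgebra

variable {S : GrRing.{u}} {V : GrMod.{u, w} S} {W : GrMod.{u, v} S}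

theorem homog_ext {x y : V.Homog} (h : x.1 = y.1) (h' : (x.2 : V.carrier) = y.2) : x = y := by
  obtain ⟨d, x⟩ := x
  obtain ⟨e, y⟩ := y
  obtain rfl : d = e := h
  obtain rfl : x = y := Subtype.ext h'
  rfl

theorem sdeg_nil : sdeg ([] : List V.Homog) = 0 := rfl

theorem sdeg_cons (y : V.Homog) (l : List V.Homog) : sdeg (y :: l) = y.1 + sdeg l := rfl

theorem sdeg_append (l l' : List V.Homog) : sdeg (l ++ l') = sdeg l + sdeg l' := by
  simp [sdeg]

theorem GrMod.smul_smul_comm (W : GrMod.{u, v} S) {i j e : ℤ} (r : S.deg i) (s : S.deg j)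
    (x : W.deg e) :
    W.act i r (W.act j s x) = (i * j).negOnePow • W.act j s (W.act i r x) := by
  rw [← W.mul_act, ← W.mul_act]
  have h := S.graded_comm r.2 s.2
  have hm : ((i * j).negOnePow : ℤ) • (s * r : S.carrier) ∈ S.deg (i + j) := by
    have := S.mul_mem r.2 s.2
    rwa [h, Units.smul_def] at this
  rw [W.act_congr (add_comm j i) ⟨(s : S.carrier) * r, S.mul_mem s.2 r.2⟩
    ⟨(s : S.carrier) * r, by rw [add_comm]; exact S.mul_mem s.2 r.2⟩ rfl,
    ← AddMonoidHom.smul_apply, Units.smul_def, ← map_zsmul]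
  refine DFunLike.congr_fun (W.act_congr rfl _ _ ?_) _
  simpa [Units.smul_def] using h

/-- The generator `y₁ ⊙ ⋯ ⊙ y_k ⊗ x`. -/
def gen (l : List V.Homog) (x : W.Homog) : SymTensor V W := SymTensor.mk V W (.of (l, x))

theorem symTensor_mk_rel {t : FreeAbelianGroup (List V.Homog × W.Homog)} (h : TensorRel V W t) :
    SymTensor.mk V W t = 0 :=
  (QuotientAddGroup.eq_zero_iff t).2 (AddSubgroup.subset_closure h)

theorem gen_add (l l' : List V.Homog) (d : ℤ) (y y' : V.deg d) (x : W.Homog) :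
    gen (l ++ ⟨d, y + y'⟩ :: l') x = gen (l ++ ⟨d, y⟩ :: l') x + gen (l ++ ⟨d, y'⟩ :: l') x := by
  have h := symTensor_mk_rel (.add l l' d y y' x)
  rwa [map_sub, map_add, sub_eq_zero] at h

theorem gen_add_right (l : List V.Homog) (d : ℤ) (x x' : W.deg d) :
    gen l (⟨d, x + x'⟩ : W.Homog) = gen l ⟨d, x⟩ + gen l ⟨d, x'⟩ := by
  have h := symTensor_mk_rel (.add_right l d x x')
  rwa [map_sub, map_add, sub_eq_zero] at h

theorem gen_balanced (l l' : List V.Homog) (i d e : ℤ) (r : S.deg i) (y : V.deg d) (x : W.deg e) :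
    gen (l ++ ⟨i + d, V.smul r y⟩ :: l') (⟨e, x⟩ : W.Homog) =
      (i * (d + sdeg l')).negOnePow • gen (l ++ ⟨d, y⟩ :: l') ⟨i + e, W.smul r x⟩ := by
  have h := symTensor_mk_rel (.balanced l l' i d e r y x)
  rwa [map_sub, map_negOnePow_smul, sub_eq_zero] at h

theorem gen_swap (l l' : List V.Homog) (y y' : V.Homog) (x : W.Homog) :
    gen (l ++ y :: y' :: l') x = (y.1 * y'.1).negOnePow • gen (l ++ y' :: y :: l') x := by
  have h := symTensor_mk_rel (.swap l l' y y' x)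
  rwa [map_sub, map_negOnePow_smul, sub_eq_zero] at h

/-- Additive maps on the symmetric tensors are equal if they agree on generators. -/
theorem symTensor_hom_ext {G : Type*} [AddCommGroup G] {f g : SymTensor V W →+ G}
    (h : ∀ (l : List V.Homog) (x : W.Homog), f (gen l x) = g (gen l x)) : f = g :=
  QuotientAddGroup.addMonoidHom_ext _ (FreeAbelianGroup.lift_ext _ _ fun t => h t.1 t.2)

/-- The additive map out of the symmetric tensors determined by its values on generators. -/
def symLift {G : Type*} [AddCommGroup G] (f : List V.Homog → W.Homog → G)
    (h : ∀ t, TensorRel V W t → FreeAbelianGroup.lift (fun t => f t.1 t.2) t = 0) :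
    SymTensor V W →+ G :=
  QuotientAddGroup.lift _ (FreeAbelianGroup.lift fun t => f t.1 t.2)
    ((AddSubgroup.closure_le _).2 fun t ht => h t ht)

theorem symLift_gen {G : Type*} [AddCommGroup G] (f : List V.Homog → W.Homog → G) (h) (l x) :
    symLift f h (gen l x) = f l x :=
  FreeAbelianGroup.lift_apply_of (fun t : List V.Homog × W.Homog => f t.1 t.2) (l, x)

/-- A generator as an additive function of the module entry. -/
def genRight (l : List V.Homog) (d : ℤ) : W.deg d →+ SymTensor V W :=
  AddMonoidHom.mk' (fun x => gen l ⟨d, x⟩) (gen_add_right l d)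

/-- A generator as an additive function of one entry. -/
def genMid (l l' : List V.Homog) (d : ℤ) (x : W.Homog) : V.deg d →+ SymTensor V W :=
  AddMonoidHom.mk' (fun y => gen (l ++ ⟨d, y⟩ :: l') x) (fun y y' => gen_add l l' d y y' x)

/-- Generators are linear in the module entry,
  for entries whose degrees agree only propositionally. -/
theorem gen_right_lin (l : List V.Homog) (n₁ n₂ : ℤ) {x x₁ x₂ : W.Homog}
    (h₁ : x₁.1 = x.1) (h₂ : x₂.1 = x.1)
    (h : (x.2 : W.carrier) = n₁ • (x₁.2 : W.carrier) + n₂ • (x₂.2 : W.carrier)) :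
    gen l x = n₁ • gen l x₁ + n₂ • gen l x₂ := by
  obtain ⟨d, x⟩ := x
  obtain ⟨_, x₁⟩ := x₁
  obtain ⟨_, x₂⟩ := x₂
  obtain rfl : _ = d := h₁
  obtain rfl : _ = _ := h₂
  obtain rfl : x = n₁ • x₁ + n₂ • x₂ := Subtype.ext h
  refine ((genRight l _).map_add (n₁ • x₁) (n₂ • x₂)).trans ?_
  rw [map_zsmul, map_zsmul]
  rfl

/-- Generators are linear in each entry, for entries whose degrees agree only propositionally. -/
theorem gen_mid_lin (l l' : List V.Homog) (n₁ n₂ : ℤ) {y y₁ y₂ : V.Homog}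
    (h₁ : y₁.1 = y.1) (h₂ : y₂.1 = y.1)
    (h : (y.2 : V.carrier) = n₁ • (y₁.2 : V.carrier) + n₂ • (y₂.2 : V.carrier)) (x : W.Homog) :
    gen (l ++ y :: l') x = n₁ • gen (l ++ y₁ :: l') x + n₂ • gen (l ++ y₂ :: l') x := by
  obtain ⟨d, y⟩ := y
  obtain ⟨_, y₁⟩ := y₁
  obtain ⟨_, y₂⟩ := y₂
  obtain rfl : _ = d := h₁
  obtain rfl : _ = _ := h₂
  obtain rfl : y = n₁ • y₁ + n₂ • y₂ := Subtype.ext h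
  refine ((genMid l l' _ x).map_add (n₁ • y₁) (n₂ • y₂)).trans ?_
  rw [map_zsmul, map_zsmul]
  rfl

theorem gen_right_zero (l : List V.Homog) {x : W.Homog} (h : (x.2 : W.carrier) = 0) :
    gen l x = 0 := by
  simpa using gen_right_lin l 0 0 (x := x) (x₁ := x) (x₂ := x) rfl rfl (by simpa using h)

theorem gen_mid_zero (l l' : List V.Homog) {y : V.Homog} (h : (y.2 : V.carrier) = 0)
    (x : W.Homog) : gen (l ++ y :: l') x = 0 := by
  simpa using gen_mid_lin l l' 0 0 (y := y) (y₁ := y) (y₂ := y) rfl rfl (by simpa using h) x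

/-- Left multiplication by `y` on symmetric tensors. -/
def consHom (y : V.Homog) : SymTensor V W →+ SymTensor V W :=
  symLift (fun l x => gen (y :: l) x) (by
    intro t ht
    cases ht with
    | add l l' d a b x => simpa [sub_eq_zero] using gen_add (y :: l) l' d a b x
    | add_right l d a b => simpa [sub_eq_zero] using gen_add_right (y :: l) d a b
    | balanced l l' i d e r a x =>
      simpa [sub_eq_zero, map_negOnePow_smul] using gen_balanced (y :: l) l' i d e r a x
    | swap l l' a b x => simpa [sub_eq_zero, map_negOnePow_smul] using gen_swap (y :: l) l' a b x)

theorem consHom_gen (y : V.Homog) (l : List V.Homog) (x : W.Homog) :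
    consHom y (gen l x) = gen (y :: l) x := symLift_gen _ _ _ _

theorem consHom_lin (n₁ n₂ : ℤ) {y y₁ y₂ : V.Homog} (h₁ : y₁.1 = y.1) (h₂ : y₂.1 = y.1)
    (h : (y.2 : V.carrier) = n₁ • (y₁.2 : V.carrier) + n₂ • (y₂.2 : V.carrier))
    (t : SymTensor V W) : consHom y t = n₁ • consHom y₁ t + n₂ • consHom y₂ t := by
  have : (consHom y : SymTensor V W →+ _) = n₁ • consHom y₁ + n₂ • consHom y₂ :=
    symTensor_hom_ext fun l x => by
      simpa [consHom_gen] using gen_mid_lin [] l n₁ n₂ h₁ h₂ h x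
  rw [this]; rfl

theorem consHom_swap (y y' : V.Homog) (t : SymTensor V W) :
    consHom y (consHom y' t) = (y.1 * y'.1).negOnePow • consHom y' (consHom y t) := by
  have : (consHom y : SymTensor V W →+ _).comp (consHom y') =
      ((y.1 * y'.1).negOnePow : ℤ) • (consHom y').comp (consHom y) :=
    symTensor_hom_ext fun l x => by
      simpa [consHom_gen, Units.smul_def] using gen_swap [] l y y' x
  simpa [Units.smul_def] using DFunLike.congr_fun this t

/-- The product of a homogeneous scalar with a homogeneous element, with its degree. -/
def hsmul {i : ℤ} (r : S.deg i) (x : W.Homog) : W.Homog := ⟨i + x.1, W.smul r x.2⟩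

/-- Multiplication by a homogeneous scalar on symmetric tensors. -/
def actHom {i : ℤ} (r : S.deg i) : SymTensor V W →+ SymTensor V W :=
  symLift (fun l x => (i * sdeg l).negOnePow • gen l (hsmul r x)) (by
    intro t ht
    cases ht with
    | add l l' d a b x =>
      simp [gen_add, sdeg_append, sdeg_cons]
    | add_right l d a b =>
      have : gen l (hsmul r (⟨d, a + b⟩ : W.Homog)) =
          gen l (hsmul r ⟨d, a⟩) + gen l (hsmul r ⟨d, b⟩) := by
        simpa using gen_right_lin l 1 1 (x := hsmul r (⟨d, a + b⟩ : W.Homog))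
          (x₁ := hsmul r ⟨d, a⟩) (x₂ := hsmul r ⟨d, b⟩) rfl rfl (by simp [hsmul, GrMod.smul])
      simp [this]
    | balanced l l' j d e s a x =>
      have h1 := gen_balanced l l' j d (i + e) s a (W.smul r x)
      have h2 : gen (l ++ ⟨d, a⟩ :: l') (⟨j + (i + e), W.smul s (W.smul r x)⟩ : W.Homog) =
          (i * j).negOnePow • gen (l ++ ⟨d, a⟩ :: l')
            (hsmul r ⟨j + e, W.smul s x⟩) := by
        have := gen_right_lin (l ++ ⟨d, a⟩ :: l') ((i * j).negOnePow : ℤ) 0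
          (x := (⟨j + (i + e), W.smul s (W.smul r x)⟩ : W.Homog))
          (x₁ := hsmul r ⟨j + e, W.smul s x⟩) (x₂ := hsmul r ⟨j + e, W.smul s x⟩)
          (by simp [hsmul]; ring) (by simp [hsmul]; ring)
          (by rw [zero_smul, add_zero]
              have := W.smul_smul_comm s r x
              rw [mul_comm j i, Units.smul_def] at this
              exact this)
        simpa [Units.smul_def] using this
      rw [h2] at h1
      simp only [hsmul] at h1 ⊢
      simp only [map_sub, map_negOnePow_smul, FreeAbelianGroup.lift_apply_of, sub_eq_zero,
        h1, negOnePow_smul_smul, sdeg_append, sdeg_cons]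
      refine negOnePow_smul_congr ?_ rfl
      push_cast; grind
    | swap l l' a b x =>
      simp only [map_sub, map_negOnePow_smul, FreeAbelianGroup.lift_apply_of, sub_eq_zero,
        gen_swap l l' a b, negOnePow_smul_smul, sdeg_append, sdeg_cons]
      refine negOnePow_smul_congr ?_ rfl
      push_cast; grind)

theorem actHom_gen {i : ℤ} (r : S.deg i) (l : List V.Homog) (x : W.Homog) :
    actHom r (gen l x) = (i * sdeg l).negOnePow • gen l (hsmul r x) := symLift_gen _ _ _ _

theorem consHom_hsmul {i : ℤ} (r : S.deg i) (y : V.Homog) (t : SymTensor V W) :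
    consHom (hsmul r y) t = (i * y.1).negOnePow • consHom y (actHom r t) := by
  have : (consHom (hsmul r y) : SymTensor V W →+ _) =
      ((i * y.1).negOnePow : ℤ) • (consHom y).comp (actHom r) :=
    symTensor_hom_ext fun l x => by
      have h := gen_balanced [] l i y.1 x.1 r y.2 x.2
      simp only [List.nil_append] at h
      rw [consHom_gen]
      refine h.trans ?_
      rw [AddMonoidHom.smul_apply, AddMonoidHom.comp_apply, actHom_gen, map_negOnePow_smul,
        consHom_gen, ← Units.smul_def, negOnePow_smul_smul]
      refine negOnePow_smul_congr ?_ rfl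
      push_cast; grind
  rw [this, AddMonoidHom.smul_apply, Units.smul_def]; rfl

theorem actHom_consHom {i : ℤ} (r : S.deg i) (y : V.Homog) (t : SymTensor V W) :
    actHom r (consHom y t) = (i * y.1).negOnePow • consHom y (actHom r t) := by
  have : (actHom r : SymTensor V W →+ _).comp (consHom y) =
      ((i * y.1).negOnePow : ℤ) • (consHom y).comp (actHom r) :=
    symTensor_hom_ext fun l x => by
      simp only [AddMonoidHom.smul_apply, AddMonoidHom.comp_apply, actHom_gen, map_negOnePow_smul,
        consHom_gen, ← Units.smul_def, negOnePow_smul_smul, sdeg_cons]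
      refine negOnePow_smul_congr ?_ rfl
      push_cast; grind
  exact (DFunLike.congr_fun this t).trans (by rw [AddMonoidHom.smul_apply, Units.smul_def]; rfl)

end Coalgebra

/-! ### Coderivations and their commutators -/

section Coder

variable {S : GrRing.{u}} {V : GrMod.{u, w} S} {W : GrMod.{u, v} S}

/-- A family of operations `V^{⊗ k} → V`, `V^{⊗ k} ⊗ W → W` of arbitrary degree `e`, including
`k = 0` in both cases, as functions of tuples of homogeneous elements. -/
structure GOp (V : GrMod.{u, w} S) (W : GrMod.{u, v} S) (e : ℤ) where
  fV : List V.Homog → V.carrier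
  memV : ∀ l, fV l ∈ V.deg (sdeg l + e)
  fW : List V.Homog → W.Homog → W.carrier
  memW : ∀ l x, fW l x ∈ W.deg (sdeg l + x.1 + e)

namespace GOp

variable {e f : ℤ}

/-- The value in `V`, with its degree. -/
def homogV (a : GOp V W e) (l : List V.Homog) : V.Homog := ⟨sdeg l + e, a.fV l, a.memV l⟩

/-- The value in `W`, with its degree. -/
def homogW (a : GOp V W e) (l : List V.Homog) (x : W.Homog) : W.Homog :=
  ⟨sdeg l + x.1 + e, a.fW l x, a.memW l x⟩

/-- The family with first input fixed to `y`. -/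
def insert (a : GOp V W e) (y : V.Homog) : GOp V W (e + y.1) where
  fV l := a.fV (y :: l)
  memV l := by
    have := a.memV (y :: l)
    rwa [show sdeg (y :: l) + e = sdeg l + (e + y.1) by rw [sdeg_cons]; ring] at this
  fW l := a.fW (y :: l)
  memW l x := by
    have := a.memW (y :: l) x
    rwa [show sdeg (y :: l) + x.1 + e = sdeg l + x.1 + (e + y.1) by rw [sdeg_cons]; ring] at this

/-- Multilinearity and graded symmetry. -/
structure IsHom (a : GOp V W e) : Prop where
  addV : ∀ (l l' : List V.Homog) (d : ℤ) (y y' : V.deg d),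
    a.fV (l ++ ⟨d, y + y'⟩ :: l') = a.fV (l ++ ⟨d, y⟩ :: l') + a.fV (l ++ ⟨d, y'⟩ :: l')
  smulV : ∀ (l l' : List V.Homog) (i : ℤ) (r : S.deg i) (y : V.Homog),
    a.fV (l ++ hsmul r y :: l') =
      (i * (e + sdeg l)).negOnePow • V.act i r (a.fV (l ++ y :: l'))
  swapV : ∀ (l l' : List V.Homog) (y y' : V.Homog),
    a.fV (l ++ y :: y' :: l') = (y.1 * y'.1).negOnePow • a.fV (l ++ y' :: y :: l')
  addW : ∀ (l l' : List V.Homog) (d : ℤ) (y y' : V.deg d) (x : W.Homog),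
    a.fW (l ++ ⟨d, y + y'⟩ :: l') x =
      a.fW (l ++ ⟨d, y⟩ :: l') x + a.fW (l ++ ⟨d, y'⟩ :: l') x
  add_right : ∀ (l : List V.Homog) (d : ℤ) (x x' : W.deg d),
    a.fW l ⟨d, x + x'⟩ = a.fW l ⟨d, x⟩ + a.fW l ⟨d, x'⟩
  smulW : ∀ (l l' : List V.Homog) (i : ℤ) (r : S.deg i) (y : V.Homog) (x : W.Homog),
    a.fW (l ++ hsmul r y :: l') x =
      (i * (e + sdeg l)).negOnePow • W.act i r (a.fW (l ++ y :: l') x)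
  smul_right : ∀ (l : List V.Homog) (i : ℤ) (r : S.deg i) (x : W.Homog),
    a.fW l (hsmul r x) = (i * (e + sdeg l)).negOnePow • W.act i r (a.fW l x)
  swapW : ∀ (l l' : List V.Homog) (y y' : V.Homog) (x : W.Homog),
    a.fW (l ++ y :: y' :: l') x =
      (y.1 * y'.1).negOnePow • a.fW (l ++ y' :: y :: l') x

theorem IsHom.insert {a : GOp V W e} (h : a.IsHom) (y : V.Homog) : (a.insert y).IsHom where
  addV l l' d y₁ y₂ := h.addV (y :: l) l' d y₁ y₂
  smulV l l' i r y₁ := (h.smulV (y :: l) l' i r y₁).trans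
    (by rw [sdeg_cons, ← add_assoc]; rfl)
  swapV l l' y₁ y₂ := h.swapV (y :: l) l' y₁ y₂
  addW l l' d y₁ y₂ x := h.addW (y :: l) l' d y₁ y₂ x
  add_right l d x x' := h.add_right (y :: l) d x x'
  smulW l l' i r y₁ x := (h.smulW (y :: l) l' i r y₁ x).trans
    (by rw [sdeg_cons, ← add_assoc]; rfl)
  smul_right l i r x := (h.smul_right (y :: l) i r x).trans
    (by rw [sdeg_cons, ← add_assoc]; rfl)
  swapW l l' y₁ y₂ x := h.swapW (y :: l) l' y₁ y₂ x

/-- The value on `y₁ ⊙ ⋯ ⊙ y_k ⊗ x` of the coderivation determined by a family of operations.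
It is defined by moving the operation past the first entry or inserting the latter. -/
def coder : ∀ {e : ℤ}, GOp V W e → List V.Homog → W.Homog → SymTensor V W
  | _, a, [], x => gen [a.homogV []] x + gen [] (a.homogW [] x)
  | e, a, y :: l, x =>
      (e * y.1).negOnePow • consHom y (coder a l x) + coder (a.insert y) l x

theorem coder_nil (a : GOp V W e) (x : W.Homog) :
    a.coder [] x = gen [a.homogV []] x + gen [] (a.homogW [] x) := rfl

theorem coder_cons (a : GOp V W e) (y : V.Homog) (l : List V.Homog) (x : W.Homog) :
    a.coder (y :: l) x =
      (e * y.1).negOnePow • consHom y (a.coder l x) + (a.insert y).coder l x := rfl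

/-- The coderivation depends linearly on the family of operations, for families whose degrees agree
only propositionally. -/
theorem coder_lin {e e₁ e₂ : ℤ} (b : GOp V W e) (a₁ : GOp V W e₁) (a₂ : GOp V W e₂) (n₁ n₂ : ℤ)
    (h₁ : e₁ = e) (h₂ : e₂ = e) (hV : ∀ l, b.fV l = n₁ • a₁.fV l + n₂ • a₂.fV l)
    (hW : ∀ l x, b.fW l x = n₁ • a₁.fW l x + n₂ • a₂.fW l x) (l : List V.Homog) (x : W.Homog) :
    b.coder l x = n₁ • a₁.coder l x + n₂ • a₂.coder l x := by
  subst h₁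
  obtain rfl := h₂
  induction l generalizing e₂ with
  | nil =>
    have h1 := gen_mid_lin [] [] n₁ n₂ (y := b.homogV []) (y₁ := a₁.homogV [])
      (y₂ := a₂.homogV []) rfl rfl (hV []) x
    have h2 := gen_right_lin (V := V) [] n₁ n₂ (x := b.homogW [] x) (x₁ := a₁.homogW [] x)
      (x₂ := a₂.homogW [] x) rfl rfl (hW [] x)
    simp only [List.nil_append] at h1
    rw [coder_nil, coder_nil, coder_nil, h1, h2, smul_add, smul_add]
    abel
  | cons y l ih =>
    rw [coder_cons, coder_cons, coder_cons, ih (b := b) (a₁ := a₁) (a₂ := a₂) (hV := hV) (hW := hW),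
      ih (b := b.insert y) (a₁ := a₁.insert y) (a₂ := a₂.insert y) (hV := fun l => hV (y :: l))
        (hW := fun l => hW (y :: l)),
      map_add, map_zsmul, map_zsmul, smul_add, smul_add, smul_add, smul_units_smul,
      smul_units_smul]
    abel

/-- If two families of operations differ by a scalar and a sign, then so do their coderivations. -/
theorem coder_hsmul {e f i : ℤ} (r : S.deg i) (b : GOp V W f) (a : GOp V W e) (n : ℤ)
    (hf : f = i + e) (hV : ∀ l, b.fV l = n.negOnePow • V.act i r (a.fV l))
    (hW : ∀ l x, b.fW l x = n.negOnePow • W.act i r (a.fW l x)) (l : List V.Homog)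
    (x : W.Homog) : b.coder l x = n.negOnePow • actHom r (a.coder l x) := by
  induction l generalizing e f with
  | nil =>
    have h1 := consHom_lin n.negOnePow 0 (y := b.homogV []) (y₁ := hsmul r (a.homogV []))
      (y₂ := b.homogV []) (by simp [homogV, hsmul, sdeg_nil, hf]) rfl
      (by rw [zero_smul, add_zero]; exact hV []) (gen [] x)
    have h2 := gen_right_lin (V := V) [] n.negOnePow 0 (x := b.homogW [] x)
      (x₁ := hsmul r (a.homogW [] x)) (x₂ := b.homogW [] x)
      (by simp [homogW, hsmul, sdeg_nil, hf]; ring) rfl (by rw [zero_smul, add_zero]; exact hW [] x)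
    rw [zero_smul, add_zero, consHom_gen, ← Units.smul_def] at h1
    rw [zero_smul, add_zero, ← Units.smul_def] at h2
    have h3 : consHom (hsmul r (a.homogV [])) (gen [] x) =
        actHom r (gen [a.homogV []] x) := by
      rw [consHom_hsmul, ← consHom_gen, actHom_consHom]
    have h4 : actHom r (gen ([] : List V.Homog) (a.homogW [] x)) =
        gen [] (hsmul r (a.homogW [] x)) := by
      rw [actHom_gen, sdeg_nil, mul_zero, Int.negOnePow_zero, one_smul]
    rw [coder_nil, coder_nil, h1, h2, map_add, smul_add, h3, h4]
  | cons y l ih =>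
    rw [coder_cons, coder_cons, ih b a hf hV hW, ih (b.insert y) (a.insert y)
      (by rw [hf]; ring) (fun l => hV (y :: l)) (fun l => hW (y :: l)), map_add, smul_add,
      map_negOnePow_smul, map_negOnePow_smul, actHom_consHom]
    simp only [negOnePow_smul_smul]
    congr 1
    refine negOnePow_smul_congr ?_ rfl
    rw [hf]; push_cast; grind

namespace IsHom

variable {a : GOp V W e}

theorem coder_add_right (h : a.IsHom) (l : List V.Homog) (d : ℤ) (x x' : W.deg d) :
    a.coder l ⟨d, x + x'⟩ = a.coder l ⟨d, x⟩ + a.coder l ⟨d, x'⟩ := by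
  induction l generalizing e with
  | nil =>
    have h2 := gen_right_lin (V := V) [] 1 1 (x := a.homogW [] ⟨d, x + x'⟩)
      (x₁ := a.homogW [] ⟨d, x⟩) (x₂ := a.homogW [] ⟨d, x'⟩) rfl rfl
      (by rw [one_smul, one_smul]; exact h.add_right [] d x x')
    rw [coder_nil, coder_nil, coder_nil, h2, one_smul, one_smul, gen_add_right]
    abel
  | cons y l ih =>
    rw [coder_cons, coder_cons, coder_cons, ih h, ih (h.insert y), map_add, smul_add]
    abel

theorem coder_smul_right (h : a.IsHom) (l : List V.Homog) {i : ℤ} (r : S.deg i) (x : W.Homog) :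
    a.coder l (hsmul r x) = (i * (e + sdeg l)).negOnePow • actHom r (a.coder l x) := by
  induction l generalizing e with
  | nil =>
    have h2 := gen_right_lin (V := V) [] (i * e).negOnePow 0 (x := a.homogW [] (hsmul r x))
      (x₁ := hsmul r (a.homogW [] x)) (x₂ := hsmul r (a.homogW [] x))
      (by simp [homogW, hsmul, sdeg_nil]; ring) (by simp [homogW, hsmul, sdeg_nil]; ring)
      (by
        rw [zero_smul, add_zero]
        exact (h.smul_right [] i r x).trans (by rw [sdeg_nil, add_zero]; rfl))
    rw [zero_smul, add_zero, ← Units.smul_def] at h2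
    rw [coder_nil, coder_nil, map_add, actHom_gen, actHom_gen, h2, sdeg_cons, sdeg_nil, smul_add,
      negOnePow_smul_smul, mul_zero, Int.negOnePow_zero, one_smul, add_zero, add_zero]
    congr 1
    have : Even (i * e + i * (a.homogV []).1) := by
      simp only [homogV, sdeg_nil, zero_add]
      exact ⟨i * e, rfl⟩
    rw [Int.negOnePow_even _ this, one_smul]
  | cons y l ih =>
    rw [coder_cons, coder_cons, ih h, ih (h.insert y), map_add, smul_add, map_negOnePow_smul,
      map_negOnePow_smul, actHom_consHom, sdeg_cons]
    simp only [negOnePow_smul_smul]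
    congr 1 <;>
    · refine negOnePow_smul_congr ?_ rfl
      push_cast; grind

theorem coder_add (h : a.IsHom) (l l' : List V.Homog) (d : ℤ) (y y' : V.deg d) (x : W.Homog) :
    a.coder (l ++ ⟨d, y + y'⟩ :: l') x =
      a.coder (l ++ ⟨d, y⟩ :: l') x + a.coder (l ++ ⟨d, y'⟩ :: l') x := by
  induction l generalizing e with
  | nil =>
    have h1 := consHom_lin 1 1 (y := (⟨d, y + y'⟩ : V.Homog)) (y₁ := ⟨d, y⟩) (y₂ := ⟨d, y'⟩)
      rfl rfl (by simp) (a.coder l' x)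
    have h2 := coder_lin (a.insert ⟨d, y + y'⟩) (a.insert ⟨d, y⟩) (a.insert ⟨d, y'⟩) 1 1 rfl rfl
      (fun l => by rw [one_smul, one_smul]; exact h.addV [] l d y y')
      (fun l x => by rw [one_smul, one_smul]; exact h.addW [] l d y y' x) l' x
    simp only [one_smul] at h1 h2
    rw [List.nil_append, List.nil_append, List.nil_append, coder_cons, coder_cons, coder_cons, h1,
      h2, smul_add]
    abel
  | cons z l ih =>
    rw [List.cons_append, List.cons_append, List.cons_append, coder_cons, coder_cons, coder_cons,
      ih h, ih (h.insert z), map_add, smul_add]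
    abel

theorem coder_balanced (h : a.IsHom) (l l' : List V.Homog) {i : ℤ} (r : S.deg i) (y : V.Homog)
    (x : W.Homog) :
    a.coder (l ++ hsmul r y :: l') x =
      (i * (y.1 + sdeg l')).negOnePow • a.coder (l ++ y :: l') (hsmul r x) := by
  induction l generalizing e with
  | nil =>
    have h2 := coder_hsmul r (a.insert (hsmul r y)) (a.insert y) (i * e)
      (by simp only [hsmul]; ring)
      (fun l => (h.smulV [] l i r y).trans (by rw [sdeg_nil, add_zero]; rfl))
      (fun l x => (h.smulW [] l i r y x).trans (by rw [sdeg_nil, add_zero]; rfl)) l' x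
    rw [List.nil_append, List.nil_append, coder_cons, coder_cons, h2, consHom_hsmul,
      h.coder_smul_right, (h.insert y).coder_smul_right, map_negOnePow_smul, smul_add]
    simp only [negOnePow_smul_smul]
    congr 1
    · refine negOnePow_smul_congr ?_ rfl
      simp only [hsmul]
      push_cast; grind
    · refine negOnePow_smul_congr ?_ rfl
      push_cast; grind
  | cons z l ih =>
    rw [List.cons_append, List.cons_append, coder_cons, coder_cons, ih h, ih (h.insert z),
      map_negOnePow_smul, smul_add]
    simp only [negOnePow_smul_smul]
    rw [add_comm (e * z.1)]

/-- The values of the coderivation on tuples respect the symmetry relation of `SymTensor`: for the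
first two entries this is the symmetry of the family with two inputs inserted. -/
theorem coder_swap (h : a.IsHom) (l l' : List V.Homog) (y y' : V.Homog) (x : W.Homog) :
    a.coder (l ++ y :: y' :: l') x = (y.1 * y'.1).negOnePow • a.coder (l ++ y' :: y :: l') x := by
  induction l generalizing e with
  | nil =>
    have h2 := coder_lin ((a.insert y).insert y') ((a.insert y').insert y)
      ((a.insert y').insert y) ((y.1 * y'.1).negOnePow) 0 (by ring) (by ring)
      (fun l => by rw [zero_smul, add_zero]; exact h.swapV [] l y y')
      (fun l x => by rw [zero_smul, add_zero]; exact h.swapW [] l y y' x) l' x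
    rw [zero_smul, add_zero, ← Units.smul_def] at h2
    simp only [List.nil_append, coder_cons, h2, map_add, smul_add, map_negOnePow_smul]
    rw [consHom_swap y y']
    simp only [negOnePow_smul_smul]
    have e1 : ((e * y.1 + (e * y'.1 + y.1 * y'.1))).negOnePow =
        (y.1 * y'.1 + (e * y'.1 + e * y.1)).negOnePow :=
      negOnePow_eq_of_zmod (by push_cast; grind)
    have e2 : ((e + y.1) * y'.1).negOnePow = (y.1 * y'.1 + e * y'.1).negOnePow :=
      negOnePow_eq_of_zmod (by push_cast; grind)
    have e3 : (e * y.1).negOnePow = (y.1 * y'.1 + (e + y'.1) * y.1).negOnePow :=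
      negOnePow_eq_of_zmod (by push_cast; grind)
    rw [e1, e2, ← e3]
    abel
  | cons z l ih =>
    rw [List.cons_append, List.cons_append, coder_cons, coder_cons, ih h, ih (h.insert z),
      map_negOnePow_smul, smul_add]
    simp only [negOnePow_smul_smul]
    rw [add_comm (e * z.1)]

/-- The coderivation determined by a multilinear symmetric family of operations. -/
def coderHom (h : a.IsHom) : SymTensor V W →+ SymTensor V W :=
  symLift a.coder (by
    intro t ht
    cases ht with
    | add l l' d y y' x => simp [h.coder_add]
    | add_right l d x x' => simp [h.coder_add_right]
    | balanced l l' i d e r y x =>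
      simpa [sub_eq_zero, map_negOnePow_smul, hsmul] using h.coder_balanced l l' r ⟨d, y⟩ ⟨e, x⟩
    | swap l l' y y' x =>
      simpa [sub_eq_zero, map_negOnePow_smul] using h.coder_swap l l' y y' x)

theorem coderHom_gen (h : a.IsHom) (l : List V.Homog) (x : W.Homog) :
    h.coderHom (gen l x) = a.coder l x := symLift_gen _ _ _ _

theorem coderHom_consHom (h : a.IsHom) (y : V.Homog) (t : SymTensor V W) :
    h.coderHom (consHom y t) =
      (e * y.1).negOnePow • consHom y (h.coderHom t) + (h.insert y).coderHom t := by
  have : h.coderHom.comp (consHom y) =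
      ((e * y.1).negOnePow : ℤ) • (consHom y).comp h.coderHom + (h.insert y).coderHom :=
    symTensor_hom_ext fun l x => by
      simp only [AddMonoidHom.add_apply, AddMonoidHom.smul_apply, AddMonoidHom.comp_apply,
        coderHom_gen, consHom_gen, coder_cons, Units.smul_def]
  refine (DFunLike.congr_fun this t).trans ?_
  rw [AddMonoidHom.add_apply, AddMonoidHom.smul_apply, Units.smul_def]; rfl

end IsHom

/-- The `V`-component of the graded commutator of two families of operations. -/
def brV : ∀ {e f : ℤ}, GOp V W e → GOp V W f → List V.Homog → V.carrier
  | e, f, a, b, [] => a.fV [b.homogV []] - (e * f).negOnePow • b.fV [a.homogV []]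
  | _, f, a, b, y :: l =>
      (f * y.1).negOnePow • brV (a.insert y) b l + brV a (b.insert y) l

/-- The `W`-component of the graded commutator of two families of operations. -/
def brW : ∀ {e f : ℤ}, GOp V W e → GOp V W f → List V.Homog → W.Homog → W.carrier
  | e, f, a, b, [], x =>
      (a.fW [] (b.homogW [] x) + a.fW [b.homogV []] x) -
        (e * f).negOnePow • (b.fW [] (a.homogW [] x) + b.fW [a.homogV []] x)
  | _, f, a, b, y :: l, x =>
      (f * y.1).negOnePow • brW (a.insert y) b l x + brW a (b.insert y) l x

theorem brV_mem {e f : ℤ} (a : GOp V W e) (b : GOp V W f) (l : List V.Homog) :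
    brV a b l ∈ V.deg (sdeg l + (e + f)) := by
  induction l generalizing e f with
  | nil =>
    rw [brV]
    refine sub_mem ?_ (units_smul_mem _ ?_)
    · have := a.memV [b.homogV []]
      rwa [show sdeg [b.homogV []] + e = sdeg ([] : List V.Homog) + (e + f) by
        simp only [sdeg_cons, sdeg_nil, homogV]; ring] at this
    · have := b.memV [a.homogV []]
      rwa [show sdeg [a.homogV []] + f = sdeg ([] : List V.Homog) + (e + f) by
        simp only [sdeg_cons, sdeg_nil, homogV]; ring] at this
  | cons y l ih =>
    rw [brV]
    refine add_mem (units_smul_mem _ ?_) ?_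
    · have := ih (a.insert y) b
      rwa [show sdeg l + (e + y.1 + f) = sdeg (y :: l) + (e + f) by
        rw [sdeg_cons]; ring] at this
    · have := ih a (b.insert y)
      rwa [show sdeg l + (e + (f + y.1)) = sdeg (y :: l) + (e + f) by
        rw [sdeg_cons]; ring] at this

theorem brW_mem {e f : ℤ} (a : GOp V W e) (b : GOp V W f) (l : List V.Homog) (x : W.Homog) :
    brW a b l x ∈ W.deg (sdeg l + x.1 + (e + f)) := by
  induction l generalizing e f with
  | nil =>
    rw [brW]
    refine sub_mem (add_mem ?_ ?_) (units_smul_mem _ (add_mem ?_ ?_))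
    · have := a.memW [] (b.homogW [] x)
      rwa [show sdeg [] + (b.homogW [] x).1 + e = sdeg ([] : List V.Homog) + x.1 + (e + f) by
        simp only [sdeg_nil, homogW]; ring] at this
    · have := a.memW [b.homogV []] x
      rwa [show sdeg [b.homogV []] + x.1 + e = sdeg ([] : List V.Homog) + x.1 + (e + f) by
        simp only [sdeg_cons, sdeg_nil, homogV]; ring] at this
    · have := b.memW [] (a.homogW [] x)
      rwa [show sdeg [] + (a.homogW [] x).1 + f = sdeg ([] : List V.Homog) + x.1 + (e + f) by
        simp only [sdeg_nil, homogW]; ring] at this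
    · have := b.memW [a.homogV []] x
      rwa [show sdeg [a.homogV []] + x.1 + f = sdeg ([] : List V.Homog) + x.1 + (e + f) by
        simp only [sdeg_cons, sdeg_nil, homogV]; ring] at this
  | cons y l ih =>
    rw [brW]
    refine add_mem (units_smul_mem _ ?_) ?_
    · have := ih (a.insert y) b
      rwa [show sdeg l + x.1 + (e + y.1 + f) = sdeg (y :: l) + x.1 + (e + f) by
        rw [sdeg_cons]; ring] at this
    · have := ih a (b.insert y)
      rwa [show sdeg l + x.1 + (e + (f + y.1)) = sdeg (y :: l) + x.1 + (e + f) by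
        rw [sdeg_cons]; ring] at this

/-- The graded commutator of two families of operations: the family whose coderivation is the
graded commutator of the two coderivations. -/
def br (a : GOp V W e) (b : GOp V W f) : GOp V W (e + f) := ⟨brV a b, brV_mem a b, brW a b, brW_mem a b⟩

/-- The graded commutator of two coderivations is the coderivation of the commutator of the families.
The induction on the number of inputs uses that `[D_a,
  y ⊙ ·]` is the coderivation of `a.insert y`. -/
theorem IsHom.coderHom_comm {a : GOp V W e} {b : GOp V W f} (ha : a.IsHom) (hb : b.IsHom)
    (l : List V.Homog) (x : W.Homog) :
    ha.coderHom (hb.coderHom (gen l x)) - (e * f).negOnePow • hb.coderHom (ha.coderHom (gen l x)) =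
      (br a b).coder l x := by
  induction l generalizing e f with
  | nil =>
    have h1 := gen_mid_lin [] [] 1 (-((e * f).negOnePow : ℤ)) (y := (br a b).homogV [])
      (y₁ := a.homogV [b.homogV []]) (y₂ := b.homogV [a.homogV []])
      (by simp only [homogV, sdeg_nil, sdeg_cons]; ring)
      (by simp only [homogV, sdeg_nil, sdeg_cons]; ring)
      (by rw [one_smul, neg_smul, ← Units.smul_def, ← sub_eq_add_neg]; rfl) x
    have e1 : (br a b).coder [] x = (gen [a.homogV [b.homogV []]] x -
        (e * f).negOnePow • gen [b.homogV [a.homogV []]] x) +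
        ((gen [] (a.homogW [] (b.homogW [] x)) + gen [] (a.homogW [b.homogV []] x)) -
        (e * f).negOnePow • (gen [] (b.homogW [] (a.homogW [] x)) +
          gen [] (b.homogW [a.homogV []] x))) := by
      rw [one_smul, neg_smul, ← Units.smul_def, ← sub_eq_add_neg] at h1
      rw [coder_nil, List.nil_append] at *
      rw [h1]
      congr 1
      have m1 := a.memW [] (b.homogW [] x)
      have m2 := a.memW [b.homogV []] x
      have m3 := b.memW [] (a.homogW [] x)
      have m4 := b.memW [a.homogV []] x
      rw [show sdeg [] + (b.homogW [] x).1 + e = sdeg ([] : List V.Homog) + x.1 + (e + f) by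
        simp only [sdeg_nil, homogW]; ring] at m1
      rw [show sdeg [b.homogV []] + x.1 + e = sdeg ([] : List V.Homog) + x.1 + (e + f) by
        simp only [sdeg_cons, sdeg_nil, homogV]; ring] at m2
      rw [show sdeg [] + (a.homogW [] x).1 + f = sdeg ([] : List V.Homog) + x.1 + (e + f) by
        simp only [sdeg_nil, homogW]; ring] at m3
      rw [show sdeg [a.homogV []] + x.1 + f = sdeg ([] : List V.Homog) + x.1 + (e + f) by
        simp only [sdeg_cons, sdeg_nil, homogV]; ring] at m4
      have k1 : a.homogW [] (b.homogW [] x) = ⟨_, _, m1⟩ :=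
        homog_ext (by simp only [sdeg_nil, homogW]; ring) rfl
      have k2 : a.homogW [b.homogV []] x = ⟨_, _, m2⟩ :=
        homog_ext (by simp only [sdeg_cons, sdeg_nil, homogW, homogV]; ring) rfl
      have k3 : b.homogW [] (a.homogW [] x) = ⟨_, _, m3⟩ :=
        homog_ext (by simp only [sdeg_nil, homogW]; ring) rfl
      have k4 : b.homogW [a.homogV []] x = ⟨_, _, m4⟩ :=
        homog_ext (by simp only [sdeg_cons, sdeg_nil, homogW, homogV]; ring) rfl
      rw [k1, k2, k3, k4]
      change genRight [] _ _ = (genRight [] _ _ + genRight [] _ _) -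
        _ • (genRight [] _ _ + genRight [] _ _)
      rw [← map_add, ← map_add, ← map_negOnePow_smul, ← map_sub]
      rfl
    have key : ∀ {e f : ℤ} {a : GOp V W e} {b : GOp V W f} (ha : a.IsHom) (hb : b.IsHom),
        ha.coderHom (hb.coderHom (gen [] x)) =
          (e * f).negOnePow • gen [b.homogV [], a.homogV []] x +
          (e * f).negOnePow • gen [b.homogV []] (a.homogW [] x) +
          gen [a.homogV [b.homogV []]] x + gen [] (a.homogW [b.homogV []] x) +
          gen [a.homogV []] (b.homogW [] x) + gen [] (a.homogW [] (b.homogW [] x)) := by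
      intro e f a b ha hb
      have k1 : (a.insert (b.homogV [])).homogV [] = a.homogV [b.homogV []] :=
        homog_ext (by simp only [sdeg_nil, sdeg_cons, homogV]; ring) rfl
      have k2 : (a.insert (b.homogV [])).homogW [] x = a.homogW [b.homogV []] x :=
        homog_ext (by simp only [sdeg_nil, sdeg_cons, homogW, homogV]; ring) rfl
      rw [hb.coderHom_gen, coder_nil, map_add, ha.coderHom_gen, ha.coderHom_gen, coder_cons,
        coder_nil, coder_nil, coder_nil, map_add, consHom_gen, consHom_gen, k1, k2,
        show (b.homogV []).1 = f by simp [homogV, sdeg_nil], smul_add]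
      abel
    have hs := gen_swap [] [] (b.homogV []) (a.homogV []) x
    rw [List.nil_append, List.nil_append] at hs
    rw [e1, key ha hb, key hb ha, hs,
      show (b.homogV []).1 = f by simp [homogV, sdeg_nil],
      show (a.homogV []).1 = e by simp [homogV, sdeg_nil], mul_comm f e]
    simp only [smul_add, negOnePow_smul_self]
    abel
  | cons y l ih =>
    have h1 := ih (ha.insert y) hb
    have h2 := ih ha (hb.insert y)
    have h3 := coder_lin ((br a b).insert y) (br (a.insert y) b) (br a (b.insert y))
      ((f * y.1).negOnePow) 1 (by ring) (by ring)
      (fun l => by rw [one_smul]; rfl) (fun l x => by rw [one_smul]; rfl) l x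
    rw [one_smul, ← Units.smul_def] at h3
    rw [coder_cons, h3, ← ih ha hb, ← h1, ← h2, ← consHom_gen]
    simp only [ha.coderHom_consHom, hb.coderHom_consHom, map_add, map_sub, smul_add, smul_sub,
      map_negOnePow_smul, negOnePow_smul_smul]
    rw [negOnePow_eq_of_zmod (m := f * y.1 + e * y.1) (n := (e + f) * y.1) (by push_cast; grind),
      negOnePow_eq_of_zmod (m := f * y.1 + (e + y.1) * f) (n := e * f) (by push_cast; grind),
      negOnePow_eq_of_zmod (m := e * f + (e * y.1 + f * y.1)) (n := (e + f) * y.1 + e * f)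
        (by push_cast; grind),
      negOnePow_eq_of_zmod (m := e * (f + y.1)) (n := e * f + e * y.1) (by push_cast; grind)]
    abel

/-- The square of a family of operations of degree `1`: the family whose coderivation is the
square of the given coderivation. -/
def sqV (a : GOp V W 1) : List V.Homog → V.carrier
  | [] => 0
  | y :: l => brV a (a.insert y) l

/-- The `W`-component of the square of a family of operations of degree `1`. -/
def sqW (a : GOp V W 1) : List V.Homog → W.Homog → W.carrier
  | [], x => a.fW [] (a.homogW [] x)
  | y :: l, x => brW a (a.insert y) l x

/-- The square of a family of operations of degree `1`, `k ≥ 1` in the `V`-component. -/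
def sq (a : GOp V W 1) : GOp V W 2 where
  fV := a.sqV
  memV
    | [] => zero_mem _
    | y :: l => by
      have := brV_mem a (a.insert y) l
      rwa [show sdeg l + (1 + (1 + y.1)) = sdeg (y :: l) + 2 by rw [sdeg_cons]; ring] at this
  fW := a.sqW
  memW
    | [], x => by
      have := a.memW [] (a.homogW [] x)
      rwa [show sdeg [] + (a.homogW [] x).1 + 1 = sdeg ([] : List V.Homog) + x.1 + 2 by
        simp only [sdeg_nil, homogW]; ring] at this
    | y :: l, x => by
      have := brW_mem a (a.insert y) l x
      rwa [show sdeg l + x.1 + (1 + (1 + y.1)) = sdeg (y :: l) + x.1 + 2 by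
        rw [sdeg_cons]; ring] at this

/-- The square of an odd coderivation without constant term is a coderivation again. Peeling off an
input `y` reduces this to the commutator of `a` with `a.insert y`, so that no division by `2` is
needed. -/
theorem IsHom.coderHom_sq {a : GOp V W 1} (ha : a.IsHom) (h0 : a.fV [] = 0)
    (l : List V.Homog) (x : W.Homog) :
    ha.coderHom (ha.coderHom (gen l x)) = a.sq.coder l x := by
  induction l with
  | nil =>
    have h1 : ∀ x : W.Homog, gen [a.homogV []] x = 0 := fun x => gen_mid_zero [] [] h0 x
    have h2 : ∀ x : W.Homog, gen [a.sq.homogV []] x = 0 := fun x => gen_mid_zero [] [] rfl x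
    rw [ha.coderHom_gen, coder_nil, h1, zero_add, ha.coderHom_gen, coder_nil, h1, zero_add,
      coder_nil, h2, zero_add]
    exact congrArg _ (homog_ext (by simp only [sdeg_nil, homogW]; ring) rfl)
  | cons y l ih =>
    have h3 := coder_lin (a.sq.insert y) (br a (a.insert y)) (br a (a.insert y)) 1 0
      (by ring) (by ring) (fun l => by rw [one_smul, zero_smul, add_zero]; rfl)
      (fun l x => by rw [one_smul, zero_smul, add_zero]; rfl) l x
    rw [one_smul, zero_smul, add_zero] at h3
    rw [coder_cons, h3, ← ih, ← ha.coderHom_comm (ha.insert y), ← consHom_gen]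
    simp only [ha.coderHom_consHom, map_add, smul_add, map_negOnePow_smul, negOnePow_smul_smul]
    rw [negOnePow_eq_of_zmod (m := 1 * y.1 + 1 * y.1) (n := 2 * y.1) (by push_cast; grind),
      show (1 * (1 + y.1)).negOnePow = -(1 * y.1).negOnePow by
        rw [mul_add, mul_one, add_comm, Int.negOnePow_succ], Units.neg_smul]
    abel

end GOp
end Coder

namespace GOp

variable {S : GrRing.{u}} {V : GrMod.{u, w} S} {W : GrMod.{u, v} S} {e f : ℤ}

/-! ### Comparison with the shuffle formula -/

theorem homogV_insert (a : GOp V W e) (y : V.Homog) (l : List V.Homog) :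
    (a.insert y).homogV l = a.homogV (y :: l) :=
  homog_ext (by simp only [homogV, sdeg_cons]; ring) rfl

theorem insert_fV (a : GOp V W e) (y : V.Homog) (l : List V.Homog) :
    (a.insert y).fV l = a.fV (y :: l) := rfl

theorem insert_fW (a : GOp V W e) (y : V.Homog) (l : List V.Homog) (x : W.Homog) :
    (a.insert y).fW l x = a.fW (y :: l) x := rfl

theorem homogW_insert (a : GOp V W e) (y : V.Homog) (l : List V.Homog) (x : W.Homog) :
    (a.insert y).homogW l x = a.homogW (y :: l) x :=
  homog_ext (by simp only [homogW, sdeg_cons]; ring) rfl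

theorem list_sum_units_smul {G α : Type*} [AddCommGroup G] (u : ℤˣ) (L : List α) (g : α → G) :
    u • (L.map g).sum = (L.map fun t => u • g t).sum := by
  induction L with
  | nil => simp
  | cons t L ih => simp [smul_add, ih]

/-- The recursively defined coderivation agrees with the sum over shuffles. -/
theorem coder_eq_sum (a : GOp V W e) (l : List V.Homog) (x : W.Homog) :
    a.coder l x = ((unshuffles l).map fun t => t.1 • gen (a.homogV t.2.1 :: t.2.2) x).sum +
      ((unshuffles l).map fun t =>
        ((e * sdeg t.2.1).negOnePow * t.1) • gen t.2.1 (a.homogW t.2.2 x)).sum := by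
  induction l generalizing e with
  | nil => simp [coder_nil, unshuffles, sdeg_nil]
  | cons y l ih =>
    rw [coder_cons, ih, ih, map_add, map_list_sum, map_list_sum, smul_add, list_sum_units_smul,
      list_sum_units_smul, List.map_map, List.map_map]
    simp only [unshuffles, List.map_append, List.map_map, List.sum_append, Function.comp_def,
      homogV_insert, homogW_insert, map_negOnePow_smul, consHom_gen, smul_smul]
    have e1 : ∀ t : ℤˣ × List V.Homog × List V.Homog,
        ((e * y.1).negOnePow * t.1) • gen (y :: a.homogV t.2.1 :: t.2.2) x =
          ((y.1 * sdeg t.2.1).negOnePow * t.1) • gen (a.homogV t.2.1 :: y :: t.2.2) x := by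
      intro t
      have h := gen_swap [] t.2.2 y (a.homogV t.2.1) x
      rw [List.nil_append, List.nil_append] at h
      rw [h, smul_smul, mul_right_comm, ← Int.negOnePow_add]
      congr 2
      refine negOnePow_eq_of_zmod ?_
      simp only [homogV]; push_cast; grind
    have e2 : ∀ t : ℤˣ × List V.Homog × List V.Homog,
        ((e * y.1).negOnePow * ((e * sdeg t.2.1).negOnePow * t.1)) •
          gen (y :: t.2.1) (a.homogW t.2.2 x) =
          ((e * sdeg (y :: t.2.1)).negOnePow * t.1) • gen (y :: t.2.1) (a.homogW t.2.2 x) := by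
      intro t
      rw [sdeg_cons, mul_add, Int.negOnePow_add, mul_assoc]
    have e3 : ∀ t : ℤˣ × List V.Homog × List V.Homog,
        (((e + y.1) * sdeg t.2.1).negOnePow * t.1) • gen t.2.1 (a.homogW (y :: t.2.2) x) =
        ((e * sdeg t.2.1).negOnePow * ((y.1 * sdeg t.2.1).negOnePow * t.1)) •
          gen t.2.1 (a.homogW (y :: t.2.2) x) := by
      intro t
      rw [add_mul, Int.negOnePow_add, mul_assoc]
    simp only [e1, e2, e3]
    abel

/-- The family of operations given by `{ℓ_k}` and `{ℓ^W_k}`. -/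
def ofOps (ℓ : Op V) (ℓW : ModOp V W) : GOp V W 1 := ⟨ℓ.toFun, ℓ.mem, ℓW.toFun, ℓW.mem⟩

theorem isHom_ofOps {ℓ : Op V} {ℓW : ModOp V W} (h : ℓ.IsHom) (hW : ℓW.IsHom) :
    (ofOps ℓ ℓW).IsHom where
  addV := h.add
  smulV l l' i r y := h.smul l l' i y.1 r y.2
  swapV := h.swap
  addW := hW.add
  add_right := hW.add_right
  smulW l l' i r y x := hW.smul l l' i y.1 r y.2 x
  smul_right l i r x := hW.smul_right l i x.1 r x.2
  swapW := hW.swap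

theorem sum_map_filter {G α : Type*} [AddCommMonoid G] (L : List α) (p : α → Bool) (g : α → G)
    (h : ∀ t, p t = false → g t = 0) : ((L.filter p).map g).sum = (L.map g).sum := by
  induction L with
  | nil => rfl
  | cons t L ih =>
    by_cases hp : p t
    · rw [List.filter_cons_of_pos hp, List.map_cons, List.map_cons, List.sum_cons, List.sum_cons,
        ih]
    · rw [List.filter_cons_of_neg hp, ih, List.map_cons, List.sum_cons, h t (by simpa using hp),
        zero_add]

theorem mk_coderivFormula (ℓ : Op V) (ℓW : ModOp V W) (l : List V.Homog) (x : W.Homog) :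
    SymTensor.mk V W (coderivFormula ℓ ℓW l x) = (ofOps ℓ ℓW).coder l x := by
  rw [coder_eq_sum, coderivFormula, map_add, map_list_sum, map_list_sum, List.map_map,
    List.map_map, sum_map_filter]
  · simp only [Function.comp_def, map_negOnePow_smul, one_mul]
    rfl
  · intro t ht
    have h0 : t.2.1 = [] := by simpa using ht
    have h1 : gen (ℓ.homog t.2.1 :: t.2.2) x = 0 := by
      refine gen_mid_zero [] t.2.2 ?_ x
      rw [h0]
      exact ℓ.nil
    rw [Function.comp_apply, map_negOnePow_smul]
    exact (congrArg _ h1).trans (smul_zero _)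

theorem isCoderivationOf_coderHom {ℓ : Op V} {ℓW : ModOp V W} (h : (ofOps ℓ ℓW).IsHom) :
    IsCoderivationOf ℓ ℓW h.coderHom := fun l x => by
  rw [mk_coderivFormula]
  exact h.coderHom_gen l x

/-! ### Vanishing of components of the square -/

theorem brV_eq_zero (a : GOp V W e) (b : GOp V W f) (l : List V.Homog)
    (h : ∀ s t : List V.Homog, s.length + t.length = l.length →
      a.fV (s ++ [b.homogV t]) = 0 ∧ b.fV (s ++ [a.homogV t]) = 0) : brV a b l = 0 := by
  induction l generalizing e f with
  | nil =>
    rw [brV]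
    have := h [] [] rfl
    rw [List.nil_append, List.nil_append] at this
    rw [this.1, this.2, smul_zero, sub_zero]
  | cons y l ih =>
    rw [brV, ih, ih, smul_zero, add_zero]
    · intro s t hst
      rw [homogV_insert]
      exact ⟨(h s (y :: t) (by simp only [List.length_cons]; omega)).1,
        (h (y :: s) t (by simp only [List.length_cons]; omega)).2⟩
    · intro s t hst
      rw [homogV_insert]
      exact ⟨(h (y :: s) t (by simp only [List.length_cons]; omega)).1,
        (h s (y :: t) (by simp only [List.length_cons]; omega)).2⟩

theorem brW_eq_zero (a : GOp V W e) (b : GOp V W f) (l : List V.Homog) (x : W.Homog)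
    (ω : V.Homog → ℕ)
    (h : ∀ s t : List V.Homog, s.length + t.length = l.length →
      (s.map ω).sum + (t.map ω).sum = (l.map ω).sum →
      a.fW (s ++ [b.homogV t]) x = 0 ∧ b.fW (s ++ [a.homogV t]) x = 0 ∧
      a.fW s (b.homogW t x) = 0 ∧ b.fW s (a.homogW t x) = 0) : brW a b l x = 0 := by
  induction l generalizing e f with
  | nil =>
    rw [brW]
    have := h [] [] rfl rfl
    rw [List.nil_append, List.nil_append] at this
    simp [this]
  | cons y l ih =>
    rw [brW, ih, ih, smul_zero, add_zero]
    · intro s t hst hω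
      rw [homogV_insert, homogW_insert]
      have h1 := h s (y :: t) (by simp only [List.length_cons]; omega)
        (by simp only [List.map_cons, List.sum_cons]; omega)
      have h2 := h (y :: s) t (by simp only [List.length_cons]; omega)
        (by simp only [List.map_cons, List.sum_cons]; omega)
      exact ⟨h1.1, h2.2.1, h1.2.2.1, h2.2.2.2⟩
    · intro s t hst hω
      rw [homogV_insert, homogW_insert]
      have h1 := h s (y :: t) (by simp only [List.length_cons]; omega)
        (by simp only [List.map_cons, List.sum_cons]; omega)
      have h2 := h (y :: s) t (by simp only [List.length_cons]; omega)
        (by simp only [List.map_cons, List.sum_cons]; omega)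
      exact ⟨h2.1, h1.2.1, h2.2.2.1, h1.2.2.2⟩

namespace IsHom

variable {a : GOp V W e}

theorem fV_zero (h : a.IsHom) (l l' : List V.Homog) {y : V.Homog} (hy : (y.2 : V.carrier) = 0) :
    a.fV (l ++ y :: l') = 0 := by
  obtain ⟨d, y⟩ := y
  obtain rfl : y = 0 := Subtype.ext hy
  simpa using h.addV l l' d 0 0

theorem fW_zero (h : a.IsHom) (l l' : List V.Homog) {y : V.Homog} (hy : (y.2 : V.carrier) = 0)
    (x : W.Homog) : a.fW (l ++ y :: l') x = 0 := by
  obtain ⟨d, y⟩ := y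
  obtain rfl : y = 0 := Subtype.ext hy
  simpa using h.addW l l' d 0 0 x

theorem fW_right_zero (h : a.IsHom) (l : List V.Homog) {x : W.Homog}
    (hx : (x.2 : W.carrier) = 0) : a.fW l x = 0 := by
  obtain ⟨d, x⟩ := x
  obtain rfl : x = 0 := Subtype.ext hx
  simpa using h.add_right l d 0 0

end IsHom

/-- The component of a symmetric tensor in `W`. -/
def proj : SymTensor V W →+ W.carrier :=
  symLift (fun l x => if l.isEmpty then x.2 else 0) (by
    intro t ht
    cases ht with
    | add l l' d y y' x => simp
    | add_right l d x x' => by_cases h : l = [] <;> simp [h]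
    | balanced l l' i d e r y x => simp
    | swap l l' y y' x => simp)

theorem proj_consHom (y : V.Homog) (t : SymTensor V W) : proj (consHom y t) = 0 := by
  have : (proj : SymTensor V W →+ W.carrier).comp (consHom y) = 0 :=
    symTensor_hom_ext fun l x => by
      rw [AddMonoidHom.comp_apply, consHom_gen, proj, symLift_gen]; rfl
  exact DFunLike.congr_fun this t

theorem proj_coder (a : GOp V W e) (l : List V.Homog) (x : W.Homog) :
    proj (a.coder l x) = a.fW l x := by
  induction l generalizing e with
  | nil =>
    rw [coder_nil, map_add, ← consHom_gen, proj_consHom, zero_add, proj, symLift_gen]; rfl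
  | cons y l ih => rw [coder_cons, map_add, map_negOnePow_smul, proj_consHom, ih, smul_zero, zero_add]; rfl

section Square

variable {a : GOp V W 1}

/-- The `W`-component of the square is read off from the square of the coderivation by projecting to
the tensors without entries from `V`; hence it inherits multilinearity and symmetry. -/
theorem IsHom.sqW_eq_proj (ha : a.IsHom) (h0 : a.fV [] = 0) (l : List V.Homog) (x : W.Homog) :
    a.sqW l x = proj (ha.coderHom (ha.coderHom (gen l x))) := by
  rw [ha.coderHom_sq h0, proj_coder]; rfl

theorem IsHom.sqW_swap (ha : a.IsHom) (h0 : a.fV [] = 0) (l l' : List V.Homog) (y y' : V.Homog)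
    (x : W.Homog) :
    a.sqW (l ++ y :: y' :: l') x = (y.1 * y'.1).negOnePow • a.sqW (l ++ y' :: y :: l') x := by
  simp only [ha.sqW_eq_proj h0, gen_swap l l' y y', map_negOnePow_smul]

/-- A family of operations with at most two inputs from `V` squares to zero, as far as `V` is
concerned, if the first three identities of an `L_∞` algebra hold. -/
theorem IsHom.sqV_eq_zero (ha : a.IsHom) (h0 : a.fV [] = 0)
    (hV : ∀ l : List V.Homog, 3 ≤ l.length → a.fV l = 0)
    (J1 : ∀ y, a.fV [a.homogV [y]] = 0)
    (J2 : ∀ y z, a.fV [a.homogV [y, z]] + ((1 + y.1) * z.1).negOnePow • a.fV [z, a.homogV [y]] +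
      y.1.negOnePow • a.fV [y, a.homogV [z]] = 0)
    (J3 : ∀ y z t, y.1.negOnePow • a.fV [y, a.homogV [z, t]] +
      ((1 + y.1) * z.1).negOnePow • a.fV [z, a.homogV [y, t]] +
      ((1 + y.1 + z.1) * t.1).negOnePow • a.fV [t, a.homogV [y, z]] = 0)
    (l : List V.Homog) : a.sqV l = 0 := by
  have z0 : ((a.homogV []).2 : V.carrier) = 0 := h0
  match l with
  | [] => rfl
  | [y] =>
    have h := ha.fV_zero [y] [] z0
    rw [List.cons_append, List.nil_append] at h
    simp only [sqV, brV, insert_fV, homogV_insert, J1, h, smul_zero, sub_zero]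
  | [y, z] =>
    have h := ha.fV_zero [y, z] [] z0
    simp only [List.cons_append, List.nil_append] at h
    have := J2 y z
    simp only [sqV, brV, homogV_insert]
    simp only [insert_fV, h, smul_zero, sub_zero]
    rw [← this, smul_sub, negOnePow_smul_smul, negOnePow_eq_of_zmod
      (m := (1 + y.1) * z.1 + (1 + z.1) * (1 + y.1)) (n := y.1 + 1) (by push_cast; grind),
      Int.negOnePow_succ, Units.neg_smul]
    abel
  | [y, z, t] =>
    have h3 : ∀ u v w', a.fV [u, v, w'] = 0 := fun u v w' => hV _ le_rfl
    have h4 : ∀ u v w' x', a.fV [u, v, w', x'] = 0 := fun u v w' x' => hV _ (by simp)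
    have h5 := ha.fV_zero [] [] (y := a.homogV [y, z, t]) (h3 y z t)
    have h6 := ha.fV_zero [] [] (y := a.homogV [t, z, y]) (h3 t z y)
    have := J3 y z t
    simp only [List.nil_append] at h5 h6
    simp only [sqV, brV, homogV_insert]
    simp only [insert_fV, h3, h4, h5, smul_zero, sub_zero, add_zero, zero_sub, smul_neg, smul_add,
      negOnePow_smul_smul]
    rw [← this, negOnePow_eq_of_zmod
      (m := (1 + y.1) * z.1 + ((1 + y.1) * t.1 + (1 + z.1 + t.1) * (1 + y.1))) (n := y.1 + 1)
      (by push_cast; grind), Int.negOnePow_succ, Units.neg_smul, neg_neg]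
  | y :: z :: t :: q :: l =>
    refine brV_eq_zero _ _ _ fun s t' hst => ⟨?_, ?_⟩
    · by_cases hs : 2 ≤ s.length
      · exact hV _ (by simp; omega)
      · refine ha.fV_zero s [] ?_
        exact hV _ (by simp at hst ⊢; omega)
    · by_cases hs : 1 ≤ s.length
      · exact hV _ (by simp; omega)
      · refine ha.fV_zero (y :: s) [] ?_
        exact hV _ (by simp at hst ⊢; omega)

/-- The component of the square on one input. -/
theorem IsHom.sqW_one (ha : a.IsHom) (h0 : a.fV [] = 0) (y : V.Homog) (x : W.Homog) :
    a.sqW [y] x = a.fW [] (a.homogW [y] x) + a.fW [a.homogV [y]] x +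
      y.1.negOnePow • a.fW [y] (a.homogW [] x) := by
  have z0 : ((a.homogV []).2 : V.carrier) = 0 := h0
  have h := ha.fW_zero [y] [] z0 x
  simp only [List.cons_append, List.nil_append] at h
  simp only [sqW, brW, homogV_insert, homogW_insert]
  simp only [insert_fW, h, add_zero]
  rw [negOnePow_eq_of_zmod (m := 1 * (1 + y.1)) (n := y.1 + 1) (by push_cast; grind),
    Int.negOnePow_succ, Units.neg_smul, sub_neg_eq_add]

/-- The component of the square on two inputs. -/
theorem IsHom.sqW_two (ha : a.IsHom) (h0 : a.fV [] = 0) (y z : V.Homog) (x : W.Homog) :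
    a.sqW [y, z] x = ((1 + y.1) * z.1).negOnePow •
        (a.fW [z] (a.homogW [y] x) + a.fW [z, a.homogV [y]] x) +
      y.1.negOnePow • (a.fW [y] (a.homogW [z] x) + a.fW [y, a.homogV [z]] x) +
      (a.fW [] (a.homogW [y, z] x) + a.fW [a.homogV [y, z]] x) +
      (y.1 + z.1).negOnePow • a.fW [y, z] (a.homogW [] x) := by
  have z0 : ((a.homogV []).2 : V.carrier) = 0 := h0
  have h := ha.fW_zero [y, z] [] z0 x
  simp only [List.cons_append, List.nil_append] at h
  simp only [sqW, brW, homogV_insert, homogW_insert]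
  simp only [insert_fW, h, add_zero, smul_sub, negOnePow_smul_smul]
  rw [negOnePow_eq_of_zmod (m := 1 * (1 + y.1 + z.1)) (n := y.1 + z.1 + 1)
      (by push_cast; grind), negOnePow_eq_of_zmod
      (m := (1 + y.1) * z.1 + (1 + z.1) * (1 + y.1)) (n := y.1 + 1) (by push_cast; grind),
    Int.negOnePow_succ, Int.negOnePow_succ, Units.neg_smul, Units.neg_smul]
  abel

/-- The component of the square on three inputs. -/
theorem IsHom.sqW_three (ha : a.IsHom) (h0 : a.fV [] = 0)
    (hV : ∀ l : List V.Homog, 3 ≤ l.length → a.fV l = 0)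
    (hW : ∀ (l : List V.Homog) x, 3 ≤ l.length → a.fW l x = 0)
    (y z t : V.Homog) (x : W.Homog) :
    a.sqW [y, z, t] x =
      y.1.negOnePow • (a.fW [y] (a.homogW [z, t] x) + a.fW [y, a.homogV [z, t]] x) +
      ((1 + y.1) * z.1).negOnePow • (a.fW [z] (a.homogW [y, t] x) + a.fW [z, a.homogV [y, t]] x) +
      ((1 + y.1 + z.1) * t.1).negOnePow •
        (a.fW [t] (a.homogW [y, z] x) + a.fW [t, a.homogV [y, z]] x) +
      (y.1 + z.1).negOnePow • a.fW [y, z] (a.homogW [t] x) +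
      (y.1 + z.1 * t.1 + t.1).negOnePow • a.fW [y, t] (a.homogW [z] x) +
      (y.1 * (z.1 + t.1) + z.1 + t.1).negOnePow • a.fW [z, t] (a.homogW [y] x) := by
  have h3 : ∀ u v w' x, a.fW [u, v, w'] x = 0 := fun u v w' x => hW _ x le_rfl
  have h4 : ∀ u v w' x' x, a.fW [u, v, w', x'] x = 0 := fun u v w' x' x => hW _ x (by simp)
  have z0 : ∀ u v w', ((a.homogV [u, v, w']).2 : V.carrier) = 0 := fun u v w' => hV _ le_rfl
  have w0 : ∀ u v w', ((a.homogW [u, v, w'] x).2 : W.carrier) = 0 := fun u v w' => hW _ x le_rfl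
  have h5 : ∀ u v w' x, a.fW [a.homogV [u, v, w']] x = 0 :=
    fun u v w' x => ha.fW_zero [] [] (z0 u v w') x
  have h6 : ∀ u v w', a.fW [] (a.homogW [u, v, w'] x) = 0 :=
    fun u v w' => ha.fW_right_zero [] (w0 u v w')
  simp only [sqW, brW, homogV_insert, homogW_insert]
  simp only [insert_fW, h3, h4, h5, h6, add_zero, smul_zero, sub_zero, smul_sub, smul_add,
    negOnePow_smul_smul]
  rw [negOnePow_eq_of_zmod
      (m := (1 + y.1) * z.1 + ((1 + y.1) * t.1 + (1 + z.1 + t.1) * (1 + y.1))) (n := y.1 + 1)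
      (by push_cast; grind), negOnePow_eq_of_zmod
      (m := (1 + y.1) * z.1 + (1 + z.1) * (1 + y.1 + t.1)) (n := y.1 + z.1 * t.1 + t.1 + 1)
      (by push_cast; grind), negOnePow_eq_of_zmod
      (m := (1 + y.1 + z.1) * t.1 + (1 + t.1) * (1 + y.1 + z.1)) (n := y.1 + z.1 + 1)
      (by push_cast; grind), negOnePow_eq_of_zmod
      (m := (1 + y.1) * z.1 + (1 + y.1) * t.1) (n := y.1 * (z.1 + t.1) + z.1 + t.1)
      (by push_cast; grind)]
  simp only [Int.negOnePow_succ, Units.neg_smul]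
  abel

/-- Vanishing of the square on four or more inputs. -/
theorem IsHom.sqW_eq_zero_of_four_le (ha : a.IsHom)
    (hV : ∀ l : List V.Homog, 3 ≤ l.length → a.fV l = 0)
    (hW : ∀ (l : List V.Homog) x, 3 ≤ l.length → a.fW l x = 0)
    (ω : V.Homog → ℕ)
    (hω : ∀ (l : List V.Homog) x, 2 ≤ l.length → (l.map ω).sum = 0 → a.fW l x = 0)
    (l : List V.Homog) (hl : 4 ≤ l.length) (hl' : (l.map ω).sum ≤ 1) (x : W.Homog) :
    a.sqW l x = 0 := by
  match l, hl with
  | y :: l, hl =>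
    simp only [List.length_cons] at hl
    simp only [List.map_cons, List.sum_cons] at hl'
    refine brW_eq_zero _ _ _ _ ω fun s t hst hs => ⟨?_, ?_, ?_, ?_⟩
    · by_cases h : 2 ≤ s.length
      · exact hW _ _ (by simp; omega)
      · exact ha.fW_zero s [] (hV _ (by simp; omega)) x
    · by_cases h : 1 ≤ s.length
      · exact hW _ _ (by simp; omega)
      · exact ha.fW_zero (y :: s) [] (hV _ (by omega)) x
    · by_cases h : 3 ≤ s.length
      · exact hW _ _ h
      by_cases h' : 3 ≤ (y :: t).length
      · exact ha.fW_right_zero s (hW _ _ h')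
      simp only [List.length_cons] at h'
      by_cases h'' : (s.map ω).sum = 0
      · exact hω _ _ (by omega) h''
      · exact ha.fW_right_zero s (hω _ _ (by simp only [List.length_cons]; omega)
          (by simp only [List.map_cons, List.sum_cons]; omega))
    · by_cases h : 3 ≤ t.length
      · exact ha.fW_right_zero (y :: s) (hW _ _ h)
      by_cases h' : 3 ≤ (y :: s).length
      · exact hW _ _ h'
      simp only [List.length_cons] at h'
      by_cases h'' : (t.map ω).sum = 0
      · exact ha.fW_right_zero (y :: s) (hω _ _ (by omega) h'')
      · exact hω (y :: s) _ (by simp only [List.length_cons]; omega)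
          (by simp only [List.map_cons, List.sum_cons]; omega)

end Square

/-! ### Criteria -/

theorem isHom_modOp_zero : (ModOp.zero V W).IsHom where
  add _ _ _ _ _ _ := (add_zero _).symm
  add_right _ _ _ _ := (add_zero _).symm
  smul _ _ _ _ _ _ _ := by
    change 0 = _ • W.act _ _ 0
    rw [map_zero, smul_zero]
  smul_right _ _ _ _ _ := by
    change 0 = _ • W.act _ _ 0
    rw [map_zero, smul_zero]
  swap _ _ _ _ _ := by
    change 0 = _ • (0 : W.carrier)
    rw [smul_zero]

theorem coder_eq_zero (a : GOp V W e) (hV : ∀ l, a.fV l = 0) (hW : ∀ l x, a.fW l x = 0)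
    (l : List V.Homog) (x : W.Homog) : a.coder l x = 0 := by
  simpa using coder_lin a a a 0 0 rfl rfl (by simpa using hV) (by simpa using hW) l x

theorem sqW_eq_zero_of_fW (a : GOp V W 1) (h : ∀ l x, a.fW l x = 0) (l : List V.Homog)
    (x : W.Homog) : a.sqW l x = 0 := by
  match l with
  | [] => exact h _ _
  | y :: l => exact brW_eq_zero _ _ _ _ (fun _ => 0) fun s t _ _ => ⟨h _ _, h _ _, h _ _, h _ _⟩

theorem isLInfinityAlgebra_of_sqV {ℓ : Op V} (h : ℓ.IsHom)
    (hsq : ∀ l, (ofOps ℓ (ModOp.zero V (GrMod.self S))).sqV l = 0) : IsLInfinityAlgebra ℓ := by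
  have H := isHom_ofOps h (isHom_modOp_zero (W := GrMod.self S))
  refine ⟨h, H.coderHom, isCoderivationOf_coderHom H, fun t => ?_⟩
  have : H.coderHom.comp H.coderHom = 0 := symTensor_hom_ext fun l x => by
    rw [AddMonoidHom.comp_apply, H.coderHom_sq ℓ.nil]
    exact coder_eq_zero _ hsq (sqW_eq_zero_of_fW _ fun _ _ => rfl) _ _
  exact DFunLike.congr_fun this t

theorem gen_mem_filtration {FV : ℤ → AddSubgroup V.carrier} {FW : ℤ → AddSubgroup W.carrier}
    {l : List V.Homog} {x : W.Homog} {c : List ℤ} {b : ℤ}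
    (hl : List.Forall₂ (fun y e => (y.2 : V.carrier) ∈ FV e) l c)
    (hx : (x.2 : W.carrier) ∈ FW b) : gen l x ∈ tensorFiltration FV FW (c.sum + b) :=
  AddSubgroup.subset_closure ⟨l, x, c, b, hl, hx, rfl, rfl⟩

theorem consHom_mem_filtration {FV : ℤ → AddSubgroup V.carrier} {FW : ℤ → AddSubgroup W.carrier}
    {y : V.Homog} {n a : ℤ} (hy : (y.2 : V.carrier) ∈ FV n) {t : SymTensor V W}
    (ht : t ∈ tensorFiltration FV FW a) : consHom y t ∈ tensorFiltration FV FW (n + a) := by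
  induction ht using AddSubgroup.closure_induction with
  | mem t ht =>
    obtain ⟨l, x, c, b, hl, hx, rfl, rfl⟩ := ht
    rw [← add_assoc, ← List.sum_cons]
    exact (consHom_gen y l x).symm ▸ gen_mem_filtration (List.Forall₂.cons hy hl) hx
  | zero => rw [map_zero]; exact zero_mem _
  | add t t' _ _ h h' => rw [map_add]; exact add_mem h h'
  | neg t _ h => rw [map_neg]; exact neg_mem h

section Cone

variable {W : GrMod.{u, v} (psRing S)}

theorem coneFiltration_zero :
    coneFiltration V 0 = (⊤ : AddSubgroup (psMod V).carrier).prod ⊥ :=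
  (if_neg (by omega)).trans (if_pos rfl)

theorem coneFiltration_pos {n : ℤ} (hn : 0 < n) : coneFiltration V n = ⊥ :=
  (if_neg (by omega)).trans (if_neg (by omega))

/-- A coderivation whose operations with values in `V` vanish and whose operations with values in
`W` vanish on tuples of total weight `> -k` raises the filtration degree by `k`. -/
theorem coder_mem_filtration (Z : GOp (cone V) W e) (k : ℤ) (hV : ∀ l, Z.fV l = 0)
    (hZ : ∀ (l : List (cone V).Homog) (c : List ℤ),
      List.Forall₂ (fun y e => (y.2 : (cone V).carrier) ∈ coneFiltration V e) l c →
      (∀ i ∈ c, i ≤ 0) → -k < c.sum → ∀ x, Z.fW l x = 0)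
    (l : List (cone V).Homog) (c : List ℤ)
    (hl : List.Forall₂ (fun y e => (y.2 : (cone V).carrier) ∈ coneFiltration V e) l c)
    (hc : ∀ i ∈ c, i ≤ 0) (b : ℤ) (hb : b ≤ 0) (x : W.Homog) :
    Z.coder l x ∈ tensorFiltration (coneFiltration V) (trivialFiltration W) (c.sum + b + k) := by
  induction hl generalizing e k with
  | nil =>
    have h1 : gen [Z.homogV []] x = 0 := gen_mid_zero [] [] (hV []) x
    rw [coder_nil, h1, zero_add]
    by_cases hk : -k < 0
    · rw [gen_right_zero [] (hZ [] [] .nil (by simp) (by simpa using hk) x)]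
      exact zero_mem _
    · have : (([] : List ℤ).sum + b + k) = ([] : List ℤ).sum + (b + k) := by ring
      rw [this]
      refine gen_mem_filtration .nil ?_
      rw [trivialFiltration, if_pos (by omega)]
      exact AddSubgroup.mem_top _
  | @cons y n l c hy hl ih =>
    rw [coder_cons]
    refine add_mem (units_smul_mem _ ?_) ?_
    · have h1 := ih Z k hV hZ (fun i hi => hc i (List.mem_cons_of_mem _ hi))
      have h2 := consHom_mem_filtration hy h1
      rwa [show n + (c.sum + b + k) = (n :: c).sum + b + k by rw [List.sum_cons]; ring] at h2
    · have h1 := ih (Z.insert y) (k + n) (fun l => hV (y :: l))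
        (fun l' c' hl' hc' hs x => hZ (y :: l') (n :: c') (.cons hy hl')
          (by
            intro i hi
            rcases List.mem_cons.1 hi with rfl | hi
            · exact hc _ List.mem_cons_self
            · exact hc' i hi) (by rw [List.sum_cons]; omega) x)
        (fun i hi => hc i (List.mem_cons_of_mem _ hi))
      rwa [show c.sum + b + (k + n) = (n :: c).sum + b + k by rw [List.sum_cons]; ring] at h1

/-- The weight of an element of the cone: `0` if it has no `ε`-component, else `1`. -/
def epsWeight (y : (cone V).Homog) : ℕ :=
  open Classical in if (y.2 : (cone V).carrier).2 = 0 then 0 else 1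

/-- An entry of filtration degree `0` has no `ε`-component, so the filtration degree of a tensor
bounds the number of entries with an `ε`-component. -/
theorem epsWeight_sum_le {l : List (cone V).Homog} {c : List ℤ}
    (hl : List.Forall₂ (fun y e => (y.2 : (cone V).carrier) ∈ coneFiltration V e) l c)
    (hc : ∀ i ∈ c, i ≤ 0) : ((l.map epsWeight).sum : ℤ) ≤ -c.sum := by
  induction hl with
  | nil => simp
  | @cons y n l c hy hl ih =>
    have h1 := ih (fun i hi => hc i (List.mem_cons_of_mem _ hi))
    have h2 := hc n List.mem_cons_self
    simp only [List.map_cons, List.sum_cons]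
    have h3 : (epsWeight y : ℤ) ≤ -n := by
      rw [epsWeight]
      split_ifs with h
      · simpa using h2
      · have : n ≠ 0 := by
          rintro rfl
          rw [coneFiltration_zero] at hy
          exact h hy.2
        push_cast; omega
    rw [Nat.cast_add]; omega

/-- The filtration vanishes in positive degrees, so only non-positive weights contribute. -/
theorem gen_eq_zero_of_pos {l : List (cone V).Homog} {c : List ℤ}
    (hl : List.Forall₂ (fun y e => (y.2 : (cone V).carrier) ∈ coneFiltration V e) l c)
    (hc : ¬ ∀ i ∈ c, i ≤ 0) (x : W.Homog) : gen l x = 0 := by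
  induction hl with
  | nil => simp at hc
  | @cons y n l c hy hl ih =>
    by_cases hn : n ≤ 0
    · rw [← consHom_gen, ih, map_zero]
      intro h
      refine hc fun i hi => ?_
      rcases List.mem_cons.1 hi with rfl | hi
      · exact hn
      · exact h i hi
    · rw [coneFiltration_pos (by omega)] at hy
      exact gen_mid_zero [] l hy x

/-- Modulo `ε²`, only the components of the square with at most one `ε` matter. -/
theorem isLInfinityModuleMod_two {ℓ : Op V} {ℓW : ModOp (cone V) W} (h : (coneOp ℓ).IsHom)
    (hW : ℓW.IsHom) (hsqV : ∀ l, (ofOps (coneOp ℓ) ℓW).sqV l = 0)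
    (hsqW : ∀ l x, (l.map epsWeight).sum ≤ 1 → (ofOps (coneOp ℓ) ℓW).sqW l x = 0) :
    IsLInfinityModuleMod 2 ℓ ℓW := by
  have H := isHom_ofOps h hW
  refine ⟨hW, H.coderHom, isCoderivationOf_coderHom H, fun a t ht => ?_⟩
  induction ht using AddSubgroup.closure_induction with
  | mem t ht =>
    obtain ⟨l, x, c, b, hl, hx, rfl, rfl⟩ := ht
    change H.coderHom (H.coderHom (gen l x)) ∈ _
    by_cases hc : ∀ i ∈ c, i ≤ 0
    · by_cases hb : b ≤ 0
      · rw [H.coderHom_sq (coneOp ℓ).nil]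
        refine coder_mem_filtration _ 2 hsqV (fun l c hl hc hs x => hsqW l x ?_) l c hl hc b hb x
        have := epsWeight_sum_le hl hc
        omega
      · rw [trivialFiltration, if_neg hb] at hx
        rw [gen_right_zero l hx, map_zero, map_zero]
        exact zero_mem _
    · rw [gen_eq_zero_of_pos hl hc, map_zero, map_zero]
      exact zero_mem _
  | zero => rw [map_zero, map_zero]; exact zero_mem _
  | add t t' _ _ h h' => rw [map_add, map_add]; exact add_mem h h'
  | neg t _ h => rw [map_neg, map_neg]; exact neg_mem h

end Cone

end GOp

/-! ### Sums over the splittings of a word -/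

namespace Word

variable {Ob : Type v} {Q : Ob → Ob → Type w} {G : Type*} [AddCommMonoid G]

theorem append_nil {X Y : Ob} (s : Word Q X Y) : s.append (nil Y) = s := by
  induction s with
  | nil => rfl
  | cons x s ih => exact congrArg (cons x) ih

theorem append_assoc {X Y Z T : Ob} (s : Word Q X Y) (t : Word Q Y Z) (r : Word Q Z T) :
    (s.append t).append r = s.append (t.append r) := by
  induction s with
  | nil => rfl
  | cons x s ih => exact congrArg (cons x) (ih t)

theorem sum₂_nil (X : Ob) (f : ∀ {Z : Ob}, Word Q X Z → Word Q Z X → G) :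
    sum₂ (nil X) f = f (nil X) (nil X) := by
  simp [sum₂, splits]

theorem sum₂_cons {X Y Z : Ob} (x : Q X Y) (t : Word Q Y Z)
    (f : ∀ {T : Ob}, Word Q X T → Word Q T Z → G) :
    sum₂ (cons x t) f = f (nil X) (cons x t) + sum₂ t (fun u v => f (cons x u) v) := by
  simp [sum₂, splits, Function.comp_def]

theorem sum₂_congr {X Y : Ob} {t : Word Q X Y} {f g : ∀ {Z : Ob}, Word Q X Z → Word Q Z Y → G}
    (h : ∀ (Z : Ob) (u : Word Q X Z) (v : Word Q Z Y), u.append v = t → f u v = g u v) :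
    sum₂ t f = sum₂ t g := by
  induction t with
  | nil X => rw [sum₂_nil, sum₂_nil, h _ _ _ rfl]
  | cons x t ih =>
    rw [sum₂_cons, sum₂_cons, h _ _ _ rfl]
    congr 1
    exact ih fun Z u v huv => h Z (cons x u) v (congrArg (cons x) huv)

theorem sum₂_zero {X Y : Ob} (t : Word Q X Y) : sum₂ t (fun _ _ => (0 : G)) = 0 := by
  simp [sum₂]

theorem sum₂_eq_zero {X Y : Ob} {t : Word Q X Y} {f : ∀ {Z : Ob}, Word Q X Z → Word Q Z Y → G}
    (h : ∀ (Z : Ob) (u : Word Q X Z) (v : Word Q Z Y), u.append v = t → f u v = 0) :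
    sum₂ t f = 0 := (sum₂_congr h).trans (sum₂_zero t)

theorem sum₂_add {X Y : Ob} (t : Word Q X Y) (f g : ∀ {Z : Ob}, Word Q X Z → Word Q Z Y → G) :
    sum₂ t (fun u v => f u v + g u v) = sum₂ t f + sum₂ t g := by
  simp [sum₂, List.sum_map_add]

theorem map_sum₂ {H : Type*} [AddCommMonoid H] (F : G →+ H) {X Y : Ob} (t : Word Q X Y)
    (f : ∀ {Z : Ob}, Word Q X Z → Word Q Z Y → G) :
    F (sum₂ t f) = sum₂ t (fun u v => F (f u v)) := by
  simp [sum₂, map_list_sum, Function.comp_def]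

theorem sum₂_comm {X Y X' Y' : Ob} (t : Word Q X Y) (t' : Word Q X' Y')
    (f : ∀ {Z Z' : Ob}, Word Q X Z → Word Q Z Y → Word Q X' Z' → Word Q Z' Y' → G) :
    sum₂ t (fun u v => sum₂ t' fun u' v' => f u v u' v') =
      sum₂ t' (fun u' v' => sum₂ t fun u v => f u v u' v') := by
  induction t with
  | nil X => simp only [sum₂_nil]
  | cons x t ih =>
    simp only [sum₂_cons, sum₂_add]
    congr 1
    exact ih fun u v u' v' => f (cons x u) v u' v'

/-- Splitting a word and then its first part amounts to splitting it and then its second part. -/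
theorem sum₂_assoc {X Y : Ob} (t : Word Q X Y)
    (f : ∀ {Z Z' : Ob}, Word Q X Z' → Word Q X Z → Word Q Z Z' → Word Q Z' Y → G) :
    sum₂ t (fun r c => sum₂ r fun a b => f r a b c) =
      sum₂ t (fun a t₁ => sum₂ t₁ fun b c => f (a.append b) a b c) := by
  induction t with
  | nil X => simp only [sum₂_nil]; rfl
  | cons x t ih =>
    simp only [sum₂_cons, sum₂_nil, sum₂_add]
    rw [ih fun r a b c => f (cons x r) (cons x a) b c, ← add_assoc]
    rfl

/-- The sum over a splitting of the first of several consecutive pieces. -/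
theorem sum₂_flat₃ {X Y : Ob} (t : Word Q X Y)
    (f : ∀ {Z Z' Z₁ : Ob}, Word Q X Z' → Word Q X Z → Word Q Z Z' → Word Q Z' Y → Word Q Z' Z₁ →
        Word Q Z₁
      Y → G) :
    (sum₂ t fun r s₀ => sum₂ s₀ fun c d =>
      sum₂ r fun a b => f r a b s₀ c d) =
    sum₂ t fun a s => sum₂ s fun b s₀ => sum₂ s₀ fun c d =>
      f (a.append b) a b s₀ c d := by
  rw [← sum₂_assoc t (fun r a b s₀ => sum₂ s₀ fun c d => f r a b s₀ c d)]
  exact sum₂_congr fun Z r s₀ _ => sum₂_comm s₀ r fun c d a b => f r a b s₀ c d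

theorem sum₂_flat₄ {X Y : Ob} (t : Word Q X Y)
    (f : ∀ {Z Z' Z₁ Z₂ : Ob}, Word Q X Z' → Word Q X Z → Word Q Z Z' → Word Q Z' Y → Word Q Z' Z₁ →
        Word Q Z₁
      Y → Word Q Z₁ Z₂ → Word Q Z₂ Y → G) :
    (sum₂ t fun r s₀ => sum₂ s₀ fun c s₁ => sum₂ s₁ fun d e =>
      sum₂ r fun a b => f r a b s₀ c s₁ d e) =
    sum₂ t fun a s => sum₂ s fun b s₀ => sum₂ s₀ fun c s₁ => sum₂ s₁ fun d e =>
      f (a.append b) a b s₀ c s₁ d e := by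
  rw [← sum₂_flat₃ t (fun r a b s₀ c s₁ => sum₂ s₁ fun d e => f r a b s₀ c s₁ d e)]
  exact sum₂_congr fun Z r s₀ _ => sum₂_congr fun _ c s₁ _ =>
    sum₂_comm s₁ r fun d e a b => f r a b s₀ c s₁ d e

theorem sum₂_flat₅ {X Y : Ob} (t : Word Q X Y)
    (f : ∀ {Z Z' Z₁ Z₂ Z₃ : Ob}, Word Q X Z' → Word Q X Z → Word Q Z Z' → Word Q Z' Y →
        Word Q Z' Z₁ → Word Q Z₁
      Y → Word Q Z₁ Z₂ → Word Q Z₂ Y → Word Q Z₂ Z₃ → Word Q Z₃ Y → G) :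
    (sum₂ t fun r s₀ => sum₂ s₀ fun c s₁ => sum₂ s₁ fun d s₂ => sum₂ s₂ fun e g =>
      sum₂ r fun a b => f r a b s₀ c s₁ d s₂ e g) =
    sum₂ t fun a s => sum₂ s fun b s₀ => sum₂ s₀ fun c s₁ => sum₂ s₁ fun d s₂ => sum₂ s₂ fun e g =>
      f (a.append b) a b s₀ c s₁ d s₂ e g := by
  rw [← sum₂_flat₄ t (fun r a b s₀ c s₁ d s₂ => sum₂ s₂ fun e g => f r a b s₀ c s₁ d s₂ e g)]
  exact sum₂_congr fun Z r s₀ _ => sum₂_congr fun _ c s₁ _ => sum₂_congr fun _ d s₂ _ =>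
    sum₂_comm s₂ r fun e g a b => f r a b s₀ c s₁ d s₂ e g

theorem sum₂_flat₆ {X Y : Ob} (t : Word Q X Y)
    (f : ∀ {Z Z' Z₁ Z₂ Z₃ Z₄ : Ob}, Word Q X Z' → Word Q X Z → Word Q Z Z' → Word Q Z' Y →
        Word Q Z' Z₁ → Word Q Z₁
      Y → Word Q Z₁ Z₂ → Word Q Z₂ Y → Word Q Z₂ Z₃ → Word Q Z₃ Y → Word Q Z₃ Z₄ →
      Word Q Z₄ Y → G) :
    (sum₂ t fun r s₀ => sum₂ s₀ fun c s₁ => sum₂ s₁ fun d s₂ => sum₂ s₂ fun e s₃ =>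
      sum₂ s₃ fun g h =>
      sum₂ r fun a b => f r a b s₀ c s₁ d s₂ e s₃ g h) =
    sum₂ t fun a s => sum₂ s fun b s₀ => sum₂ s₀ fun c s₁ => sum₂ s₁ fun d s₂ =>
      sum₂ s₂ fun e s₃ => sum₂ s₃ fun g h =>
      f (a.append b) a b s₀ c s₁ d s₂ e s₃ g h := by
  rw [← sum₂_flat₅ t (fun r a b s₀ c s₁ d s₂ e s₃ => sum₂ s₃ fun g h =>
    f r a b s₀ c s₁ d s₂ e s₃ g h)]
  exact sum₂_congr fun Z r s₀ _ => sum₂_congr fun _ c s₁ _ => sum₂_congr fun _ d s₂ _ =>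
    sum₂_congr fun _ e s₃ _ =>
    sum₂_comm s₃ r fun g h a b => f r a b s₀ c s₁ d s₂ e s₃ g h

theorem length_append {X Y Z : Ob} (s : Word Q X Y) (t : Word Q Y Z) :
    (s.append t).length = s.length + t.length := by
  induction s with
  | nil => exact (Nat.zero_add _).symm
  | cons x s ih => rw [append, length, length, ih]; omega

theorem sum₂_left_length_zero {X Y : Ob} (t : Word Q X Y) (C : G) :
    sum₂ t (fun u _ => if u.length = 0 then C else 0) = C := by
  cases t with
  | nil => rw [sum₂_nil]; rfl
  | cons x t =>
    rw [sum₂_cons, sum₂_eq_zero (fun Z u v _ => if_neg (by simp [length])), add_zero]; rfl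

theorem sum₂_left_length_one {X Y : Ob} (t : Word Q X Y) (C : G) :
    sum₂ t (fun u _ => if u.length = 1 then C else 0) = if t.length = 0 then 0 else C := by
  cases t with
  | nil => rw [sum₂_nil]; rfl
  | cons x t =>
    rw [sum₂_cons]
    refine (zero_add _).trans ((Eq.trans ?_ (sum₂_left_length_zero t C)))
    simp [length]

theorem sum₂_right_length_zero {X Y : Ob} (t : Word Q X Y) (C : G) :
    sum₂ t (fun _ v => if v.length = 0 then C else 0) = C := by
  induction t with
  | nil => rw [sum₂_nil]; rfl
  | cons x t ih => rw [sum₂_cons, ih]; exact zero_add _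

theorem sum₂_right_length_one {X Y : Ob} (t : Word Q X Y) (C : G) :
    sum₂ t (fun _ v => if v.length = 1 then C else 0) = if t.length = 0 then 0 else C := by
  induction t with
  | nil => rw [sum₂_nil]; rfl
  | cons x t ih =>
    rw [sum₂_cons, ih]
    by_cases h : t.length = 0 <;> simp [length, h]

theorem smul_sum₂ {G : Type*} [AddCommGroup G] (u : ℤˣ) {X Y : Ob} (t : Word Q X Y)
    (f : ∀ {Z : Ob}, Word Q X Z → Word Q Z Y → G) :
    u • sum₂ t f = sum₂ t (fun a b => u • f a b) := by
  simpa [Units.smul_def] using map_sum₂ (zsmulAddGroupHom (α := G) (u : ℤ)) t f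

theorem sum₂_mem {G : Type*} [AddCommGroup G] {H : AddSubgroup G} {X Y : Ob} {t : Word Q X Y}
    {f : ∀ {Z : Ob}, Word Q X Z → Word Q Z Y → G}
    (h : ∀ (Z : Ob) (u : Word Q X Z) (v : Word Q Z Y), u.append v = t → f u v ∈ H) :
    sum₂ t f ∈ H := by
  induction t with
  | nil X => rw [sum₂_nil]; exact h _ _ _ rfl
  | cons x t ih =>
    rw [sum₂_cons]
    exact add_mem (h _ _ _ rfl) (ih fun Z u v huv => h Z (cons x u) v (congrArg (cons x) huv))

end Word

namespace UnitalGradedQuiver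

open Word

variable {R : Type u} [Ring R] {𝓡 : ℤ → AddSubgroup R} [GradedRing 𝓡]
  {A : UnitalGradedQuiver.{u, v, w} 𝓡}

theorem ins_nil {X Y Z : A.Ob} (x : A.Arr X Y) (t : A.Path Y Z) :
    ins (.nil X) x t = .cons x t := rfl

theorem ins_cons {X Y Z T U : A.Ob} (y : A.Arr X Y) (s : A.Path Y Z) (x : A.Arr Z T)
    (t : A.Path T U) : ins (.cons y s) x t = .cons y (ins s x t) := rfl

theorem ins_ins {X Y Z T U V : A.Ob} (a : A.Path X Y) (x : A.Arr Y Z) (b : A.Path Z T)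
    (y : A.Arr T U) (c : A.Path U V) : ins (ins a x b) y c = ins a x (ins b y c) :=
  append_assoc a (.cons x b) (.cons y c)

theorem pdeg_nil (X : A.Ob) : pdeg (.nil X : A.Path X X) = 0 := rfl

theorem pdeg_cons {X Y Z : A.Ob} (x : A.Arr X Y) (t : A.Path Y Z) :
    pdeg (.cons x t : A.Path X Z) = sdeg₁ x + pdeg t := rfl

theorem pdeg_append {X Y Z : A.Ob} (s : A.Path X Y) (t : A.Path Y Z) :
    pdeg (s.append t : A.Path X Z) = pdeg s + pdeg t := by
  induction s with
  | nil => simp [Word.append, pdeg_nil]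
  | cons x s ih => rw [Word.append, pdeg_cons, ih, pdeg_cons, add_assoc]

theorem pdeg_ins {X Y Z T : A.Ob} (s : A.Path X Y) (x : A.Arr Y Z) (t : A.Path Z T) :
    pdeg (ins s x t) = pdeg s + sdeg₁ x + pdeg t := by
  rw [ins, pdeg_append, pdeg_cons, add_assoc]

theorem sdeg₁_value {q : ℤ} (ψ : A.cochains q) {X Y : A.Ob} (t : A.Path X Y) :
    sdeg₁ (value ψ t) = q + pdeg t := by
  simp [sdeg₁, value]

theorem sdeg₁_unit (X : A.Ob) : sdeg₁ (A.unit X) = -1 := rfl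

/-- The splittings of a word with a marked letter: this letter lies in the second or in the first
part. -/
theorem sum₂_ins {G : Type*} [AddCommMonoid G] {X Y Z T : A.Ob} (s : A.Path X Y) (x : A.Arr Y Z)
    (t : A.Path Z T) (f : ∀ {U : A.Ob}, A.Path X U → A.Path U T → G) :
    sum₂ (ins s x t) f =
      sum₂ s (fun a b => f a (ins b x t)) + sum₂ t (fun a b => f (ins s x a) b) := by
  induction s with
  | nil X => rw [ins_nil, sum₂_cons, sum₂_nil]; rfl
  | cons y s ih =>
    rw [ins_cons, sum₂_cons, sum₂_cons, ih, add_assoc]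
    rfl

/-! ### Linearity in one entry -/

/-- `Φ` is additive, and linear up to the sign `(-1)^{|r| n}`, in one entry of a word, for some
action `act` of the homogeneous scalars on the target. -/
structure IsLin {G : Type*} [AddCommGroup G] (act : ∀ {i : ℤ}, 𝓡 i → G →+ G) {X Y : A.Ob} (n : ℤ)
    (Φ : A.Arr X Y → G) : Prop where
  add : ∀ {x x₁ x₂ : A.Arr X Y}, x₁.1 = x.1 → x₂.1 = x.1 →
    (x.2 : A.Hom X Y) = x₁.2 + x₂.2 → Φ x = Φ x₁ + Φ x₂
  smul : ∀ {i : ℤ} (r : 𝓡 i) {x y : A.Arr X Y}, x.1 = i + y.1 →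
    (x.2 : A.Hom X Y) = (r : R) • (y.2 : A.Hom X Y) → Φ x = (i * n).negOnePow • act r (Φ y)

/-- The analogue of `IsLin` for maps between homogeneous morphisms, homogeneous of degree `k`. -/
structure IsLinArr {X Y X' Y' : A.Ob} (n : ℤ) (Ψ : A.Arr X Y → A.Arr X' Y') : Prop where
  deg : ∃ k : ℤ, ∀ x, (Ψ x).1 = x.1 + k
  add : ∀ {x x₁ x₂ : A.Arr X Y}, x₁.1 = x.1 → x₂.1 = x.1 →
    (x.2 : A.Hom X Y) = x₁.2 + x₂.2 → ((Ψ x).2 : A.Hom X' Y') = (Ψ x₁).2 + (Ψ x₂).2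
  smul : ∀ {i : ℤ} (r : 𝓡 i) {x y : A.Arr X Y}, x.1 = i + y.1 →
    (x.2 : A.Hom X Y) = (r : R) • (y.2 : A.Hom X Y) →
    ((Ψ x).2 : A.Hom X' Y') = (i * n).negOnePow • ((r : R) • ((Ψ y).2 : A.Hom X' Y'))

namespace IsLin

variable {G : Type*} [AddCommGroup G] {act : ∀ {i : ℤ}, 𝓡 i → G →+ G} {X Y X' Y' : A.Ob} {n : ℤ}
  {Φ Φ' : A.Arr X Y → G}

theorem map_lin (h : IsLin act n Φ) {x x₁ x₂ : A.Arr X Y} (h₁ : x₁.1 = x.1) (h₂ : x₂.1 = x.1)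
    (k₁ k₂ : ℤ) (hx : (x.2 : A.Hom X Y) = k₁ • (x₁.2 : A.Hom X Y) + k₂ • (x₂.2 : A.Hom X Y)) :
    Φ x = k₁ • Φ x₁ + k₂ • Φ x₂ := by
  obtain ⟨d, x⟩ := x
  obtain ⟨d₁, x₁⟩ := x₁
  obtain ⟨d₂, x₂⟩ := x₂
  obtain rfl : d₁ = d := h₁
  obtain rfl : d₂ = d₁ := h₂
  let F : A.gr X Y d₂ →+ G := AddMonoidHom.mk' (fun z => Φ ⟨d₂, z⟩) fun z z' =>
    h.add (x := ⟨d₂, z + z'⟩) (x₁ := ⟨d₂, z⟩) (x₂ := ⟨d₂, z'⟩) rfl rfl rfl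
  obtain rfl : x = k₁ • x₁ + k₂ • x₂ := Subtype.ext hx
  exact (F.map_add _ _).trans (by rw [map_zsmul, map_zsmul]; rfl)

theorem map_zero (h : IsLin act n Φ) {x : A.Arr X Y} (hx : (x.2 : A.Hom X Y) = 0) : Φ x = 0 := by
  simpa using h.map_lin (x := x) (x₁ := x) (x₂ := x) rfl rfl 0 0 (by simpa using hx)

theorem map_units_smul (h : IsLin act n Φ) {x x₁ : A.Arr X Y} (h₁ : x₁.1 = x.1) (k : ℤˣ)
    (hx : (x.2 : A.Hom X Y) = k • (x₁.2 : A.Hom X Y)) : Φ x = k • Φ x₁ := by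
  simpa [Units.smul_def] using h.map_lin (x := x) (x₁ := x₁) (x₂ := x) h₁ rfl k 0
    (by simpa [Units.smul_def] using hx)

theorem congr_deg (h : IsLin act n Φ) {n' : ℤ} (hn : (n : ZMod 2) = n') : IsLin act n' Φ where
  add := h.add
  smul r _ _ hx hx' := (h.smul r hx hx').trans
    (negOnePow_smul_congr (by push_cast; rw [hn]) rfl)

theorem congr_fun (h : IsLin act n Φ) (hΦ : ∀ x, Φ' x = Φ x) : IsLin act n Φ' := by
  obtain rfl : Φ' = Φ := funext hΦ
  exact h

theorem comp {m : ℤ} {Φ : A.Arr X' Y' → G} {Ψ : A.Arr X Y → A.Arr X' Y'} (h : IsLin act n Φ)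
    (hΨ : IsLinArr m Ψ) : IsLin act (n + m) (fun x => Φ (Ψ x)) where
  add {x x₁ x₂} h₁ h₂ hx := by
    obtain ⟨k, hk⟩ := hΨ.deg
    exact h.add (by rw [hk, hk, h₁]) (by rw [hk, hk, h₂]) (hΨ.add h₁ h₂ hx)
  smul {i} r {x y} hx hx' := by
    obtain ⟨k, hk⟩ := hΨ.deg
    let z : A.Arr X' Y' := smulArr r (Ψ y).2
    have hz : z.1 = i + (Ψ y).1 := rfl
    rw [h.map_units_smul (x := Ψ x) (x₁ := z) (by rw [hz, hk, hk, hx]; ring)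
      ((i * m).negOnePow) (hΨ.smul r hx hx'), h.smul r (x := z) (y := Ψ y) hz rfl,
      negOnePow_smul_smul]
    exact negOnePow_smul_congr (by push_cast; ring) rfl

theorem sign (h : IsLin act n Φ) (k : A.Arr X Y → ℤ) (α β : ℤ)
    (hk : ∀ x, (k x : ZMod 2) = α + β * x.1) :
    IsLin act (n + β) (fun x => (k x).negOnePow • Φ x) where
  add {x x₁ x₂} h₁ h₂ hx := by
    have e₁ : (k x₁).negOnePow = (k x).negOnePow :=
      negOnePow_eq_of_zmod (by rw [hk, hk, h₁])
    have e₂ : (k x₂).negOnePow = (k x).negOnePow :=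
      negOnePow_eq_of_zmod (by rw [hk, hk, h₂])
    rw [h.add h₁ h₂ hx, smul_add, e₁, e₂]
  smul {i} r {x y} hx hx' := by
    rw [h.smul r hx hx', map_negOnePow_smul, negOnePow_smul_smul, negOnePow_smul_smul]
    refine negOnePow_smul_congr ?_ rfl
    push_cast
    rw [hk, hk, hx]
    push_cast
    ring

theorem add' (h : IsLin act n Φ) (h' : IsLin act n Φ') : IsLin act n (fun x => Φ x + Φ' x) where
  add h₁ h₂ hx := by rw [h.add h₁ h₂ hx, h'.add h₁ h₂ hx]; abel
  smul r _ _ hx hx' := by rw [h.smul r hx hx', h'.smul r hx hx', map_add, smul_add]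

theorem sum₂ {Z T : A.Ob} {t : A.Path Z T}
    {F : ∀ {U : A.Ob}, A.Path Z U → A.Path U T → A.Arr X Y → G}
    (h : ∀ (U : A.Ob) (a : A.Path Z U) (b : A.Path U T), pdeg t = pdeg a + pdeg b →
      IsLin act n (F a b)) : IsLin act n (fun x => Word.sum₂ t fun a b => F a b x) where
  add h₁ h₂ hx := by
    rw [← Word.sum₂_add]
    exact Word.sum₂_congr fun U a b hab => (h U a b (by rw [← hab, pdeg_append])).add h₁ h₂ hx
  smul r _ _ hx hx' := by
    rw [Word.map_sum₂, Word.smul_sum₂]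
    exact Word.sum₂_congr fun U a b hab =>
      (h U a b (by rw [← hab, pdeg_append])).smul r hx hx'

end IsLin

/-- A map which is linear in the sense of `IsLin`, restricted to morphisms of degree `d` and
extended by zero to the other homogeneous components. -/
def IsLin.toHom {G : Type*} [AddCommGroup G] {act : ∀ {i : ℤ}, 𝓡 i → G →+ G} {X Y : A.Ob} {n : ℤ}
    {Φ : A.Arr X Y → G} (h : IsLin act n Φ) (d : ℤ) : A.Hom X Y →+ G :=
  (AddMonoidHom.mk' (fun z : A.gr X Y d => Φ ⟨d, z⟩) fun z z' =>
    h.add (x := ⟨d, z + z'⟩) (x₁ := ⟨d, z⟩) (x₂ := ⟨d, z'⟩) rfl rfl rfl).comp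
  ((DFinsupp.evalAddMonoidHom d).comp
    (DirectSum.decomposeAddEquiv (A.gr X Y)).toAddMonoidHom)

theorem IsLin.toHom_apply {G : Type*} [AddCommGroup G] {act : ∀ {i : ℤ}, 𝓡 i → G →+ G}
    {X Y : A.Ob} {n : ℤ} {Φ : A.Arr X Y → G} (h : IsLin act n Φ) {d : ℤ} {x : A.Arr X Y}
    (hx : x.1 = d) : h.toHom d x.2 = Φ x := by
  obtain ⟨d, x⟩ := x
  obtain rfl : d = _ := hx
  have : (DirectSum.decompose (A.gr X Y) (x : A.Hom X Y)) d = x :=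
    Subtype.ext (DirectSum.decompose_of_mem_same _ x.2)
  exact congrArg (fun z => Φ ⟨d, z⟩) this

theorem isLinArr_value {p : ℤ} (φ : A.cochains p) {X Y Z T : A.Ob} (s : A.Path X Y)
    (t : A.Path Z T) : IsLinArr (p + pdeg s) (fun x : A.Arr Y Z => value φ (ins s x t)) where
  deg := ⟨p + pdeg s + pdeg t, fun x => by simp only [value, pdeg_ins, sdeg₁]; ring⟩
  add {x x₁ x₂} h₁ h₂ hx := by
    obtain ⟨d, x⟩ := x
    obtain ⟨_, x₁⟩ := x₁
    obtain ⟨_, x₂⟩ := x₂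
    obtain rfl : _ = d := h₁
    obtain rfl : _ = _ := h₂
    obtain rfl : x = x₁ + x₂ := Subtype.ext hx
    exact φ.2.2.1 _ _ _ _ s t _ x₁ x₂
  smul {i} r {x y} hx hx' := by
    obtain ⟨d, x⟩ := x
    obtain ⟨e, y⟩ := y
    obtain rfl : d = i + e := hx
    obtain rfl : x = smulGr r y := Subtype.ext hx'
    exact φ.2.2.2 _ _ _ _ s t i e r y

/-- The action of scalars on morphisms. -/
def homAct (X Y : A.Ob) {i : ℤ} (r : 𝓡 i) : A.Hom X Y →+ A.Hom X Y :=
  DistribSMul.toAddMonoidHom _ (r : R)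

theorem isLin_cochain {p : ℤ} (φ : A.cochains p) {X Y Z T : A.Ob} (s : A.Path X Y)
    (t : A.Path Z T) : IsLin (homAct X T) (p + pdeg s) (fun x => φ.1 X T (ins s x t)) where
  add h₁ h₂ hx := (isLinArr_value φ s t).add h₁ h₂ hx
  smul r _ _ hx hx' := (isLinArr_value φ s t).smul r hx hx'

theorem mem_cochains_of_isLin {p : ℤ} {φ : A.CochainFun}
    (h₁ : ∀ X Y (t : A.Path X Y), φ X Y t ∈ A.gr X Y (p + pdeg t + 1))
    (h₂ : ∀ {X Y Z T : A.Ob} (s : A.Path X Y) (t : A.Path Z T),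
      IsLin (homAct X T) (p + pdeg s) (fun x => φ X T (ins s x t))) : φ ∈ A.cochains p :=
  ⟨h₁, fun _ _ _ _ s t _ _ _ => (h₂ s t).add rfl rfl rfl,
    fun _ _ _ _ s t _ _ r _ => (h₂ s t).smul r rfl rfl⟩

end UnitalGradedQuiver

namespace UnitalGradedQuiver

open Word

variable {R : Type u} [Ring R] {𝓡 : ℤ → AddSubgroup R} [GradedRing 𝓡]
  {A : UnitalGradedQuiver.{u, v, w} 𝓡}

/-! ### The Gerstenhaber bracket -/

theorem circ_isLin {p q : ℤ} (φ : A.cochains p) (ψ : A.cochains q) {X Y Z T : A.Ob}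
    (s : A.Path X Y) (t : A.Path Z T) :
    IsLin (homAct X T) (p + q + pdeg s) (fun x => circ φ ψ X T (ins s x t)) := by
  simp only [circ, sum₂_ins, sum₂_add]
  refine .add' (.add' (.sum₂ fun _ a v hav => .sum₂ fun _ b c hbc => ?_)
    (.sum₂ fun _ a v hav => .sum₂ fun _ b c hbc => ?_))
    (.sum₂ fun _ a v hav => .sum₂ fun _ b c hbc => ?_)
  · refine (((isLin_cochain φ (ins a (value ψ b) c) t).congr_fun fun x => by rw [ins_ins]).sign
      _ (q * pdeg a) 0 fun x => by push_cast; ring).congr_deg ?_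
    rw [pdeg_ins, sdeg₁_value, hav, hbc]
    push_cast; grind
  · refine (((isLin_cochain φ a c).comp (isLinArr_value ψ v b)).sign
      _ (q * pdeg a) 0 fun x => by push_cast; ring).congr_deg ?_
    rw [hav]
    push_cast; grind
  · refine (((isLin_cochain φ s (ins a (value ψ b) c)).congr_fun fun x => by rw [ins_ins]).sign
      _ (q * (pdeg s + pdeg a - 1)) q fun x => by rw [pdeg_ins, sdeg₁]; push_cast; ring).congr_deg ?_
    push_cast; grind

theorem circ_mem {p q : ℤ} (φ : A.cochains p) (ψ : A.cochains q) :
    circ φ ψ ∈ A.cochains (p + q) := by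
  refine mem_cochains_of_isLin (fun X Y t => ?_) fun s t => circ_isLin φ ψ s t
  refine sum₂_mem fun Z a t' h => sum₂_mem fun _ b c h' => units_smul_mem _ ?_
  have := φ.2.1 X Y (ins a (value ψ b) c)
  rwa [pdeg_ins, sdeg₁_value, show p + (pdeg a + (q + pdeg b) + pdeg c) + 1 =
    p + q + pdeg t + 1 by rw [← h, ← h', pdeg_append, pdeg_append]; ring] at this

/-- `φ ∘ ψ` as a homogeneous cochain. -/
def circC {p q : ℤ} (φ : A.cochains p) (ψ : A.cochains q) : A.cochains (p + q) :=
  ⟨circ φ ψ, circ_mem φ ψ⟩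

theorem bracket_mem {p q : ℤ} (φ : A.cochains p) (ψ : A.cochains q) :
    bracket φ ψ ∈ A.cochains (p + q) := by
  refine sub_mem (circ_mem φ ψ) (units_smul_mem _ ?_)
  rw [add_comm p q]
  exact circ_mem ψ φ

/-- `[φ, ψ]` as a homogeneous cochain. -/
def bracketC {p q : ℤ} (φ : A.cochains p) (ψ : A.cochains q) : A.cochains (p + q) :=
  ⟨bracket φ ψ, bracket_mem φ ψ⟩

/-- A function which is linear in the entry occupied by the value of `φ ∘ ψ` can be evaluated term by
term. -/
theorem IsLin.map_circ {G : Type*} [AddCommGroup G] {act : ∀ {i : ℤ}, 𝓡 i → G →+ G}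
    {X Y : A.Ob} {n : ℤ} {Φ : A.Arr X Y → G} (h : IsLin act n Φ) {p q : ℤ} (φ : A.cochains p)
    (ψ : A.cochains q) (t : A.Path X Y) :
    Φ (value (circC φ ψ) t) = t.sum₂ fun a t' => t'.sum₂ fun b c =>
      (q * pdeg a).negOnePow • Φ (value φ (ins a (value ψ b) c)) := by
  rw [← h.toHom_apply (d := p + q + pdeg t + 1) rfl]
  have hv : ((value (circC φ ψ) t).2 : A.Hom X Y) = circ φ ψ X Y t := rfl
  rw [hv, circ]
  simp only [Word.map_sum₂, map_negOnePow_smul]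
  refine sum₂_congr fun Z a t' ht => sum₂_congr fun Z' b c ht' => ?_
  congr 1
  refine h.toHom_apply (x := value φ (ins a (value ψ b) c)) ?_
  change p + pdeg (ins a (value ψ b) c) + 1 = p + q + pdeg t + 1
  rw [pdeg_ins, sdeg₁_value, ← ht, ← ht', pdeg_append, pdeg_append]
  ring

/-- The part of `(φ ∘ ψ) ∘ χ` in which `ψ` and `χ` are inserted into `φ` independently of each
other, `ψ` to the left of `χ`. -/
def circ₂ {p q r : ℤ} (φ : A.cochains p) (ψ : A.cochains q) (χ : A.cochains r) : A.CochainFun :=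
  fun X Y t => t.sum₂ fun a t₁ => t₁.sum₂ fun b t₂ => t₂.sum₂ fun c t₃ => t₃.sum₂ fun e f =>
    (q * pdeg a + r * (pdeg a + pdeg b + pdeg c)).negOnePow •
      φ.1 X Y (ins a (value ψ b) (ins c (value χ e) f))

/-- The pre-Lie identity: `(φ ∘ ψ) ∘ χ - φ ∘ (ψ ∘ χ)` is graded symmetric in `ψ` and `χ`. -/
theorem circ_circ {p q r : ℤ} (φ : A.cochains p) (ψ : A.cochains q) (χ : A.cochains r) :
    circ (circC φ ψ) χ =
      circ φ (circC ψ χ) + circ₂ φ ψ χ + (q * r).negOnePow • circ₂ φ χ ψ := by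
  funext X Y t
  simp only [Pi.add_apply, Pi.smul_apply]
  have e1 : circ φ (circC ψ χ) X Y t =
      t.sum₂ fun a t₁ => t₁.sum₂ fun u t₂ => t₂.sum₂ fun b t₃ => t₃.sum₂ fun c d =>
        ((q + r) * pdeg a + r * pdeg u).negOnePow •
          φ.1 X Y (ins a (value ψ (ins u (value χ b) c)) d) := by
    have h : ∀ {Z Z' : A.Ob} (a : A.Path X Z) (b : A.Path Z Z') (c : A.Path Z' Y),
        φ.1 X Y (ins a (value (circC ψ χ) b) c) = b.sum₂ fun u t' => t'.sum₂ fun v w =>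
          (r * pdeg u).negOnePow • φ.1 X Y (ins a (value ψ (ins u (value χ v) w)) c) :=
      fun a b c => (isLin_cochain φ a c).map_circ ψ χ b
    simp only [circ, h, smul_sum₂, negOnePow_smul_smul, sum₂_assoc]
  rw [e1]
  simp only [circ, circ₂, circC, sum₂_ins, sum₂_add, smul_add, smul_sum₂, negOnePow_smul_smul,
    ins_ins, sum₂_flat₃, pdeg_append, pdeg_ins, sdeg₁_value]
  rw [add_comm (sum₂ t _) (sum₂ t _)]
  refine congrArg₂ (· + ·) (congrArg₂ (· + ·) ?_ ?_) ?_ <;>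
  · repeat refine sum₂_congr fun _ _ _ _ => ?_
    exact negOnePow_smul_congr (by push_cast; grind) rfl

theorem circ_left_lin {p p₁ p₂ q : ℤ} (φ : A.cochains p) (φ₁ : A.cochains p₁)
    (φ₂ : A.cochains p₂) (ψ : A.cochains q) (k₁ k₂ : ℤ)
    (h : φ.1 = k₁ • φ₁.1 + k₂ • φ₂.1) :
    circ φ ψ = k₁ • circ φ₁ ψ + k₂ • circ φ₂ ψ := by
  funext X Y t
  have e : ∀ (k : ℤ) (f : A.Hom X Y), k • f = zsmulAddGroupHom k f := fun _ _ => rfl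
  simp only [Pi.add_apply, Pi.smul_apply, circ, h]
  simp only [e, Word.map_sum₂, ← sum₂_add]
  simp only [← e, smul_add, smul_units_smul]

theorem circ_right_lin {p q q₁ q₂ : ℤ} (φ : A.cochains p) (ψ : A.cochains q)
    (ψ₁ : A.cochains q₁) (ψ₂ : A.cochains q₂) (k₁ k₂ : ℤ) (h₁ : q₁ = q) (h₂ : q₂ = q)
    (h : ψ.1 = k₁ • ψ₁.1 + k₂ • ψ₂.1) :
    circ φ ψ = k₁ • circ φ ψ₁ + k₂ • circ φ ψ₂ := by
  subst h₁
  obtain rfl := h₂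
  funext X Y t
  have e : ∀ (k : ℤ) (f : A.Hom X Y), k • f = zsmulAddGroupHom k f := fun _ _ => rfl
  simp only [Pi.add_apply, Pi.smul_apply, circ]
  simp only [e, Word.map_sum₂, ← sum₂_add]
  refine sum₂_congr fun Z a t' _ => sum₂_congr fun Z' b c _ => ?_
  rw [(isLin_cochain φ a c).map_lin (x := value ψ b) (x₁ := value ψ₁ b) (x₂ := value ψ₂ b)
    rfl rfl k₁ k₂ (by simp only [value, h]; rfl), ← e, ← e, smul_add, smul_units_smul,
    smul_units_smul]

/-- The bracket does not depend on how the degrees are written. -/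
theorem bracket_congr {p p' q q' : ℤ} {φ : A.cochains p} {φ' : A.cochains p'} {ψ : A.cochains q}
    {ψ' : A.cochains q'} (hp : p = p') (hφ : φ.1 = φ'.1) (hq : q = q') (hψ : ψ.1 = ψ'.1) :
    bracket φ ψ = bracket φ' ψ' := by
  subst hp
  subst hq
  rw [Subtype.ext hφ, Subtype.ext hψ]

theorem bracket_left_lin {p q : ℤ} (φ φ₁ φ₂ : A.cochains p) (ψ : A.cochains q) (k₁ k₂ : ℤ)
    (h : φ.1 = k₁ • φ₁.1 + k₂ • φ₂.1) :
    bracket φ ψ = k₁ • bracket φ₁ ψ + k₂ • bracket φ₂ ψ := by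
  rw [bracket, bracket, bracket, circ_left_lin φ φ₁ φ₂ ψ k₁ k₂ h,
    circ_right_lin ψ φ φ₁ φ₂ k₁ k₂ rfl rfl h]
  simp only [smul_add, smul_sub, smul_units_smul]
  abel

theorem bracket_antisymm {p q : ℤ} (φ : A.cochains p) (ψ : A.cochains q) :
    bracket φ ψ = -((p * q).negOnePow • bracket ψ φ) := by
  rw [bracket, bracket, smul_sub, mul_comm q p, negOnePow_smul_self]
  abel

theorem circ_bracketC {p q r : ℤ} (φ : A.cochains p) (ψ : A.cochains q) (χ : A.cochains r) :
    circ φ (bracketC ψ χ) =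
      circ φ (circC ψ χ) - (q * r).negOnePow • circ φ (circC χ ψ) := by
  rw [circ_right_lin φ (bracketC ψ χ) (circC ψ χ) (circC χ ψ) 1 (-((q * r).negOnePow : ℤ)) rfl
    (add_comm _ _) (by rw [one_smul, neg_smul, ← sub_eq_add_neg]; rfl), one_smul, neg_smul,
    ← sub_eq_add_neg]
  rfl

theorem circ_bracketC_left {p q r : ℤ} (φ : A.cochains p) (ψ : A.cochains q) (χ : A.cochains r) :
    circ (bracketC φ ψ) χ =
      circ (circC φ ψ) χ - (p * q).negOnePow • circ (circC ψ φ) χ := by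
  rw [circ_left_lin (bracketC φ ψ) (circC φ ψ) (circC ψ φ) χ 1 (-((p * q).negOnePow : ℤ))
    (by rw [one_smul, neg_smul, ← sub_eq_add_neg]; rfl), one_smul, neg_smul, ← sub_eq_add_neg]
  rfl

/-- The Jacobi identity, a formal consequence of the pre-Lie identity `circ_circ`. -/
theorem bracket_jacobi {p q r : ℤ} (φ : A.cochains p) (ψ : A.cochains q) (χ : A.cochains r) :
    bracket φ (bracketC ψ χ) =
      bracket (bracketC φ ψ) χ + (p * q).negOnePow • bracket ψ (bracketC φ χ) := by
  simp only [bracket, circ_bracketC, circ_bracketC_left, circ_circ, mul_add, add_mul,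
    Int.negOnePow_add, mul_comm r q, mul_comm r p, mul_comm q p, mul_smul]
  rcases Int.units_eq_one_or (p * q).negOnePow with h₁ | h₁ <;>
  rcases Int.units_eq_one_or (p * r).negOnePow with h₂ | h₂ <;>
  rcases Int.units_eq_one_or (q * r).negOnePow with h₃ | h₃ <;>
  · simp only [h₁, h₂, h₃, one_smul, Units.neg_smul]
    abel

/-- Multiplication by a scalar on homogeneous cochains. -/
def smulC [IsGradedComm 𝓡] {i p : ℤ} (r : 𝓡 i) (φ : A.cochains p) : A.cochains (i + p) :=
  ⟨cochainAct r φ.1, by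
    refine mem_cochains_of_isLin (fun X Y t => ?_) fun {X Y Z T} s t => ⟨?_, ?_⟩
    · have h := SetLike.GradedSMul.smul_mem (A := 𝓡) (B := A.gr X Y) r.2 (φ.2.1 X Y t)
      rw [vadd_eq_add, show i + (p + pdeg t + 1) = i + p + pdeg t + 1 by ring] at h
      exact units_smul_mem _ h
    · intro x x₁ x₂ h₁ h₂ hx
      simp only [cochainAct_apply]
      rw [(isLin_cochain φ s t).add h₁ h₂ hx, smul_add, smul_add]
    · intro j r' x y hx hx'
      have hc : (r : R) * r' = (i * j).negOnePow • ((r' : R) * r) := IsGradedComm.comm r.2 r'.2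
      simp only [cochainAct_apply]
      rw [(isLin_cochain φ s t).smul r' hx hx', homAct]
      simp only [DistribSMul.toAddMonoidHom_apply, Units.smul_def, smul_comm (_ : R) (_ : ℤ),
        smul_smul (_ : R) (_ : R)] at hc ⊢
      rw [hc]
      simp only [smul_assoc]
      simp only [← Units.smul_def, negOnePow_smul_smul]
      exact negOnePow_smul_congr (by push_cast; grind) rfl⟩

theorem circ_smulC_left [IsGradedComm 𝓡] {i p q : ℤ} (r : 𝓡 i) (φ : A.cochains p)
    (ψ : A.cochains q) : circ (smulC r φ) ψ = cochainAct r (circ φ ψ) := by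
  funext X Y t
  have e : ∀ f : A.Hom X Y, (r : R) • f = homAct X Y r f := fun _ => rfl
  simp only [cochainAct_apply, circ, smulC]
  simp only [e, Word.map_sum₂, smul_sum₂, map_negOnePow_smul, negOnePow_smul_smul]
  refine sum₂_congr fun _ _ _ _ => sum₂_congr fun _ _ _ _ => ?_
  exact negOnePow_smul_congr (by push_cast; ring) rfl

theorem circ_smulC_right [IsGradedComm 𝓡] {i p q : ℤ} (r : 𝓡 i) (φ : A.cochains p)
    (ψ : A.cochains q) :
    circ ψ (smulC r φ) = (i * q).negOnePow • cochainAct r (circ ψ φ) := by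
  funext X Y t
  have e : ∀ f : A.Hom X Y, (r : R) • f = homAct X Y r f := fun _ => rfl
  simp only [Pi.smul_apply, cochainAct_apply, circ]
  simp only [e, Word.map_sum₂, smul_sum₂, map_negOnePow_smul, negOnePow_smul_smul]
  refine sum₂_congr fun Z a t' _ => sum₂_congr fun Z' b c _ => ?_
  have h := (isLin_cochain ψ a c).map_units_smul (x := value (smulC r φ) b)
    (x₁ := smulArr r (value φ b).2) (by simp only [value, smulArr]; ring) i.negOnePow rfl
  have h' := (isLin_cochain ψ a c).smul r (x := smulArr r (value φ b).2) (y := value φ b) rfl rfl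
  rw [h, h', negOnePow_smul_smul, negOnePow_smul_smul]
  exact negOnePow_smul_congr (by push_cast; grind) rfl

theorem bracket_smulC_left [IsGradedComm 𝓡] {i p q : ℤ} (r : 𝓡 i) (φ : A.cochains p)
    (ψ : A.cochains q) : bracket (smulC r φ) ψ = cochainAct r (bracket φ ψ) := by
  rw [bracket, bracket, circ_smulC_left, circ_smulC_right, map_sub, map_negOnePow_smul,
    negOnePow_smul_smul]
  congr 1
  exact negOnePow_smul_congr (by push_cast; grind) rfl

theorem bracket_smulC_right [IsGradedComm 𝓡] {i p q : ℤ} (r : 𝓡 i) (φ : A.cochains p)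
    (ψ : A.cochains q) :
    bracket ψ (smulC r φ) = (i * q).negOnePow • cochainAct r (bracket ψ φ) := by
  rw [bracket, bracket, circ_smulC_left, circ_smulC_right, map_sub, map_negOnePow_smul,
    smul_sub, negOnePow_smul_smul]
  congr 1
  exact negOnePow_smul_congr (by push_cast; grind) rfl

/-! ### Strict units -/

theorem IsStrictlyUnitalCurved.eq_zero {m : A.cochains 1} (hm : IsStrictlyUnitalCurved m)
    {X Y Z : A.Ob} (s : A.Path X Y) (t : A.Path Y Z)
    (h : s.length + t.length ≠ 1) : m.1 X Z (ins s (A.unit Y) t) = 0 :=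
  hm.unit_other X Y Z s t (by omega)

theorem length_ins {X Y Z T : A.Ob} (s : A.Path X Y) (x : A.Arr Y Z) (t : A.Path Z T) :
    (ins s x t).length = s.length + 1 + t.length := by
  rw [ins, length_append, Word.length]; omega

theorem eq_nil_of_length {X Y : A.Ob} {s : A.Path X Y} (h : s.length = 0) :
    X = Y ∧ HEq s (.nil X : A.Path X X) := by
  cases s with
  | nil => exact ⟨rfl, HEq.rfl⟩
  | cons x t => exact absurd h (Nat.succ_ne_zero _)

theorem eq_singleton_of_length {X Y : A.Ob} {s : A.Path X Y} (h : s.length = 1) :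
    ∃ x : A.Arr X Y, s = .cons x (.nil Y) := by
  cases s with
  | nil => exact absurd h (by simp [Word.length])
  | cons x t =>
    cases t with
    | nil => exact ⟨x, rfl⟩
    | cons y t => exact absurd h (by simp [Word.length])

/-- The sum of all terms in which `m` is applied to a piece of a word that contains a given unit:
the two terms in which this unit is multiplied with one of its neighbours cancel, as far as
both neighbours exist. -/
theorem IsStrictlyUnitalCurved.sum_unit {m : A.cochains 1} (hm : IsStrictlyUnitalCurved m)
    {G : Type*} [AddCommGroup G] {act : ∀ {i : ℤ}, 𝓡 i → G →+ G}
    {X Y Z : A.Ob} (s : A.Path X Y) (t : A.Path Y Z)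
    (F : ∀ {T U : A.Ob}, A.Path X T → A.Arr T U → A.Path U Z → G) (k : ℤ) (H : G)
    (hF : ∀ {T U : A.Ob} (a : A.Path X T) (c : A.Path U Z), ∃ n : ℤ, IsLin act n (fun x => F a x c))
    (hs : ∀ {T : A.Ob} (a : A.Path X T) (y : A.Arr T Y), a.append (.cons y (.nil Y)) = s →
      F a y t = H)
    (ht : ∀ {T : A.Ob} (y : A.Arr Y T) (c : A.Path T Z), .cons y c = t → F s y c = H) :
    s.sum₂ (fun a v => t.sum₂ fun t₁ t₂ =>
      (k + pdeg a).negOnePow • F a (value m (ins v (A.unit Y) t₁)) t₂) =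
    (k + pdeg s).negOnePow • ((if t.length = 0 then 0 else H) - (if s.length = 0 then 0 else H)) := by
  let C := (k + pdeg s).negOnePow • H
  have key : s.sum₂ (fun a v => t.sum₂ fun t₁ t₂ =>
      (k + pdeg a).negOnePow • F a (value m (ins v (A.unit Y) t₁)) t₂) =
      s.sum₂ (fun a v => t.sum₂ fun t₁ t₂ =>
        (if v.length = 1 then if t₁.length = 0 then -C else 0 else 0) +
        (if v.length = 0 then if t₁.length = 1 then C else 0 else 0)) := by
    refine sum₂_congr fun T a v hav => sum₂_congr fun U t₁ t₂ ht' => ?_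
    obtain ⟨n, hn⟩ := hF a t₂
    by_cases h : v.length + t₁.length = 1
    · rcases Nat.eq_zero_or_pos v.length with h0 | h0
      · have h1 : t₁.length = 1 := by omega
        obtain ⟨rfl, rfl⟩ := eq_nil_of_length h0
        obtain ⟨y, rfl⟩ := eq_singleton_of_length h1
        obtain rfl : a = s := (Word.append_nil a).symm.trans hav
        rw [if_neg (by omega), if_pos h0, if_pos h1, zero_add]
        rw [hn.map_units_smul (x := value m _) (x₁ := y) (by
          change y.1 = 1 + (0 - 1 + (y.1 - 1 + 0)) + 1; ring) 1
          (by rw [one_smul]; exact hm.unit_left _ _ y), one_smul, ht y t₂ ht']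
      · have h1 : t₁.length = 0 := by omega
        obtain ⟨rfl, rfl⟩ := eq_nil_of_length h1
        obtain ⟨y, rfl⟩ := eq_singleton_of_length (s := v) (by omega)
        obtain rfl : t₂ = t := ht'
        rw [if_pos (by rfl), if_pos h1, if_neg (by omega), add_zero]
        rw [hn.map_units_smul (x := value m _) (x₁ := y) (by
          change y.1 = 1 + (y.1 - 1 + (0 - 1 + 0)) + 1; ring) y.1.negOnePow
          (by
            have := congrArg (fun z => y.1.negOnePow • z) (hm.unit_right _ _ y)
            rw [negOnePow_smul_self] at this
            exact this), hs a y hav, negOnePow_smul_smul]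
        rw [← Units.neg_smul, ← Int.negOnePow_succ]
        refine negOnePow_smul_congr ?_ rfl
        rw [← hav, pdeg_append, pdeg_cons, pdeg_nil, sdeg₁]
        push_cast; grind
    · rw [hn.map_zero (hm.eq_zero v t₁ h), smul_zero]
      split_ifs <;> first | omega | simp
  rw [key]
  simp only [sum₂_add]
  have h1 : ∀ {T : A.Ob} (v : A.Path T Y), (t.sum₂ fun t₁ _ =>
      if v.length = 1 then if t₁.length = 0 then -C else 0 else 0) =
      if v.length = 1 then -C else 0 := by
    intro T v
    split_ifs
    · exact sum₂_left_length_zero t _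
    · exact sum₂_zero t
  have h2 : ∀ {T : A.Ob} (v : A.Path T Y), (t.sum₂ fun t₁ _ =>
      if v.length = 0 then if t₁.length = 1 then C else 0 else 0) =
      if v.length = 0 then if t.length = 0 then 0 else C else 0 := by
    intro T v
    split_ifs with h h'
    · rw [sum₂_left_length_one, if_pos h']
    · rw [sum₂_left_length_one, if_neg h']
    · exact sum₂_zero t
  simp only [h1, h2]
  rw [sum₂_right_length_one, sum₂_right_length_zero]
  split_ifs <;> simp [C]

theorem isReduced_circ {p q : ℤ} {φ : A.cochains p} {ψ : A.cochains q}
    (hφ : φ.1 ∈ A.reducedFun) (hψ : ψ.1 ∈ A.reducedFun) : circ φ ψ ∈ A.reducedFun := by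
  intro X Y Z s t
  simp only [circ, sum₂_ins, sum₂_add]
  have h1 : ∀ {T U : A.Ob} (a : A.Path X T) (b : A.Path T U) (c : A.Path U Y),
      φ.1 X Z (ins a (value ψ b) (ins c (A.unit Y) t)) = 0 := fun a b c => by
    rw [← ins_ins]; exact hφ _ _ _ _ _
  have h2 : ∀ {T U : A.Ob} (a : A.Path X T) (v : A.Path T Y) (b : A.Path Y U) (c : A.Path U Z),
      φ.1 X Z (ins a (value ψ (ins v (A.unit Y) b)) c) = 0 := fun a v b c =>
    (isLin_cochain φ a c).map_zero (hψ _ _ _ _ _)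
  have h3 : ∀ {T U : A.Ob} (a : A.Path Y T) (b : A.Path T U) (c : A.Path U Z),
      φ.1 X Z (ins (ins s (A.unit Y) a) (value ψ b) c) = 0 := fun a b c => by
    rw [ins_ins]; exact hφ _ _ _ _ _
  simp only [h1, h2, h3, smul_zero, sum₂_zero, add_zero]

/-- The bracket of reduced cochains is reduced. -/
theorem isReduced_bracket {p q : ℤ} {φ : A.cochains p} {ψ : A.cochains q}
    (hφ : φ.1 ∈ A.reducedFun) (hψ : ψ.1 ∈ A.reducedFun) : bracket φ ψ ∈ A.reducedFun :=
  sub_mem (isReduced_circ hφ hψ) (units_smul_mem _ (isReduced_circ hψ hφ))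

/-- In `m ∘ φ` with `φ` reduced, a unit contributes only when `m_2` multiplies it with `φ` of the
whole remaining word, which forces the unit to stand at one of the ends. -/
theorem IsStrictlyUnitalCurved.circ_left_unit {m : A.cochains 1} (hm : IsStrictlyUnitalCurved m)
    {p : ℤ} {φ : A.cochains p} (hφ : φ.1 ∈ A.reducedFun) {X Y Z : A.Ob} (s : A.Path X Y)
    (t : A.Path Y Z) : circ m φ X Z (ins s (A.unit Y) t) =
      (p + pdeg s).negOnePow •
        ((if s.length = 0 then φ.1 X Z (s.append t) else 0) -
          (if t.length = 0 then φ.1 X Z (s.append t) else 0)) := by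
  simp only [circ, sum₂_ins, sum₂_add]
  have h1 : s.sum₂ (fun a b => b.sum₂ fun a_1 b =>
      (p * pdeg a).negOnePow • m.1 X Z (ins a (value φ a_1) (ins b (A.unit Y) t))) =
      if t.length = 0 then (p + pdeg s + 1).negOnePow • φ.1 X Z (s.append t) else 0 := by
    by_cases ht : t.length = 0
    · obtain ⟨rfl, rfl⟩ := eq_nil_of_length ht
      rw [if_pos ht, Word.append_nil, ← sum₂_left_length_zero s (_ • φ.1 X Y s)]
      refine sum₂_congr fun T a b hab => ?_
      split_ifs with ha
      · obtain ⟨rfl, rfl⟩ := eq_nil_of_length ha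
        obtain rfl : b = s := hab
        rw [← sum₂_right_length_zero b (_ • φ.1 X Y b)]
        refine sum₂_congr fun U b' c hbc => ?_
        split_ifs with hc
        · obtain ⟨rfl, rfl⟩ := eq_nil_of_length hc
          obtain rfl : b' = b := (Word.append_nil _).symm.trans hbc
          rw [pdeg_nil, mul_zero, Int.negOnePow_zero, one_smul]
          exact (negOnePow_smul_self (p + pdeg b' + 1) (m.1 _ _ (.cons (value φ b')
            (.cons (A.unit U) (.nil U))))).symm.trans (congrArg
              (fun z => (p + pdeg b' + 1).negOnePow • z) (hm.unit_right _ _ (value φ b')))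
        · rw [← ins_ins, hm.eq_zero _ _ (by rw [length_ins]; omega), smul_zero]
      · refine sum₂_eq_zero fun U b' c hbc => ?_
        rw [← ins_ins, hm.eq_zero _ _ (by rw [length_ins]; omega), smul_zero]
    · rw [if_neg ht]
      refine sum₂_eq_zero fun T a b hab => sum₂_eq_zero fun U b' c hbc => ?_
      rw [← ins_ins, hm.eq_zero _ _ (by rw [length_ins]; omega), smul_zero]
  have h3 : t.sum₂ (fun a b => b.sum₂ fun a_1 b =>
      (p * pdeg (ins s (A.unit Y) a)).negOnePow •
        m.1 X Z (ins (ins s (A.unit Y) a) (value φ a_1) b)) =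
      if s.length = 0 then p.negOnePow • φ.1 X Z (s.append t) else 0 := by
    by_cases hs : s.length = 0
    · obtain ⟨rfl, rfl⟩ := eq_nil_of_length hs
      rw [if_pos hs, Word.append, ← sum₂_left_length_zero t (_ • φ.1 X Z t)]
      refine sum₂_congr fun T a b hab => ?_
      split_ifs with ha
      · obtain ⟨rfl, rfl⟩ := eq_nil_of_length ha
        obtain rfl : b = t := hab
        rw [← sum₂_right_length_zero b (_ • φ.1 X Z b)]
        refine sum₂_congr fun U b' c hbc => ?_
        split_ifs with hc
        · obtain ⟨rfl, rfl⟩ := eq_nil_of_length hc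
          obtain rfl : b' = b := (Word.append_nil _).symm.trans hbc
          refine negOnePow_smul_congr ?_ (hm.unit_left _ _ (value φ b'))
          simp only [pdeg_ins, pdeg_nil, sdeg₁_unit]; push_cast; grind
        · rw [ins_ins, hm.eq_zero _ _ (by rw [length_ins]; omega), smul_zero]
      · refine sum₂_eq_zero fun U b' c hbc => ?_
        rw [ins_ins, hm.eq_zero _ _ (by rw [length_ins]; omega), smul_zero]
    · rw [if_neg hs]
      refine sum₂_eq_zero fun T a b hab => sum₂_eq_zero fun U b' c hbc => ?_
      rw [ins_ins, hm.eq_zero _ _ (by rw [length_ins]; omega), smul_zero]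
  have h2 : ∀ {T U : A.Ob} (a : A.Path X T) (v : A.Path T Y) (b : A.Path Y U) (c : A.Path U Z),
      m.1 X Z (ins a (value φ (ins v (A.unit Y) b)) c) = 0 := fun a v b c =>
    (isLin_cochain m a c).map_zero (hφ _ _ _ _ _)
  rw [h1, h3]
  simp only [h2, smul_zero, sum₂_zero, add_zero]
  rw [Int.negOnePow_succ, Units.neg_smul]
  by_cases hs : s.length = 0
  · obtain ⟨rfl, rfl⟩ := eq_nil_of_length hs
    rw [pdeg_nil, add_zero]
    split_ifs <;> simp
  · split_ifs <;> simp

/-- In `φ ∘ m` with `φ` reduced, a unit contributes only through `m_2` with one of its neighbours;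
these two terms cancel unless the unit stands at one of the ends. -/
theorem IsStrictlyUnitalCurved.circ_right_unit {m : A.cochains 1} (hm : IsStrictlyUnitalCurved m)
    {p : ℤ} {φ : A.cochains p} (hφ : φ.1 ∈ A.reducedFun) {X Y Z : A.Ob} (s : A.Path X Y)
    (t : A.Path Y Z) : circ φ m X Z (ins s (A.unit Y) t) =
      (pdeg s).negOnePow • ((if t.length = 0 then 0 else φ.1 X Z (s.append t)) -
          (if s.length = 0 then 0 else φ.1 X Z (s.append t))) := by
  simp only [circ, sum₂_ins, sum₂_add]
  have h1 : ∀ {T U : A.Ob} (a : A.Path X T) (b : A.Path T U) (c : A.Path U Y),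
      φ.1 X Z (ins a (value m b) (ins c (A.unit Y) t)) = 0 := fun a b c => by
    rw [← ins_ins]; exact hφ _ _ _ _ _
  have h3 : ∀ {T U : A.Ob} (a : A.Path Y T) (b : A.Path T U) (c : A.Path U Z),
      φ.1 X Z (ins (ins s (A.unit Y) a) (value m b) c) = 0 := fun a b c => by
    rw [ins_ins]; exact hφ _ _ _ _ _
  simp only [h1, h3, smul_zero, sum₂_zero, add_zero, zero_add, one_mul]
  have := hm.sum_unit (act := fun {i} => homAct X Z) s t (fun a x c => φ.1 X Z (ins a x c)) 0
    (φ.1 X Z (s.append t)) (fun a c => ⟨_, isLin_cochain φ a c⟩)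
    (fun a y h => by rw [← h, Word.append_assoc]; rfl) (fun y c h => by rw [← h]; rfl)
  simpa only [zero_add] using this

/-- `δ` preserves reduced cochains, although `m` is not reduced: the boundary terms of `m ∘ φ` and
`φ ∘ m` cancel. -/
theorem IsStrictlyUnitalCurved.isReduced_bracket {m : A.cochains 1}
    (hm : IsStrictlyUnitalCurved m) {p : ℤ} {φ : A.cochains p} (hφ : φ.1 ∈ A.reducedFun) :
    bracket m φ ∈ A.reducedFun := by
  intro X Y Z s t
  change circ m φ X Z _ - (1 * p).negOnePow • circ φ m X Z _ = 0
  rw [hm.circ_left_unit hφ, hm.circ_right_unit hφ, one_mul, negOnePow_smul_smul, ← smul_sub]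
  split_ifs <;> simp

end UnitalGradedQuiver

namespace UnitalGradedQuiver

open Word

variable {R : Type u} [Ring R] {𝓡 : ℤ → AddSubgroup R} [GradedRing 𝓡]
  {A : UnitalGradedQuiver.{u, v, w} 𝓡}

/-! ### The differential graded Lie algebra of reduced cochains -/

/-- The only use of `ℚ ⊆ R`: there is no `2`-torsion. -/
theorem hom_eq_zero_of_add_self [Algebra ℚ R] {X Y : A.Ob} {x : A.Hom X Y} (h : x + x = 0) :
    x = 0 := by
  have h2 : ((2 : R)) • x = 0 := by rw [two_smul, h]
  have hi : algebraMap ℚ R (1 / 2) * 2 = 1 := by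
    rw [← map_ofNat (algebraMap ℚ R) 2, ← map_mul]; norm_num
  calc x = (algebraMap ℚ R (1 / 2) * 2 : R) • x := by rw [hi, one_smul]
    _ = 0 := by rw [mul_smul, h2, smul_zero]

theorem cochain_eq_zero_of_add_self [Algebra ℚ R] {φ : A.CochainFun} (h : φ + φ = 0) : φ = 0 := by
  funext X Y t
  exact hom_eq_zero_of_add_self (congrFun (congrFun (congrFun h X) Y) t)

/-- `[m, m] = 2 m ∘ m`, since `m` has odd degree. -/
theorem IsStrictlyUnitalCurved.circ_self [Algebra ℚ R] {m : A.cochains 1}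
    (hm : IsStrictlyUnitalCurved m) : circ m m = 0 := by
  refine cochain_eq_zero_of_add_self ?_
  have h := hm.bracket_self
  rwa [bracket, show ((1 : ℤ) * 1).negOnePow = -1 from Int.negOnePow_one, Units.neg_smul, one_smul,
    sub_neg_eq_add] at h

theorem bracket_zero_left {p q : ℤ} {φ : A.cochains p} (hφ : φ.1 = 0) (ψ : A.cochains q) :
    bracket φ ψ = 0 := by
  simpa using bracket_left_lin φ φ φ ψ 0 0 (by simpa using hφ)

theorem IsStrictlyUnitalCurved.bracket_bracket [Algebra ℚ R] {m : A.cochains 1}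
    (hm : IsStrictlyUnitalCurved m) {p : ℤ} (φ : A.cochains p) :
    bracket m (bracketC m φ) = 0 := by
  refine cochain_eq_zero_of_add_self ?_
  have h := bracket_jacobi m m φ
  rw [bracket_zero_left (φ := bracketC m m) hm.bracket_self, zero_add,
    show ((1 : ℤ) * 1).negOnePow = -1 from Int.negOnePow_one, Units.neg_smul, one_smul] at h
  nth_rewrite 2 [h]
  exact add_neg_cancel _

theorem bracket_right_lin {p q : ℤ} (ψ : A.cochains q) (φ φ₁ φ₂ : A.cochains p) (k₁ k₂ : ℤ)
    (h : φ.1 = k₁ • φ₁.1 + k₂ • φ₂.1) :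
    bracket ψ φ = k₁ • bracket ψ φ₁ + k₂ • bracket ψ φ₂ := by
  rw [bracket_antisymm, bracket_left_lin φ φ₁ φ₂ ψ k₁ k₂ h, bracket_antisymm ψ φ₁,
    bracket_antisymm ψ φ₂]
  simp only [smul_add, smul_neg, smul_units_smul]
  abel

variable [IsGradedComm 𝓡]

/-- `δφ = [m, φ]` on reduced cochains. -/
def redDiff {m : A.cochains 1} (hm : IsStrictlyUnitalCurved m) (p : ℤ) (φ : A.redCochains.deg p) :
    A.redCochains.deg (p + 1) :=
  ⟨bracket m (incl φ), by rw [add_comm p 1]; exact bracket_mem m (incl φ),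
    hm.isReduced_bracket φ.2.2⟩

/-- The bracket of reduced cochains. -/
def redBr (p q : ℤ) (φ : A.redCochains.deg p) (ψ : A.redCochains.deg q) :
    A.redCochains.deg (p + q) :=
  ⟨bracket (incl φ) (incl ψ), bracket_mem _ _, isReduced_bracket φ.2.2 ψ.2.2⟩

theorem coe_add_eq {p : ℤ} (φ ψ : A.redCochains.deg p) :
    (incl (φ + ψ)).1 = (1 : ℤ) • (incl φ).1 + (1 : ℤ) • (incl ψ).1 := by
  rw [one_smul, one_smul]; rfl

/-- The DGLA of reduced Hochschild cochains of a strictly unital curved `A_∞` structure. -/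
def redDGLA [Algebra ℚ R] {m : A.cochains 1} (hm : IsStrictlyUnitalCurved m) :
    DGLA A.redCochains where
  diff p := AddMonoidHom.mk' (redDiff hm p) fun φ ψ => Subtype.ext (by
    change bracket m (incl (φ + ψ)) = bracket m (incl φ) + bracket m (incl ψ)
    rw [bracket_right_lin m (incl (φ + ψ)) (incl φ) (incl ψ) 1 1 (coe_add_eq φ ψ), one_smul,
      one_smul])
  br p q := AddMonoidHom.mk' (fun φ => AddMonoidHom.mk' (redBr p q φ) fun ψ ψ' => Subtype.ext (by
      change bracket (incl φ) (incl (ψ + ψ')) = bracket (incl φ) (incl ψ) +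
        bracket (incl φ) (incl ψ')
      rw [bracket_right_lin (incl φ) (incl (ψ + ψ')) (incl ψ) (incl ψ') 1 1 (coe_add_eq ψ ψ'),
        one_smul, one_smul]))
    fun φ φ' => AddMonoidHom.ext fun ψ => Subtype.ext (by
      change bracket (incl (φ + φ')) (incl ψ) = bracket (incl φ) (incl ψ) +
        bracket (incl φ') (incl ψ)
      rw [bracket_left_lin (incl (φ + φ')) (incl φ) (incl φ') (incl ψ) 1 1 (coe_add_eq φ φ'),
        one_smul, one_smul])
  diff_smul {i p} r x := by
    have h := bracket_smulC_right (𝓡 := 𝓡) (i := i) r (incl x) m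
    rw [mul_one] at h
    exact h
  br_smul {i p q} r x y := bracket_smulC_left (𝓡 := 𝓡) (i := i) r (incl x) (incl y)
  antisymm x y := bracket_antisymm (incl x) (incl y)
  jacobi x y t := bracket_jacobi (incl x) (incl y) (incl t)
  diff_diff {p} x := (bracket_congr (φ := m) (ψ := incl (redDiff hm p x)) (φ' := m)
    (ψ' := bracketC m (incl x)) rfl rfl (add_comm _ _) rfl).trans (hm.bracket_bracket (incl x))
  leibniz {p q} x y := by
    change bracket m (bracketC (incl x) (incl y)) =
      bracket (incl (redDiff hm p x)) (incl y) +
        p.negOnePow • bracket (incl x) (incl (redDiff hm q y))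
    rw [bracket_jacobi, one_mul]
    exact congrArg₂ (· + ·) (bracket_congr (add_comm _ _) rfl rfl rfl)
      (congrArg _ (bracket_congr rfl rfl (add_comm _ _) rfl))

end UnitalGradedQuiver

namespace UnitalGradedQuiver

open Word

variable {R : Type u} [Ring R] {𝓡 : ℤ → AddSubgroup R} [GradedRing 𝓡]
  {A : UnitalGradedQuiver.{u, v, w} 𝓡}

/-! ### Operators on the reduced chains -/

/-- The class of `x₀ ⊗ x₁ ⊗ ⋯ ⊗ x_k`, where `t = (x₁, …, x_k)`. -/
def cw {X Y : A.Ob} (x₀ : A.Arr X Y) (t : A.Path Y X) : A.ChainGroup := A.chainMk (.of ⟨x₀, t⟩)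

/-- The defining relation of the reduced chains. -/
theorem cw_unit {X Y Z : A.Ob} (x₀ : A.Arr X Y) (s : A.Path Y Z) (t : A.Path Z X) :
    cw x₀ (ins s (A.unit Z) t) = 0 := A.chainMk_rel (.unit x₀ s t)

theorem cw_mem {X Y : A.Ob} (x₀ : A.Arr X Y) (t : A.Path Y X) {d : ℤ}
    (hd : sdeg₁ x₀ + pdeg t = d) : cw x₀ t ∈ A.chainDeg d :=
  AddSubgroup.mem_map_of_mem _ (AddSubgroup.subset_closure ⟨⟨x₀, t⟩, hd, rfl⟩)

theorem mem_chainDeg_induction {d : ℤ} {P : A.ChainGroup → Prop} (h0 : P 0)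
    (hadd : ∀ x y, P x → P y → P (x + y)) (hneg : ∀ x, P x → P (-x))
    (hcw : ∀ {X Y : A.Ob} (x₀ : A.Arr X Y) (t : A.Path Y X), sdeg₁ x₀ + pdeg t = d → P (cw x₀ t))
    {x : A.ChainGroup} (hx : x ∈ A.chainDeg d) : P x := by
  obtain ⟨c, hc, rfl⟩ := hx
  induction hc using AddSubgroup.closure_induction with
  | mem c hc =>
    obtain ⟨g, hg, rfl⟩ := hc
    exact hcw g.head g.tail hg
  | zero => rwa [map_zero]
  | add c c' _ _ h h' => rw [map_add]; exact hadd _ _ h h'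
  | neg c _ h => rw [map_neg]; exact hneg _ h

/-- `ℒ_φ(x₀ ⊗ t)`. -/
def lieCh {p : ℤ} (φ : A.cochains p) {X Y : A.Ob} (x₀ : A.Arr X Y) (t : A.Path Y X) :
    A.ChainGroup :=
  (t.sum₂ fun a t₁ => t₁.sum₂ fun b c =>
    (p * (sdeg₁ x₀ + pdeg a)).negOnePow • cw x₀ (ins a (value φ b) c)) +
  (t.sum₂ fun a t₁ => t₁.sum₂ fun b c =>
    ((sdeg₁ x₀ + pdeg a + pdeg b) * pdeg c).negOnePow • cw (value φ (ins c x₀ a)) b)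

/-- `ρ_{φ,ψ}(x₀ ⊗ t)`. -/
def rhoCh {p q : ℤ} (φ : A.cochains p) (ψ : A.cochains q) {X Y : A.Ob} (x₀ : A.Arr X Y)
    (t : A.Path Y X) : A.ChainGroup :=
  t.sum₂ fun a t₁ => t₁.sum₂ fun b t₂ => t₂.sum₂ fun c t₃ => t₃.sum₂ fun e f =>
    (q * pdeg c + (sdeg₁ x₀ + pdeg a + pdeg b) * (pdeg c + pdeg e + pdeg f)).negOnePow •
      cw (value φ (ins c (value ψ e) (ins f x₀ a))) b

/-- `B(x₀ ⊗ t)`. -/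
def connesCh {X Y : A.Ob} (x₀ : A.Arr X Y) (t : A.Path Y X) : A.ChainGroup :=
  t.sum₂ fun {Z} a c =>
    ((sdeg₁ x₀ + pdeg a) * pdeg c).negOnePow • cw (A.unit Z) (ins c x₀ a)

/-- `B¹_φ(x₀ ⊗ t)`. -/
def connesOneCh {p : ℤ} (φ : A.cochains p) {X Y : A.Ob} (x₀ : A.Arr X Y) (t : A.Path Y X) :
    A.ChainGroup :=
  t.sum₂ fun {Z} a t₁ => t₁.sum₂ fun b t₂ => t₂.sum₂ fun e c =>
    ((sdeg₁ x₀ + pdeg a) * (pdeg b + pdeg e + pdeg c) + p * pdeg b).negOnePow •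
      cw (A.unit Z) (ins b (value φ e) (ins c x₀ a))

theorem isInducedBy_lie {p : ℤ} {φ : A.cochains p} {f : A.ChainGroup →+ A.ChainGroup} :
    IsInducedBy f (lieFormula φ) ↔
      ∀ {X Y : A.Ob} (x₀ : A.Arr X Y) (t : A.Path Y X), f (cw x₀ t) = lieCh φ x₀ t := by
  have h : ∀ g : A.CyclicWord, A.chainMk (lieFormula φ g) = lieCh φ g.head g.tail := fun g => by
    simp only [lieFormula, lieCh, map_add, Word.map_sum₂, map_negOnePow_smul]; rfl
  exact ⟨fun H X Y x₀ t => (H ⟨x₀, t⟩).trans (h _), fun H g => (H g.head g.tail).trans (h g).symm⟩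

theorem isInducedBy_rho {p q : ℤ} {φ : A.cochains p} {ψ : A.cochains q}
    {f : A.ChainGroup →+ A.ChainGroup} : IsInducedBy f (rhoFormula φ ψ) ↔
      ∀ {X Y : A.Ob} (x₀ : A.Arr X Y) (t : A.Path Y X), f (cw x₀ t) = rhoCh φ ψ x₀ t := by
  have h : ∀ g : A.CyclicWord, A.chainMk (rhoFormula φ ψ g) = rhoCh φ ψ g.head g.tail :=
    fun g => by
      simp only [rhoFormula, rhoCh, Word.map_sum₂, map_negOnePow_smul]; rfl
  exact ⟨fun H X Y x₀ t => (H ⟨x₀, t⟩).trans (h _), fun H g => (H g.head g.tail).trans (h g).symm⟩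

theorem isInducedBy_connes {f : A.ChainGroup →+ A.ChainGroup} : IsInducedBy f connesFormula ↔
      ∀ {X Y : A.Ob} (x₀ : A.Arr X Y) (t : A.Path Y X), f (cw x₀ t) = connesCh x₀ t := by
  have h : ∀ g : A.CyclicWord, A.chainMk (connesFormula g) = connesCh g.head g.tail :=
    fun g => by
      simp only [connesFormula, connesCh, Word.map_sum₂, map_negOnePow_smul]; rfl
  exact ⟨fun H X Y x₀ t => (H ⟨x₀, t⟩).trans (h _), fun H g => (H g.head g.tail).trans (h g).symm⟩

theorem isInducedBy_connesOne {p : ℤ} {φ : A.cochains p} {f : A.ChainGroup →+ A.ChainGroup} :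
    IsInducedBy f (connesOneFormula φ) ↔
      ∀ {X Y : A.Ob} (x₀ : A.Arr X Y) (t : A.Path Y X), f (cw x₀ t) = connesOneCh φ x₀ t := by
  have h : ∀ g : A.CyclicWord, A.chainMk (connesOneFormula φ g) = connesOneCh φ g.head g.tail :=
    fun g => by
      simp only [connesOneFormula, connesOneCh, Word.map_sum₂, map_negOnePow_smul]; rfl
  exact ⟨fun H X Y x₀ t => (H ⟨x₀, t⟩).trans (h _), fun H g => (H g.head g.tail).trans (h g).symm⟩

theorem IsLin.sign' {G : Type*} [AddCommGroup G] {act : ∀ {i : ℤ}, 𝓡 i → G →+ G}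
    {X Y : A.Ob} {n : ℤ} {Φ : A.Arr X Y → G} (h : IsLin act n Φ) (β : ℤ) {k : A.Arr X Y → ℤ}
    (hk : ∀ x y : A.Arr X Y, ((k x - k y : ℤ) : ZMod 2) = (β * (x.1 - y.1) : ℤ)) :
    IsLin act (n + β) (fun x => (k x).negOnePow • Φ x) := by
  by_cases hn : Nonempty (A.Arr X Y)
  · obtain ⟨y⟩ := hn
    refine h.sign k (k y - β * y.1) β fun x => ?_
    have := hk x y
    push_cast at this ⊢
    linear_combination this
  · exact ⟨fun {x _ _} => (hn ⟨x⟩).elim, fun {_} _ {x _} => (hn ⟨x⟩).elim⟩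

theorem lieCh_mem {p : ℤ} (φ : A.cochains p) {X Y : A.Ob} (x₀ : A.Arr X Y) (t : A.Path Y X) :
    lieCh φ x₀ t ∈ A.chainDeg (p + (sdeg₁ x₀ + pdeg t)) := by
  refine add_mem (sum₂_mem fun _ a v h₁ => sum₂_mem fun _ b c h₂ =>
    units_smul_mem _ (cw_mem _ _ ?_))
    (sum₂_mem fun _ a v h₁ => sum₂_mem fun _ b c h₂ => units_smul_mem _ (cw_mem _ _ ?_)) <;>
  · simp only [← h₁, ← h₂, pdeg_append, pdeg_ins, sdeg₁_value]; ring

theorem rhoCh_mem {p q : ℤ} (φ : A.cochains p) (ψ : A.cochains q) {X Y : A.Ob} (x₀ : A.Arr X Y)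
    (t : A.Path Y X) : rhoCh φ ψ x₀ t ∈ A.chainDeg (p + q + (sdeg₁ x₀ + pdeg t)) := by
  refine sum₂_mem fun _ a v h₁ => sum₂_mem fun _ b v' h₂ => sum₂_mem fun _ c v'' h₃ =>
    sum₂_mem fun _ e f h₄ => units_smul_mem _ (cw_mem _ _ ?_)
  simp only [← h₁, ← h₂, ← h₃, ← h₄, pdeg_append, pdeg_ins, sdeg₁_value]; ring

theorem connesCh_mem {X Y : A.Ob} (x₀ : A.Arr X Y) (t : A.Path Y X) :
    connesCh x₀ t ∈ A.chainDeg (-1 + (sdeg₁ x₀ + pdeg t)) := by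
  refine sum₂_mem fun _ a c h₁ => units_smul_mem _ (cw_mem _ _ ?_)
  simp only [← h₁, pdeg_append, pdeg_ins, sdeg₁_unit]; ring

theorem connesOneCh_mem {p : ℤ} (φ : A.cochains p) {X Y : A.Ob} (x₀ : A.Arr X Y)
    (t : A.Path Y X) : connesOneCh φ x₀ t ∈ A.chainDeg (p - 1 + (sdeg₁ x₀ + pdeg t)) := by
  refine sum₂_mem fun _ a v h₁ => sum₂_mem fun _ b v' h₂ => sum₂_mem fun _ e c h₃ =>
    units_smul_mem _ (cw_mem _ _ ?_)
  simp only [← h₁, ← h₂, ← h₃, pdeg_append, pdeg_ins, sdeg₁_value, sdeg₁_unit]; ring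

theorem cw_ins_unit {X Y Z T U : A.Ob} (x₀ : A.Arr X Y) (s : A.Path Y Z) (y : A.Arr Z T)
    (t : A.Path T U) (r : A.Path U X) : cw x₀ (ins s y (ins t (A.unit U) r)) = 0 := by
  rw [← ins_ins]
  exact cw_unit x₀ (ins s y t) r

theorem value_value_eq_zero {p q : ℤ} (φ : A.cochains p) (ψ : A.cochains q) {X Y Z T : A.Ob}
    (s : A.Path X Y) (b : A.Path Y Z) (t : A.Path Z T) (h : ψ.1 Y Z b = 0) :
    φ.1 X T (ins s (value ψ b) t) = 0 := (isLin_cochain φ s t).map_zero h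

variable [IsGradedComm 𝓡]

theorem isLin_cw_head {X Y : A.Ob} (t : A.Path Y X) :
    IsLin (fun {_} r => chainAct (A := A) r) 1 (fun x => cw x t) where
  add {x x₁ x₂} h₁ h₂ hx := by
    obtain ⟨d, x⟩ := x
    obtain ⟨_, x₁⟩ := x₁
    obtain ⟨_, x₂⟩ := x₂
    obtain rfl : _ = d := h₁
    obtain rfl : _ = _ := h₂
    obtain rfl : x = x₁ + x₂ := Subtype.ext hx
    exact map_add (headHom _ t) x₁ x₂
  smul {i} r {x y} hx hx' := by
    obtain ⟨d, x⟩ := x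
    obtain ⟨e, y⟩ := y
    obtain rfl : d = i + e := hx
    obtain rfl : x = smulGr r y := Subtype.ext hx'
    change A.chainMk _ = _ • chainAct r (A.chainMk _)
    rw [chainAct_of, mul_one, negOnePow_smul_self]
    rfl

theorem isLin_cw_tail {X Y Z T : A.Ob} (x₀ : A.Arr X Y) (s : A.Path Y Z) (t : A.Path T X) :
    IsLin (fun {_} r => chainAct (A := A) r) (1 + sdeg₁ x₀ + pdeg s)
      (fun x => cw x₀ (ins s x t)) where
  add {x x₁ x₂} h₁ h₂ hx := by
    obtain ⟨d, x⟩ := x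
    obtain ⟨_, x₁⟩ := x₁
    obtain ⟨_, x₂⟩ := x₂
    obtain rfl : _ = d := h₁
    obtain rfl : _ = _ := h₂
    obtain rfl : x = x₁ + x₂ := Subtype.ext hx
    have h := A.chainMk_rel (.add_tail x₀ s _ x₁ x₂ t)
    rwa [map_sub, map_add, sub_eq_zero] at h
  smul {i} r {x y} hx hx' := by
    obtain ⟨d, x⟩ := x
    obtain ⟨e, y⟩ := y
    obtain rfl : d = i + e := hx
    obtain rfl : x = smulGr r y := Subtype.ext hx'
    obtain ⟨d₀, x₀⟩ := x₀
    have h := A.chainMk_rel (.balanced d₀ x₀ s i e r y t)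
    rw [map_sub, map_negOnePow_smul, sub_eq_zero] at h
    refine h.trans ?_
    change _ = _ • chainAct r (A.chainMk _)
    rw [chainAct_of, negOnePow_smul_smul]
    exact negOnePow_smul_congr (by simp only [sdeg₁]; push_cast; grind) rfl

/-- `F`, a function of the generators `x₀ ⊗ t`, is compatible with the defining relations of the
reduced chains and defines an endomorphism of degree `n`. -/
structure IsOperator (n : ℤ) (F : ∀ {X Y : A.Ob}, A.Arr X Y → A.Path Y X → A.ChainGroup) :
    Prop where
  head : ∀ {X Y : A.Ob} (t : A.Path Y X),
    IsLin (fun {_} r => chainAct (A := A) r) (n + 1) (fun x => F x t)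
  tail : ∀ {X Y Z T : A.Ob} (x₀ : A.Arr X Y) (s : A.Path Y Z) (t : A.Path T X),
    IsLin (fun {_} r => chainAct (A := A) r) (n + 1 + sdeg₁ x₀ + pdeg s)
      (fun x => F x₀ (ins s x t))
  unit : ∀ {X Y Z : A.Ob} (x₀ : A.Arr X Y) (s : A.Path Y Z) (t : A.Path Z X),
    F x₀ (ins s (A.unit Z) t) = 0
  mem : ∀ {X Y : A.Ob} (x₀ : A.Arr X Y) (t : A.Path Y X),
    F x₀ t ∈ A.chainDeg (n + (sdeg₁ x₀ + pdeg t))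

/-- The endomorphism of the reduced chains given by `F` on generators. -/
def IsOperator.toHom {n : ℤ} {F : ∀ {X Y : A.Ob}, A.Arr X Y → A.Path Y X → A.ChainGroup}
    (h : IsOperator n F) : A.ChainGroup →+ A.ChainGroup :=
  QuotientAddGroup.lift _ (FreeAbelianGroup.lift fun g : A.CyclicWord => F g.head g.tail)
    ((AddSubgroup.closure_le _).2 fun c hc => by
      change FreeAbelianGroup.lift _ c = 0
      cases hc with
      | add_head d x y t =>
        simp only [map_sub, map_add, FreeAbelianGroup.lift_apply_of]
        rw [(h.head t).add (x := ⟨d, x + y⟩) (x₁ := ⟨d, x⟩) (x₂ := ⟨d, y⟩) rfl rfl rfl, sub_self]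
      | add_tail x₀ s d x y t =>
        simp only [map_sub, map_add, FreeAbelianGroup.lift_apply_of]
        rw [(h.tail x₀ s t).add (x := ⟨d, x + y⟩) (x₁ := ⟨d, x⟩) (x₂ := ⟨d, y⟩) rfl rfl rfl,
          sub_self]
      | balanced d₀ x₀ s i d r x t =>
        simp only [map_sub, map_negOnePow_smul, FreeAbelianGroup.lift_apply_of]
        rw [(h.tail ⟨d₀, x₀⟩ s t).smul r (x := smulArr r x) (y := ⟨d, x⟩) rfl rfl,
          (h.head _).smul r (x := smulArr r x₀) (y := ⟨d₀, x₀⟩) rfl rfl, negOnePow_smul_smul,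
          sub_eq_zero]
        exact negOnePow_smul_congr (by simp only [sdeg₁]; push_cast; grind) rfl
      | unit x₀ s t =>
        rw [FreeAbelianGroup.lift_apply_of]
        exact h.unit x₀ s t)

theorem IsOperator.toHom_cw {n : ℤ} {F : ∀ {X Y : A.Ob}, A.Arr X Y → A.Path Y X → A.ChainGroup}
    (h : IsOperator n F) {X Y : A.Ob} (x₀ : A.Arr X Y) (t : A.Path Y X) :
    h.toHom (cw x₀ t) = F x₀ t := FreeAbelianGroup.lift_apply_of _ _

theorem chainAct_cw {i : ℤ} (r : 𝓡 i) {X Y : A.Ob} (x₀ : A.Arr X Y) (t : A.Path Y X) :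
    chainAct r (cw x₀ t) = i.negOnePow • cw (smulArr r x₀.2) t := chainAct_of r ⟨x₀, t⟩

theorem IsOperator.map_chainAct {n : ℤ}
    {F : ∀ {X Y : A.Ob}, A.Arr X Y → A.Path Y X → A.ChainGroup} (h : IsOperator n F)
    {f : A.ChainGroup →+ A.ChainGroup}
    (hf : ∀ {X Y : A.Ob} (x₀ : A.Arr X Y) (t : A.Path Y X), f (cw x₀ t) = F x₀ t)
    {i : ℤ} (r : 𝓡 i) (c : A.ChainGroup) :
    f (chainAct r c) = (i * n).negOnePow • chainAct r (f c) := by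
  refine DFunLike.congr_fun (f := f.comp (chainAct r))
    (g := (i * n).negOnePow • (chainAct r).comp f) (chain_hom_ext fun g => ?_) c
  change f (chainAct r (cw g.head g.tail)) =
    (i * n).negOnePow • chainAct r (f (cw g.head g.tail))
  rw [chainAct_cw, map_negOnePow_smul, hf, hf,
    (h.head _).smul r (x := smulArr r g.head.2) (y := g.head) rfl rfl, negOnePow_smul_smul]
  exact negOnePow_smul_congr (by push_cast; grind) rfl

theorem IsOperator.map_mem {n : ℤ}
    {F : ∀ {X Y : A.Ob}, A.Arr X Y → A.Path Y X → A.ChainGroup} (h : IsOperator n F)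
    {f : A.ChainGroup →+ A.ChainGroup}
    (hf : ∀ {X Y : A.Ob} (x₀ : A.Arr X Y) (t : A.Path Y X), f (cw x₀ t) = F x₀ t)
    {d : ℤ} {c : A.ChainGroup} (hc : c ∈ A.chainDeg d) : f c ∈ A.chainDeg (n + d) := by
  refine mem_chainDeg_induction (P := fun c => f c ∈ A.chainDeg (n + d)) ?_ ?_ ?_ ?_ hc
  · rw [map_zero]; exact zero_mem _
  · intro x y hx hy; rw [map_add]; exact add_mem hx hy
  · intro x hx; rw [map_neg]; exact neg_mem hx
  · intro X Y x₀ t hd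
    rw [hf, ← hd]
    exact h.mem x₀ t

theorem isLin_lieCh_head {p : ℤ} (φ : A.cochains p) {X Y : A.Ob} (t : A.Path Y X) :
    IsLin (fun {_} r => chainAct (A := A) r) (p + 1) (fun x => lieCh φ x t) := by
  refine .add' (.sum₂ fun _ a v h0 => .sum₂ fun _ b c h1 => ?_) (.sum₂ fun _ a v h0 =>
    .sum₂ fun _ b c h1 => ?_)
  · refine ((isLin_cw_head (ins a (value φ b) c)).congr_fun fun x => rfl).sign' (p) ?_
      |>.congr_deg ?_
    · intro x y; simp only [sdeg₁]; push_cast; ring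
    · try simp only [*, pdeg_ins, sdeg₁_value, sdeg₁_unit]
      push_cast; grind
  · refine (((isLin_cw_head b).comp (isLinArr_value φ c a)).congr_fun fun x =>
      rfl).sign' (pdeg c) ?_ |>.congr_deg ?_
    · intro x y; simp only [sdeg₁]; push_cast; ring
    · try simp only [*, pdeg_ins, sdeg₁_value, sdeg₁_unit]
      push_cast; grind

theorem isLin_lieCh_tail {p : ℤ} (φ : A.cochains p) {X Y Z T : A.Ob} (x₀ : A.Arr X Y)
    (s : A.Path Y Z) (t : A.Path T X) :
    IsLin (fun {_} r => chainAct (A := A) r) (p + 1 + sdeg₁ x₀ + pdeg s)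
      (fun x => lieCh φ x₀ (ins s x t)) := by
  simp only [lieCh, sum₂_ins, sum₂_add]
  refine .add' (.add' (.add' (.sum₂ fun _ a v h0 => .sum₂ fun _ b c h1 => ?_)
    (.sum₂ fun _ a v h0 => .sum₂ fun _ b c h1 => ?_))
    (.sum₂ fun _ a v h0 => .sum₂ fun _ b c h1 => ?_))
    (.add' (.add' (.sum₂ fun _ a v h0 => .sum₂ fun _ b c h1 => ?_)
    (.sum₂ fun _ a v h0 => .sum₂ fun _ b c h1 => ?_))
    (.sum₂ fun _ a v h0 => .sum₂ fun _ b c h1 => ?_))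
  · refine ((isLin_cw_tail x₀ (ins a (value φ b) c) t).congr_fun fun x => by
      first | rfl | simp only [ins_ins]).sign' (0) ?_ |>.congr_deg ?_
    · intro x y; simp only [sdeg₁]; push_cast; ring
    · try simp only [*, pdeg_ins, sdeg₁_value]
      push_cast; grind
  · refine (((isLin_cw_tail x₀ a c).comp (isLinArr_value φ v b)).congr_fun fun x =>
      rfl).sign' (0) ?_ |>.congr_deg ?_
    · intro x y; simp only [sdeg₁]; push_cast; ring
    · try simp only [*]
      push_cast; grind
  · refine ((isLin_cw_tail x₀ s (ins a (value φ b) c)).congr_fun fun x => by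
      first | rfl | simp only [ins_ins]).sign' (p) ?_ |>.congr_deg ?_
    · intro x y; simp only [pdeg_ins, sdeg₁]; push_cast; ring
    · try simp only [*, pdeg_ins, sdeg₁_value, sdeg₁_unit]
      push_cast; grind
  · refine (((isLin_cw_head b).comp (isLinArr_value φ c (ins t x₀ a))).congr_fun fun x => by
      first | rfl | simp only [ins_ins]).sign' (sdeg₁ x₀ + pdeg a + pdeg b) ?_ |>.congr_deg ?_
    · intro x y; simp only [pdeg_ins, sdeg₁]; push_cast; ring
    · try simp only [*]
      push_cast; grind
  · refine ((isLin_cw_tail (value φ (ins c x₀ a)) v b).congr_fun fun x => rfl).sign' (pdeg c) ?_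
      |>.congr_deg ?_
    · intro x y; simp only [pdeg_ins, sdeg₁]; push_cast; ring
    · try simp only [*, pdeg_ins, sdeg₁_value]
      push_cast; grind
  · refine (((isLin_cw_head b).comp (isLinArr_value φ (ins c x₀ s) a)).congr_fun fun x => by
      first | rfl | simp only [ins_ins]).sign' (pdeg c) ?_ |>.congr_deg ?_
    · intro x y; simp only [pdeg_ins, sdeg₁]; push_cast; ring
    · try simp only [*, pdeg_ins]
      push_cast; grind

theorem isLin_rhoCh_head {p q : ℤ} (φ : A.cochains p) (ψ : A.cochains q) {X Y : A.Ob}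
    (t : A.Path Y X) :
    IsLin (fun {_} r => chainAct (A := A) r) (p + q + 1) (fun x => rhoCh φ ψ x t) := by
  refine .sum₂ fun _ a v h0 => .sum₂ fun _ b v' h1 => .sum₂ fun _ c v'' h2 => .sum₂ fun _ e f h3 =>
    ?_
  · refine (((isLin_cw_head b).comp (isLinArr_value φ (ins c (value ψ e) f) a)).congr_fun fun x => by
      first | rfl | simp only [ins_ins]).sign' (pdeg c + pdeg e + pdeg f) ?_ |>.congr_deg ?_
    · intro x y; simp only [sdeg₁]; push_cast; ring
    · try simp only [*, pdeg_ins, sdeg₁_value]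
      push_cast; grind

theorem isLin_rhoCh_tail {p q : ℤ} (φ : A.cochains p) (ψ : A.cochains q) {X Y Z T : A.Ob}
    (x₀ : A.Arr X Y) (s : A.Path Y Z) (t : A.Path T X) :
    IsLin (fun {_} r => chainAct (A := A) r) (p + q + 1 + sdeg₁ x₀ + pdeg s)
      (fun x => rhoCh φ ψ x₀ (ins s x t)) := by
  simp only [rhoCh, sum₂_ins, sum₂_add]
  refine .add' (.add' (.add' (.add' (.sum₂ fun _ a v h0 => .sum₂ fun _ b v' h1 =>
    .sum₂ fun _ c v'' h2 => .sum₂ fun _ e f h3 => ?_)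
    (.sum₂ fun _ a v h0 => .sum₂ fun _ b v' h1 => .sum₂ fun _ c v'' h2 => .sum₂ fun _ e f h3 => ?_))
    (.sum₂ fun _ a v h0 => .sum₂ fun _ b v' h1 => .sum₂ fun _ c v'' h2 => .sum₂ fun _ e f h3 => ?_))
    (.sum₂ fun _ a v h0 => .sum₂ fun _ b v' h1 => .sum₂ fun _ c v'' h2 => .sum₂ fun _ e f h3 => ?_))
    (.sum₂ fun _ a v h0 => .sum₂ fun _ b v' h1 => .sum₂ fun _ c v'' h2 => .sum₂ fun _ e f h3 => ?_)
  · refine (((isLin_cw_head b).comp (isLinArr_value φ (ins c (value ψ e) f) (ins t x₀ a))).congr_fun fun x => by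
      first | rfl | simp only [ins_ins]).sign' (sdeg₁ x₀ + pdeg a + pdeg b) ?_ |>.congr_deg ?_
    · intro x y; simp only [pdeg_ins, sdeg₁]; push_cast; ring
    · try simp only [*, pdeg_ins, sdeg₁_value]
      push_cast; grind
  · refine ((((isLin_cw_head b).comp (isLinArr_value φ c (ins f x₀ a))).comp (isLinArr_value ψ v'' e)).congr_fun fun x => rfl).sign' (sdeg₁ x₀ + pdeg a + pdeg b) ?_ |>.congr_deg ?_
    · intro x y; simp only [pdeg_ins, sdeg₁]; push_cast; ring
    · try simp only [*]
      push_cast; grind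
  · refine (((isLin_cw_head b).comp (isLinArr_value φ v' (ins c (value ψ e) (ins f x₀ a)))).congr_fun fun x => by
      first | rfl | simp only [ins_ins]).sign' (q + sdeg₁ x₀ + pdeg a + pdeg b) ?_ |>.congr_deg ?_
    · intro x y; simp only [pdeg_ins, sdeg₁]; push_cast; ring
    · try simp only [*]
      push_cast; grind
  · refine ((isLin_cw_tail (value φ (ins c (value ψ e) (ins f x₀ a))) v b).congr_fun fun x =>
      rfl).sign' (pdeg c + pdeg e + pdeg f) ?_ |>.congr_deg ?_
    · intro x y; simp only [pdeg_ins, sdeg₁]; push_cast; ring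
    · try simp only [*, pdeg_ins, sdeg₁_value]
      push_cast; grind
  · refine (((isLin_cw_head b).comp (isLinArr_value φ (ins c (value ψ e) (ins f x₀ s)) a)).congr_fun fun x => by
      first | rfl | simp only [ins_ins]).sign' (pdeg c + pdeg e + pdeg f) ?_ |>.congr_deg ?_
    · intro x y; simp only [pdeg_ins, sdeg₁]; push_cast; ring
    · try simp only [*, pdeg_ins, sdeg₁_value]
      push_cast; grind

theorem isLin_connesCh_head {X Y : A.Ob} (t : A.Path Y X) :
    IsLin (fun {_} r => chainAct (A := A) r) (-1 + 1) (fun x => connesCh x t) := by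
  refine .sum₂ fun U a c h0 => ?_
  · refine ((isLin_cw_tail (A.unit U) c a).congr_fun fun x => rfl).sign' (pdeg c) ?_ |>.congr_deg ?_
    · intro x y; simp only [sdeg₁]; push_cast; ring
    · try simp only [*, sdeg₁_unit]
      push_cast; grind

theorem isLin_connesCh_tail {X Y Z T : A.Ob} (x₀ : A.Arr X Y) (s : A.Path Y Z)
    (t : A.Path T X) :
    IsLin (fun {_} r => chainAct (A := A) r) (-1 + 1 + sdeg₁ x₀ + pdeg s)
      (fun x => connesCh x₀ (ins s x t)) := by
  simp only [connesCh, sum₂_ins]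
  refine .add' (.sum₂ fun U a c h0 => ?_) (.sum₂ fun U a c h0 => ?_)
  · refine ((isLin_cw_tail (A.unit U) c (ins t x₀ a)).congr_fun fun x => by
      first | rfl | simp only [ins_ins]).sign' (sdeg₁ x₀ + pdeg a) ?_ |>.congr_deg ?_
    · intro x y; simp only [pdeg_ins, sdeg₁]; push_cast; ring
    · try simp only [*, sdeg₁_unit]
      push_cast; grind
  · refine ((isLin_cw_tail (A.unit U) (ins c x₀ s) a).congr_fun fun x => by
      first | rfl | simp only [ins_ins]).sign' (pdeg c) ?_ |>.congr_deg ?_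
    · intro x y; simp only [pdeg_ins, sdeg₁]; push_cast; ring
    · try simp only [*, pdeg_ins, sdeg₁_unit]
      push_cast; grind

theorem isLin_connesOneCh_head {p : ℤ} (φ : A.cochains p) {X Y : A.Ob} (t : A.Path Y X) :
    IsLin (fun {_} r => chainAct (A := A) r) (p - 1 + 1) (fun x => connesOneCh φ x t) := by
  refine .sum₂ fun U a v h0 => .sum₂ fun _ b v' h1 => .sum₂ fun _ e c h2 => ?_
  · refine ((isLin_cw_tail (A.unit U) (ins b (value φ e) c) a).congr_fun fun x => by
      first | rfl | simp only [ins_ins]).sign' (pdeg b + pdeg e + pdeg c) ?_ |>.congr_deg ?_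
    · intro x y; simp only [sdeg₁]; push_cast; ring
    · try simp only [*, pdeg_ins, sdeg₁_value, sdeg₁_unit]
      push_cast; grind

theorem isLin_connesOneCh_tail {p : ℤ} (φ : A.cochains p) {X Y Z T : A.Ob} (x₀ : A.Arr X Y)
    (s : A.Path Y Z) (t : A.Path T X) :
    IsLin (fun {_} r => chainAct (A := A) r) (p - 1 + 1 + sdeg₁ x₀ + pdeg s)
      (fun x => connesOneCh φ x₀ (ins s x t)) := by
  simp only [connesOneCh, sum₂_ins, sum₂_add]
  refine .add' (.add' (.add' (.sum₂ fun U a v h0 => .sum₂ fun _ b v' h1 => .sum₂ fun _ e c h2 => ?_)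
    (.sum₂ fun U a v h0 => .sum₂ fun _ b v' h1 => .sum₂ fun _ e c h2 => ?_))
    (.sum₂ fun U a v h0 => .sum₂ fun _ b v' h1 => .sum₂ fun _ e c h2 => ?_))
    (.sum₂ fun U a v h0 => .sum₂ fun _ b v' h1 => .sum₂ fun _ e c h2 => ?_)
  · refine ((isLin_cw_tail (A.unit U) (ins b (value φ e) c) (ins t x₀ a)).congr_fun fun x => by
      first | rfl | simp only [ins_ins]).sign' (sdeg₁ x₀ + pdeg a) ?_ |>.congr_deg ?_
    · intro x y; simp only [pdeg_ins, sdeg₁]; push_cast; ring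
    · try simp only [*, pdeg_ins, sdeg₁_value, sdeg₁_unit]
      push_cast; grind
  · refine (((isLin_cw_tail (A.unit U) b (ins c x₀ a)).comp (isLinArr_value φ v' e)).congr_fun fun x => rfl).sign' (sdeg₁ x₀ + pdeg a) ?_ |>.congr_deg ?_
    · intro x y; simp only [pdeg_ins, sdeg₁]; push_cast; ring
    · try simp only [*, sdeg₁_unit]
      push_cast; grind
  · refine ((isLin_cw_tail (A.unit U) v (ins b (value φ e) (ins c x₀ a))).congr_fun fun x => by
      first | rfl | simp only [ins_ins]).sign' (p + sdeg₁ x₀ + pdeg a) ?_ |>.congr_deg ?_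
    · intro x y; simp only [pdeg_ins, sdeg₁]; push_cast; ring
    · try simp only [*, sdeg₁_unit]
      push_cast; grind
  · refine ((isLin_cw_tail (A.unit U) (ins b (value φ e) (ins c x₀ s)) a).congr_fun fun x => by
      first | rfl | simp only [ins_ins]).sign' (pdeg b + pdeg e + pdeg c) ?_ |>.congr_deg ?_
    · intro x y; simp only [pdeg_ins, sdeg₁]; push_cast; ring
    · try simp only [*, pdeg_ins, sdeg₁_value, sdeg₁_unit]
      push_cast; grind

theorem cw_ins_value {p : ℤ} (φ : A.cochains p) {X Y Z T : A.Ob} (x₀ : A.Arr X Y)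
    (s : A.Path Y Z) (b : A.Path Z T) (t : A.Path T X) (h : φ.1 Z T b = 0) :
    cw x₀ (ins s (value φ b) t) = 0 := (isLin_cw_tail x₀ s t).map_zero h

theorem cw_value {p : ℤ} (φ : A.cochains p) {X Y : A.Ob} (b : A.Path X Y) (t : A.Path Y X)
    (h : φ.1 X Y b = 0) : cw (value φ b) t = 0 := (isLin_cw_head t).map_zero h

/-- `ℒ_φ` descends to the reduced chains for reduced `φ`. -/
theorem lieCh_unit {p : ℤ} {φ : A.cochains p} (hφ : φ.1 ∈ A.reducedFun) {X Y Z : A.Ob}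
    (x₀ : A.Arr X Y) (s : A.Path Y Z) (t : A.Path Z X) :
    lieCh φ x₀ (ins s (A.unit Z) t) = 0 := by
  have h1 : ∀ {T U : A.Ob} (a : A.Path Z T) (b : A.Path T U) (c : A.Path U X),
      cw x₀ (ins (ins s (A.unit Z) a) (value φ b) c) = 0 := fun a b c => by
    rw [ins_ins]; exact cw_unit _ _ _
  have h2 : ∀ {T U : A.Ob} (a : A.Path Y T) (v : A.Path T Z) (b : A.Path Z U) (c : A.Path U X),
      cw x₀ (ins a (value φ (ins v (A.unit Z) b)) c) = 0 := fun a v b c =>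
    cw_ins_value φ _ _ _ _ (hφ _ _ _ _ _)
  have h3 : ∀ {T U : A.Ob} (c : A.Path U Z) (c' : A.Path Z X) (a : A.Path Y T) (b : A.Path T U),
      cw (value φ (ins (ins c (A.unit Z) c') x₀ a)) b = 0 := fun c c' a b =>
    cw_value φ _ _ (by rw [ins_ins]; exact hφ _ _ _ _ _)
  have h4 : ∀ {T U : A.Ob} (c : A.Path T X) (a : A.Path Z U) (b : A.Path U T),
      cw (value φ (ins c x₀ (ins s (A.unit Z) a))) b = 0 := fun c a b =>
    cw_value φ _ _ (by rw [← ins_ins]; exact hφ _ _ _ _ _)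
  simp only [lieCh, sum₂_ins, h1, h2, h3, h4, cw_ins_unit, cw_unit, smul_zero, sum₂_zero,
    add_zero]

/-- A reduced cochain, and also a strictly unital `A_∞` structure, vanishes on the words with at
least three entries one of which is a unit. -/
def VanishesOnLongUnits (φ : A.CochainFun) : Prop :=
  ∀ {X Y Z : A.Ob} (s : A.Path X Y) (t : A.Path Y Z), 2 ≤ s.length + t.length →
    φ X Z (ins s (A.unit Y) t) = 0

/-- `ρ_{φ,ψ}` descends to the reduced chains. The outer cochain need not be reduced, since besides a
unit it is always applied to `x₀` and to the value of `ψ`. -/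
theorem rhoCh_unit {p q : ℤ} {φ : A.cochains p} {ψ : A.cochains q}
    (hφ : VanishesOnLongUnits φ.1) (hψ : ψ.1 ∈ A.reducedFun) {X Y Z : A.Ob}
    (x₀ : A.Arr X Y) (s : A.Path Y Z) (t : A.Path Z X) :
    rhoCh φ ψ x₀ (ins s (A.unit Z) t) = 0 := by
  have h1 : ∀ {T U V W : A.Ob} (c : A.Path T U) (e : A.Path U V) (f : A.Path V Z)
      (f' : A.Path Z X) (a : A.Path Y W) (b : A.Path W T),
      cw (value φ (ins c (value ψ e) (ins (ins f (A.unit Z) f') x₀ a))) b = 0 :=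
    fun c e f f' a b => cw_value φ _ _ (by
      rw [ins_ins, ← ins_ins]; exact hφ _ _ (by simp only [length_ins]; omega))
  have h2 : ∀ {T U V W : A.Ob} (c : A.Path T U) (e : A.Path U Z) (e' : A.Path Z V)
      (f : A.Path V X) (a : A.Path Y W) (b : A.Path W T),
      cw (value φ (ins c (value ψ (ins e (A.unit Z) e')) (ins f x₀ a))) b = 0 :=
    fun c e e' f a b => cw_value φ _ _ (value_value_eq_zero φ ψ _ _ _ (hψ _ _ _ _ _))
  have h3 : ∀ {T U V W : A.Ob} (c : A.Path T Z) (c' : A.Path Z U) (e : A.Path U V)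
      (f : A.Path V X) (a : A.Path Y W) (b : A.Path W T),
      cw (value φ (ins (ins c (A.unit Z) c') (value ψ e) (ins f x₀ a))) b = 0 :=
    fun c c' e f a b => cw_value φ _ _ (by
      rw [ins_ins]; exact hφ _ _ (by simp only [length_ins]; omega))
  have h4 : ∀ {T U V W : A.Ob} (c : A.Path T U) (e : A.Path U V) (f : A.Path V X)
      (a : A.Path Z W) (b : A.Path W T),
      cw (value φ (ins c (value ψ e) (ins f x₀ (ins s (A.unit Z) a)))) b = 0 :=
    fun c e f a b => cw_value φ _ _ (by
      rw [← ins_ins f, ← ins_ins c]; exact hφ _ _ (by simp only [length_ins]; omega))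
  simp only [rhoCh, sum₂_ins, h1, h2, h3, h4, cw_unit, smul_zero, sum₂_zero, add_zero]

theorem connesCh_unit {X Y Z : A.Ob} (x₀ : A.Arr X Y) (s : A.Path Y Z) (t : A.Path Z X) :
    connesCh x₀ (ins s (A.unit Z) t) = 0 := by
  simp only [connesCh, sum₂_ins, ins_ins, cw_unit, cw_ins_unit, smul_zero, sum₂_zero, add_zero]

theorem connesOneCh_unit {p : ℤ} {φ : A.cochains p} (hφ : φ.1 ∈ A.reducedFun) {X Y Z : A.Ob}
    (x₀ : A.Arr X Y) (s : A.Path Y Z) (t : A.Path Z X) :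
    connesOneCh φ x₀ (ins s (A.unit Z) t) = 0 := by
  have h1 : ∀ {T U V : A.Ob} (b : A.Path T U) (e : A.Path U V) (c : A.Path V X) (a : A.Path Z T),
      cw (A.unit T) (ins b (value φ e) (ins c x₀ (ins s (A.unit Z) a))) = 0 := fun b e c a => by
    rw [← ins_ins c, ← ins_ins b]; exact cw_unit _ _ _
  have h2 : ∀ {T U V : A.Ob} (b : A.Path T U) (e : A.Path U Z) (e' : A.Path Z V) (c : A.Path V X)
      (a : A.Path Y T),
      cw (A.unit T) (ins b (value φ (ins e (A.unit Z) e')) (ins c x₀ a)) = 0 := fun b e e' c a =>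
    cw_ins_value φ _ _ _ _ (hφ _ _ _ _ _)
  have h3 : ∀ {T U V : A.Ob} (b : A.Path T U) (e : A.Path U V) (c : A.Path V Z) (a : A.Path Y T),
      cw (A.unit T) (ins b (value φ e) (ins c (A.unit Z) (ins t x₀ a))) = 0 := fun b e c a => by
    rw [← ins_ins b]; exact cw_unit _ _ _
  simp only [connesOneCh, sum₂_ins, ins_ins, h1, h2, h3, cw_unit, smul_zero, sum₂_zero,
    add_zero]

theorem vanishesOnLongUnits_of_reduced {φ : A.CochainFun} (hφ : φ ∈ A.reducedFun) :
    VanishesOnLongUnits φ := fun s t _ => hφ _ _ _ s t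

theorem IsStrictlyUnitalCurved.vanishesOnLongUnits {m : A.cochains 1}
    (hm : IsStrictlyUnitalCurved m) : VanishesOnLongUnits m.1 :=
  fun s t h => hm.eq_zero s t (by omega)

/-- `b = ℒ_m` descends to the reduced chains: the terms in which a unit is multiplied with its two
neighbours, among them possibly `x₀`, cancel. -/
theorem IsStrictlyUnitalCurved.lieCh_unit {m : A.cochains 1} (hm : IsStrictlyUnitalCurved m)
    {X Y Z : A.Ob} (x₀ : A.Arr X Y) (s : A.Path Y Z) (t : A.Path Z X) :
    lieCh m x₀ (ins s (A.unit Z) t) = 0 := by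
  have h1 : ∀ {T U : A.Ob} (a : A.Path Z T) (b : A.Path T U) (c : A.Path U X),
      cw x₀ (ins (ins s (A.unit Z) a) (value m b) c) = 0 := fun a b c => by
    rw [ins_ins]; exact cw_unit _ _ _
  have h2 : s.sum₂ (fun a v => t.sum₂ fun b c => (1 * (sdeg₁ x₀ + pdeg a)).negOnePow •
      cw x₀ (ins a (value m (ins v (A.unit Z) b)) c)) = (sdeg₁ x₀ + pdeg s).negOnePow •
        ((if t.length = 0 then 0 else cw x₀ (s.append t)) -
          (if s.length = 0 then 0 else cw x₀ (s.append t))) := by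
    have := hm.sum_unit (act := fun {_} r => chainAct (A := A) r) s t
      (fun a x c => cw x₀ (ins a x c)) (sdeg₁ x₀) (cw x₀ (s.append t))
      (fun a c => ⟨_, isLin_cw_tail x₀ a c⟩)
      (fun a y h => by rw [← h, Word.append_assoc]; rfl) (fun y c h => by rw [← h]; rfl)
    simpa only [one_mul] using this
  have h4 : s.sum₂ (fun a v => v.sum₂ fun b c =>
      ((sdeg₁ x₀ + pdeg a + pdeg b) * pdeg (ins c (A.unit Z) t)).negOnePow •
        cw (value m (ins (ins c (A.unit Z) t) x₀ a)) b) =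
      if t.length = 0 then (sdeg₁ x₀ + pdeg s).negOnePow • cw x₀ (s.append t) else 0 := by
    have h0 : ∀ {T U : A.Ob} (c : A.Path U Z) (a : A.Path Y T) (b : A.Path T U),
        c.length + (t.length + a.length) ≠ 0 →
        cw (value m (ins (ins c (A.unit Z) t) x₀ a)) b = 0 := fun c a b h => cw_value m _ _ (by
      rw [ins_ins]; exact hm.eq_zero _ _ (by rw [length_ins]; omega))
    by_cases ht : t.length = 0
    · rw [if_pos ht, ← sum₂_left_length_zero s (_ • cw x₀ _)]
      refine sum₂_congr fun T a v hav => ?_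
      split_ifs with ha
      · obtain ⟨rfl, ha'⟩ := eq_nil_of_length ha
        obtain rfl := eq_of_heq ha'
        obtain rfl : v = s := hav
        rw [← sum₂_right_length_zero v (_ • cw x₀ _)]
        refine sum₂_congr fun U b c hbc => ?_
        split_ifs with hc
        · obtain ⟨rfl, hc'⟩ := eq_nil_of_length hc
          obtain rfl := eq_of_heq hc'
          obtain ⟨rfl, ht'⟩ := eq_nil_of_length ht
          obtain rfl := eq_of_heq ht'
          obtain rfl : b = v := (Word.append_nil _).symm.trans hbc
          have h := (isLin_cw_head b).map_units_smul (x := value m (.cons (A.unit _) (.cons x₀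
            (.nil _)))) (x₁ := x₀)
            (by change x₀.1 = 1 + (0 - 1 + (x₀.1 - 1 + 0)) + 1; ring) 1
            (by rw [one_smul]; exact hm.unit_left _ _ x₀)
          rw [one_smul] at h
          rw [Word.append_nil]
          refine negOnePow_smul_congr ?_ h
          simp only [pdeg_ins, pdeg_nil, sdeg₁_unit]
          push_cast; grind
        · rw [h0 _ _ _ (by omega), smul_zero]
      · exact sum₂_eq_zero fun U b c hbc => by rw [h0 _ _ _ (by omega), smul_zero]
    · rw [if_neg ht]
      exact sum₂_eq_zero fun T a v hav => sum₂_eq_zero fun U b c hbc => by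
        rw [h0 _ _ _ (by omega), smul_zero]
  have h6 : t.sum₂ (fun a v => v.sum₂ fun b c =>
      ((sdeg₁ x₀ + pdeg (ins s (A.unit Z) a) + pdeg b) * pdeg c).negOnePow •
        cw (value m (ins c x₀ (ins s (A.unit Z) a))) b) =
      if s.length = 0 then (sdeg₁ x₀ + pdeg s + 1).negOnePow • cw x₀ (s.append t) else 0 := by
    have h0 : ∀ {T U : A.Ob} (c : A.Path U X) (a : A.Path Z T) (b : A.Path T U),
        c.length + (s.length + a.length) ≠ 0 →
        cw (value m (ins c x₀ (ins s (A.unit Z) a))) b = 0 := fun c a b h => cw_value m _ _ (by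
      rw [← ins_ins]; exact hm.eq_zero _ _ (by rw [length_ins]; omega))
    by_cases hs : s.length = 0
    · rw [if_pos hs, ← sum₂_left_length_zero t (_ • cw x₀ _)]
      refine sum₂_congr fun T a v hav => ?_
      split_ifs with ha
      · obtain ⟨rfl, ha'⟩ := eq_nil_of_length ha
        obtain rfl := eq_of_heq ha'
        obtain rfl : v = t := hav
        rw [← sum₂_right_length_zero v (_ • cw x₀ _)]
        refine sum₂_congr fun U b c hbc => ?_
        split_ifs with hc
        · obtain ⟨rfl, hc'⟩ := eq_nil_of_length hc
          obtain rfl := eq_of_heq hc'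
          obtain ⟨rfl, hs'⟩ := eq_nil_of_length hs
          obtain rfl := eq_of_heq hs'
          obtain rfl : b = v := (Word.append_nil _).symm.trans hbc
          have h := (isLin_cw_head b).map_units_smul (x := value m (.cons x₀ (.cons (A.unit _)
            (.nil _)))) (x₁ := x₀)
            (by change x₀.1 = 1 + (x₀.1 - 1 + (0 - 1 + 0)) + 1; ring) x₀.1.negOnePow
            ((negOnePow_smul_self _ _).symm.trans
              (congrArg (fun z => x₀.1.negOnePow • z) (hm.unit_right _ _ x₀)))
          refine (congrArg _ h).trans ?_
          rw [negOnePow_smul_smul]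
          refine negOnePow_smul_congr ?_ rfl
          simp only [pdeg_ins, pdeg_nil, sdeg₁]
          push_cast; grind
        · rw [h0 _ _ _ (by omega), smul_zero]
      · exact sum₂_eq_zero fun U b c hbc => by rw [h0 _ _ _ (by omega), smul_zero]
    · rw [if_neg hs]
      exact sum₂_eq_zero fun T a v hav => sum₂_eq_zero fun U b c hbc => by
        rw [h0 _ _ _ (by omega), smul_zero]
  simp only [lieCh, sum₂_ins, h1, h2, h4, h6, cw_ins_unit, cw_unit, smul_zero, sum₂_zero,
    add_zero, zero_add]
  rw [Int.negOnePow_succ, Units.neg_smul]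
  split_ifs <;> simp

/-! ### The operators `ℒ_φ`, `ρ_{φ,ψ}`, `B` and `B¹_φ` -/

theorem isOperator_lie {p : ℤ} {φ : A.cochains p} (hφ : φ.1 ∈ A.reducedFun) :
    IsOperator p (lieCh φ) :=
  ⟨isLin_lieCh_head φ, isLin_lieCh_tail φ, UnitalGradedQuiver.lieCh_unit hφ, lieCh_mem φ⟩

theorem IsStrictlyUnitalCurved.isOperator_lie {m : A.cochains 1} (hm : IsStrictlyUnitalCurved m) :
    IsOperator 1 (lieCh m) :=
  ⟨isLin_lieCh_head m, isLin_lieCh_tail m, hm.lieCh_unit, lieCh_mem m⟩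

theorem isOperator_rho {p q : ℤ} {φ : A.cochains p} {ψ : A.cochains q}
    (hφ : VanishesOnLongUnits φ.1) (hψ : ψ.1 ∈ A.reducedFun) :
    IsOperator (p + q) (rhoCh φ ψ) :=
  ⟨isLin_rhoCh_head φ ψ, isLin_rhoCh_tail φ ψ, rhoCh_unit hφ hψ, rhoCh_mem φ ψ⟩

theorem isOperator_connes : IsOperator (A := A) (-1) connesCh :=
  ⟨isLin_connesCh_head, isLin_connesCh_tail, connesCh_unit, connesCh_mem⟩

theorem isOperator_connesOne {p : ℤ} {φ : A.cochains p} (hφ : φ.1 ∈ A.reducedFun) :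
    IsOperator (p - 1) (connesOneCh φ) :=
  ⟨isLin_connesOneCh_head φ, isLin_connesOneCh_tail φ, connesOneCh_unit hφ, connesOneCh_mem φ⟩

/-- The operators on the reduced chains. -/
def redOps {m : A.cochains 1} (hm : IsStrictlyUnitalCurved m) : ReducedOperators A m where
  lie φ := (isOperator_lie φ.2.2.2).toHom
  lie_induced φ := isInducedBy_lie.2 (isOperator_lie φ.2.2.2).toHom_cw
  rho φ ψ := (isOperator_rho (vanishesOnLongUnits_of_reduced φ.2.2.2) ψ.2.2.2).toHom
  rho_induced φ ψ := isInducedBy_rho.2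
    (isOperator_rho (vanishesOnLongUnits_of_reduced φ.2.2.2) ψ.2.2.2).toHom_cw
  b := hm.isOperator_lie.toHom
  b_induced := isInducedBy_lie.2 hm.isOperator_lie.toHom_cw
  b₁ φ := (isOperator_rho hm.vanishesOnLongUnits φ.2.2.2).toHom
  b₁_induced φ := isInducedBy_rho.2 (isOperator_rho hm.vanishesOnLongUnits φ.2.2.2).toHom_cw
  B := isOperator_connes.toHom
  B_induced := isInducedBy_connes.2 isOperator_connes.toHom_cw
  B₁ φ := (isOperator_connesOne φ.2.2.2).toHom
  B₁_induced φ := isInducedBy_connesOne.2 (isOperator_connesOne φ.2.2.2).toHom_cw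

end UnitalGradedQuiver

namespace UnitalGradedQuiver

open Word

variable {R : Type u} [Ring R] {𝓡 : ℤ → AddSubgroup R} [GradedRing 𝓡]
  {A : UnitalGradedQuiver.{u, v, w} 𝓡} [IsGradedComm 𝓡]

/-! ### Compositions of the operators on chains -/

theorem cw_circC {p q : ℤ} (φ : A.cochains p) (ψ : A.cochains q) {X Y : A.Ob} (s : A.Path X Y)
    (t : A.Path Y X) : cw (value (circC φ ψ) s) t = s.sum₂ fun a v => v.sum₂ fun b c =>
      (q * pdeg a).negOnePow • cw (value φ (ins a (value ψ b) c)) t :=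
  (isLin_cw_head t).map_circ φ ψ s

theorem cw_ins_circC {p q : ℤ} (φ : A.cochains p) (ψ : A.cochains q) {X Y Z T : A.Ob}
    (x₀ : A.Arr X Y) (r : A.Path Y Z) (s : A.Path Z T) (t : A.Path T X) :
    cw x₀ (ins r (value (circC φ ψ) s) t) = s.sum₂ fun a v => v.sum₂ fun b c =>
      (q * pdeg a).negOnePow • cw x₀ (ins r (value φ (ins a (value ψ b) c)) t) :=
  (isLin_cw_tail x₀ r t).map_circ φ ψ s

theorem cw_value_circC {p q k : ℤ} (χ : A.cochains k) (φ : A.cochains p) (ψ : A.cochains q)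
    {X Y Z T : A.Ob} (r : A.Path X Y) (s : A.Path Y Z) (r' : A.Path Z T) (t : A.Path T X) :
    cw (value χ (ins r (value (circC φ ψ) s) r')) t = s.sum₂ fun a v => v.sum₂ fun b c =>
      (q * pdeg a).negOnePow • cw (value χ (ins r (value φ (ins a (value ψ b) c)) r')) t :=
  ((isLin_cw_head t).comp (isLinArr_value χ r r')).map_circ φ ψ s

/-- The terms of `ℒ_φ ℒ_ψ` in which `φ` and `ψ` are applied to disjoint parts of the word, `φ` to
the left of `ψ` if the word is read starting from the entry at which the result starts. -/
def lieDisjoint {p q : ℤ} (φ : A.cochains p) (ψ : A.cochains q) {X Y : A.Ob} (x₀ : A.Arr X Y)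
    (t : A.Path Y X) : A.ChainGroup :=
  (t.sum₂ fun a t₁ => t₁.sum₂ fun b t₂ => t₂.sum₂ fun c t₃ => t₃.sum₂ fun e f =>
    (p * (sdeg₁ x₀ + pdeg a) + q * (sdeg₁ x₀ + pdeg a + pdeg b + pdeg c)).negOnePow •
      cw x₀ (ins a (value φ b) (ins c (value ψ e) f))) +
  (t.sum₂ fun a t₁ => t₁.sum₂ fun b t₂ => t₂.sum₂ fun c t₃ => t₃.sum₂ fun e f =>
    (q * (sdeg₁ x₀ + pdeg a + pdeg b) +
      (sdeg₁ x₀ + pdeg a + pdeg b + q + pdeg c + pdeg e) * pdeg f).negOnePow •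
      cw (value φ (ins f x₀ a)) (ins b (value ψ c) e))

/-- The terms of `ℒ_φ(x₀ ⊗ t)` in which `φ` is not applied to `x₀`. -/
def lieTail {p : ℤ} (φ : A.cochains p) {X Y : A.Ob} (x₀ : A.Arr X Y) (t : A.Path Y X) :
    A.ChainGroup :=
  t.sum₂ fun a t₁ => t₁.sum₂ fun b c =>
    (p * (sdeg₁ x₀ + pdeg a)).negOnePow • cw x₀ (ins a (value φ b) c)

/-- The terms of `ℒ_φ(x₀ ⊗ t)` in which `φ` is applied to `x₀`. -/
def lieHead {p : ℤ} (φ : A.cochains p) {X Y : A.Ob} (x₀ : A.Arr X Y) (t : A.Path Y X) :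
    A.ChainGroup :=
  t.sum₂ fun a t₁ => t₁.sum₂ fun b c =>
    ((sdeg₁ x₀ + pdeg a + pdeg b) * pdeg c).negOnePow • cw (value φ (ins c x₀ a)) b

theorem lieCh_eq {p : ℤ} (φ : A.cochains p) {X Y : A.Ob} (x₀ : A.Arr X Y) (t : A.Path Y X) :
    lieCh φ x₀ t = lieTail φ x₀ t + lieHead φ x₀ t := rfl

/-- The composition `ℒ_φ ℒ_ψ`: the nested terms form `ℒ_{φ ∘ ψ}`,
  and the others are symmetric in the
two cochains. -/
theorem lie_lieCh {p q : ℤ} (φ : A.cochains p) (ψ : A.cochains q) {f : A.ChainGroup →+ A.ChainGroup}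
    (hf : ∀ {X Y : A.Ob} (x₀ : A.Arr X Y) (t : A.Path Y X), f (cw x₀ t) = lieCh φ x₀ t)
    {X Y : A.Ob} (x₀ : A.Arr X Y) (t : A.Path Y X) :
    f (lieCh ψ x₀ t) = lieCh (circC φ ψ) x₀ t + lieDisjoint φ ψ x₀ t +
      (p * q).negOnePow • lieDisjoint ψ φ x₀ t := by
  simp only [lieCh, lieDisjoint, map_add, Word.map_sum₂, map_negOnePow_smul, hf, cw_circC,
    cw_ins_circC,
    sum₂_ins, sum₂_add, smul_add, smul_sum₂, negOnePow_smul_smul,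
    ins_ins, sum₂_flat₃, sum₂_flat₄, sum₂_assoc, pdeg_append, pdeg_ins, sdeg₁_value]
  have key : ∀ {G : Type (max v w)} [AddCommGroup G] {a₁ a₂ a₃ a₄ a₅ a₆ a₇ a₈ b₁ b₂ b₃ b₄ b₅ b₆ b₇ b₈ : G},
      a₁ = b₅ → a₂ = b₁ → a₃ = b₇ → a₄ = b₂ → a₅ = b₆ → a₆ = b₄ → a₇ = b₈ → a₈ = b₃ →
      a₁ + a₂ + a₃ + (a₄ + a₅ + a₆) + (a₇ + a₈) =
        b₁ + (b₂ + b₃ + b₄) + (b₅ + b₆) + (b₇ + b₈) := by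
    intros; subst_vars; abel
  refine key ?_ ?_ ?_ ?_ ?_ ?_ ?_ ?_ <;>
  · refine sum₂_congr fun _ _ _ h₁ => sum₂_congr fun _ _ _ h₂ => sum₂_congr fun _ _ _ h₃ =>
      sum₂_congr fun _ _ _ h₄ => negOnePow_smul_congr ?_ rfl
    try simp only [← h₃, ← h₄, pdeg_append]
    push_cast; grind

/-- The terms of `ℒ_χ ρ_{φ,ψ}` in which `χ` is applied to a part of the word which is disjoint
from the input of `φ`. -/
def rhoDisjoint {p q r : ℤ} (φ : A.cochains p) (ψ : A.cochains q) (χ : A.cochains r) {X Y : A.Ob}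
    (x₀ : A.Arr X Y) (t : A.Path Y X) : A.ChainGroup :=
  t.sum₂ fun a t₁ => t₁.sum₂ fun b₁ t₂ => t₂.sum₂ fun b₂ t₃ => t₃.sum₂ fun b₃ t₄ =>
    t₄.sum₂ fun c t₅ => t₅.sum₂ fun e f =>
      (q * pdeg c + (sdeg₁ x₀ + pdeg a + pdeg b₁ + pdeg b₂ + pdeg b₃) *
        (pdeg c + pdeg e + pdeg f) + r * (p + pdeg c + q + pdeg e + pdeg f + sdeg₁ x₀ + pdeg a +
        pdeg b₁)).negOnePow •
        cw (value φ (ins c (value ψ e) (ins f x₀ a))) (ins b₁ (value χ b₂) b₃)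

/-- The terms of `ℒ_χ ρ_{φ,ψ}` in which `χ` is applied to a part of the word which contains the
value of `φ`. -/
def rhoNested {p q r : ℤ} (χ : A.cochains r) (φ : A.cochains p) (ψ : A.cochains q) {X Y : A.Ob}
    (x₀ : A.Arr X Y) (t : A.Path Y X) : A.ChainGroup :=
  t.sum₂ fun a₁ t₁ => t₁.sum₂ fun a₂ t₂ => t₂.sum₂ fun b t₃ => t₃.sum₂ fun c₁ t₄ =>
    t₄.sum₂ fun c₂ t₅ => t₅.sum₂ fun e f =>
      (q * pdeg c₂ + (sdeg₁ x₀ + pdeg a₁ + pdeg a₂ + pdeg b + pdeg c₁) *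
        (pdeg c₂ + pdeg e + pdeg f) + (p + pdeg c₂ + q + pdeg e + pdeg f + sdeg₁ x₀ + pdeg a₁ +
        pdeg a₂ + pdeg b) * pdeg c₁).negOnePow •
        cw (value χ (ins c₁ (value φ (ins c₂ (value ψ e) (ins f x₀ a₁))) a₂)) b

/-- The composition `ℒ_χ ρ_{φ,ψ}`. -/
theorem lie_rhoCh {p q r : ℤ} (φ : A.cochains p) (ψ : A.cochains q) (χ : A.cochains r)
    {f : A.ChainGroup →+ A.ChainGroup}
    (hf : ∀ {X Y : A.Ob} (x₀ : A.Arr X Y) (t : A.Path Y X), f (cw x₀ t) = lieCh χ x₀ t)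
    {X Y : A.Ob} (x₀ : A.Arr X Y) (t : A.Path Y X) :
    f (rhoCh φ ψ x₀ t) = rhoDisjoint φ ψ χ x₀ t + rhoNested χ φ ψ x₀ t := by
  simp only [rhoCh, rhoDisjoint, rhoNested, lieCh, Word.map_sum₂, map_negOnePow_smul, hf,
    sum₂_add, smul_add, smul_sum₂, negOnePow_smul_smul, sum₂_flat₄,
    pdeg_append, pdeg_ins, sdeg₁_value]
  refine congrArg₂ (· + ·) ?_ ?_ <;>
  · refine sum₂_congr fun _ _ _ h₁ => sum₂_congr fun _ _ _ h₂ => sum₂_congr fun _ _ _ h₃ =>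
      sum₂_congr fun _ _ _ h₄ => sum₂_congr fun _ _ _ h₅ => sum₂_congr fun _ _ _ h₆ =>
      negOnePow_smul_congr ?_ rfl
    try simp only [← h₁, ← h₂, ← h₃, ← h₄, ← h₅, ← h₆, pdeg_append, pdeg_ins, sdeg₁_value]
    push_cast; grind

/-- The composition `ρ_{φ,ψ} ℒ_χ`: here `χ` is applied next to, inside,
  or around the value of `ψ`. -/
theorem rho_lieCh {p q r : ℤ} (φ : A.cochains p) (ψ : A.cochains q) (χ : A.cochains r)
    {f : A.ChainGroup →+ A.ChainGroup}
    (hf : ∀ {X Y : A.Ob} (x₀ : A.Arr X Y) (t : A.Path Y X), f (cw x₀ t) = rhoCh φ ψ x₀ t)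
    {X Y : A.Ob} (x₀ : A.Arr X Y) (t : A.Path Y X) :
    (r * (p + q)).negOnePow • f (lieCh χ x₀ t) +
        ((r * p).negOnePow • rhoCh φ (circC χ ψ) x₀ t +
        (r * p).negOnePow • rhoNested φ χ ψ x₀ t) =
      rhoDisjoint φ ψ χ x₀ t + ((r * p).negOnePow • rhoCh (circC φ χ) ψ x₀ t +
        (r * (p + q)).negOnePow • rhoCh φ (circC ψ χ) x₀ t) := by
  simp only [rhoCh, rhoDisjoint, rhoNested, lieCh, map_add, Word.map_sum₂, map_negOnePow_smul, hf,
    cw_circC, cw_value_circC,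
    sum₂_ins, sum₂_add, smul_add, smul_sum₂, negOnePow_smul_smul, ins_ins, sum₂_flat₃,
    sum₂_flat₅, sum₂_flat₆, sum₂_assoc, pdeg_append, pdeg_ins, sdeg₁_value]
  have key : ∀ {G : Type (max v w)} [AddCommGroup G] {a₁ a₂ a₃ a₄ a₅ a₆ a₇ a₈
      b₁ b₂ b₃ b₄ b₅ b₆ b₇ b₈ : G}, a₁ = b₅ → a₂ = b₈ → a₃ = b₂ → a₄ = b₁ → a₅ = b₇ → a₆ = b₆ →
        a₇ = b₃ → a₈ = b₄ →
      a₁ + a₂ + a₃ + a₄ + a₅ + a₆ + (a₇ + a₈) =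
        b₁ + (b₂ + (b₃ + b₄) + (b₅ + b₆ + b₇) + b₈) := by
    intros; subst_vars; abel
  refine key ?_ ?_ ?_ ?_ ?_ ?_ ?_ ?_ <;>
  · refine sum₂_congr fun _ _ _ h₁ => sum₂_congr fun _ _ _ h₂ => sum₂_congr fun _ _ _ h₃ =>
      sum₂_congr fun _ _ _ h₄ => sum₂_congr fun _ _ _ h₅ => sum₂_congr fun _ _ _ h₆ =>
      negOnePow_smul_congr ?_ rfl
    try simp only [← h₅, ← h₆, pdeg_append]
    push_cast; grind

/-- `ℒ_φ` commutes with `B` up to the terms in which `φ` is applied to the unit produced by `B`. -/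
theorem lie_connesCh {p : ℤ} (φ : A.cochains p) {f g : A.ChainGroup →+ A.ChainGroup}
    (hf : ∀ {X Y : A.Ob} (x₀ : A.Arr X Y) (t : A.Path Y X), f (cw x₀ t) = lieCh φ x₀ t)
    (hg : ∀ {X Y : A.Ob} (x₀ : A.Arr X Y) (t : A.Path Y X), g (cw x₀ t) = connesCh x₀ t)
    {X Y : A.Ob} (x₀ : A.Arr X Y) (t : A.Path Y X) :
    f (connesCh x₀ t) = p.negOnePow • g (lieCh φ x₀ t) + (t.sum₂ fun {Z} a c =>
      ((sdeg₁ x₀ + pdeg a) * pdeg c).negOnePow • lieHead φ (A.unit Z) (ins c x₀ a)) := by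
  simp only [connesCh, Word.map_sum₂, map_negOnePow_smul, hf, lieCh_eq, smul_add, sum₂_add]
  refine congrArg (· + _) ?_
  simp only [connesCh, lieTail, lieHead, map_add, Word.map_sum₂, map_negOnePow_smul, hg,
    sum₂_ins, sum₂_add, smul_add, smul_sum₂, negOnePow_smul_smul, ins_ins, sum₂_flat₃,
    sum₂_assoc, pdeg_append, pdeg_ins, sdeg₁_value, sdeg₁_unit]
  have key : ∀ {G : Type (max v w)} [AddCommGroup G] {a₁ a₂ a₃
      b₁ b₂ b₃ : G}, a₁ = b₁ → a₂ = b₃ → a₃ = b₂ →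
      a₁ + a₂ + a₃ =
        b₁ + b₂ + b₃ := by
    intros; subst_vars; abel
  refine key ?_ ?_ ?_ <;>
  · refine sum₂_congr fun _ _ _ h₁ => sum₂_congr fun _ _ _ h₂ => sum₂_congr fun _ _ _ h₃ =>
      negOnePow_smul_congr ?_ rfl
    try simp only [← h₂, ← h₃, pdeg_append]
    push_cast; grind

/-- The commutator of `ℒ_φ` and `B¹_ψ`,
  up to the terms in which `φ` is applied to the unit produced by
`B¹_ψ`. -/
theorem lie_connesOneCh {p q : ℤ} (φ : A.cochains p) (ψ : A.cochains q)
    {f g h : A.ChainGroup →+ A.ChainGroup}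
    (hf : ∀ {X Y : A.Ob} (x₀ : A.Arr X Y) (t : A.Path Y X), f (cw x₀ t) = lieCh φ x₀ t)
    (hg : ∀ {X Y : A.Ob} (x₀ : A.Arr X Y) (t : A.Path Y X), g (cw x₀ t) = connesCh x₀ t)
    (hh : ∀ {X Y : A.Ob} (x₀ : A.Arr X Y) (t : A.Path Y X), h (cw x₀ t) = connesOneCh ψ x₀ t)
    {X Y : A.Ob} (x₀ : A.Arr X Y) (t : A.Path Y X) :
    f (connesOneCh ψ x₀ t) + (p + p * q).negOnePow • connesOneCh (circC ψ φ) x₀ t =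
      (p + p * q).negOnePow • h (lieCh φ x₀ t) + p.negOnePow • connesOneCh (circC φ ψ) x₀ t +
      p.negOnePow • g (rhoCh φ ψ x₀ t) +
      (t.sum₂ fun {Z} a t₁ => t₁.sum₂ fun b t₂ => t₂.sum₂ fun e c =>
        ((sdeg₁ x₀ + pdeg a) * (pdeg b + pdeg e + pdeg c) + q * pdeg b).negOnePow •
        lieHead φ (A.unit Z) (ins b (value ψ e) (ins c x₀ a))) := by
  have e : f (connesOneCh ψ x₀ t) =
      (t.sum₂ fun {Z} a t₁ => t₁.sum₂ fun b t₂ => t₂.sum₂ fun e c =>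
        ((sdeg₁ x₀ + pdeg a) * (pdeg b + pdeg e + pdeg c) + q * pdeg b).negOnePow •
        lieTail φ (A.unit Z) (ins b (value ψ e) (ins c x₀ a))) +
      (t.sum₂ fun {Z} a t₁ => t₁.sum₂ fun b t₂ => t₂.sum₂ fun e c =>
        ((sdeg₁ x₀ + pdeg a) * (pdeg b + pdeg e + pdeg c) + q * pdeg b).negOnePow •
        lieHead φ (A.unit Z) (ins b (value ψ e) (ins c x₀ a))) := by
    simp only [connesOneCh, Word.map_sum₂, map_negOnePow_smul, hf, lieCh_eq, smul_add, sum₂_add]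
  rw [e, add_right_comm]
  refine congrArg (· + _) ?_
  simp only [lieCh_eq, connesCh, connesOneCh, rhoCh, lieTail, lieHead, map_add, Word.map_sum₂,
    map_negOnePow_smul, hg, hh, cw_ins_circC,
    sum₂_ins, sum₂_add, smul_add, smul_sum₂, negOnePow_smul_smul, ins_ins, sum₂_flat₃, sum₂_flat₄,
    sum₂_flat₅, sum₂_assoc, pdeg_append, pdeg_ins, sdeg₁_value, sdeg₁_unit]
  have key : ∀ {G : Type (max v w)} [AddCommGroup G] {a₁ a₂ a₃ a₄ a₅ a₆ a₇
      b₁ b₂ b₃ b₄ b₅ b₆ b₇ : G}, a₁ = b₃ → a₂ = b₆ → a₃ = b₇ → a₄ = b₁ → a₅ = b₅ → a₆ = b₄ →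
        a₇ = b₂ →
      a₁ + (a₂ + a₃) + (a₄ + a₅ + a₆) + a₇ =
        b₁ + b₂ + b₃ + b₄ + b₅ + b₆ + b₇ := by
    intros; subst_vars; abel
  refine key ?_ ?_ ?_ ?_ ?_ ?_ ?_ <;>
  · refine sum₂_congr fun _ _ _ h₁ => sum₂_congr fun _ _ _ h₂ => sum₂_congr fun _ _ _ h₃ =>
      sum₂_congr fun _ _ _ h₄ => sum₂_congr fun _ _ _ h₅ =>
      negOnePow_smul_congr ?_ rfl
    try simp only [← h₄, ← h₅, pdeg_append]
    push_cast; grind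

end UnitalGradedQuiver

namespace Word

variable {Ob : Type v} {Q : Ob → Ob → Type w} {G : Type*} [AddCommMonoid G]

/-- If only the splitting with empty first part contributes, the sum is this term. -/
theorem sum₂_eq_left_nil {X Y : Ob} (t : Word Q X Y)
    (f : ∀ {Z : Ob}, Word Q X Z → Word Q Z Y → G)
    (h : ∀ {Z : Ob} (u : Word Q X Z) (v : Word Q Z Y), u.length ≠ 0 → f u v = 0) :
    sum₂ t f = f (nil X) t := by
  cases t with
  | nil => rw [sum₂_nil]
  | cons x t =>
    rw [sum₂_cons, sum₂_eq_zero fun Z u v _ => h (cons x u) v (Nat.succ_ne_zero _), add_zero]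

/-- If only the splitting with empty second part contributes, the sum is this term. -/
theorem sum₂_eq_right_nil {X Y : Ob} (t : Word Q X Y)
    (f : ∀ {Z : Ob}, Word Q X Z → Word Q Z Y → G)
    (h : ∀ {Z : Ob} (u : Word Q X Z) (v : Word Q Z Y), v.length ≠ 0 → f u v = 0) :
    sum₂ t f = f t (nil Y) := by
  induction t with
  | nil => rw [sum₂_nil]
  | cons x t ih =>
    rw [sum₂_cons, h (nil _) (cons x t) (Nat.succ_ne_zero _), zero_add,
      ih (fun u v => f (cons x u) v) fun u v => h (cons x u) v]

end Word

namespace UnitalGradedQuiver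

open Word

variable {R : Type u} [Ring R] {𝓡 : ℤ → AddSubgroup R} [GradedRing 𝓡]
  {A : UnitalGradedQuiver.{u, v, w} 𝓡} [IsGradedComm 𝓡]

theorem neg_eq_negOnePow_smul {G : Type*} [AddCommGroup G] (x : G) :
    -x = (1 : ℤ).negOnePow • x := by
  rw [Int.negOnePow_one, Units.neg_smul, one_smul]

/-! ### Terms in which the unit produced by `B` is multiplied with a neighbour -/

section Unit

variable {m : A.cochains 1}

theorem IsStrictlyUnitalCurved.cw_eq_zero (hm : IsStrictlyUnitalCurved m) {X Y Z : A.Ob}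
    (s : A.Path X Y) (t : A.Path Y Z) (b : A.Path Z X) (h : s.length + t.length ≠ 1) :
    cw (value m (ins s (A.unit Y) t)) b = 0 := cw_value m _ _ (hm.eq_zero s t h)

theorem IsStrictlyUnitalCurved.cw_unit_left (hm : IsStrictlyUnitalCurved m) {X Y : A.Ob}
    (x : A.Arr X Y) (b : A.Path Y X) :
    cw (value m (ins (.nil X) (A.unit X) (.cons x (.nil Y)))) b = cw x b := by
  have h := (isLin_cw_head b).map_units_smul (x := value m (ins (.nil X) (A.unit X) (.cons x
    (.nil Y)))) (x₁ := x) (by change x.1 = 1 + (0 - 1 + (x.1 - 1 + 0)) + 1; ring) 1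
    (by rw [one_smul]; exact hm.unit_left _ _ x)
  rwa [one_smul] at h

theorem IsStrictlyUnitalCurved.cw_unit_right (hm : IsStrictlyUnitalCurved m) {X Y : A.Ob}
    (x : A.Arr X Y) (b : A.Path Y X) :
    cw (value m (ins (.cons x (.nil Y)) (A.unit Y) (.nil Y))) b =
      (sdeg₁ x + 1).negOnePow • cw x b :=
  ((isLin_cw_head b).map_units_smul (x := value m (ins (.cons x (.nil Y)) (A.unit Y) (.nil Y)))
    (x₁ := x) (by change x.1 = 1 + (x.1 - 1 + (0 - 1 + 0)) + 1; ring) x.1.negOnePow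
    ((negOnePow_smul_self _ _).symm.trans
      (congrArg (fun z => x.1.negOnePow • z) (hm.unit_right _ _ x)))).trans
  (negOnePow_smul_congr (by simp only [sdeg₁]; push_cast; grind) rfl)

/-- Up to the Koszul sign,
  `m` gives opposite results with a unit to the right and to the left of the
same word. -/
theorem IsStrictlyUnitalCurved.cw_unit_cancel (hm : IsStrictlyUnitalCurved m) {X Y : A.Ob}
    (s : A.Path X Y) (b : A.Path Y X) :
    cw (value m (ins s (A.unit Y) (.nil Y))) b +
      (pdeg s).negOnePow • cw (value m (ins (.nil X) (A.unit X) s)) b = 0 := by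
  by_cases h : s.length = 1
  · obtain ⟨x, rfl⟩ := eq_singleton_of_length h
    rw [hm.cw_unit_left, hm.cw_unit_right, Int.negOnePow_succ, Units.neg_smul, pdeg_cons, pdeg_nil,
      add_zero, neg_add_cancel]
  · rw [hm.cw_eq_zero _ _ _ (by simpa [Word.length] using h),
      hm.cw_eq_zero _ _ _ (by simpa [Word.length] using h), smul_zero, add_zero]

/-- Applied around a leading unit, `m` takes its further inputs from one side only. -/
theorem IsStrictlyUnitalCurved.lieHead_unit (hm : IsStrictlyUnitalCurved m) {X : A.Ob}
    (w : A.Path X X) : lieHead m (A.unit X) w =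
      (w.sum₂ fun b c => ((-1 + pdeg b) * pdeg c).negOnePow •
        cw (value m (ins c (A.unit X) (.nil X))) b) +
      w.sum₂ fun a b => cw (value m (ins (.nil X) (A.unit X) a)) b := by
  have key : lieHead m (A.unit X) w =
      w.sum₂ (fun a t₁ => t₁.sum₂ fun b c => if a.length = 0 then
        ((-1 + pdeg b) * pdeg c).negOnePow • cw (value m (ins c (A.unit X) a)) b else 0) +
      w.sum₂ fun a t₁ => t₁.sum₂ fun b c => if c.length = 0 then
        cw (value m (ins c (A.unit X) a)) b else 0 := by
    rw [lieHead, ← sum₂_add]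
    refine sum₂_congr fun _ a t₁ h₁ => ?_
    rw [← sum₂_add]
    refine sum₂_congr fun _ b c h₂ => ?_
    by_cases h : c.length + a.length = 1
    · by_cases ha : a.length = 0
      · obtain ⟨rfl, ha'⟩ := eq_nil_of_length ha
        obtain rfl := eq_of_heq ha'
        rw [if_pos ha, if_neg (by omega), add_zero]
        exact negOnePow_smul_congr (by rw [sdeg₁_unit, pdeg_nil, add_zero]) rfl
      · have hc : c.length = 0 := by omega
        obtain ⟨rfl, hc'⟩ := eq_nil_of_length hc
        obtain rfl := eq_of_heq hc'
        rw [if_pos hc, if_neg ha, zero_add, pdeg_nil, mul_zero, Int.negOnePow_zero, one_smul]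
    · rw [hm.cw_eq_zero _ _ _ h]
      simp
  rw [key]
  refine congrArg₂ (· + ·) ?_ ?_
  · refine (sum₂_eq_left_nil w _ fun u v hu => sum₂_eq_zero fun _ _ _ _ => if_neg hu).trans ?_
    exact sum₂_congr fun _ _ _ _ => if_pos rfl
  · refine sum₂_congr fun _ a t₁ _ => ?_
    exact (sum₂_eq_right_nil t₁ _ fun u v hv => if_neg hv).trans (if_pos rfl)

/-- In `b B`,
  the terms in which the unit produced by `B` is multiplied with its left neighbour cancel
those in which it is multiplied with its right neighbour, cyclically. -/
theorem IsStrictlyUnitalCurved.sum_lieHead_unit (hm : IsStrictlyUnitalCurved m) {X Y : A.Ob}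
    (x₀ : A.Arr X Y) (t : A.Path Y X) :
    (t.sum₂ fun {Z} a c =>
      ((sdeg₁ x₀ + pdeg a) * pdeg c).negOnePow • lieHead m (A.unit Z) (ins c x₀ a)) = 0 := by
  simp only [hm.lieHead_unit, sum₂_ins, sum₂_add, smul_add, smul_sum₂, negOnePow_smul_smul,
    sum₂_assoc, pdeg_append,
    pdeg_ins]
  rw [sum₂_eq_left_nil t (fun {Z} u v => v.sum₂ fun a b =>
    ((sdeg₁ x₀ + pdeg u) * pdeg v + (-1 + pdeg a) * (pdeg b + sdeg₁ x₀ + pdeg u)).negOnePow •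
      cw (value m (ins (ins b x₀ u) (A.unit Z) (.nil Z))) a) fun u v hu =>
        sum₂_eq_zero fun _ a b _ => by
          rw [hm.cw_eq_zero _ _ _ (by rw [length_ins, Word.length]; omega), smul_zero],
    sum₂_eq_right_nil t (fun a b => ((sdeg₁ x₀ + pdeg (.nil Y : A.Path Y Y)) * pdeg t +
      (-1 + pdeg a) * (pdeg b + sdeg₁ x₀ + pdeg (.nil Y : A.Path Y Y))).negOnePow •
      cw (value m (ins (ins b x₀ (.nil Y)) (A.unit Y) (.nil Y))) a) fun u v hv => by
        rw [hm.cw_eq_zero _ _ _ (by simp only [length_ins, Word.length]; omega), smul_zero],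
    ins_nil, hm.cw_unit_right, negOnePow_smul_smul]
  have e4 : (t.sum₂ fun {Z} a t₁ => t₁.sum₂ fun {Z'} b c =>
      ((sdeg₁ x₀ + (pdeg a + pdeg b)) * pdeg c).negOnePow •
        cw (value m (ins (.nil Z') (A.unit Z') (ins c x₀ a))) b) = cw x₀ t := by
    rw [sum₂_eq_left_nil t (fun {Z} a t₁ => t₁.sum₂ fun {Z'} b c =>
      ((sdeg₁ x₀ + (pdeg a + pdeg b)) * pdeg c).negOnePow •
        cw (value m (ins (.nil Z') (A.unit Z') (ins c x₀ a))) b) fun u v hu =>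
        sum₂_eq_zero fun _ a b _ => by
          rw [hm.cw_eq_zero _ _ _ (by simp only [length_ins, Word.length]; omega), smul_zero],
      sum₂_eq_right_nil t (fun {Z'} b c =>
      ((sdeg₁ x₀ + (pdeg (.nil Y : A.Path Y Y) + pdeg b)) * pdeg c).negOnePow •
        cw (value m (ins (.nil Z') (A.unit Z') (ins c x₀ (.nil Y)))) b) fun u v hv => by
        rw [hm.cw_eq_zero _ _ _ (by simp only [length_ins, Word.length]; omega), smul_zero],
      ins_nil (A := A) x₀, hm.cw_unit_left, pdeg_nil, pdeg_nil, mul_zero, Int.negOnePow_zero,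
        one_smul]
  have e2 : (t.sum₂ fun {Z} a t₁ => t₁.sum₂ fun {Z'} b c =>
      ((sdeg₁ x₀ + (pdeg a + pdeg b)) * pdeg c +
        (-1 + (pdeg c + sdeg₁ x₀ + pdeg a)) * pdeg b).negOnePow •
          cw (value m (ins b (A.unit Z') (.nil Z'))) (ins c x₀ a)) +
      (t.sum₂ fun {Z} u v => v.sum₂ fun a b => ((sdeg₁ x₀ + pdeg u) * pdeg v).negOnePow •
        cw (value m (ins (.nil Z) (A.unit Z) a)) (ins b x₀ u)) = 0 := by
    rw [← sum₂_add]
    refine sum₂_eq_zero fun _ a t₁ h₁ => ?_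
    rw [← sum₂_add]
    refine sum₂_eq_zero fun _ b c h₂ => ?_
    have h := congrArg (fun z => ((sdeg₁ x₀ + (pdeg a + pdeg b)) * pdeg c +
      (-1 + (pdeg c + sdeg₁ x₀ + pdeg a)) * pdeg b).negOnePow • z)
      (hm.cw_unit_cancel b (ins c x₀ a))
    rw [smul_zero, smul_add, negOnePow_smul_smul] at h
    rw [← h]
    refine congrArg (_ + ·) (negOnePow_smul_congr ?_ rfl)
    rw [← h₂, pdeg_append]
    push_cast; grind
  rw [e4, add_assoc, ← add_assoc _ _ (cw x₀ t), e2, zero_add, ← neg_add_cancel (cw x₀ t)]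
  refine congrArg (· + _) ?_
  rw [neg_eq_negOnePow_smul (G := A.ChainGroup)]
  refine negOnePow_smul_congr ?_ rfl
  simp only [pdeg_nil]
  push_cast; grind

/-- If `x₀` is a unit, `b¹_ψ` only multiplies it with a value of `ψ` on its left. -/
theorem IsStrictlyUnitalCurved.rhoCh_unit_head (hm : IsStrictlyUnitalCurved m) {q : ℤ}
    (ψ : A.cochains q) {X : A.Ob} (w : A.Path X X) :
    rhoCh m ψ (A.unit X) w = w.sum₂ fun b e =>
      ((-1 + pdeg b) * pdeg e + q + pdeg e + 1).negOnePow • cw (value ψ e) b := by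
  have h0 : ∀ {T U V W : A.Ob} (a : A.Path X T) (b : A.Path T U) (c : A.Path U V)
      (e : A.Path V W) (f : A.Path W X), c.length + (f.length + a.length) ≠ 0 →
      cw (value m (ins c (value ψ e) (ins f (A.unit X) a))) b = 0 := fun a b c e f h => by
    rw [← ins_ins]; exact hm.cw_eq_zero _ _ _ (by rw [length_ins]; omega)
  rw [rhoCh, sum₂_eq_left_nil w _ fun a t₁ ha => sum₂_eq_zero fun _ b t₂ _ =>
    sum₂_eq_zero fun _ c t₃ _ => sum₂_eq_zero fun _ e f _ => by
      rw [h0 _ _ _ _ _ (by omega), smul_zero]]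
  refine sum₂_congr fun _ b t₂ _ => ?_
  rw [sum₂_eq_left_nil t₂ _ fun c t₃ hc => sum₂_eq_zero fun _ e f _ => by
      rw [h0 _ _ _ _ _ (by omega), smul_zero]]
  rw [sum₂_eq_right_nil t₂ _ fun e f hf => by rw [h0 _ _ _ _ _ (by omega), smul_zero]]
  rw [show ins (.nil _) (value ψ t₂) (ins (.nil X) (A.unit X) (.nil X)) =
    ins (.cons (value ψ t₂) (.nil X)) (A.unit X) (.nil X) from rfl, hm.cw_unit_right,
    negOnePow_smul_smul]
  refine negOnePow_smul_congr ?_ rfl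
  simp only [pdeg_nil, sdeg₁_unit, sdeg₁_value]
  push_cast; grind

/-- In `[b, B¹_ψ]`, the products of the unit produced by `B¹_ψ` with its neighbours cancel in pairs
except at the two ends of its range,
  which are `x₀` and the value of `ψ`. The product with `x₀` gives
the terms of `ℒ_ψ` in which `ψ` is applied away from `x₀`; the product with the value of `ψ` cancels
the terms of `b¹_ψ B` in which `ψ` is applied away from `x₀`,
  and the other terms of `b¹_ψ B` complete
`ℒ_ψ`. -/
theorem IsStrictlyUnitalCurved.sum_lieHead_unit_value (hm : IsStrictlyUnitalCurved m) {q : ℤ}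
    (ψ : A.cochains q) {f : A.ChainGroup →+ A.ChainGroup}
    (hf : ∀ {X Y : A.Ob} (x₀ : A.Arr X Y) (t : A.Path Y X), f (cw x₀ t) = rhoCh m ψ x₀ t)
    {X Y : A.Ob} (x₀ : A.Arr X Y) (t : A.Path Y X) :
    (t.sum₂ fun {Z} a t₁ => t₁.sum₂ fun b t₂ => t₂.sum₂ fun e c =>
        ((sdeg₁ x₀ + pdeg a) * (pdeg b + pdeg e + pdeg c) + q * pdeg b).negOnePow •
        lieHead m (A.unit Z) (ins b (value ψ e) (ins c x₀ a))) + (lieCh ψ x₀ t +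
      q.negOnePow • f (connesCh x₀ t)) = 0 := by
  simp only [lieCh, connesCh, Word.map_sum₂, map_negOnePow_smul, hf, hm.rhoCh_unit_head,
    hm.lieHead_unit, sum₂_ins, sum₂_add, smul_add, smul_sum₂, negOnePow_smul_smul, sum₂_assoc,
    ins_ins, sum₂_flat₃, sum₂_flat₄, pdeg_append,
    pdeg_ins, sdeg₁_value]
  have key : ∀ {G : Type (max v w)} [AddCommGroup G]
      {a₁ a₂ a₃ a₄ a₅ a₆ b₁ b₂ b₃ b₄ : G}, a₁ = 0 → a₂ = -b₁ → a₃ + a₄ = 0 → a₅ = -b₄ → a₆ = 0 →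
      b₂ + b₃ = 0 → a₁ + (a₂ + a₃) + (a₄ + (a₅ + a₆)) + (b₁ + b₂ + (b₃ + b₄)) = 0 := by
    intro G _ a₁ a₂ a₃ a₄ a₅ a₆ b₁ b₂ b₃ b₄ h₁ h₂ h₃ h₄ h₅ h₆
    rw [h₁, h₂, eq_neg_of_add_eq_zero_left h₃, h₄, h₅, eq_neg_of_add_eq_zero_left h₆]
    abel
  refine key ?_ ?_ ?_ ?_ ?_ ?_
  · refine sum₂_eq_zero fun _ u v _ => sum₂_eq_zero fun _ a s _ => sum₂_eq_zero fun _ b s₀ _ =>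
      sum₂_eq_zero fun _ c d _ => ?_
    rw [← ins_ins d, ← ins_ins b, hm.cw_eq_zero _ _ _ (by simp only [length_ins]; omega), smul_zero]
  · rw [sum₂_eq_left_nil t _ fun u v hu => sum₂_eq_zero fun _ u₁ v₁ _ =>
      sum₂_eq_zero fun _ u₂ v₂ _ => sum₂_eq_zero fun _ a b _ => by
        rw [← ins_ins, hm.cw_eq_zero _ _ _ (by simp only [length_ins]; omega), smul_zero]]
    rw [neg_eq_negOnePow_smul (G := A.ChainGroup), smul_sum₂]
    refine sum₂_congr fun _ u₁ v₁ h₁ => ?_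
    rw [smul_sum₂]
    refine sum₂_congr fun _ u₂ v₂ h₂ => ?_
    rw [sum₂_eq_right_nil v₂ _ fun u v hv => by
        rw [← ins_ins, hm.cw_eq_zero _ _ _ (by simp only [length_ins]; omega), smul_zero],
      show ins (.nil X) x₀ (ins (.nil Y) (A.unit Y) (.nil Y)) =
        ins (.cons x₀ (.nil Y)) (A.unit Y) (.nil Y) from rfl, hm.cw_unit_right, negOnePow_smul_smul,
      negOnePow_smul_smul]
    refine negOnePow_smul_congr ?_ rfl
    simp only [pdeg_nil]
    push_cast; grind
  · rw [← sum₂_add]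
    refine sum₂_eq_zero fun _ a t₁ h₁ => ?_
    rw [← sum₂_add]
    refine sum₂_eq_zero fun _ b t₂ h₂ => ?_
    rw [← sum₂_add]
    refine sum₂_eq_zero fun _ c t₃ h₃ => ?_
    rw [← sum₂_add]
    refine sum₂_eq_zero fun _ e f h₄ => ?_
    have h := congrArg (fun z => ((sdeg₁ x₀ + pdeg a) * (pdeg b + pdeg c + pdeg e + pdeg f) +
      q * (pdeg b + pdeg c) + pdeg b).negOnePow • z)
      (hm.cw_unit_cancel b (ins c (value ψ e) (ins f x₀ a)))
    rw [smul_zero, smul_add, negOnePow_smul_smul] at h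
    rw [← h]
    exact congrArg₂ (· + ·) (negOnePow_smul_congr (by push_cast; grind) rfl)
      (negOnePow_smul_congr (by push_cast; grind) rfl)
  · rw [neg_eq_negOnePow_smul (G := A.ChainGroup), smul_sum₂]
    refine sum₂_congr fun _ a t₁ h₁ => ?_
    rw [sum₂_eq_left_nil t₁ _ fun u v hu => sum₂_eq_zero fun _ u₂ v₂ _ =>
      sum₂_eq_zero fun _ a b _ => by
        rw [hm.cw_eq_zero _ _ _ (by simp only [length_ins, Word.length]; omega), smul_zero],
          smul_sum₂]
    refine sum₂_congr fun _ u₂ v₂ h₂ => ?_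
    rw [sum₂_eq_left_nil v₂ _ fun u v hu => by
        rw [hm.cw_eq_zero _ _ _ (by simp only [length_ins, Word.length]; omega), smul_zero],
      ins_nil (A := A) (value ψ u₂), hm.cw_unit_left, negOnePow_smul_smul]
    refine negOnePow_smul_congr ?_ rfl
    simp only [pdeg_nil]
    push_cast; grind
  · refine sum₂_eq_zero fun _ u v _ => sum₂_eq_zero fun _ a s _ => sum₂_eq_zero fun _ b s₀ _ =>
      sum₂_eq_zero fun _ c d _ => ?_
    rw [hm.cw_eq_zero _ _ _ (by simp only [length_ins]; omega), smul_zero]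
  · rw [← sum₂_add]
    refine sum₂_eq_zero fun _ a t₁ h₁ => ?_
    rw [← sum₂_add]
    refine sum₂_eq_zero fun _ b c h₂ => ?_
    rw [← neg_add_cancel (((sdeg₁ x₀ + pdeg a + pdeg b) * pdeg c).negOnePow •
      cw (value ψ (ins c x₀ a)) b), add_comm]
    refine congrArg (· + _) ?_
    rw [neg_eq_negOnePow_smul (G := A.ChainGroup), negOnePow_smul_smul]
    refine negOnePow_smul_congr ?_ rfl
    rw [← h₂, pdeg_append]
    push_cast; grind

end Unit
end UnitalGradedQuiver

namespace UnitalGradedQuiver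

open Word

variable {R : Type u} [Ring R] {𝓡 : ℤ → AddSubgroup R} [GradedRing 𝓡]
  {A : UnitalGradedQuiver.{u, v, w} 𝓡}

/-! ### Dependence of the operators on the cochains -/

theorem IsLin.map_value_lin {G : Type*} [AddCommGroup G] {act : ∀ {i : ℤ}, 𝓡 i → G →+ G}
    {X Y : A.Ob} {n : ℤ} {Φ : A.Arr X Y → G} (h : IsLin act n Φ) {p p₁ p₂ : ℤ}
    {φ : A.cochains p} {φ₁ : A.cochains p₁} {φ₂ : A.cochains p₂} {k₁ k₂ : ℤ} (h₁ : p₁ = p)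
    (h₂ : p₂ = p) (hφ : φ.1 = k₁ • φ₁.1 + k₂ • φ₂.1) (b : A.Path X Y) :
    Φ (value φ b) = k₁ • Φ (value φ₁ b) + k₂ • Φ (value φ₂ b) := by
  subst h₁
  subst h₂
  exact h.map_lin (x := value φ b) (x₁ := value φ₁ b) (x₂ := value φ₂ b) rfl rfl k₁ k₂
    (by simp only [value, hφ]; rfl)

variable [IsGradedComm 𝓡]

theorem IsLin.map_smulC {G : Type*} [AddCommGroup G] {act : ∀ {i : ℤ}, 𝓡 i → G →+ G}
    {X Y : A.Ob} {n : ℤ} {Φ : A.Arr X Y → G} (h : IsLin act n Φ) {i p : ℤ} (r : 𝓡 i)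
    (φ : A.cochains p) (b : A.Path X Y) :
    Φ (value (smulC r φ) b) = (i * (n + 1)).negOnePow • act r (Φ (value φ b)) := by
  have e := h.map_units_smul (x := value (smulC r φ) b)
    (x₁ := smulArr r (value φ b).2) (by simp only [value, smulArr]; ring) i.negOnePow rfl
  rw [e, h.smul r (x := smulArr r (value φ b).2) (y := value φ b) rfl rfl, negOnePow_smul_smul]
  exact negOnePow_smul_congr (by push_cast; grind) rfl

section Lin

variable {p p₁ p₂ q : ℤ} {φ : A.cochains p} {φ₁ : A.cochains p₁} {φ₂ : A.cochains p₂} {k₁ k₂ : ℤ}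

theorem lieCh_lin (h₁ : p₁ = p) (h₂ : p₂ = p) (h : φ.1 = k₁ • φ₁.1 + k₂ • φ₂.1) {X Y : A.Ob}
    (x₀ : A.Arr X Y) (t : A.Path Y X) :
    lieCh φ x₀ t = k₁ • lieCh φ₁ x₀ t + k₂ • lieCh φ₂ x₀ t := by
  have e : ∀ (k : ℤ) (f : A.ChainGroup), k • f = zsmulAddGroupHom k f := fun _ _ => rfl
  simp only [lieCh, (isLin_cw_tail x₀ _ _).map_value_lin h₁ h₂ h,
    ((isLin_cw_head _)).map_value_lin h₁ h₂ h]
  simp only [e, Word.map_sum₂, map_add, smul_add, sum₂_add, map_negOnePow_smul]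
  subst h₁
  subst h₂
  abel

theorem rhoCh_lin_left (h₁ : p₁ = p) (h₂ : p₂ = p) (h : φ.1 = k₁ • φ₁.1 + k₂ • φ₂.1)
    (ψ : A.cochains q) {X Y : A.Ob} (x₀ : A.Arr X Y) (t : A.Path Y X) :
    rhoCh φ ψ x₀ t = k₁ • rhoCh φ₁ ψ x₀ t + k₂ • rhoCh φ₂ ψ x₀ t := by
  have e : ∀ (k : ℤ) (f : A.ChainGroup), k • f = zsmulAddGroupHom k f := fun _ _ => rfl
  simp only [rhoCh, ((isLin_cw_head _)).map_value_lin h₁ h₂ h]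
  simp only [e, Word.map_sum₂, smul_add, sum₂_add, map_negOnePow_smul]

theorem rhoCh_lin_right (h₁ : p₁ = p) (h₂ : p₂ = p) (h : φ.1 = k₁ • φ₁.1 + k₂ • φ₂.1)
    (ψ : A.cochains q) {X Y : A.Ob} (x₀ : A.Arr X Y) (t : A.Path Y X) :
    rhoCh ψ φ x₀ t = k₁ • rhoCh ψ φ₁ x₀ t + k₂ • rhoCh ψ φ₂ x₀ t := by
  have e : ∀ (k : ℤ) (f : A.ChainGroup), k • f = zsmulAddGroupHom k f := fun _ _ => rfl
  simp only [rhoCh, ((isLin_cw_head _).comp (isLinArr_value ψ _ _)).map_value_lin h₁ h₂ h]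
  simp only [e, Word.map_sum₂, smul_add, sum₂_add, map_negOnePow_smul]
  subst h₁
  subst h₂
  rfl

theorem connesOneCh_lin (h₁ : p₁ = p) (h₂ : p₂ = p) (h : φ.1 = k₁ • φ₁.1 + k₂ • φ₂.1) {X Y : A.Ob}
    (x₀ : A.Arr X Y) (t : A.Path Y X) :
    connesOneCh φ x₀ t = k₁ • connesOneCh φ₁ x₀ t + k₂ • connesOneCh φ₂ x₀ t := by
  have e : ∀ (k : ℤ) (f : A.ChainGroup), k • f = zsmulAddGroupHom k f := fun _ _ => rfl
  simp only [connesOneCh, (isLin_cw_tail _ _ _).map_value_lin h₁ h₂ h]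
  simp only [e, Word.map_sum₂, smul_add, sum₂_add, map_negOnePow_smul]
  subst h₁
  subst h₂
  rfl

end Lin

section Smul

variable {i p q : ℤ} (r : 𝓡 i) (φ : A.cochains p) (ψ : A.cochains q)

theorem lieCh_smulC {X Y : A.Ob} (x₀ : A.Arr X Y) (t : A.Path Y X) :
    lieCh (smulC r φ) x₀ t = chainAct r (lieCh φ x₀ t) := by
  simp only [lieCh, (isLin_cw_tail x₀ _ _).map_smulC, (isLin_cw_head _).map_smulC, map_add,
    Word.map_sum₂, map_negOnePow_smul, negOnePow_smul_smul]
  refine congrArg₂ (· + ·) ?_ ?_ <;>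
  · refine sum₂_congr fun _ _ _ h₁ => sum₂_congr fun _ _ _ h₂ => negOnePow_smul_congr ?_ rfl
    push_cast; grind

theorem rhoCh_smulC_left {X Y : A.Ob} (x₀ : A.Arr X Y) (t : A.Path Y X) :
    rhoCh (smulC r φ) ψ x₀ t = chainAct r (rhoCh φ ψ x₀ t) := by
  simp only [rhoCh, (isLin_cw_head _).map_smulC,
    Word.map_sum₂, map_negOnePow_smul, negOnePow_smul_smul]
  refine sum₂_congr fun _ _ _ h₁ => sum₂_congr fun _ _ _ h₂ => sum₂_congr fun _ _ _ h₃ =>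
    sum₂_congr fun _ _ _ h₄ => negOnePow_smul_congr ?_ rfl
  push_cast; grind

theorem rhoCh_smulC_right {X Y : A.Ob} (x₀ : A.Arr X Y) (t : A.Path Y X) :
    rhoCh φ (smulC r ψ) x₀ t = (i * p).negOnePow • chainAct r (rhoCh φ ψ x₀ t) := by
  simp only [rhoCh, ((isLin_cw_head _).comp (isLinArr_value φ _ _)).map_smulC,
    Word.map_sum₂, map_negOnePow_smul, negOnePow_smul_smul, smul_sum₂]
  refine sum₂_congr fun _ _ _ h₁ => sum₂_congr fun _ _ _ h₂ => sum₂_congr fun _ _ _ h₃ =>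
    sum₂_congr fun _ _ _ h₄ => negOnePow_smul_congr ?_ rfl
  push_cast; grind

theorem connesOneCh_smulC {X Y : A.Ob} (x₀ : A.Arr X Y) (t : A.Path Y X) :
    connesOneCh (smulC r φ) x₀ t = i.negOnePow • chainAct r (connesOneCh φ x₀ t) := by
  simp only [connesOneCh, (isLin_cw_tail _ _ _).map_smulC,
    Word.map_sum₂, map_negOnePow_smul, negOnePow_smul_smul, smul_sum₂]
  refine sum₂_congr fun _ _ _ h₁ => sum₂_congr fun _ _ _ h₂ => sum₂_congr fun _ _ _ h₃ =>
    negOnePow_smul_congr ?_ rfl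
  simp only [sdeg₁_unit]
  push_cast; grind

end Smul

end UnitalGradedQuiver

namespace UnitalGradedQuiver

open Word

variable {R : Type u} [Ring R] {𝓡 : ℤ → AddSubgroup R} [GradedRing 𝓡]
  {A : UnitalGradedQuiver.{u, v, w} 𝓡}

/-! ### The identities satisfied by the operators on chains -/

theorem bracket_eq_lin {p q : ℤ} (φ : A.cochains p) (ψ : A.cochains q) :
    bracket φ ψ = (1 : ℤ) • (circC φ ψ).1 + (-((p * q).negOnePow : ℤ)) • (circC ψ φ).1 := by
  rw [one_smul, neg_smul, ← sub_eq_add_neg]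
  rfl

theorem connesCh_unit_eq_zero {X : A.Ob} (t : A.Path X X) : connesCh (A.unit X) t = 0 :=
  sum₂_eq_zero fun _ _ _ _ => by rw [cw_unit, smul_zero]

theorem connesOneCh_unit_eq_zero {p : ℤ} {φ : A.cochains p} {X : A.Ob} (t : A.Path X X) :
    connesOneCh φ (A.unit X) t = 0 :=
  sum₂_eq_zero fun _ _ _ _ => sum₂_eq_zero fun _ _ _ _ => sum₂_eq_zero fun _ _ _ _ => by
    rw [← ins_ins, cw_unit, smul_zero]

variable (A) in
/-- The ring of additive endomorphisms of the reduced chains. -/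
def ChainEnd : Type max v w := AddMonoid.End A.ChainGroup

instance : Ring A.ChainEnd := inferInstanceAs (Ring (AddMonoid.End A.ChainGroup))

variable (A) in
/-- An element of `ChainEnd A` as an additive map. -/
def ChainEnd.toEnd : A.ChainEnd →+* AddMonoid.End A.ChainGroup :=
  RingHom.id (AddMonoid.End A.ChainGroup)

theorem chainEnd_ext {f g : A.ChainEnd}
    (h : ∀ {X Y : A.Ob} (x₀ : A.Arr X Y) (t : A.Path Y X),
      ChainEnd.toEnd A f (cw x₀ t) = ChainEnd.toEnd A g (cw x₀ t)) : f = g :=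
  chain_hom_ext fun c => h c.head c.tail

variable [IsGradedComm 𝓡]

section Formulas

variable {k p q l : ℤ} {ω : A.cochains k} {φ : A.cochains p} {ψ : A.cochains q}

theorem lieCh_bracket (hk : k = p + q) (h : ω.1 = bracket φ ψ) {X Y : A.Ob} (x₀ : A.Arr X Y)
    (t : A.Path Y X) :
    lieCh ω x₀ t = lieCh (circC φ ψ) x₀ t - (p * q).negOnePow • lieCh (circC ψ φ) x₀ t := by
  rw [lieCh_lin hk.symm (by rw [hk, add_comm]) (h.trans (bracket_eq_lin φ ψ)), one_smul, neg_smul,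
    ← sub_eq_add_neg]
  rfl

theorem rhoCh_bracket_left (hk : k = p + q) (h : ω.1 = bracket φ ψ) (χ : A.cochains l) {X Y : A.Ob}
    (x₀ : A.Arr X Y) (t : A.Path Y X) : rhoCh ω χ x₀ t =
      rhoCh (circC φ ψ) χ x₀ t - (p * q).negOnePow • rhoCh (circC ψ φ) χ x₀ t := by
  rw [rhoCh_lin_left hk.symm (by rw [hk, add_comm]) (h.trans (bracket_eq_lin φ ψ)), one_smul,
    neg_smul, ← sub_eq_add_neg]
  rfl

theorem rhoCh_bracket_right (hk : k = p + q) (h : ω.1 = bracket φ ψ) (χ : A.cochains l)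
    {X Y : A.Ob} (x₀ : A.Arr X Y) (t : A.Path Y X) : rhoCh χ ω x₀ t =
      rhoCh χ (circC φ ψ) x₀ t - (p * q).negOnePow • rhoCh χ (circC ψ φ) x₀ t := by
  rw [rhoCh_lin_right hk.symm (by rw [hk, add_comm]) (h.trans (bracket_eq_lin φ ψ)), one_smul,
    neg_smul, ← sub_eq_add_neg]
  rfl

theorem connesOneCh_bracket (hk : k = p + q) (h : ω.1 = bracket φ ψ) {X Y : A.Ob} (x₀ : A.Arr X Y)
    (t : A.Path Y X) : connesOneCh ω x₀ t =
      connesOneCh (circC φ ψ) x₀ t - (p * q).negOnePow • connesOneCh (circC ψ φ) x₀ t := by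
  rw [connesOneCh_lin hk.symm (by rw [hk, add_comm]) (h.trans (bracket_eq_lin φ ψ)), one_smul,
    neg_smul, ← sub_eq_add_neg]
  rfl

theorem lieCh_zero (h : φ.1 = 0) {X Y : A.Ob} (x₀ : A.Arr X Y) (t : A.Path Y X) :
    lieCh φ x₀ t = 0 := by
  rw [lieCh_lin (φ := φ) (φ₁ := φ) (φ₂ := φ) (k₁ := 0) (k₂ := 0) rfl rfl (by simpa using h),
    zero_smul, zero_add]

theorem rhoCh_zero_left (h : φ.1 = 0) {X Y : A.Ob} (x₀ : A.Arr X Y) (t : A.Path Y X) :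
    rhoCh φ ψ x₀ t = 0 := by
  rw [rhoCh_lin_left (φ := φ) (φ₁ := φ) (φ₂ := φ) (k₁ := 0) (k₂ := 0) rfl rfl (by simpa using h),
    zero_smul, zero_add]

theorem cw_value_unit (hφ : φ.1 ∈ A.reducedFun) {X Y Z : A.Ob} (s : A.Path X Y) (t : A.Path Y Z)
    (b : A.Path Z X) : cw (value φ (ins s (A.unit Y) t)) b = 0 := cw_value φ _ _ (hφ X Y Z s t)

theorem lieHead_unit_eq_zero (hφ : φ.1 ∈ A.reducedFun) {X : A.Ob} (t : A.Path X X) :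
    lieHead φ (A.unit X) t = 0 :=
  sum₂_eq_zero fun _ _ _ _ => sum₂_eq_zero fun _ _ _ _ => by rw [cw_value_unit hφ, smul_zero]

theorem rhoCh_unit_eq_zero (hφ : φ.1 ∈ A.reducedFun) {X : A.Ob} (t : A.Path X X) :
    rhoCh φ ψ (A.unit X) t = 0 :=
  sum₂_eq_zero fun _ _ _ _ => sum₂_eq_zero fun _ _ _ _ => sum₂_eq_zero fun _ _ _ _ =>
    sum₂_eq_zero fun _ _ _ _ => by rw [← ins_ins, cw_value_unit hφ, smul_zero]

/-- The commutators of `ℒ` and `ρ`: the terms of `ℒ_φ ρ_{ψ,χ} ∓ ρ_{ψ,χ} ℒ_φ` with nested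
cochains cancel against those with `φ` and `ψ` exchanged. -/
theorem lie_rhoCh_comm {χ : A.cochains l} {f₁ f₂ g₁ g₂ : A.ChainGroup →+ A.ChainGroup}
    (hf₁ : ∀ {X Y : A.Ob} (x₀ : A.Arr X Y) (t : A.Path Y X), f₁ (cw x₀ t) = lieCh φ x₀ t)
    (hf₂ : ∀ {X Y : A.Ob} (x₀ : A.Arr X Y) (t : A.Path Y X), f₂ (cw x₀ t) = lieCh ψ x₀ t)
    (hg₁ : ∀ {X Y : A.Ob} (x₀ : A.Arr X Y) (t : A.Path Y X), g₁ (cw x₀ t) = rhoCh φ χ x₀ t)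
    (hg₂ : ∀ {X Y : A.Ob} (x₀ : A.Arr X Y) (t : A.Path Y X), g₂ (cw x₀ t) = rhoCh ψ χ x₀ t)
    {X Y : A.Ob} (x₀ : A.Arr X Y) (t : A.Path Y X) :
    f₁ (rhoCh ψ χ x₀ t) - (p * (q + l)).negOnePow • g₂ (lieCh φ x₀ t) -
        (p * q).negOnePow • (f₂ (rhoCh φ χ x₀ t) - (q * (p + l)).negOnePow • g₁ (lieCh ψ x₀ t)) =
      rhoCh (bracketC φ ψ) χ x₀ t + (p * q).negOnePow • rhoCh ψ (bracketC φ χ) x₀ t -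
        rhoCh φ (bracketC ψ χ) x₀ t := by
  rw [rhoCh_bracket_left (ω := bracketC φ ψ) rfl rfl,
    rhoCh_bracket_right (ω := bracketC φ χ) rfl rfl,
      rhoCh_bracket_right (ω := bracketC ψ χ) rfl rfl,
    lie_rhoCh ψ χ φ hf₁, lie_rhoCh φ χ ψ hf₂, eq_sub_of_add_eq (rho_lieCh ψ χ φ hg₂ x₀ t),
    eq_sub_of_add_eq (rho_lieCh φ χ ψ hg₁ x₀ t)]
  simp only [mul_add, Int.negOnePow_add, mul_comm q p]
  rcases Int.units_eq_one_or (p * q).negOnePow with h₁ | h₁ <;>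
  rcases Int.units_eq_one_or (p * l).negOnePow with h₂ | h₂ <;>
  rcases Int.units_eq_one_or (q * l).negOnePow with h₃ | h₃ <;>
  · simp only [h₁, h₂, h₃, mul_one, mul_neg, neg_neg, one_smul, Units.neg_smul]
    abel

end Formulas

/-- `δφ`, with its degree. -/
def hDiff {m : A.cochains 1} (hm : IsStrictlyUnitalCurved m) (φ : A.redCochains.Homog) :
    A.redCochains.Homog := ⟨φ.1 + 1, redDiff hm φ.1 φ.2⟩

/-- `[φ, ψ]`, with its degree. -/
def hBr (φ ψ : A.redCochains.Homog) : A.redCochains.Homog := ⟨φ.1 + ψ.1, redBr φ.1 ψ.1 φ.2 ψ.2⟩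

namespace ReducedOperators

variable {m : A.cochains 1} (T : ReducedOperators A m) (φ ψ χ : A.redCochains.Homog)

/-- `ℒ_φ` as an element of the ring `ChainEnd A`. -/
def eLie : A.ChainEnd := T.lie φ

/-- `ρ_{φ,ψ}` as an element of the ring `ChainEnd A`. -/
def eRho : A.ChainEnd := T.rho φ ψ

/-- `b` as an element of the ring `ChainEnd A`. -/
def eb : A.ChainEnd := T.b

/-- `b¹_φ` as an element of the ring `ChainEnd A`. -/
def eb₁ : A.ChainEnd := T.b₁ φ

/-- `B` as an element of the ring `ChainEnd A`. -/
def eB : A.ChainEnd := T.B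

/-- `B¹_φ` as an element of the ring `ChainEnd A`. -/
def eB₁ : A.ChainEnd := T.B₁ φ

variable {X Y : A.Ob} (x₀ : A.Arr X Y) (t : A.Path Y X)

theorem lie_cw : T.lie φ (cw x₀ t) = lieCh (incl φ.2) x₀ t :=
  isInducedBy_lie.1 (T.lie_induced φ) x₀ t

theorem rho_cw : T.rho φ ψ (cw x₀ t) = rhoCh (incl φ.2) (incl ψ.2) x₀ t :=
  isInducedBy_rho.1 (T.rho_induced φ ψ) x₀ t

theorem b_cw : T.b (cw x₀ t) = lieCh m x₀ t := isInducedBy_lie.1 T.b_induced x₀ t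

theorem b₁_cw : T.b₁ φ (cw x₀ t) = rhoCh m (incl φ.2) x₀ t :=
  isInducedBy_rho.1 (T.b₁_induced φ) x₀ t

theorem B_cw : T.B (cw x₀ t) = connesCh x₀ t := isInducedBy_connes.1 T.B_induced x₀ t

theorem B₁_cw : T.B₁ φ (cw x₀ t) = connesOneCh (incl φ.2) x₀ t :=
  isInducedBy_connesOne.1 (T.B₁_induced φ) x₀ t

theorem eB_eB : T.eB * T.eB = 0 := chainEnd_ext fun x₀ t => by
  change T.B (T.B _) = 0
  rw [B_cw, connesCh, Word.map_sum₂]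
  exact sum₂_eq_zero fun _ _ _ _ => by
    rw [map_negOnePow_smul, B_cw, connesCh_unit_eq_zero, smul_zero]

theorem eB_eB₁ : T.eB * T.eB₁ φ = 0 := chainEnd_ext fun x₀ t => by
  change T.B (T.B₁ φ _) = 0
  rw [B₁_cw, connesOneCh]
  simp only [Word.map_sum₂]
  exact sum₂_eq_zero fun _ _ _ _ => sum₂_eq_zero fun _ _ _ _ => sum₂_eq_zero fun _ _ _ _ => by
    rw [map_negOnePow_smul, B_cw, connesCh_unit_eq_zero, smul_zero]

theorem eB₁_eB : T.eB₁ φ * T.eB = 0 := chainEnd_ext fun x₀ t => by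
  change T.B₁ φ (T.B _) = 0
  rw [B_cw, connesCh, Word.map_sum₂]
  exact sum₂_eq_zero fun _ _ _ _ => by
    rw [map_negOnePow_smul, B₁_cw, connesOneCh_unit_eq_zero, smul_zero]

theorem eRho_eB : T.eRho φ ψ * T.eB = 0 := chainEnd_ext fun x₀ t => by
  change T.rho φ ψ (T.B _) = 0
  rw [B_cw, connesCh, Word.map_sum₂]
  exact sum₂_eq_zero fun _ _ _ _ => by
    rw [map_negOnePow_smul, rho_cw, rhoCh_unit_eq_zero φ.2.2.2, smul_zero]

theorem eB_eLie : T.eB * T.eLie φ = φ.1.negOnePow • (T.eLie φ * T.eB) := chainEnd_ext fun x₀ t => by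
  have h := lie_connesCh (incl φ.2) (T.lie_cw φ) T.B_cw x₀ t
  rw [sum₂_eq_zero fun _ _ _ _ => by rw [lieHead_unit_eq_zero φ.2.2.2, smul_zero], add_zero] at h
  change T.B (T.lie φ _) = φ.1.negOnePow • T.lie φ (T.B _)
  rw [lie_cw, B_cw, h, negOnePow_smul_self]

theorem eLie_eB₁ : T.eLie φ * T.eB₁ ψ - (φ.1 * (ψ.1 + 1)).negOnePow • (T.eB₁ ψ * T.eLie φ) =
    φ.1.negOnePow • (T.eB₁ (hBr φ ψ) + T.eB * T.eRho φ ψ) := chainEnd_ext fun x₀ t => by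
  have h := lie_connesOneCh (incl φ.2) (incl ψ.2) (T.lie_cw φ) T.B_cw (T.B₁_cw ψ) x₀ t
  rw [sum₂_eq_zero fun _ _ _ _ => sum₂_eq_zero fun _ _ _ _ => sum₂_eq_zero fun _ _ _ _ => by
    rw [lieHead_unit_eq_zero φ.2.2.2, smul_zero], add_zero] at h
  change T.lie φ (T.B₁ ψ _) - (φ.1 * (ψ.1 + 1)).negOnePow • T.B₁ ψ (T.lie φ _) =
    φ.1.negOnePow • (T.B₁ (hBr φ ψ) _ + T.B (T.rho φ ψ _))
  rw [B₁_cw, B₁_cw, lie_cw, rho_cw,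
    connesOneCh_bracket (ω := incl (hBr φ ψ).2) (φ := incl φ.2) (ψ := incl ψ.2) rfl rfl]
  rw [eq_sub_of_add_eq h, mul_add, mul_one, smul_add, smul_sub, negOnePow_smul_smul,
    add_comm (φ.1 * ψ.1)]
  abel

/-- The Lie derivative of `ρ`, antisymmetrized; the failure of a single commutator `[ℒ_φ,
  ρ_{ψ,χ}]` to
be of this form is symmetric in `φ` and `ψ`. -/
theorem eLie_eRho :
    T.eLie φ * T.eRho ψ χ - (φ.1 * (ψ.1 + χ.1)).negOnePow • (T.eRho ψ χ * T.eLie φ) -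
      (φ.1 * ψ.1).negOnePow • (T.eLie ψ * T.eRho φ χ -
        (ψ.1 * (φ.1 + χ.1)).negOnePow • (T.eRho φ χ * T.eLie ψ)) =
    T.eRho (hBr φ ψ) χ + (φ.1 * ψ.1).negOnePow • T.eRho ψ (hBr φ χ) - T.eRho φ (hBr ψ χ) :=
  chainEnd_ext fun x₀ t => by
    change T.lie φ (T.rho ψ χ _) - (φ.1 * (ψ.1 + χ.1)).negOnePow • T.rho ψ χ (T.lie φ _) -
      (φ.1 * ψ.1).negOnePow • (T.lie ψ (T.rho φ χ _) -
        (ψ.1 * (φ.1 + χ.1)).negOnePow • T.rho φ χ (T.lie ψ _)) =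
      T.rho (hBr φ ψ) χ _ + (φ.1 * ψ.1).negOnePow • T.rho ψ (hBr φ χ) _ - T.rho φ (hBr ψ χ) _
    simp only [lie_cw, rho_cw]
    exact lie_rhoCh_comm (T.lie_cw φ) (T.lie_cw ψ) (T.rho_cw φ χ) (T.rho_cw ψ χ) x₀ t

theorem eLie_eLie : T.eLie φ * T.eLie ψ =
    (φ.1 * ψ.1).negOnePow • (T.eLie ψ * T.eLie φ) + T.eLie (hBr φ ψ) :=
  chainEnd_ext fun x₀ t => by
    change T.lie φ (T.lie ψ _) =
      (φ.1 * ψ.1).negOnePow • T.lie ψ (T.lie φ _) + T.lie (hBr φ ψ) _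
    simp only [lie_cw]
    rw [lie_lieCh _ _ (T.lie_cw φ), lie_lieCh _ _ (T.lie_cw ψ),
      lieCh_bracket (ω := incl (hBr φ ψ).2) (φ := incl φ.2) (ψ := incl ψ.2) rfl rfl, smul_add,
        smul_add,
      mul_comm ψ.1, negOnePow_smul_self]
    abel

section

variable (hm : IsStrictlyUnitalCurved m)

theorem eb_eLie : T.eb * T.eLie φ = φ.1.negOnePow • (T.eLie φ * T.eb) + T.eLie (hDiff hm φ) :=
  chainEnd_ext fun x₀ t => by
    change T.b (T.lie φ _) = φ.1.negOnePow • T.lie φ (T.b _) + T.lie (hDiff hm φ) _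
    simp only [lie_cw, b_cw]
    rw [lie_lieCh _ _ T.b_cw, lie_lieCh _ _ (T.lie_cw φ),
      lieCh_bracket (ω := incl (hDiff hm φ).2) (φ := m) (ψ := incl φ.2) (add_comm _ _) rfl,
        smul_add, smul_add,
      mul_one, one_mul, negOnePow_smul_self]
    abel

theorem eb_eB (hm : IsStrictlyUnitalCurved m) :
    T.eb * T.eB + T.eB * T.eb = 0 := chainEnd_ext fun x₀ t => by
  change T.b (T.B _) + T.B (T.b _) = 0
  rw [B_cw, b_cw, lie_connesCh m T.b_cw T.B_cw, hm.sum_lieHead_unit, add_zero,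
    Int.negOnePow_one, Units.neg_smul, one_smul, neg_add_cancel]

/-- The Cartan homotopy formula: the `z`-linear part of `[b + zB,
  b¹_φ + zB¹_φ] = -I_{δφ} - zℒ_φ`. The
commutator `[B, B¹_φ]` vanishes on reduced chains. -/
theorem eb_eB₁ : T.eb * T.eB₁ φ + T.eB * T.eb₁ φ +
      φ.1.negOnePow • (T.eB₁ φ * T.eb + T.eb₁ φ * T.eB) = -T.eLie φ - T.eB₁ (hDiff hm φ) :=
  chainEnd_ext fun x₀ t => by
    have h := lie_connesOneCh m (incl φ.2) T.b_cw T.B_cw (T.B₁_cw φ) x₀ t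
    rw [eq_neg_of_add_eq_zero_left (hm.sum_lieHead_unit_value _ (T.b₁_cw φ) x₀ t)] at h
    change T.b (T.B₁ φ _) + T.B (T.b₁ φ _) +
      φ.1.negOnePow • (T.B₁ φ (T.b _) + T.b₁ φ (T.B _)) =
        -T.lie φ _ - T.B₁ (hDiff hm φ) _
    rw [B₁_cw, B₁_cw, lie_cw, b_cw, B_cw, b₁_cw,
      connesOneCh_bracket (ω := incl (hDiff hm φ).2) (φ := m) (ψ := incl φ.2) (add_comm _ _) rfl,
        eq_sub_of_add_eq h]
    simp only [one_mul, Int.negOnePow_add, Int.negOnePow_one]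
    rcases Int.units_eq_one_or φ.1.negOnePow with h₁ | h₁ <;>
    · simp only [h₁, mul_one, mul_neg, neg_neg, one_smul, Units.neg_smul]
      abel

/-- The instance of `lie_rhoCh_comm` in which the outer cochain is `m`: `ρ_{φ,ψ}` is a homotopy for
the compatibility of `b¹` with the bracket. -/
theorem eLie_eb₁ : T.eLie φ * T.eb₁ ψ - (φ.1 * (ψ.1 + 1)).negOnePow • (T.eb₁ ψ * T.eLie φ) =
    φ.1.negOnePow • (T.eb₁ (hBr φ ψ) + T.eb * T.eRho φ ψ -
      (φ.1 + ψ.1).negOnePow • (T.eRho φ ψ * T.eb) - T.eRho (hDiff hm φ) ψ) -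
      T.eRho φ (hDiff hm ψ) := chainEnd_ext fun x₀ t => by
  change T.lie φ (T.b₁ ψ _) - (φ.1 * (ψ.1 + 1)).negOnePow • T.b₁ ψ (T.lie φ _) =
    φ.1.negOnePow • (T.b₁ (hBr φ ψ) _ + T.b (T.rho φ ψ _) -
      (φ.1 + ψ.1).negOnePow • T.rho φ ψ (T.b _) - T.rho (hDiff hm φ) ψ _) -
      T.rho φ (hDiff hm ψ) _
  have h := lie_rhoCh_comm (T.lie_cw φ) T.b_cw (T.rho_cw φ ψ) (T.b₁_cw ψ) x₀ t
  simp only [lie_cw, b₁_cw, rho_cw, b_cw]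
  rw [sub_eq_iff_eq_add] at h
  rw [add_comm ψ.1 1, h, rhoCh_bracket_left (ω := bracketC (incl φ.2) m) rfl rfl,
    rhoCh_bracket_right (ω := bracketC (incl φ.2) (incl ψ.2)) rfl rfl,
    rhoCh_bracket_right (ω := bracketC m (incl ψ.2)) rfl rfl,
      rhoCh_bracket_right (ω := incl (hDiff hm ψ).2) (φ := m) (ψ := incl ψ.2) (add_comm _ _) rfl,
    rhoCh_bracket_left (ω := incl (hDiff hm φ).2) (φ := m) (ψ := incl φ.2) (add_comm _ _) rfl,
    rhoCh_bracket_right (ω := incl (hBr φ ψ).2) (φ := incl φ.2) (ψ := incl ψ.2) rfl rfl]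
  simp only [one_mul, mul_one, Int.negOnePow_add]
  rcases Int.units_eq_one_or φ.1.negOnePow with h₁ | h₁ <;>
  rcases Int.units_eq_one_or ψ.1.negOnePow with h₂ | h₂ <;>
  · simp only [h₁, h₂, mul_one, mul_neg, neg_neg, one_smul, Units.neg_smul]
    abel

variable [Algebra ℚ R]

theorem eb_eb (hm : IsStrictlyUnitalCurved m) : T.eb * T.eb = 0 := chainEnd_ext fun x₀ t => by
  change T.b (T.b _) = 0
  rw [b_cw, lie_lieCh _ _ T.b_cw, lieCh_zero hm.circ_self, one_mul, Int.negOnePow_one,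
    Units.neg_smul, one_smul, zero_add, add_neg_cancel]

theorem eb_eb₁ : T.eb * T.eb₁ φ + φ.1.negOnePow • (T.eb₁ φ * T.eb) = -T.eb₁ (hDiff hm φ) :=
  chainEnd_ext fun x₀ t => by
    change T.b (T.b₁ φ _) + φ.1.negOnePow • T.b₁ φ (T.b _) = -T.b₁ (hDiff hm φ) _
    have h := rho_lieCh m (incl φ.2) m (T.b₁_cw φ) x₀ t
    rw [rhoCh_zero_left (φ := circC m m) hm.circ_self] at h
    rw [b₁_cw, b_cw, b₁_cw, lie_rhoCh _ _ _ T.b_cw,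
      rhoCh_bracket_right (ω := incl (hDiff hm φ).2) (φ := m) (ψ := incl φ.2) (add_comm _ _) rfl]
    rw [eq_sub_of_add_eq h.symm]
    simp only [one_mul, mul_one, Int.negOnePow_add, Int.negOnePow_one, smul_zero]
    rcases Int.units_eq_one_or φ.1.negOnePow with h₁ | h₁ <;>
    · simp only [h₁, mul_one, mul_neg, neg_neg, one_smul, Units.neg_smul]
      abel

end

end ReducedOperators

end UnitalGradedQuiver

/-! ### Sums over triples -/

section Triple

variable {G : Type*} [AddCommMonoid G] (F : ℕ → ℕ → ℕ → G) (n : ℕ)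

theorem sum_antidiagonal_assoc :
    ∑ p ∈ antidiagonal n, ∑ q ∈ antidiagonal p.1, F q.1 q.2 p.2 =
      ∑ p ∈ antidiagonal n, ∑ q ∈ antidiagonal p.2, F p.1 q.1 q.2 := by
  simp only [Finset.sum_sigma']
  apply Finset.sum_nbij' (fun ⟨⟨_i, j⟩, ⟨k, l⟩⟩ => ⟨(k, l + j), (l, j)⟩)
    (fun ⟨⟨i, _j⟩, ⟨k, l⟩⟩ => ⟨(i + k, l), (i, k)⟩)
  · rintro ⟨⟨a, b⟩, ⟨c, d⟩⟩ h
    simp only [Finset.mem_sigma, mem_antidiagonal] at h ⊢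
    obtain ⟨rfl, rfl⟩ := h
    exact ⟨by ring, trivial⟩
  · rintro ⟨⟨a, b⟩, ⟨c, d⟩⟩ h
    simp only [Finset.mem_sigma, mem_antidiagonal] at h ⊢
    obtain ⟨rfl, rfl⟩ := h
    exact ⟨by ring, trivial⟩
  · rintro ⟨⟨a, b⟩, ⟨c, d⟩⟩ h
    simp only [Finset.mem_sigma, mem_antidiagonal] at h
    obtain ⟨rfl, rfl⟩ := h
    rfl
  · rintro ⟨⟨a, b⟩, ⟨c, d⟩⟩ h
    simp only [Finset.mem_sigma, mem_antidiagonal] at h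
    obtain ⟨rfl, rfl⟩ := h
    rfl
  · rintro ⟨⟨a, b⟩, ⟨c, d⟩⟩ h
    rfl

theorem sum_antidiagonal_swap₁₂ :
    ∑ p ∈ antidiagonal n, ∑ q ∈ antidiagonal p.2, F q.1 p.1 q.2 =
      ∑ p ∈ antidiagonal n, ∑ q ∈ antidiagonal p.2, F p.1 q.1 q.2 := by
  rw [← sum_antidiagonal_assoc, ← sum_antidiagonal_assoc fun a b c => F b a c]
  exact Finset.sum_congr rfl fun p _ =>
    Finset.Nat.sum_antidiagonal_swap (f := fun q => F q.1 q.2 p.2)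

theorem sum_antidiagonal_swap₂₃ :
    ∑ p ∈ antidiagonal n, ∑ q ∈ antidiagonal p.2, F p.1 q.2 q.1 =
      ∑ p ∈ antidiagonal n, ∑ q ∈ antidiagonal p.2, F p.1 q.1 q.2 :=
  Finset.sum_congr rfl fun p _ => Finset.Nat.sum_antidiagonal_swap (f := fun q => F p.1 q.1 q.2)

end Triple

section Extension

variable {S : GrRing.{u}} {V : GrMod.{u, w} S} {G : Type*} [AddCommGroup G]

/-! ### Additive functions of homogeneous elements -/

/-- `f` is additive in each degree. -/
def IsAdditive (f : V.Homog → G) : Prop :=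
  ∀ (d : ℤ) (y y' : V.deg d), f ⟨d, y + y'⟩ = f ⟨d, y⟩ + f ⟨d, y'⟩

namespace IsAdditive

variable {f : V.Homog → G}

theorem map_sum (hf : IsAdditive f) {ι : Type*} (s : Finset ι) (g : ι → V.Homog) {y : V.Homog}
    (hd : ∀ i ∈ s, (g i).1 = y.1) (h : (y.2 : V.carrier) = ∑ i ∈ s, ((g i).2 : V.carrier)) :
    f y = ∑ i ∈ s, f (g i) := by
  let F : V.deg y.1 →+ G := AddMonoidHom.mk' (fun z => f ⟨y.1, z⟩) (hf y.1)
  have hm : ∀ i ∈ s, ((g i).2 : V.carrier) ∈ V.deg y.1 := fun i hi => hd i hi ▸ (g i).2.2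
  have e : y.2 = ∑ i ∈ s.attach, (⟨(g i.1).2, hm i.1 i.2⟩ : V.deg y.1) := by
    apply Subtype.ext
    rw [AddSubgroup.val_finsetSum, h]
    exact (Finset.sum_attach s (fun i => ((g i).2 : V.carrier))).symm
  calc f y = F y.2 := rfl
    _ = ∑ i ∈ s.attach, f (g i.1) := by
      rw [e, _root_.map_sum]
      exact Finset.sum_congr rfl fun i _ => congrArg f (homog_ext (hd i.1 i.2).symm rfl)
    _ = ∑ i ∈ s, f (g i) := Finset.sum_attach s (fun i => f (g i))

theorem map_add_of_eq (hf : IsAdditive f) {y y₁ y₂ : V.Homog} (h₁ : y₁.1 = y.1) (h₂ : y₂.1 = y.1)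
    (h : (y.2 : V.carrier) = y₁.2 + y₂.2) : f y = f y₁ + f y₂ := by
  obtain ⟨d, y⟩ := y
  obtain ⟨d₁, y₁⟩ := y₁
  obtain ⟨d₂, y₂⟩ := y₂
  obtain rfl : d₁ = d := h₁
  obtain rfl : d₂ = d₁ := h₂
  obtain rfl : y = y₁ + y₂ := Subtype.ext h
  exact hf _ _ _

theorem map_units_smul_of_eq (hf : IsAdditive f) {y y₁ : V.Homog} (h₁ : y₁.1 = y.1) (u : ℤˣ)
    (h : (y.2 : V.carrier) = u • (y₁.2 : V.carrier)) : f y = u • f y₁ := by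
  let F : V.deg y.1 →+ G := AddMonoidHom.mk' (fun z => f ⟨y.1, z⟩) (hf y.1)
  have hm : (y₁.2 : V.carrier) ∈ V.deg y.1 := h₁ ▸ y₁.2.2
  have e : y.2 = (u : ℤ) • (⟨y₁.2, hm⟩ : V.deg y.1) := Subtype.ext h
  calc f y = F y.2 := rfl
    _ = (u : ℤ) • f ⟨y.1, ⟨y₁.2, hm⟩⟩ := by rw [e, map_zsmul]; rfl
    _ = u • f y₁ := by rw [Units.smul_def, homog_ext (x := ⟨y.1, ⟨y₁.2, hm⟩⟩) (y := y₁) h₁.symm rfl]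

theorem map_neg_of_eq (hf : IsAdditive f) {y y₁ : V.Homog} (h₁ : y₁.1 = y.1)
    (h : (y.2 : V.carrier) = -(y₁.2 : V.carrier)) : f y = -f y₁ := by
  have := hf.map_units_smul_of_eq h₁ (-1) (by rw [h, Units.neg_smul, one_smul])
  rwa [Units.neg_smul, one_smul] at this

theorem map_zero_of_eq (hf : IsAdditive f) {y : V.Homog} (h : (y.2 : V.carrier) = 0) : f y = 0 := by
  have := hf.map_add_of_eq (y := y) (y₁ := y) (y₂ := y) rfl rfl (by rw [h, add_zero])
  simpa using this

end IsAdditive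

theorem Op.IsHom.isAdditive {ℓ : Op V} (h : ℓ.IsHom) (l l' : List V.Homog) :
    IsAdditive fun y => ℓ.toFun (l ++ y :: l') := fun d y y' => h.add l l' d y y'

theorem Op.isHom_of_le_two {ℓ : Op V} (h3 : ∀ l, 3 ≤ l.length → ℓ.toFun l = 0)
    (add₁ : ∀ (d : ℤ) (y y' : V.deg d), ℓ.toFun [⟨d, y + y'⟩] = ℓ.toFun [⟨d, y⟩] + ℓ.toFun [⟨d, y'⟩])
    (add₂ : ∀ (d : ℤ) (y y' : V.deg d) (z : V.Homog),
      ℓ.toFun [⟨d, y + y'⟩, z] = ℓ.toFun [⟨d, y⟩, z] + ℓ.toFun [⟨d, y'⟩, z])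
    (smul₁ : ∀ (i d : ℤ) (r : S.deg i) (y : V.deg d),
      ℓ.toFun [⟨i + d, V.smul r y⟩] = i.negOnePow • V.act i r (ℓ.toFun [⟨d, y⟩]))
    (smul₂ : ∀ (i d : ℤ) (r : S.deg i) (y : V.deg d) (z : V.Homog),
      ℓ.toFun [⟨i + d, V.smul r y⟩, z] = i.negOnePow • V.act i r (ℓ.toFun [⟨d, y⟩, z]))
    (swap : ∀ y z : V.Homog, ℓ.toFun [y, z] = (y.1 * z.1).negOnePow • ℓ.toFun [z, y]) :
    ℓ.IsHom where
  add l l' d y y' := by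
    match l, l' with
    | [], [] => exact add₁ d y y'
    | [], [z] => exact add₂ d y y' z
    | [z], [] =>
      simp only [List.cons_append, List.nil_append]
      rw [swap z, swap z, swap z, add₂, smul_add]
    | [], _ :: _ :: _ => rw [h3, h3, h3, add_zero] <;> simp
    | [_], _ :: _ => rw [h3, h3, h3, add_zero] <;> simp
    | _ :: _ :: _, _ => rw [h3, h3, h3, add_zero] <;> simp <;> omega
  smul l l' i d r y := by
    match l, l' with
    | [], [] => rw [sdeg_nil, add_zero, mul_one]; exact smul₁ i d r y
    | [], [z] => rw [sdeg_nil, add_zero, mul_one]; exact smul₂ i d r y z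
    | [z], [] =>
      simp only [List.cons_append, List.nil_append]
      rw [swap z, swap z, smul₂, map_negOnePow_smul, negOnePow_smul_smul, negOnePow_smul_smul]
      exact negOnePow_smul_congr (by rw [sdeg_cons, sdeg_nil]; push_cast; grind) rfl
    | [], _ :: _ :: _ => rw [h3, h3, map_zero, smul_zero] <;> simp
    | [_], _ :: _ => rw [h3, h3, map_zero, smul_zero] <;> simp
    | _ :: _ :: _, _ => rw [h3, h3, map_zero, smul_zero] <;> simp <;> omega
  swap l l' y y' := by
    match l, l' with
    | [], [] => exact swap y y'
    | [], _ :: _ => rw [h3, h3, smul_zero] <;> simp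
    | _ :: _, _ => rw [h3, h3, smul_zero] <;> simp <;> omega

/-! ### `L_∞` algebras with at most binary operations -/

/-- `ℓ_k = 0` for `k ≥ 3`, and `ℓ_1`, `ℓ_2` satisfy the identities of an `L_∞` algebra. -/
structure Op.IsBinary (ℓ : Op V) : Prop where
  isHom : ℓ.IsHom
  three : ∀ l, 3 ≤ l.length → ℓ.toFun l = 0
  sq_one : ∀ y, ℓ.toFun [ℓ.homog [y]] = 0
  sq_two : ∀ y z, ℓ.toFun [ℓ.homog [y, z]] +
    ((1 + y.1) * z.1).negOnePow • ℓ.toFun [z, ℓ.homog [y]] +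
      y.1.negOnePow • ℓ.toFun [y, ℓ.homog [z]] = 0
  sq_three : ∀ y z t, y.1.negOnePow • ℓ.toFun [y, ℓ.homog [z, t]] +
    ((1 + y.1) * z.1).negOnePow • ℓ.toFun [z, ℓ.homog [y, t]] +
      ((1 + y.1 + z.1) * t.1).negOnePow • ℓ.toFun [t, ℓ.homog [y, z]] = 0

theorem Op.IsBinary.sqV_eq_zero {ℓ : Op V} (h : ℓ.IsBinary) {W : GrMod.{u, v} S} {ℓW : ModOp V W}
    (hW : ℓW.IsHom) (l : List V.Homog) : (GOp.ofOps ℓ ℓW).sqV l = 0 :=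
  (GOp.isHom_ofOps h.isHom hW).sqV_eq_zero ℓ.nil h.three h.sq_one h.sq_two h.sq_three l

theorem Op.IsBinary.isLInfinityAlgebra {ℓ : Op V} (h : ℓ.IsBinary) : IsLInfinityAlgebra ℓ :=
  GOp.isLInfinityAlgebra_of_sqV h.isHom (h.sqV_eq_zero GOp.isHom_modOp_zero)

/-! ### Extension to power series -/

theorem psEval_eq_zero {X : Type v} [AddCommMonoid X] (l : List (psMod V).Homog) :
    ∀ (F : List V.Homog → X) (n : ℕ), (∀ t, t.length = l.length → F t = 0) → psEval F l n = 0 := by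
  induction l with
  | nil =>
    intro F n h
    rw [psEval]
    split_ifs
    · exact h [] rfl
    · rfl
  | cons y l ih =>
    intro F n h
    rw [psEval]
    exact Finset.sum_eq_zero fun p _ => ih _ _ fun t ht => h _ (by simp [ht])

theorem psEval_one {X : Type v} [AddCommMonoid X] (F : List V.Homog → X) (y : (psMod V).Homog)
    (n : ℕ) : psEval F [y] n = F [psCoeff y n] := by
  rw [psEval, Finset.sum_eq_single (n, 0)]
  · simp [psEval]
  · rintro ⟨a, b⟩ hab hne
    have hb : b ≠ 0 := by
      rintro rfl
      have := mem_antidiagonal.1 hab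
      exact hne (by simpa using this)
    simp [psEval, hb]
  · intro h
    exact absurd (mem_antidiagonal.2 (by simp)) h

theorem psEval_two {X : Type v} [AddCommMonoid X] (F : List V.Homog → X) (y z : (psMod V).Homog)
    (n : ℕ) : psEval F [y, z] n = ∑ p ∈ antidiagonal n, F [psCoeff y p.1, psCoeff z p.2] := by
  rw [psEval]
  exact Finset.sum_congr rfl fun p _ => psEval_one _ z p.2

/-- The `z`-multilinear extension of `{ℓ_k}` to `V[[z]]`. -/
def psOp (ℓ : Op V) : Op (psMod V) where
  toFun := ℓ.ps
  nil := funext fun n => by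
    change psEval _ _ _ = (0 : V.carrier)
    simp [psEval, ℓ.nil]
  mem l n := psEval_mem _ _ _ _ fun t ht => by
    have := ℓ.mem t
    rwa [ht, show sdeg l - 2 * (n : ℤ) + 1 = sdeg l + 1 - 2 * n by ring] at this

section PsOp

variable {ℓ : Op V} {f : V.Homog → G}

theorem psCoeff_psOp_one (y : (psMod V).Homog) (n : ℕ) :
    psCoeff ((psOp ℓ).homog [y]) n = ℓ.homog [psCoeff y n] :=
  homog_ext (by simp only [psCoeff, Op.homog, sdeg_cons, sdeg_nil]; ring) (psEval_one _ y n)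

theorem IsAdditive.psCoeff_psOp_two (hf : IsAdditive f) (y z : (psMod V).Homog) (n : ℕ) :
    f (psCoeff ((psOp ℓ).homog [y, z]) n) =
      ∑ p ∈ antidiagonal n, f (ℓ.homog [psCoeff y p.1, psCoeff z p.2]) := by
  refine hf.map_sum _ _ (fun p hp => ?_) (psEval_two _ y z n)
  have := mem_antidiagonal.1 hp
  simp only [psCoeff, Op.homog, sdeg_cons, sdeg_nil, ← this]
  push_cast; ring

theorem IsAdditive.psCoeff (hf : IsAdditive f) (n : ℕ) :
    IsAdditive fun y : (psMod V).Homog => f (psCoeff y n) := fun d y y' =>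
  hf (d - 2 * n) ⟨y.1 n, y.2 n⟩ ⟨y'.1 n, y'.2 n⟩

theorem IsAdditive.psCoeff_smul (hf : IsAdditive f) {i d : ℤ} (r : (psRing S).deg i)
    (y : (psMod V).deg d) (n : ℕ) : f (CHStruct.psCoeff ⟨i + d, (psMod V).smul r y⟩ n) =
      ∑ p ∈ antidiagonal n, f ⟨i - 2 * p.1 + (d - 2 * p.2),
        V.smul (psRingCoeff i p.1 r) (CHStruct.psCoeff ⟨d, y⟩ p.2).2⟩ := by
  refine hf.map_sum _ _ (fun p hp => ?_) rfl
  have := mem_antidiagonal.1 hp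
  simp only [CHStruct.psCoeff, ← this]
  push_cast; ring

theorem psOp_isHom (h : ℓ.IsHom) (h3 : ∀ l, 3 ≤ l.length → ℓ.toFun l = 0) : (psOp ℓ).IsHom := by
  have a₁ : IsAdditive fun y => ℓ.toFun [y] := h.isAdditive [] []
  have a₂ : ∀ z, IsAdditive fun y => ℓ.toFun [y, z] := fun z => h.isAdditive [] [z]
  have s : ∀ (i : ℤ) (a : ℕ), (i - 2 * (a : ℤ)).negOnePow = i.negOnePow := fun i a =>
    negOnePow_eq_of_zmod (by push_cast; grind)
  refine Op.isHom_of_le_two (fun l hl => funext fun n => ?_) (fun d y y' => funext fun n => ?_)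
    (fun d y y' z => funext fun n => ?_) (fun i d r y => funext fun n => ?_)
    (fun i d r y z => funext fun n => ?_) (fun y z => funext fun n => ?_)
  · exact psEval_eq_zero _ _ _ fun t ht => h3 t (ht ▸ hl)
  · exact (psEval_one _ _ n).trans ((a₁.psCoeff n d y y').trans
      (congrArg₂ (· + ·) (psEval_one _ _ n).symm (psEval_one _ _ n).symm))
  · refine (psEval_two _ _ _ n).trans ((Finset.sum_congr rfl fun p _ =>
      (a₂ _).psCoeff p.1 d y y').trans (Finset.sum_add_distrib.trans ?_))
    exact congrArg₂ (· + ·) (psEval_two _ _ _ n).symm (psEval_two _ _ _ n).symm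
  · refine (psEval_one _ _ n).trans ((a₁.psCoeff_smul r y n).trans ?_)
    change _ = i.negOnePow • ∑ p ∈ antidiagonal n, V.act _ _ (psEval ℓ.toFun _ p.2)
    rw [Finset.smul_sum]
    refine Finset.sum_congr rfl fun p _ => ?_
    rw [psEval_one]
    refine (h.smul [] [] _ _ _ _).trans ?_
    rw [sdeg_nil, add_zero, mul_one, s]
    rfl
  · refine (psEval_two _ _ _ n).trans ((Finset.sum_congr rfl fun p _ =>
      (a₂ _).psCoeff_smul r y p.1).trans ?_)
    change _ = i.negOnePow • ∑ p ∈ antidiagonal n, V.act _ _ (psEval ℓ.toFun _ p.2)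
    rw [Finset.smul_sum]
    have e := sum_antidiagonal_assoc (fun a b c => i.negOnePow • V.act _ (psRingCoeff i a r)
      (ℓ.toFun [psCoeff ⟨d, y⟩ b, psCoeff z c])) n
    refine (Eq.trans (Finset.sum_congr rfl fun p _ => Finset.sum_congr rfl fun q _ => ?_) e).trans
      (Finset.sum_congr rfl fun p _ => ?_)
    · refine (h.smul [] [psCoeff z p.2] _ _ _ _).trans ?_
      rw [sdeg_nil, add_zero, mul_one, s]
      rfl
    · rw [psEval_two, map_sum, Finset.smul_sum]
  · refine (psEval_two _ _ _ n).trans ?_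
    change _ = (y.1 * z.1).negOnePow • psEval ℓ.toFun _ n
    rw [psEval_two, ← Finset.Nat.sum_antidiagonal_swap, Finset.smul_sum]
    refine Finset.sum_congr rfl fun p _ => (h.swap [] [] _ _).trans ?_
    refine negOnePow_smul_congr ?_ rfl
    simp only [psCoeff]
    push_cast; grind

theorem Op.IsBinary.psOp (h : ℓ.IsBinary) : (psOp ℓ).IsBinary where
  isHom := psOp_isHom h.isHom h.three
  three l hl := funext fun n => psEval_eq_zero _ _ _ fun t ht => h.three t (ht ▸ hl)
  sq_one y := funext fun n => (psEval_one _ _ n).trans (by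
    rw [psCoeff_psOp_one]
    exact h.sq_one _)
  sq_two y z := funext fun n => by
    have a₁ : IsAdditive fun y => ℓ.toFun [y] := h.isHom.isAdditive [] []
    change psEval ℓ.toFun _ n + ((1 + y.1) * z.1).negOnePow • psEval ℓ.toFun _ n +
      y.1.negOnePow • psEval ℓ.toFun _ n = 0
    rw [psEval_one, psEval_two, psEval_two, a₁.psCoeff_psOp_two,
      ← Finset.Nat.sum_antidiagonal_swap
        (f := fun p => ℓ.toFun [psCoeff z p.1, psCoeff ((CHStruct.psOp ℓ).homog [y]) p.2]),
      Finset.smul_sum, Finset.smul_sum, ← Finset.sum_add_distrib, ← Finset.sum_add_distrib]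
    refine Finset.sum_eq_zero fun p _ => ?_
    rw [← h.sq_two (psCoeff y p.1) (psCoeff z p.2)]
    simp only [Prod.fst_swap, Prod.snd_swap, psCoeff_psOp_one]
    refine congrArg₂ (· + ·) (congrArg (_ + ·) ?_) ?_ <;>
    · refine negOnePow_smul_congr ?_ rfl
      simp only [psCoeff]
      push_cast; grind
  sq_three y z t := funext fun n => by
    have a₂ : ∀ z, IsAdditive fun y => ℓ.toFun [z, y] := fun z => h.isHom.isAdditive [z] []
    have e : ∀ x y z, psEval ℓ.toFun [x, (CHStruct.psOp ℓ).homog [y, z]] n =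
        ∑ p ∈ antidiagonal n, ∑ q ∈ antidiagonal p.2,
          ℓ.toFun [psCoeff x p.1, ℓ.homog [psCoeff y q.1, psCoeff z q.2]] := fun x y z => by
      rw [psEval_two]
      exact Finset.sum_congr rfl fun p _ => (a₂ _).psCoeff_psOp_two y z p.2
    change y.1.negOnePow • psEval ℓ.toFun _ n + ((1 + y.1) * z.1).negOnePow • psEval ℓ.toFun _ n +
      ((1 + y.1 + z.1) * t.1).negOnePow • psEval ℓ.toFun _ n = 0
    rw [e, e, e, ← sum_antidiagonal_swap₁₂ (fun a b c =>
        ℓ.toFun [psCoeff z a, ℓ.homog [psCoeff y b, psCoeff t c]]),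
      ← sum_antidiagonal_swap₁₂ (fun a b c =>
        ℓ.toFun [psCoeff t a, ℓ.homog [psCoeff y b, psCoeff z c]]),
      ← sum_antidiagonal_swap₂₃ (fun b a c =>
        ℓ.toFun [psCoeff t a, ℓ.homog [psCoeff y b, psCoeff z c]])]
    simp only [Finset.smul_sum, ← Finset.sum_add_distrib]
    refine Finset.sum_eq_zero fun p _ => Finset.sum_eq_zero fun q _ => ?_
    rw [← h.sq_three (psCoeff y p.1) (psCoeff z q.1) (psCoeff t q.2)]
    refine congrArg₂ (· + ·) (congrArg₂ (· + ·) ?_ ?_) ?_ <;>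
    · refine negOnePow_smul_congr ?_ rfl
      simp only [psCoeff]
      push_cast; grind

end PsOp

end Extension

section Cone

variable {S : GrRing.{u}} {V : GrMod.{u, w} S} {G : Type*} [AddCommGroup G]

/-! ### Multiplication by `z` -/

/-- Multiplication by `z`, as an additive map. -/
def zmulHom (V : GrMod.{u, w} S) : (psMod V).carrier →+ (psMod V).carrier :=
  AddMonoidHom.mk' (zmul (X := V.carrier)) fun x y => funext fun n => by
    cases n with
    | zero => exact (add_zero (0 : V.carrier)).symm
    | succ n => rfl

theorem zmulHom_act {i : ℤ} (r : (psRing S).deg i) (x : (psMod V).carrier) :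
    zmulHom V ((psMod V).act i r x) = (psMod V).act i r (zmulHom V x) := by
  funext n
  cases n with
  | zero =>
    change (0 : V.carrier) = ∑ p ∈ antidiagonal 0, V.act _ _ (zmul x p.2)
    simp [zmul]
  | succ n =>
    change ∑ p ∈ antidiagonal n, V.act _ _ (x p.2) =
      ∑ p ∈ antidiagonal (n + 1), V.act _ _ (zmul x p.2)
    rw [Finset.Nat.sum_antidiagonal_succ']
    simp [zmul]

/-- `z y`, with its degree. -/
def zHomog (y : (psMod V).Homog) : (psMod V).Homog :=
  ⟨y.1 + 2, zmulHom V (y.2 : (psMod V).carrier), fun n => by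
    cases n with
    | zero => exact zero_mem _
    | succ n =>
      have := y.2.2 n
      rwa [show y.1 - 2 * (n : ℤ) = y.1 + 2 - 2 * ((n + 1 : ℕ) : ℤ) by push_cast; ring] at this⟩

theorem IsAdditive.psCoeff_zHomog_zero {f : V.Homog → G} (hf : IsAdditive f)
    (y : (psMod V).Homog) : f (CHStruct.psCoeff (zHomog y) 0) = 0 := hf.map_zero_of_eq rfl

theorem psCoeff_zHomog_succ (y : (psMod V).Homog) (n : ℕ) :
    psCoeff (zHomog y) (n + 1) = psCoeff y n :=
  homog_ext (by simp only [psCoeff, zHomog]; push_cast; ring) rfl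

theorem psOp_one_zHomog {ℓ : Op V} (h : ℓ.IsHom) (y : (psMod V).Homog) :
    (psOp ℓ).toFun [zHomog y] = zmulHom V ((psOp ℓ).toFun [y]) := by
  have a₁ : IsAdditive fun y => ℓ.toFun [y] := h.isAdditive [] []
  funext n
  refine (psEval_one _ _ n).trans ?_
  cases n with
  | zero => exact a₁.psCoeff_zHomog_zero y
  | succ n => rw [psCoeff_zHomog_succ]; exact (psEval_one _ _ n).symm

theorem psOp_two_zHomog {ℓ : Op V} (h : ℓ.IsHom) (y z : (psMod V).Homog) :
    (psOp ℓ).toFun [y, zHomog z] = zmulHom V ((psOp ℓ).toFun [y, z]) := by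
  have a₂ : ∀ y, IsAdditive fun z => ℓ.toFun [y, z] := fun y => h.isAdditive [y] []
  funext n
  refine (psEval_two _ _ _ n).trans ?_
  cases n with
  | zero =>
    refine Finset.sum_eq_zero fun p hp => ?_
    have h0 : p.2 = 0 := by have := mem_antidiagonal.1 hp; omega
    rw [h0]
    exact (a₂ _).psCoeff_zHomog_zero z
  | succ n =>
    rw [Finset.Nat.sum_antidiagonal_succ', (a₂ _).psCoeff_zHomog_zero z, zero_add]
    simp only [psCoeff_zHomog_succ]
    exact (psEval_two _ _ _ n).symm

/-! ### The operations on the cone -/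

variable {ℓ : Op V}

theorem coneOp_one (y : (cone V).Homog) : (coneOp ℓ).toFun [y] =
    ((psOp ℓ).toFun [cone.fst y] + zmulHom V (cone.snd y).2.1,
      -(psOp ℓ).toFun [cone.snd y]) := by
  refine Prod.ext rfl ?_
  change -((epsTerms [y]).map _).sum = -ℓ.ps _
  simp [epsTerms]

theorem coneOp_two (y z : (cone V).Homog) : (coneOp ℓ).toFun [y, z] =
    ((psOp ℓ).toFun [cone.fst y, cone.fst z], -((psOp ℓ).toFun [cone.snd y, cone.fst z] +
      y.1.negOnePow • (psOp ℓ).toFun [cone.fst y, cone.snd z])) := by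
  refine Prod.ext (add_zero _) ?_
  change -((epsTerms [y, z]).map _).sum = -(ℓ.ps _ + _ • ℓ.ps _)
  simp [epsTerms]

/-- The projection `y + ε y' ↦ y`. -/
def cone.fstHom (V : GrMod.{u, w} S) : (cone V).carrier →+ (psMod V).carrier :=
  AddMonoidHom.fst (psMod V).carrier (psMod V).carrier

/-- The projection `y + ε y' ↦ y'`. -/
def cone.sndHom (V : GrMod.{u, w} S) : (cone V).carrier →+ (psMod V).carrier :=
  AddMonoidHom.snd (psMod V).carrier (psMod V).carrier

theorem cone.fst_fst (y : (cone V).Homog) : (cone.fst y).1 = y.1 := rfl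

theorem cone.snd_fst (y : (cone V).Homog) : (cone.snd y).1 = y.1 - 1 := rfl

theorem cone.ext {x y : (cone V).carrier} (h₁ : cone.fstHom V x = cone.fstHom V y)
    (h₂ : cone.sndHom V x = cone.sndHom V y) : x = y :=
  Prod.ext h₁ h₂

theorem cone.fstHom_one (y : (cone V).Homog) : cone.fstHom V ((coneOp ℓ).toFun [y]) =
    (psOp ℓ).toFun [cone.fst y] + zmulHom V (cone.snd y).2.1 :=
  congrArg Prod.fst (coneOp_one y)

theorem cone.sndHom_one (y : (cone V).Homog) : cone.sndHom V ((coneOp ℓ).toFun [y]) =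
    -(psOp ℓ).toFun [cone.snd y] :=
  congrArg Prod.snd (coneOp_one y)

theorem cone.fstHom_two (y z : (cone V).Homog) : cone.fstHom V ((coneOp ℓ).toFun [y, z]) =
    (psOp ℓ).toFun [cone.fst y, cone.fst z] :=
  congrArg Prod.fst (coneOp_two y z)

theorem cone.sndHom_two (y z : (cone V).Homog) : cone.sndHom V ((coneOp ℓ).toFun [y, z]) =
    -((psOp ℓ).toFun [cone.snd y, cone.fst z] +
      y.1.negOnePow • (psOp ℓ).toFun [cone.fst y, cone.snd z]) :=
  congrArg Prod.snd (coneOp_two y z)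

theorem cone.snd_homog (l : List (cone V).Homog) :
    ((cone.snd ((coneOp ℓ).homog l)).2 : (psMod V).carrier) =
      cone.sndHom V ((coneOp ℓ).toFun l) := rfl

theorem epsTerms_length (l : List (cone V).Homog) : ∀ t ∈ epsTerms l, t.2.length = l.length := by
  induction l with
  | nil => simp [epsTerms]
  | cons y l ih =>
    intro t ht
    rw [epsTerms, List.mem_cons, List.mem_map] at ht
    rcases ht with rfl | ⟨s, hs, rfl⟩
    · simp
    · simp [ih s hs]

theorem coneOp_three (h3 : ∀ l, 3 ≤ l.length → ℓ.toFun l = 0) (l : List (cone V).Homog)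
    (hl : 3 ≤ l.length) : (coneOp ℓ).toFun l = 0 := by
  have hp : ∀ t : List (psMod V).Homog, 3 ≤ t.length → ℓ.ps t = 0 := fun t ht =>
    funext fun n => psEval_eq_zero _ _ _ fun t' ht' => h3 t' (ht' ▸ ht)
  refine Prod.ext ?_ ?_
  · change ℓ.ps _ + coneZ l = 0
    rw [hp _ (by simpa using hl), zero_add]
    match l, hl with
    | _ :: _ :: _ :: _, _ => rfl
  · change -(List.map _ _).sum = (0 : (psMod V).carrier)
    rw [List.sum_eq_zero, neg_zero]
    intro x hx
    obtain ⟨t, ht, rfl⟩ := List.mem_map.1 hx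
    rw [hp _ (by rw [epsTerms_length l t ht]; exact hl), smul_zero]

variable {f : (psMod V).Homog → G}

theorem IsAdditive.fst_one (hf : IsAdditive f) (y : (cone V).Homog) :
    f (cone.fst ((coneOp ℓ).homog [y])) =
      f ((psOp ℓ).homog [cone.fst y]) + f (zHomog (cone.snd y)) :=
  hf.map_add_of_eq rfl
    (by simp only [Op.homog, cone.fst, cone.snd, zHomog, sdeg_cons, sdeg_nil]; ring)
    (congrArg Prod.fst (coneOp_one y))

theorem IsAdditive.snd_one (hf : IsAdditive f) (y : (cone V).Homog) :
    f (cone.snd ((coneOp ℓ).homog [y])) = -f ((psOp ℓ).homog [cone.snd y]) :=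
  hf.map_neg_of_eq (by simp only [Op.homog, cone.snd, sdeg_cons, sdeg_nil]; ring)
    (congrArg Prod.snd (coneOp_one y))

theorem cone.fst_homog_two (y z : (cone V).Homog) :
    cone.fst ((coneOp ℓ).homog [y, z]) = (psOp ℓ).homog [cone.fst y, cone.fst z] :=
  homog_ext rfl (congrArg Prod.fst (coneOp_two y z))

theorem IsAdditive.snd_two (hf : IsAdditive f) (y z : (cone V).Homog) :
    f (cone.snd ((coneOp ℓ).homog [y, z])) =
      -(f ((psOp ℓ).homog [cone.snd y, cone.fst z]) +
        y.1.negOnePow • f ((psOp ℓ).homog [cone.fst y, cone.snd z])) := by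
  let x : (psMod V).Homog := ⟨y.1 + z.1, y.1.negOnePow •
    (psOp ℓ).toFun [cone.fst y, cone.snd z], units_smul_mem _ (by
      have := (psOp ℓ).mem [cone.fst y, cone.snd z]
      rwa [show sdeg [cone.fst y, cone.snd z] + 1 = y.1 + z.1 by
        simp only [cone.fst, cone.snd, sdeg_cons, sdeg_nil]; ring] at this)⟩
  let x' : (psMod V).Homog := ⟨y.1 + z.1, (psOp ℓ).toFun [cone.snd y, cone.fst z] +
    y.1.negOnePow • (psOp ℓ).toFun [cone.fst y, cone.snd z], add_mem (by
      have := (psOp ℓ).mem [cone.snd y, cone.fst z]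
      rwa [show sdeg [cone.snd y, cone.fst z] + 1 = y.1 + z.1 by
        simp only [cone.fst, cone.snd, sdeg_cons, sdeg_nil]; ring] at this) x.2.2⟩
  rw [hf.map_neg_of_eq (y₁ := x') (by simp only [x', Op.homog, cone.snd, sdeg_cons, sdeg_nil]; ring)
      (congrArg Prod.snd (coneOp_two y z)),
    hf.map_add_of_eq (y := x') (y₁ := (psOp ℓ).homog [cone.snd y, cone.fst z]) (y₂ := x)
      (by simp only [x', Op.homog, cone.fst, cone.snd, sdeg_cons, sdeg_nil]; ring) rfl rfl,
    hf.map_units_smul_of_eq (y := x) (y₁ := (psOp ℓ).homog [cone.fst y, cone.snd z])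
      (by simp only [x, Op.homog, cone.fst, cone.snd, sdeg_cons, sdeg_nil]; ring) _ rfl]

theorem IsAdditive.fst (hf : IsAdditive f) : IsAdditive fun y : (cone V).Homog => f (cone.fst y) :=
  fun d y y' => hf d ⟨y.1.1, y.2.1⟩ ⟨y'.1.1, y'.2.1⟩

theorem IsAdditive.snd (hf : IsAdditive f) : IsAdditive fun y : (cone V).Homog => f (cone.snd y) :=
  fun d y y' => hf (d - 1) ⟨y.1.2, y.2.2⟩ ⟨y'.1.2, y'.2.2⟩

theorem IsAdditive.snd_smul (hf : IsAdditive f) {i d : ℤ} (r : (psRing S).deg i)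
    (y : (cone V).deg d) : f (cone.snd ⟨i + d, (cone V).smul r y⟩) =
      i.negOnePow • f ⟨i + (d - 1), (psMod V).smul r ⟨y.1.2, y.2.2⟩⟩ :=
  hf.map_units_smul_of_eq (by simp only [cone.snd]; ring) _ rfl

theorem coneOp_isHom (h : ℓ.IsHom) (h3 : ∀ l, 3 ≤ l.length → ℓ.toFun l = 0) :
    (coneOp ℓ).IsHom := by
  have hP := psOp_isHom h h3
  have a₁ : IsAdditive fun y => (psOp ℓ).toFun [y] := hP.isAdditive [] []
  have a₂ : ∀ z, IsAdditive fun y => (psOp ℓ).toFun [y, z] := fun z => hP.isAdditive [] [z]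
  have s₁ : ∀ {i d : ℤ} (r : (psRing S).deg i) (y : (psMod V).deg d),
      (psOp ℓ).toFun [⟨i + d, (psMod V).smul r y⟩] =
        i.negOnePow • (psMod V).act i r ((psOp ℓ).toFun [⟨d, y⟩]) := fun {i d} r y => by
    have := hP.smul [] [] i d r y
    rwa [sdeg_nil, add_zero, mul_one] at this
  have s₂ : ∀ {i d : ℤ} (r : (psRing S).deg i) (y : (psMod V).deg d) (z : (psMod V).Homog),
      (psOp ℓ).toFun [⟨i + d, (psMod V).smul r y⟩, z] =
        i.negOnePow • (psMod V).act i r ((psOp ℓ).toFun [⟨d, y⟩, z]) := fun {i d} r y z => by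
    have := hP.smul [] [z] i d r y
    rwa [sdeg_nil, add_zero, mul_one] at this
  have sw : ∀ y z, (psOp ℓ).toFun [y, z] = (y.1 * z.1).negOnePow • (psOp ℓ).toFun [z, y] :=
    hP.swap [] []
  refine Op.isHom_of_le_two (coneOp_three h3) (fun d y y' => ?_) (fun d y y' z => ?_)
    (fun i d r y => ?_) (fun i d r y z => ?_) (fun y z => ?_)
  · rw [coneOp_one, coneOp_one, coneOp_one]
    refine Prod.ext ?_ ?_
    · refine Eq.trans (congrArg₂ (· + ·) (a₁.fst d y y')
        (map_add (zmulHom V) y.1.2 y'.1.2)) (add_add_add_comm _ _ _ _)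
    · exact (congrArg Neg.neg (a₁.snd d y y')).trans (neg_add _ _)
  · rw [coneOp_two, coneOp_two, coneOp_two]
    refine Prod.ext ((a₂ _).fst d y y') ?_
    refine (congrArg Neg.neg (congrArg₂ (· + ·) ((a₂ (cone.fst z)).snd d y y')
      (congrArg (d.negOnePow • ·) ((a₂ (cone.snd z)).fst d y y')))).trans ?_
    change _ = -(_ + d.negOnePow • _) + -(_ + d.negOnePow • _)
    dsimp only
    rw [smul_add]
    abel
  · rw [coneOp_one, coneOp_one]
    refine Prod.ext ?_ ?_
    · change (psOp ℓ).toFun [⟨i + d, (psMod V).smul r ⟨y.1.1, y.2.1⟩⟩] +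
        zmulHom V (i.negOnePow • (psMod V).act i r y.1.2) = i.negOnePow •
        (psMod V).act i r ((psOp ℓ).toFun [cone.fst ⟨d, y⟩] + zmulHom V y.1.2)
      rw [s₁, map_negOnePow_smul, zmulHom_act, map_add, smul_add]
      rfl
    · refine (congrArg Neg.neg ((a₁.snd_smul r y).trans (congrArg _ (s₁ r _)))).trans ?_
      change _ = i.negOnePow • i.negOnePow • (psMod V).act i r (-_)
      rw [map_neg, smul_neg, smul_neg]
      rfl
  · rw [coneOp_two, coneOp_two]
    refine Prod.ext (s₂ r ⟨y.1.1, y.2.1⟩ (cone.fst z)) ?_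
    refine (congrArg Neg.neg (congrArg₂ (· + ·)
      (((a₂ (cone.fst z)).snd_smul r y).trans (congrArg _ (s₂ r _ _)))
      (congrArg ((i + d).negOnePow • ·) (s₂ r ⟨y.1.1, y.2.1⟩ (cone.snd z))))).trans ?_
    change _ = i.negOnePow • i.negOnePow • (psMod V).act i r (-(_ + d.negOnePow • _))
    rw [map_neg, map_add, map_negOnePow_smul]
    simp only [smul_neg, smul_add, negOnePow_smul_smul]
    refine congrArg Neg.neg (congrArg₂ (· + ·) rfl ?_)
    exact negOnePow_smul_congr (by push_cast; grind) rfl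
  · refine cone.ext ?_ ?_
    · rw [map_negOnePow_smul, cone.fstHom_two, cone.fstHom_two]
      exact sw _ _
    · rw [map_negOnePow_smul, cone.sndHom_two, cone.sndHom_two, sw (cone.snd y), sw (cone.fst y)]
      simp only [smul_neg, smul_add, negOnePow_smul_smul]
      rw [add_comm]
      refine congrArg Neg.neg (congrArg₂ (· + ·) ?_ ?_) <;>
      · refine negOnePow_smul_congr ?_ rfl
        simp only [cone.fst, cone.snd]
        push_cast; grind

theorem Op.IsBinary.coneOp (hℓ : ℓ.IsBinary) : (coneOp ℓ).IsBinary := by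
  have h := hℓ.psOp
  have a₁ : IsAdditive fun y => (CHStruct.psOp ℓ).toFun [y] := h.isHom.isAdditive [] []
  have a₂ : ∀ z, IsAdditive fun y => (CHStruct.psOp ℓ).toFun [z, y] :=
    fun z => h.isHom.isAdditive [z] []
  have z₁ := psOp_one_zHomog hℓ.isHom
  have z₂ := psOp_two_zHomog hℓ.isHom
  have sw : ∀ y z, (CHStruct.psOp ℓ).toFun [y, z] =
    (y.1 * z.1).negOnePow • (CHStruct.psOp ℓ).toFun [z, y] := h.isHom.swap [] []
  have sq₂ := h.sq_two
  have sq₃ := h.sq_three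
  have hs₁ : ∀ a b : ℤ, ((1 + a) * b).negOnePow = (a * b).negOnePow * b.negOnePow := fun a b => by
    rw [← Int.negOnePow_add]; congr 1; ring
  have hs₂ : ∀ a b : ℤ, (a * (b - 1)).negOnePow = (a * b).negOnePow * a.negOnePow := fun a b => by
    rw [← Int.negOnePow_add]; exact negOnePow_eq_of_zmod (by push_cast; grind)
  have hs₃ : ∀ a b : ℤ, ((a - 1) * b).negOnePow = (a * b).negOnePow * b.negOnePow := fun a b => by
    rw [← Int.negOnePow_add]; exact negOnePow_eq_of_zmod (by push_cast; grind)
  have hs₄ : ∀ a : ℤ, (a - 1).negOnePow = -a.negOnePow := fun a => by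
    rw [← Int.negOnePow_succ]; exact negOnePow_eq_of_zmod (by push_cast; grind)
  have hs₅ : ∀ a b c : ℤ, ((1 + a + b) * c).negOnePow =
      (a * c).negOnePow * (b * c).negOnePow * c.negOnePow := fun a b c => by
    rw [← Int.negOnePow_add, ← Int.negOnePow_add]; congr 1; ring
  have hs₆ : ∀ a b : ℤ, (1 + a + b).negOnePow = -(a.negOnePow * b.negOnePow) := fun a b => by
    rw [← Int.negOnePow_add, ← Int.negOnePow_succ]; congr 1; ring
  refine ⟨coneOp_isHom hℓ.isHom hℓ.three, coneOp_three hℓ.three, fun y => ?_, fun y z => ?_,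
    fun y z t => ?_⟩
  · refine cone.ext ?_ ?_
    · rw [cone.fstHom_one, cone.snd_homog, cone.sndHom_one, a₁.fst_one, h.sq_one, z₁, zero_add,
        map_neg, add_neg_cancel, map_zero]
    · rw [cone.sndHom_one, a₁.snd_one, h.sq_one, neg_zero, neg_zero, map_zero]
  · refine cone.ext ?_ ?_
    · rw [map_add, map_add, map_negOnePow_smul, map_negOnePow_smul, cone.fstHom_one,
        cone.snd_homog, cone.sndHom_two, cone.fstHom_two, cone.fstHom_two, cone.fst_homog_two,
        (a₂ _).fst_one, (a₂ _).fst_one, z₂, z₂, sw (cone.fst z) (cone.snd y), map_neg, map_add,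
        map_negOnePow_smul, map_negOnePow_smul, map_zero]
      have e := sq₂ (cone.fst y) (cone.fst z)
      simp only [cone.fst_fst, cone.snd_fst, hs₁, hs₂] at e ⊢
      rw [mul_comm z.1]
      refine Eq.trans ?_ e
      rcases Int.units_eq_one_or y.1.negOnePow with hy | hy <;>
      rcases Int.units_eq_one_or z.1.negOnePow with hz | hz <;>
      rcases Int.units_eq_one_or (y.1 * z.1).negOnePow with hyz | hyz <;>
      · simp only [hy, hz, hyz, mul_one, mul_neg, neg_neg, one_smul,
          Units.neg_smul]
        abel
    · rw [map_add, map_add, map_negOnePow_smul, map_negOnePow_smul, cone.sndHom_one,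
        cone.sndHom_two, cone.sndHom_two, a₁.snd_two, (a₂ _).fst_one, (a₂ _).snd_one,
        (a₂ _).fst_one, (a₂ _).snd_one, z₂, z₂, map_zero, sw (cone.snd z) (cone.snd y),
          map_negOnePow_smul]
      have e₁ := sq₂ (cone.snd y) (cone.fst z)
      have e₂ := sq₂ (cone.fst y) (cone.snd z)
      simp only [cone.fst_fst, cone.snd_fst, hs₁, hs₂, hs₃, hs₄] at e₁ e₂ ⊢
      have e := congrArg₂ (· + y.1.negOnePow • ·) e₁ e₂
      simp only [smul_zero, add_zero] at e
      rw [mul_comm z.1]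
      refine Eq.trans ?_ e
      rcases Int.units_eq_one_or y.1.negOnePow with hy | hy <;>
      rcases Int.units_eq_one_or z.1.negOnePow with hz | hz <;>
      rcases Int.units_eq_one_or (y.1 * z.1).negOnePow with hyz | hyz <;>
      · simp only [hy, hz, hyz, mul_one, mul_neg, neg_neg, one_smul,
          Units.neg_smul]
        abel
  · refine cone.ext ?_ ?_
    · simp only [map_add, map_negOnePow_smul, cone.fstHom_two, cone.fst_homog_two, map_zero]
      exact sq₃ (cone.fst y) (cone.fst z) (cone.fst t)
    · simp only [map_add, map_negOnePow_smul, cone.sndHom_two, cone.fst_homog_two, (a₂ _).snd_two,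
        map_zero]
      have e₁ := sq₃ (cone.snd y) (cone.fst z) (cone.fst t)
      have e₂ := sq₃ (cone.fst y) (cone.snd z) (cone.fst t)
      have e₃ := sq₃ (cone.fst y) (cone.fst z) (cone.snd t)
      simp only [cone.fst_fst, cone.snd_fst, hs₁, hs₂, hs₃, hs₄, hs₅, hs₆] at e₁ e₂ e₃ ⊢
      have e := congrArg₂ (· + ·) (congrArg₂ (· + y.1.negOnePow • ·) e₁ e₂)
        (congrArg ((y.1.negOnePow * z.1.negOnePow) • ·) e₃)
      simp only [smul_zero, add_zero] at e
      refine Eq.trans ?_ e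
      rcases Int.units_eq_one_or y.1.negOnePow with hy | hy <;>
      rcases Int.units_eq_one_or z.1.negOnePow with hz | hz <;>
      rcases Int.units_eq_one_or t.1.negOnePow with ht | ht <;>
      rcases Int.units_eq_one_or (y.1 * z.1).negOnePow with hyz | hyz <;>
      rcases Int.units_eq_one_or (y.1 * t.1).negOnePow with hyt | hyt <;>
      rcases Int.units_eq_one_or (z.1 * t.1).negOnePow with hzt | hzt <;>
      · simp only [hy, hz, ht, hyz, hyt, hzt, mul_one, mul_neg, neg_neg, one_smul,
          Units.neg_smul]
        abel

end Cone

/-! ### The `L_∞` algebra of a DGLA -/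

namespace DGLA

variable {S : GrRing.{u}} {L : GrMod.{u, w} S} (G : DGLA L) {H : Type*} [AddCommGroup H]

/-- The differential, with degrees. -/
def hd (x : L.Homog) : L.Homog := ⟨x.1 + 1, G.diff x.1 x.2⟩

/-- The bracket, with degrees. -/
def hb (x y : L.Homog) : L.Homog := ⟨x.1 + y.1, G.br x.1 y.1 x.2 y.2⟩

theorem isAdditive_hd : IsAdditive fun x => ((G.hd x).2 : L.carrier) := fun d x y =>
  congrArg Subtype.val (map_add (G.diff d) x y)

theorem isAdditive_hb_left (y : L.Homog) : IsAdditive fun x => ((G.hb x y).2 : L.carrier) :=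
  fun d x x' => congrArg Subtype.val (DFunLike.congr_fun (map_add (G.br d y.1) x x') y.2)

theorem isAdditive_hb_right (x : L.Homog) : IsAdditive fun y => ((G.hb x y).2 : L.carrier) :=
  fun d y y' => congrArg Subtype.val (map_add (G.br x.1 d x.2) y y')

theorem _root_.CHStruct.IsAdditive.unshift {f : L.Homog → H} (hf : IsAdditive f) :
    IsAdditive fun y : L.shift.Homog => f (unshift y) := fun d y y' => hf (d + 1) y y'

theorem _root_.CHStruct.IsAdditive.unshift_smul {f : L.Homog → H} (hf : IsAdditive f) {i d : ℤ}
    (r : S.deg i) (y : L.shift.deg d) : f (CHStruct.unshift ⟨i + d, L.shift.smul r y⟩) =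
      i.negOnePow • f ⟨i + (d + 1), L.smul r (CHStruct.unshift ⟨d, y⟩).2⟩ :=
  hf.map_units_smul_of_eq (by simp only [CHStruct.unshift]; ring) _ rfl

/-- The operations of the `L_∞` algebra, with values in `L` instead of `L[1]`. -/
def op (l : List L.shift.Homog) : L.carrier := G.toOp.toFun l

theorem op_one (y : L.shift.Homog) : G.op [y] = -((G.hd (unshift y)).2 : L.carrier) := rfl

theorem op_two (y z : L.shift.Homog) : G.op [y, z] =
    (unshift y).1.negOnePow • ((G.hb (unshift y) (unshift z)).2 : L.carrier) := rfl

theorem unshift_homog_one {f : L.Homog → H} (hf : IsAdditive f) (y : L.shift.Homog) :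
    f (unshift (G.toOp.homog [y])) = -f (G.hd (unshift y)) :=
  hf.map_neg_of_eq (by simp only [hd, unshift, Op.homog, sdeg_cons, sdeg_nil]; ring) rfl

theorem unshift_homog_two {f : L.Homog → H} (hf : IsAdditive f) (y z : L.shift.Homog) :
    f (unshift (G.toOp.homog [y, z])) =
      (unshift y).1.negOnePow • f (G.hb (unshift y) (unshift z)) :=
  hf.map_units_smul_of_eq (by simp only [hb, unshift, Op.homog, sdeg_cons, sdeg_nil]; ring) _ rfl

theorem toOp_three (l : List L.shift.Homog) (hl : 3 ≤ l.length) : G.toOp.toFun l = 0 := by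
  match l, hl with
  | _ :: _ :: _ :: _, _ => rfl

theorem toOp_isHom : G.toOp.IsHom := by
  refine Op.isHom_of_le_two G.toOp_three (fun d y y' => ?_) (fun d y y' z => ?_)
    (fun i d r y => ?_) (fun i d r y z => ?_) (fun y z => ?_)
  · exact (congrArg Neg.neg (G.isAdditive_hd.unshift d y y')).trans (neg_add _ _)
  · exact (congrArg ((d + 1).negOnePow • ·) ((G.isAdditive_hb_left _).unshift d y y')).trans
      (smul_add _ _ _)
  · change -((G.hd _).2 : L.carrier) = i.negOnePow • i.negOnePow • L.act i r (-(G.hd _).2)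
    rw [G.isAdditive_hd.unshift_smul, negOnePow_smul_self, map_neg]
    refine congrArg Neg.neg ((congrArg (i.negOnePow • ·) (G.diff_smul r _)).trans ?_)
    exact negOnePow_smul_self _ _
  · change (i + d + 1).negOnePow • ((G.hb _ _).2 : L.carrier) =
      i.negOnePow • i.negOnePow • L.act i r ((d + 1).negOnePow • ((G.hb _ _).2 : L.carrier))
    rw [(G.isAdditive_hb_left _).unshift_smul, negOnePow_smul_self, map_negOnePow_smul]
    refine (congrArg (fun x => (i + d + 1).negOnePow • i.negOnePow • x)
      (G.br_smul r _ _)).trans ?_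
    rw [negOnePow_smul_smul]
    exact negOnePow_smul_congr (by push_cast; grind) rfl
  · change (y.1 + 1).negOnePow • ((G.hb _ _).2 : L.carrier) =
      (y.1 * z.1).negOnePow • (z.1 + 1).negOnePow • ((G.hb _ _).2 : L.carrier)
    refine (congrArg ((y.1 + 1).negOnePow • ·) (G.antisymm _ _)).trans ?_
    change _ • -(((y.1 + 1) * (z.1 + 1)).negOnePow • ((G.hb _ _).2 : L.carrier)) = _
    rw [UnitalGradedQuiver.neg_eq_negOnePow_smul, negOnePow_smul_smul, negOnePow_smul_smul,
      negOnePow_smul_smul]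
    exact negOnePow_smul_congr (by push_cast; grind) rfl

theorem toOp_isBinary : G.toOp.IsBinary where
  isHom := G.toOp_isHom
  three := G.toOp_three
  sq_one y := by
    change G.op _ = 0
    rw [op_one, G.unshift_homog_one G.isAdditive_hd, neg_neg]
    exact G.diff_diff _
  sq_two y z := by
    change G.op _ + ((1 + y.1) * z.1).negOnePow • G.op _ + y.1.negOnePow • G.op _ = 0
    rw [op_one, op_two, op_two, G.unshift_homog_two G.isAdditive_hd,
      G.unshift_homog_one (G.isAdditive_hb_right _), G.unshift_homog_one (G.isAdditive_hb_right _)]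
    have h₁ := G.leibniz (unshift y).2 (unshift z).2
    have h₂ := G.antisymm (unshift z).2 (G.hd (unshift y)).2
    change ((G.hd (G.hb (unshift y) (unshift z))).2 : L.carrier) = (G.hb (G.hd _) _).2 +
      _ • ((G.hb _ (G.hd _)).2 : L.carrier) at h₁
    change ((G.hb _ (G.hd _)).2 : L.carrier) = -(_ • ((G.hb (G.hd _) _).2 : L.carrier)) at h₂
    rw [h₁, h₂]
    have e₁ : (unshift y).1 = y.1 + 1 := rfl
    have e₂ : (unshift z).1 = z.1 + 1 := rfl
    have e₃ : (G.hd (unshift y)).1 = y.1 + 1 + 1 := rfl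
    simp only [e₁, e₂, e₃]
    have s₁ : ((1 + y.1) * z.1).negOnePow = (y.1 * z.1).negOnePow * z.1.negOnePow := by
      rw [← Int.negOnePow_add]; exact negOnePow_eq_of_zmod (by push_cast; grind)
    have s₂ : ((z.1 + 1) * (y.1 + 1 + 1)).negOnePow = (y.1 * z.1).negOnePow * y.1.negOnePow := by
      rw [← Int.negOnePow_add]; exact negOnePow_eq_of_zmod (by push_cast; grind)
    rw [s₁, s₂]
    simp only [Int.negOnePow_succ]
    rcases Int.units_eq_one_or y.1.negOnePow with hy | hy <;>
    rcases Int.units_eq_one_or z.1.negOnePow with hz | hz <;>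
    rcases Int.units_eq_one_or (y.1 * z.1).negOnePow with hyz | hyz <;>
    · simp only [hy, hz, hyz, mul_one, mul_neg, neg_neg, one_smul,
        Units.neg_smul]
      abel
  sq_three y z t := by
    change y.1.negOnePow • G.op _ + ((1 + y.1) * z.1).negOnePow • G.op _ +
      ((1 + y.1 + z.1) * t.1).negOnePow • G.op _ = 0
    simp only [op_two]
    rw [G.unshift_homog_two (G.isAdditive_hb_right _),
      G.unshift_homog_two (G.isAdditive_hb_right _),
      G.unshift_homog_two (G.isAdditive_hb_right _)]
    have h₁ := G.jacobi (unshift y).2 (unshift z).2 (unshift t).2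
    have h₂ := G.antisymm (unshift t).2 (G.hb (unshift y) (unshift z)).2
    change ((G.hb _ (G.hb _ _)).2 : L.carrier) = (G.hb (G.hb _ _) _).2 +
      _ • ((G.hb _ (G.hb _ _)).2 : L.carrier) at h₁
    change ((G.hb _ (G.hb _ _)).2 : L.carrier) = -(_ • ((G.hb (G.hb _ _) _).2 : L.carrier)) at h₂
    rw [h₁, h₂]
    have e₁ : (unshift y).1 = y.1 + 1 := rfl
    have e₂ : (unshift z).1 = z.1 + 1 := rfl
    have e₃ : (unshift t).1 = t.1 + 1 := rfl
    have e₄ : (G.hb (unshift y) (unshift z)).1 = y.1 + 1 + (z.1 + 1) := rfl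
    simp only [e₁, e₂, e₃, e₄]
    have s₁ : ((1 + y.1) * z.1).negOnePow = (y.1 * z.1).negOnePow * z.1.negOnePow := by
      rw [← Int.negOnePow_add]; exact negOnePow_eq_of_zmod (by push_cast; grind)
    have s₂ : ((y.1 + 1) * (z.1 + 1)).negOnePow =
        -((y.1 * z.1).negOnePow * y.1.negOnePow * z.1.negOnePow) := by
      rw [← Int.negOnePow_add, ← Int.negOnePow_add, ← Int.negOnePow_succ]
      exact negOnePow_eq_of_zmod (by push_cast; grind)
    have s₃ : ((t.1 + 1) * (y.1 + 1 + (z.1 + 1))).negOnePow =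
        ((y.1 + z.1) * t.1).negOnePow * y.1.negOnePow * z.1.negOnePow := by
      rw [← Int.negOnePow_add, ← Int.negOnePow_add]
      exact negOnePow_eq_of_zmod (by push_cast; grind)
    have s₄ : ((1 + y.1 + z.1) * t.1).negOnePow =
        ((y.1 + z.1) * t.1).negOnePow * t.1.negOnePow := by
      rw [← Int.negOnePow_add]
      exact negOnePow_eq_of_zmod (by push_cast; grind)
    rw [s₁, s₂, s₃, s₄]
    simp only [Int.negOnePow_succ]
    rcases Int.units_eq_one_or y.1.negOnePow with hy | hy <;>
    rcases Int.units_eq_one_or z.1.negOnePow with hz | hz <;>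
    rcases Int.units_eq_one_or t.1.negOnePow with ht | ht <;>
    rcases Int.units_eq_one_or (y.1 * z.1).negOnePow with hyz | hyz <;>
    rcases Int.units_eq_one_or ((y.1 + z.1) * t.1).negOnePow with hyzt | hyzt <;>
    · simp only [hy, hz, ht, hyz, hyzt, mul_one, mul_neg, neg_neg, one_smul,
        Units.neg_smul, smul_add, smul_neg]
      abel

end DGLA

/-! ### Series of endomorphisms -/

section Series

variable {M : Type v} [AddCommGroup M]

/-- A power series of endomorphisms of `M` acts on `M[[z]]`. -/
def seriesEnd (M : Type v) [AddCommGroup M] :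
    PowerSeries (AddMonoid.End M) →+* AddMonoid.End (ℕ → M) where
  toFun P := AddMonoidHom.mk' (fun x n => ∑ p ∈ antidiagonal n, PowerSeries.coeff p.1 P (x p.2))
    fun x y => funext fun n => by simp [Finset.sum_add_distrib]
  map_one' := by
    ext x n
    change ∑ p ∈ antidiagonal n, PowerSeries.coeff p.1 (1 : PowerSeries (AddMonoid.End M)) (x p.2) =
      x n
    rw [Finset.sum_eq_single (0, n)]
    · simp
    · rintro ⟨a, b⟩ hab hne
      have ha : a ≠ 0 := by
        rintro rfl
        exact hne (by simpa using mem_antidiagonal.1 hab)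
      simp [PowerSeries.coeff_one, ha]
    · intro h
      exact absurd (mem_antidiagonal.2 (by simp)) h
  map_mul' P Q := by
    ext x n
    change ∑ p ∈ antidiagonal n, PowerSeries.coeff p.1 (P * Q) (x p.2) =
      ∑ p ∈ antidiagonal n, PowerSeries.coeff p.1 P
        (∑ q ∈ antidiagonal p.2, PowerSeries.coeff q.1 Q (x q.2))
    simp only [PowerSeries.coeff_mul, map_sum]
    refine Eq.trans (Finset.sum_congr rfl fun p _ => ?_) (sum_antidiagonal_assoc
      (fun a b c => PowerSeries.coeff a P (PowerSeries.coeff b Q (x c))) n)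
    exact AddMonoidHom.finsetSum_apply _ _ _
  map_zero' := by
    ext x n
    change ∑ p ∈ antidiagonal n, PowerSeries.coeff p.1 (0 : PowerSeries (AddMonoid.End M)) (x p.2) =
      0
    exact Finset.sum_eq_zero fun p _ => by rw [map_zero]; rfl
  map_add' P Q := by
    ext x n
    change ∑ p ∈ antidiagonal n, PowerSeries.coeff p.1 (P + Q) (x p.2) =
      (∑ p ∈ antidiagonal n, PowerSeries.coeff p.1 P (x p.2)) +
        ∑ p ∈ antidiagonal n, PowerSeries.coeff p.1 Q (x p.2)
    rw [← Finset.sum_add_distrib]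
    exact Finset.sum_congr rfl fun p _ => by rw [map_add]; rfl

theorem seriesEnd_apply (P : PowerSeries (AddMonoid.End M)) (x : ℕ → M) (n : ℕ) :
    seriesEnd M P x n = ∑ p ∈ antidiagonal n, PowerSeries.coeff p.1 P (x p.2) := rfl

theorem seriesEnd_C (f : AddMonoid.End M) (x : ℕ → M) :
    seriesEnd M (PowerSeries.C f) x = fun n => f (x n) := by
  funext n
  rw [seriesEnd_apply, Finset.sum_eq_single (0, n)]
  · simp
  · rintro ⟨a, b⟩ hab hne
    have ha : a ≠ 0 := by
      rintro rfl
      exact hne (by simpa using mem_antidiagonal.1 hab)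
    simp [PowerSeries.coeff_C, ha]
  · intro h
    exact absurd (mem_antidiagonal.2 (by simp)) h

theorem seriesEnd_X (x : ℕ → M) : seriesEnd M PowerSeries.X x = zmul x := by
  funext n
  rw [seriesEnd_apply]
  cases n with
  | zero => simp [zmul]
  | succ n =>
    rw [Finset.Nat.sum_antidiagonal_succ, Finset.sum_eq_single (0, n)]
    · simp [zmul]
    · rintro ⟨a, b⟩ hab hne
      have ha : a ≠ 0 := by
        rintro rfl
        exact hne (by simpa using mem_antidiagonal.1 hab)
      simp [PowerSeries.coeff_X, ha]
    · intro h
      exact absurd (mem_antidiagonal.2 (by simp)) h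

theorem mul_X_mul {E : Type*} [Ring E] (P Q : PowerSeries E) :
    P * (PowerSeries.X * Q) = PowerSeries.X * (P * Q) := by
  rw [← mul_assoc, ← mul_assoc, PowerSeries.X_mul]

end Series

/-! ### Extension of functions of homogeneous elements to series -/

section Hat

variable {S : GrRing.{u}} {V : GrMod.{u, w} S} {E : Type*} [Ring E]

/-- `∑ f(y_n) zⁿ` for `y = ∑ y_n zⁿ`. -/
def hat (f : V.Homog → E) (y : (psMod V).Homog) : PowerSeries E :=
  PowerSeries.mk fun n => f (psCoeff y n)

/-- The `z`-bilinear extension of a function of two homogeneous elements. -/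
def hat₂ (f : V.Homog → V.Homog → E) (y z : (psMod V).Homog) : PowerSeries E :=
  PowerSeries.mk fun n => ∑ p ∈ antidiagonal n, f (psCoeff y p.1) (psCoeff z p.2)

/-- The `z`-trilinear extension of a function of three homogeneous elements. -/
def hat₃ (f : V.Homog → V.Homog → V.Homog → E) (y z t : (psMod V).Homog) : PowerSeries E :=
  PowerSeries.mk fun n => ∑ p ∈ antidiagonal n, ∑ q ∈ antidiagonal p.2,
    f (psCoeff y p.1) (psCoeff z q.1) (psCoeff t q.2)

theorem psCoeff_sign (y : (psMod V).Homog) (n : ℕ) :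
    (psCoeff y n).1.negOnePow = y.1.negOnePow :=
  negOnePow_eq_of_zmod (by simp only [psCoeff]; push_cast; grind)

theorem psCoeff_sign_mul (y z : (psMod V).Homog) (n k : ℕ) :
    ((psCoeff y n).1 * (psCoeff z k).1).negOnePow = (y.1 * z.1).negOnePow :=
  negOnePow_eq_of_zmod (by simp only [psCoeff]; push_cast; grind)

variable {f f' : V.Homog → E} {g g' : V.Homog → V.Homog → E}
  {h h' : V.Homog → V.Homog → V.Homog → E} (y z t : (psMod V).Homog) {ℓ : Op V}

theorem hat_eq_zero (H : ∀ n, f (psCoeff y n) = 0) : hat f y = 0 :=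
  PowerSeries.ext fun n => by rw [hat, PowerSeries.coeff_mk, H, map_zero]

theorem hat₂_eq_zero (H : ∀ n k, g (psCoeff y n) (psCoeff z k) = 0) : hat₂ g y z = 0 :=
  PowerSeries.ext fun n => by
    rw [hat₂, PowerSeries.coeff_mk, map_zero]
    exact Finset.sum_eq_zero fun p _ => H _ _

theorem hat₃_eq_zero (H : ∀ n k l, h (psCoeff y n) (psCoeff z k) (psCoeff t l) = 0) :
    hat₃ h y z t = 0 :=
  PowerSeries.ext fun n => by
    rw [hat₃, PowerSeries.coeff_mk, map_zero]
    exact Finset.sum_eq_zero fun p _ => Finset.sum_eq_zero fun q _ => H _ _ _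

theorem hat_add : hat f y + hat f' y = hat (fun v => f v + f' v) y := rfl

theorem hat_sub : hat f y - hat f' y = hat (fun v => f v - f' v) y := by
  ext n
  rw [map_sub]
  rfl

theorem hat_smul (u : ℤˣ) : u • hat f y = hat (fun v => u • f v) y := by
  ext n
  rw [Units.smul_def, map_zsmul]
  rfl

theorem hat₂_add : hat₂ g y z + hat₂ g' y z = hat₂ (fun v w => g v w + g' v w) y z := by
  ext n
  simp only [hat₂, map_add, PowerSeries.coeff_mk, Finset.sum_add_distrib]

theorem hat₂_sub : hat₂ g y z - hat₂ g' y z = hat₂ (fun v w => g v w - g' v w) y z := by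
  ext n
  simp only [hat₂, map_sub, PowerSeries.coeff_mk, Finset.sum_sub_distrib]

theorem hat₂_smul (u : ℤˣ) : u • hat₂ g y z = hat₂ (fun v w => u • g v w) y z := by
  ext n
  rw [Units.smul_def, map_zsmul, hat₂, hat₂, PowerSeries.coeff_mk, PowerSeries.coeff_mk,
    Finset.smul_sum]
  rfl

theorem hat₃_add :
    hat₃ h y z t + hat₃ h' y z t = hat₃ (fun a b c => h a b c + h' a b c) y z t := by
  ext n
  simp only [hat₃, map_add, PowerSeries.coeff_mk, Finset.sum_add_distrib]

theorem hat₃_sub :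
    hat₃ h y z t - hat₃ h' y z t = hat₃ (fun a b c => h a b c - h' a b c) y z t := by
  ext n
  simp only [hat₃, map_sub, PowerSeries.coeff_mk, Finset.sum_sub_distrib]

theorem hat₃_smul (u : ℤˣ) : u • hat₃ h y z t = hat₃ (fun a b c => u • h a b c) y z t := by
  ext n
  rw [Units.smul_def, map_zsmul, hat₃, hat₃, PowerSeries.coeff_mk, PowerSeries.coeff_mk,
    Finset.smul_sum]
  simp only [Finset.smul_sum]
  rfl

theorem C_mul_hat (a : E) : PowerSeries.C a * hat f y = hat (fun v => a * f v) y := by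
  ext n
  simp only [hat, PowerSeries.coeff_C_mul, PowerSeries.coeff_mk]

theorem hat_mul_C (a : E) : hat f y * PowerSeries.C a = hat (fun v => f v * a) y := by
  ext n
  simp only [hat, PowerSeries.coeff_mul_C, PowerSeries.coeff_mk]

theorem C_mul_hat₂ (a : E) : PowerSeries.C a * hat₂ g y z = hat₂ (fun v w => a * g v w) y z := by
  ext n
  simp only [hat₂, PowerSeries.coeff_C_mul, PowerSeries.coeff_mk, Finset.mul_sum]

theorem hat₂_mul_C (a : E) : hat₂ g y z * PowerSeries.C a = hat₂ (fun v w => g v w * a) y z := by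
  ext n
  simp only [hat₂, PowerSeries.coeff_mul_C, PowerSeries.coeff_mk, Finset.sum_mul]

/-- Multiplication of extended functions; with `hat_zHomog` and the compatibility with `psOp`, it
reduces identities between series to identities between functions of homogeneous elements. -/
theorem hat_mul_hat : hat f y * hat f' z = hat₂ (fun v w => f v * f' w) y z := by
  ext n
  simp only [hat, hat₂, PowerSeries.coeff_mul, PowerSeries.coeff_mk]

theorem hat₂_swap : hat₂ g z y = hat₂ (fun v w => g w v) y z := by
  ext n
  simp only [hat₂, PowerSeries.coeff_mk]
  exact (Finset.Nat.sum_antidiagonal_swap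
    (f := fun p => g (psCoeff z p.1) (psCoeff y p.2))).symm

theorem hat_mul_hat₂ : hat f y * hat₂ g z t = hat₃ (fun a b c => f a * g b c) y z t := by
  ext n
  simp only [hat, hat₂, hat₃, PowerSeries.coeff_mul, PowerSeries.coeff_mk, Finset.mul_sum]

theorem hat₂_mul_hat : hat₂ g y z * hat f t = hat₃ (fun a b c => g a b * f c) y z t := by
  ext n
  simp only [hat, hat₂, hat₃, PowerSeries.coeff_mul, PowerSeries.coeff_mk, Finset.sum_mul]
  exact sum_antidiagonal_assoc
    (fun a b c => g (psCoeff y a) (psCoeff z b) * f (psCoeff t c)) n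

theorem hat₃_swap₁₂ : hat₃ h z y t = hat₃ (fun a b c => h b a c) y z t := by
  ext n
  simp only [hat₃, PowerSeries.coeff_mk]
  exact sum_antidiagonal_swap₁₂ (fun a b c => h (psCoeff z b) (psCoeff y a) (psCoeff t c)) n

theorem hat₃_swap₂₃ : hat₃ h y t z = hat₃ (fun a b c => h a c b) y z t := by
  ext n
  simp only [hat₃, PowerSeries.coeff_mk]
  exact sum_antidiagonal_swap₂₃ (fun a b c => h (psCoeff y a) (psCoeff t c) (psCoeff z b)) n

/-! ### Compatibility with the operations -/

theorem hat_psOp_one : hat f ((psOp ℓ).homog [y]) = hat (fun v => f (ℓ.homog [v])) y := by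
  ext n
  rw [hat, hat, PowerSeries.coeff_mk, PowerSeries.coeff_mk, psCoeff_psOp_one]

theorem hat_psOp_two (hf : IsAdditive f) :
    hat f ((psOp ℓ).homog [y, z]) = hat₂ (fun v w => f (ℓ.homog [v, w])) y z := by
  ext n
  rw [hat, hat₂, PowerSeries.coeff_mk, PowerSeries.coeff_mk, hf.psCoeff_psOp_two]

theorem hat₂_psOp_one_left :
    hat₂ g ((psOp ℓ).homog [y]) z = hat₂ (fun v w => g (ℓ.homog [v]) w) y z := by
  ext n
  simp only [hat₂, PowerSeries.coeff_mk, psCoeff_psOp_one]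

theorem hat₂_psOp_one_right :
    hat₂ g y ((psOp ℓ).homog [z]) = hat₂ (fun v w => g v (ℓ.homog [w])) y z := by
  ext n
  simp only [hat₂, PowerSeries.coeff_mk, psCoeff_psOp_one]

theorem hat₂_psOp_two_right (hg : ∀ v, IsAdditive (g v)) :
    hat₂ g y ((psOp ℓ).homog [z, t]) = hat₃ (fun a b c => g a (ℓ.homog [b, c])) y z t := by
  ext n
  simp only [hat₂, hat₃, PowerSeries.coeff_mk, (hg _).psCoeff_psOp_two]

theorem hat₂_psOp_two_left (hg : ∀ w, IsAdditive fun v => g v w) :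
    hat₂ g ((psOp ℓ).homog [y, z]) t = hat₃ (fun a b c => g (ℓ.homog [a, b]) c) y z t := by
  ext n
  simp only [hat₂, hat₃, PowerSeries.coeff_mk, (hg _).psCoeff_psOp_two]
  exact sum_antidiagonal_assoc
    (fun a b c => g (ℓ.homog [psCoeff y a, psCoeff z b]) (psCoeff t c)) n

theorem hat_zHomog (hf : IsAdditive f) : hat f (zHomog y) = PowerSeries.X * hat f y := by
  ext n
  cases n with
  | zero =>
    rw [PowerSeries.coeff_zero_X_mul, hat, PowerSeries.coeff_mk, hf.psCoeff_zHomog_zero]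
  | succ n =>
    rw [PowerSeries.coeff_succ_X_mul, hat, hat, PowerSeries.coeff_mk, PowerSeries.coeff_mk,
      psCoeff_zHomog_succ]

theorem isAdditive_hat (hf : IsAdditive f) : IsAdditive (hat f) := fun d y y' => by
  ext n
  simp only [hat, map_add, PowerSeries.coeff_mk]
  exact hf.psCoeff n d y y'

theorem isAdditive_hat₂_left (hg : ∀ w, IsAdditive fun v => g v w) :
    IsAdditive fun y => hat₂ g y z := fun d y y' => by
  ext n
  simp only [hat₂, map_add, PowerSeries.coeff_mk, ← Finset.sum_add_distrib]
  exact Finset.sum_congr rfl fun p _ => (hg _).psCoeff p.1 d y y'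

theorem isAdditive_hat₂_right (hg : ∀ v, IsAdditive (g v)) :
    IsAdditive fun z => hat₂ g y z := fun d z z' => by
  ext n
  simp only [hat₂, map_add, PowerSeries.coeff_mk, ← Finset.sum_add_distrib]
  exact Finset.sum_congr rfl fun p _ => (hg _).psCoeff p.2 d z z'

end Hat

namespace UnitalGradedQuiver

namespace ReducedOperators

variable {R : Type u} [Ring R] {𝓡 : ℤ → AddSubgroup R} [GradedRing 𝓡] [IsGradedComm 𝓡]
  {A : UnitalGradedQuiver.{u, v, w} 𝓡} {m : A.cochains 1} (T : ReducedOperators A m)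

/-! ### Linearity of the operators in the cochains -/

theorem isAdditive_eLie : IsAdditive T.eLie := fun d φ φ' => chainEnd_ext fun x₀ t => by
  change T.lie _ _ = T.lie _ _ + T.lie _ _
  rw [lie_cw, lie_cw, lie_cw, lieCh_lin (φ := incl (φ + φ')) (φ₁ := incl φ) (φ₂ := incl φ')
    (k₁ := 1) (k₂ := 1) rfl rfl (coe_add_eq φ φ'), one_smul, one_smul]

theorem isAdditive_eb₁ : IsAdditive T.eb₁ := fun d φ φ' => chainEnd_ext fun x₀ t => by
  change T.b₁ _ _ = T.b₁ _ _ + T.b₁ _ _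
  rw [b₁_cw, b₁_cw, b₁_cw, rhoCh_lin_right (φ := incl (φ + φ')) (φ₁ := incl φ) (φ₂ := incl φ')
    (k₁ := 1) (k₂ := 1) rfl rfl (coe_add_eq φ φ'), one_smul, one_smul]

theorem isAdditive_eB₁ : IsAdditive T.eB₁ := fun d φ φ' => chainEnd_ext fun x₀ t => by
  change T.B₁ _ _ = T.B₁ _ _ + T.B₁ _ _
  rw [B₁_cw, B₁_cw, B₁_cw, connesOneCh_lin (φ := incl (φ + φ')) (φ₁ := incl φ) (φ₂ := incl φ')
    (k₁ := 1) (k₂ := 1) rfl rfl (coe_add_eq φ φ'), one_smul, one_smul]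

theorem isAdditive_eRho_left (ψ : A.redCochains.Homog) : IsAdditive fun φ => T.eRho φ ψ :=
  fun d φ φ' => chainEnd_ext fun x₀ t => by
    change T.rho _ _ _ = T.rho _ _ _ + T.rho _ _ _
    rw [rho_cw, rho_cw, rho_cw, rhoCh_lin_left (φ := incl (φ + φ')) (φ₁ := incl φ)
      (φ₂ := incl φ') (k₁ := 1) (k₂ := 1) rfl rfl (coe_add_eq φ φ'), one_smul, one_smul]

theorem isAdditive_eRho_right (ψ : A.redCochains.Homog) : IsAdditive (T.eRho ψ) :=
  fun d φ φ' => chainEnd_ext fun x₀ t => by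
    change T.rho _ _ _ = T.rho _ _ _ + T.rho _ _ _
    rw [rho_cw, rho_cw, rho_cw, rhoCh_lin_right (φ := incl (φ + φ')) (φ₁ := incl φ)
      (φ₂ := incl φ') (k₁ := 1) (k₂ := 1) rfl rfl (coe_add_eq φ φ'), one_smul, one_smul]

/-- Multiplication by a scalar as an element of the ring `ChainEnd A`. -/
def eAct {i : ℤ} (r : 𝓡 i) : A.ChainEnd := chainAct r

section Smul

variable {i p q : ℤ} (r : 𝓡 i) (φ : A.redCochains.deg p) (ψ : A.redCochains.Homog)

theorem eLie_smul : T.eLie ⟨i + p, A.redCochains.smul r φ⟩ = eAct r * T.eLie ⟨p, φ⟩ :=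
  chainEnd_ext fun x₀ t => by
    change T.lie _ _ = chainAct r (T.lie _ _)
    rw [lie_cw, lie_cw]
    exact lieCh_smulC r (incl φ) x₀ t

theorem eb₁_smul :
    T.eb₁ ⟨i + p, A.redCochains.smul r φ⟩ = i.negOnePow • (eAct r * T.eb₁ ⟨p, φ⟩) :=
  chainEnd_ext fun x₀ t => by
    change T.b₁ _ _ = i.negOnePow • chainAct r (T.b₁ _ _)
    rw [b₁_cw, b₁_cw]
    have := rhoCh_smulC_right r m (incl φ) x₀ t
    rwa [mul_one] at this

theorem eB₁_smul :
    T.eB₁ ⟨i + p, A.redCochains.smul r φ⟩ = i.negOnePow • (eAct r * T.eB₁ ⟨p, φ⟩) :=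
  chainEnd_ext fun x₀ t => by
    change T.B₁ _ _ = i.negOnePow • chainAct r (T.B₁ _ _)
    rw [B₁_cw, B₁_cw]
    exact connesOneCh_smulC r (incl φ) x₀ t

theorem eRho_smul_left :
    T.eRho ⟨i + p, A.redCochains.smul r φ⟩ ψ = eAct r * T.eRho ⟨p, φ⟩ ψ :=
  chainEnd_ext fun x₀ t => by
    change T.rho _ _ _ = chainAct r (T.rho _ _ _)
    rw [rho_cw, rho_cw]
    exact rhoCh_smulC_left r (incl φ) (incl ψ.2) x₀ t

theorem eRho_smul_right : T.eRho ψ ⟨i + p, A.redCochains.smul r φ⟩ =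
    (i * ψ.1).negOnePow • (eAct r * T.eRho ψ ⟨p, φ⟩) :=
  chainEnd_ext fun x₀ t => by
    change T.rho _ _ _ = (i * ψ.1).negOnePow • chainAct r (T.rho _ _ _)
    rw [rho_cw, rho_cw]
    exact rhoCh_smulC_right r (incl ψ.2) (incl φ) x₀ t

end Smul

/-! ### The signs of the module structure -/

variable (y z : A.redCochains.shift.Homog)

/-- `(-1)^{|y|} ℒ_y`, as a function of `y ∈ L[1]`. -/
def sLie : A.ChainEnd := (y.1 + 1).negOnePow • T.eLie (unshift y)

/-- `(-1)^{|y| + 1} b¹_y`, as a function of `y ∈ L[1]`. -/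
def sb₁ : A.ChainEnd := y.1.negOnePow • T.eb₁ (unshift y)

/-- `(-1)^{|y| + 1} B¹_y`, as a function of `y ∈ L[1]`. -/
def sB₁ : A.ChainEnd := y.1.negOnePow • T.eB₁ (unshift y)

/-- `(-1)^{|y| + |z|} ρ_{y,z}`, as a function of `y, z ∈ L[1]`. -/
def sRho : A.ChainEnd := (y.1 + z.1).negOnePow • T.eRho (unshift y) (unshift z)

theorem isAdditive_sLie : IsAdditive T.sLie := fun d y y' =>
  (congrArg ((d + 1).negOnePow • ·) (T.isAdditive_eLie.unshift d y y')).trans (smul_add _ _ _)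

theorem isAdditive_sb₁ : IsAdditive T.sb₁ := fun d y y' =>
  (congrArg (d.negOnePow • ·) (T.isAdditive_eb₁.unshift d y y')).trans (smul_add _ _ _)

theorem isAdditive_sB₁ : IsAdditive T.sB₁ := fun d y y' =>
  (congrArg (d.negOnePow • ·) (T.isAdditive_eB₁.unshift d y y')).trans (smul_add _ _ _)

theorem isAdditive_sRho_left : IsAdditive fun y => T.sRho y z := fun d y y' =>
  (congrArg ((d + z.1).negOnePow • ·) ((T.isAdditive_eRho_left _).unshift d y y')).trans
    (smul_add _ _ _)

theorem isAdditive_sRho_right : IsAdditive (T.sRho y) := fun d z z' =>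
  (congrArg ((y.1 + d).negOnePow • ·) ((T.isAdditive_eRho_right _).unshift d z z')).trans
    (smul_add _ _ _)

section Smul

variable {i d : ℤ} (r : 𝓡 i) (y : A.redCochains.shift.deg d) (z : A.redCochains.shift.Homog)

theorem sLie_smul : T.sLie ⟨i + d, A.redCochains.shift.smul r y⟩ = eAct r * T.sLie ⟨d, y⟩ := by
  rw [sLie, T.isAdditive_eLie.unshift_smul r y, sLie, mul_smul_comm, negOnePow_smul_smul]
  refine (congrArg (_ • ·) (T.eLie_smul r _)).trans (negOnePow_smul_congr ?_ rfl)
  push_cast; grind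

theorem sb₁_smul : T.sb₁ ⟨i + d, A.redCochains.shift.smul r y⟩ =
    i.negOnePow • (eAct r * T.sb₁ ⟨d, y⟩) := by
  rw [sb₁, T.isAdditive_eb₁.unshift_smul r y, sb₁, mul_smul_comm, negOnePow_smul_smul,
    negOnePow_smul_smul]
  refine (congrArg (_ • ·) (T.eb₁_smul r _)).trans ?_
  rw [negOnePow_smul_smul]
  exact negOnePow_smul_congr (by push_cast; grind) rfl

theorem sB₁_smul : T.sB₁ ⟨i + d, A.redCochains.shift.smul r y⟩ =
    i.negOnePow • (eAct r * T.sB₁ ⟨d, y⟩) := by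
  rw [sB₁, T.isAdditive_eB₁.unshift_smul r y, sB₁, mul_smul_comm, negOnePow_smul_smul,
    negOnePow_smul_smul]
  refine (congrArg (_ • ·) (T.eB₁_smul r _)).trans ?_
  rw [negOnePow_smul_smul]
  exact negOnePow_smul_congr (by push_cast; grind) rfl

theorem sRho_smul_left : T.sRho ⟨i + d, A.redCochains.shift.smul r y⟩ z =
    eAct r * T.sRho ⟨d, y⟩ z := by
  rw [sRho, (T.isAdditive_eRho_left _).unshift_smul r y, sRho, mul_smul_comm, negOnePow_smul_smul]
  refine (congrArg (_ • ·) (T.eRho_smul_left r _ _)).trans (negOnePow_smul_congr ?_ rfl)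
  push_cast; grind

theorem sRho_smul_right : T.sRho z ⟨i + d, A.redCochains.shift.smul r y⟩ =
    (i * (z.1 + 1)).negOnePow • (eAct r * T.sRho z ⟨d, y⟩) := by
  rw [sRho, (T.isAdditive_eRho_right _).unshift_smul r y, sRho, mul_smul_comm, negOnePow_smul_smul,
    negOnePow_smul_smul]
  refine (congrArg (_ • ·) (T.eRho_smul_right r _ _)).trans ?_
  rw [negOnePow_smul_smul]
  exact negOnePow_smul_congr (by simp only [unshift]; push_cast; grind) rfl

end Smul

/-! ### The identities of the module structure, before the extension to series -/

theorem eB_sLie : T.eB * T.sLie y + y.1.negOnePow • (T.sLie y * T.eB) = 0 := by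
  have h := T.eB_eLie (unshift y)
  have e : (unshift y).1 = y.1 + 1 := rfl
  simp only [sLie, e, Int.negOnePow_succ] at h ⊢
  rcases Int.units_eq_one_or y.1.negOnePow with hy | hy <;>
  · simp only [hy, one_smul, neg_neg, Units.neg_smul, mul_neg, neg_mul] at h ⊢
    rw [h]
    abel

theorem eB_sB₁ : T.eB * T.sB₁ y = 0 := by
  rw [sB₁, mul_smul_comm, eB_eB₁, smul_zero]

theorem sB₁_eB : T.sB₁ y * T.eB = 0 := by
  rw [sB₁, smul_mul_assoc, eB₁_eB, smul_zero]

theorem sRho_eB : T.sRho y z * T.eB = 0 := by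
  rw [sRho, smul_mul_assoc, eRho_eB, smul_zero]

variable [Algebra ℚ R] (hm : IsStrictlyUnitalCurved m)

section Homog

variable {H : Type*} [AddCommGroup H] {f : A.redCochains.Homog → H} (hf : IsAdditive f)

theorem unshift_toOp_one (hf : IsAdditive f) :
    f (unshift ((redDGLA hm).toOp.homog [y])) = -f (hDiff hm (unshift y)) :=
  (redDGLA hm).unshift_homog_one hf y

theorem unshift_toOp_two (hf : IsAdditive f) : f (unshift ((redDGLA hm).toOp.homog [y, z])) =
    (y.1 + 1).negOnePow • f (hBr (unshift y) (unshift z)) :=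
  (redDGLA hm).unshift_homog_two hf y z

end Homog

theorem unshift_toOp_one_fst : ((redDGLA hm).toOp.homog [y]).1 = y.1 + 1 := by
  simp only [Op.homog, sdeg_cons, sdeg_nil, add_zero]

theorem unshift_toOp_two_fst : ((redDGLA hm).toOp.homog [y, z]).1 = y.1 + z.1 + 1 := by
  simp only [Op.homog, sdeg_cons, sdeg_nil, add_zero]

theorem sLie_toOp_one : T.sLie ((redDGLA hm).toOp.homog [y]) =
    T.eb * T.sLie y + y.1.negOnePow • (T.sLie y * T.eb) := by
  have h := T.eb_eLie (unshift y) hm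
  have e : (unshift y).1 = y.1 + 1 := rfl
  rw [sLie, unshift_toOp_one y hm T.isAdditive_eLie, unshift_toOp_one_fst]
  simp only [sLie, e, Int.negOnePow_succ] at h ⊢
  rcases Int.units_eq_one_or y.1.negOnePow with hy | hy <;>
  · simp only [hy, one_smul, neg_neg, Units.neg_smul, mul_neg, neg_mul] at h ⊢
    rw [h]
    abel

theorem sb₁_toOp_one : T.sb₁ ((redDGLA hm).toOp.homog [y]) =
    y.1.negOnePow • (T.sb₁ y * T.eb) - T.eb * T.sb₁ y := by
  have h := T.eb_eb₁ (unshift y) hm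
  have e : (unshift y).1 = y.1 + 1 := rfl
  rw [sb₁, unshift_toOp_one y hm T.isAdditive_eb₁, unshift_toOp_one_fst]
  simp only [sb₁, e, Int.negOnePow_succ] at h ⊢
  rw [← h]
  rcases Int.units_eq_one_or y.1.negOnePow with hy | hy <;>
  · simp only [hy, one_smul, neg_neg, Units.neg_smul, mul_neg, neg_mul]
    abel

theorem sB₁_toOp_one : T.sB₁ ((redDGLA hm).toOp.homog [y]) = T.sLie y -
    (T.eb * T.sB₁ y + T.eB * T.sb₁ y) + y.1.negOnePow • (T.sB₁ y * T.eb + T.sb₁ y * T.eB) := by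
  have h := T.eb_eB₁ (unshift y) hm
  have e : (unshift y).1 = y.1 + 1 := rfl
  rw [sB₁, unshift_toOp_one y hm T.isAdditive_eB₁, unshift_toOp_one_fst]
  simp only [sb₁, sB₁, sLie, e, Int.negOnePow_succ] at h ⊢
  rw [eq_sub_iff_add_eq, ← eq_sub_iff_add_eq'] at h
  rw [h]
  rcases Int.units_eq_one_or y.1.negOnePow with hy | hy <;>
  · simp only [hy, one_smul, neg_neg, Units.neg_smul, mul_neg, neg_mul]
    abel

theorem sLie_toOp_two : T.sLie ((redDGLA hm).toOp.homog [y, z]) =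
    -(((y.1 * z.1).negOnePow * z.1.negOnePow) • (T.sLie z * T.sLie y) +
      y.1.negOnePow • (T.sLie y * T.sLie z)) := by
  have h := T.eLie_eLie (unshift y) (unshift z)
  have e : (unshift y).1 = y.1 + 1 := rfl
  have e' : (unshift z).1 = z.1 + 1 := rfl
  rw [sLie, unshift_toOp_two y z hm T.isAdditive_eLie, unshift_toOp_two_fst]
  rw [← sub_eq_iff_eq_add'] at h
  rw [← h]
  simp only [sLie, e, e', Int.negOnePow_add, add_mul, mul_add, one_mul, mul_one]
  rcases Int.units_eq_one_or y.1.negOnePow with hy | hy <;>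
  rcases Int.units_eq_one_or z.1.negOnePow with hz | hz <;>
  rcases Int.units_eq_one_or (y.1 * z.1).negOnePow with hyz | hyz <;>
  · simp only [hy, hz, hyz, one_smul, neg_neg, Units.neg_smul, mul_neg, neg_mul, mul_one,
      Int.negOnePow_one]
    abel

theorem sb₁_toOp_two : y.1.negOnePow • T.sb₁ ((redDGLA hm).toOp.homog [y, z]) =
    y.1.negOnePow • (T.sLie y * T.sb₁ z - T.sRho y ((redDGLA hm).toOp.homog [z])) -
    ((y.1 * z.1).negOnePow * y.1.negOnePow * z.1.negOnePow) • (T.sb₁ z * T.sLie y) +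
    T.sRho ((redDGLA hm).toOp.homog [y]) z - T.eb * T.sRho y z +
    (y.1.negOnePow * z.1.negOnePow) • (T.sRho y z * T.eb) := by
  have h := T.eLie_eb₁ (unshift y) (unshift z) hm
  have e : (unshift y).1 = y.1 + 1 := rfl
  have e' : (unshift z).1 = z.1 + 1 := rfl
  rw [sb₁, unshift_toOp_two y z hm T.isAdditive_eb₁, unshift_toOp_two_fst, sRho,
    unshift_toOp_one z hm (T.isAdditive_eRho_right _), unshift_toOp_one_fst, sRho,
    unshift_toOp_one y hm (T.isAdditive_eRho_left _), unshift_toOp_one_fst]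
  simp only [sLie, sb₁, sRho, e, e', Int.negOnePow_add, add_mul, mul_add, one_mul, mul_one,
    Int.negOnePow_one] at h ⊢
  rw [← sub_eq_zero] at h ⊢
  rcases Int.units_eq_one_or y.1.negOnePow with hy | hy <;>
  rcases Int.units_eq_one_or z.1.negOnePow with hz | hz <;>
  rcases Int.units_eq_one_or (y.1 * z.1).negOnePow with hyz | hyz <;>
  · simp only [hy, hz, hyz, one_smul, neg_neg, Units.neg_smul, mul_neg, neg_mul,
      mul_one] at h ⊢
    first
    | refine Eq.trans ?_ h
      abel1
    | refine Eq.trans ?_ (neg_eq_zero.2 h)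
      abel1

theorem sB₁_toOp_two : y.1.negOnePow • T.sB₁ ((redDGLA hm).toOp.homog [y, z]) =
    y.1.negOnePow • (T.sLie y * T.sB₁ z) -
    ((y.1 * z.1).negOnePow * y.1.negOnePow * z.1.negOnePow) • (T.sB₁ z * T.sLie y) -
    T.eB * T.sRho y z := by
  have h := T.eLie_eB₁ (unshift y) (unshift z)
  have e : (unshift y).1 = y.1 + 1 := rfl
  have e' : (unshift z).1 = z.1 + 1 := rfl
  rw [sB₁, unshift_toOp_two y z hm T.isAdditive_eB₁, unshift_toOp_two_fst]
  simp only [sLie, sB₁, sRho, e, e', Int.negOnePow_add, add_mul, mul_add, one_mul, mul_one,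
    Int.negOnePow_one] at h ⊢
  rw [← sub_eq_zero] at h ⊢
  rcases Int.units_eq_one_or y.1.negOnePow with hy | hy <;>
  rcases Int.units_eq_one_or z.1.negOnePow with hz | hz <;>
  rcases Int.units_eq_one_or (y.1 * z.1).negOnePow with hyz | hyz <;>
  · simp only [hy, hz, hyz, one_smul, neg_neg, Units.neg_smul, mul_neg, neg_mul,
      mul_one] at h ⊢
    first
    | refine Eq.trans ?_ h
      abel1
    | refine Eq.trans ?_ (neg_eq_zero.2 h)
      abel1

theorem sLie_sRho (t : A.redCochains.shift.Homog) :
    y.1.negOnePow • (T.sLie y * T.sRho z t) -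
      (y.1.negOnePow * z.1.negOnePow) • T.sRho y ((redDGLA hm).toOp.homog [z, t]) +
    ((y.1 * z.1).negOnePow * z.1.negOnePow) • (T.sLie z * T.sRho y t -
      y.1.negOnePow • T.sRho z ((redDGLA hm).toOp.homog [y, t])) +
    T.sRho ((redDGLA hm).toOp.homog [y, z]) t -
    (y.1.negOnePow * (z.1 * t.1).negOnePow * z.1.negOnePow * t.1.negOnePow) •
      (T.sRho y t * T.sLie z) -
    ((y.1 * z.1).negOnePow * (y.1 * t.1).negOnePow * y.1.negOnePow * z.1.negOnePow *
      t.1.negOnePow) • (T.sRho z t * T.sLie y) = 0 := by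
  have h := T.eLie_eRho (unshift y) (unshift z) (unshift t)
  have e : (unshift y).1 = y.1 + 1 := rfl
  have e' : (unshift z).1 = z.1 + 1 := rfl
  have e'' : (unshift t).1 = t.1 + 1 := rfl
  rw [sRho, sRho, sRho, sRho, sRho, unshift_toOp_two z t hm (T.isAdditive_eRho_right _),
    unshift_toOp_two_fst, unshift_toOp_two y t hm (T.isAdditive_eRho_right _),
    unshift_toOp_two_fst, unshift_toOp_two y z hm (T.isAdditive_eRho_left _),
    unshift_toOp_two_fst]
  simp only [sLie, e, e', e'', Int.negOnePow_add, add_mul, mul_add, one_mul,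
    mul_one, Int.negOnePow_one, mul_comm z.1 y.1] at h ⊢
  rw [← sub_eq_zero] at h
  rcases Int.units_eq_one_or y.1.negOnePow with hy | hy <;>
  rcases Int.units_eq_one_or z.1.negOnePow with hz | hz <;>
  rcases Int.units_eq_one_or t.1.negOnePow with ht | ht <;>
  rcases Int.units_eq_one_or (y.1 * z.1).negOnePow with hyz | hyz <;>
  rcases Int.units_eq_one_or (y.1 * t.1).negOnePow with hyt | hyt <;>
  rcases Int.units_eq_one_or (z.1 * t.1).negOnePow with hzt | hzt <;>
  · simp only [hy, hz, ht, hyz, hyt, hzt, one_smul, neg_neg, Units.neg_smul, mul_neg, neg_mul,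
      mul_one] at h ⊢
    first
    | refine Eq.trans ?_ h
      abel1
    | refine Eq.trans ?_ (neg_eq_zero.2 h)
      abel1

end ReducedOperators

end UnitalGradedQuiver

namespace UnitalGradedQuiver

namespace ReducedOperators

variable {R : Type u} [Ring R] {𝓡 : ℤ → AddSubgroup R} [GradedRing 𝓡] [IsGradedComm 𝓡]
  {A : UnitalGradedQuiver.{u, v, w} 𝓡} {m : A.cochains 1} (T : ReducedOperators A m)

/-! ### The identities of the module structure -/

/-- `d = b + zB` as a series of endomorphisms of the chains. -/
def serD : PowerSeries A.ChainEnd := PowerSeries.C T.eb + PowerSeries.X * PowerSeries.C T.eB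

variable (y z t : (LPs A).Homog)

/-- `(-1)^{|y|} ℒ_y` as a series of endomorphisms of the chains. -/
def serLie : PowerSeries A.ChainEnd := hat T.sLie y

/-- `(-1)^{|y| + 1} I_y` as a series of endomorphisms of the chains. -/
def serI : PowerSeries A.ChainEnd := hat T.sb₁ y + PowerSeries.X * hat T.sB₁ y

/-- `(-1)^{|y| + |z|} ρ_{y,z}` as a series of endomorphisms of the chains. -/
def serRho : PowerSeries A.ChainEnd := hat₂ T.sRho y z

theorem isAdditive_serLie : IsAdditive T.serLie := isAdditive_hat T.isAdditive_sLie

theorem isAdditive_serI : IsAdditive T.serI := fun d y y' => by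
  change hat T.sb₁ ⟨d, y + y'⟩ + PowerSeries.X * hat T.sB₁ ⟨d, y + y'⟩ =
    hat T.sb₁ ⟨d, y⟩ + PowerSeries.X * hat T.sB₁ ⟨d, y⟩ +
      (hat T.sb₁ ⟨d, y'⟩ + PowerSeries.X * hat T.sB₁ ⟨d, y'⟩)
  rw [isAdditive_hat T.isAdditive_sb₁ d y y', isAdditive_hat T.isAdditive_sB₁ d y y', mul_add]
  abel

theorem isAdditive_serRho_left : IsAdditive fun y => T.serRho y z :=
  isAdditive_hat₂_left z T.isAdditive_sRho_left

theorem isAdditive_serRho_right : IsAdditive (T.serRho y) :=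
  isAdditive_hat₂_right y T.isAdditive_sRho_right

theorem serLie_zHomog : T.serLie (zHomog y) = PowerSeries.X * T.serLie y :=
  hat_zHomog y T.isAdditive_sLie

variable [Algebra ℚ R] (hm : IsStrictlyUnitalCurved m)

/-- `d² = 0`, from `b² = 0`, `bB + Bb = 0` and `B² = 0`. -/
theorem serD_serD (hm : IsStrictlyUnitalCurved m) : T.serD * T.serD = 0 := by
  simp only [serD, add_mul, mul_add, mul_assoc, mul_X_mul, ← map_mul]
  rw [T.eb_eb hm, T.eB_eB, eq_neg_of_add_eq_zero_left (T.eb_eB hm)]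
  simp

theorem serLie_psOp_one : T.serLie ((psOp (redDGLA hm).toOp).homog [y]) =
    T.serD * T.serLie y + y.1.negOnePow • (T.serLie y * T.serD) := by
  have h₁ : hat T.sLie ((psOp (redDGLA hm).toOp).homog [y]) = PowerSeries.C T.eb * hat T.sLie y +
      y.1.negOnePow • (hat T.sLie y * PowerSeries.C T.eb) := by
    rw [hat_psOp_one, C_mul_hat, hat_mul_C, hat_smul, hat_add, ← sub_eq_zero, hat_sub]
    exact hat_eq_zero _ fun n => by rw [sLie_toOp_one, psCoeff_sign, sub_self]
  have h₂ : PowerSeries.C T.eB * hat T.sLie y +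
      y.1.negOnePow • (hat T.sLie y * PowerSeries.C T.eB) = 0 := by
    rw [C_mul_hat, hat_mul_C, hat_smul, hat_add]
    exact hat_eq_zero _ fun n => by rw [← psCoeff_sign y n]; exact T.eB_sLie _
  simp only [serD, serLie, add_mul, mul_add, mul_assoc, mul_X_mul]
  rw [h₁, eq_neg_of_add_eq_zero_left h₂]
  rcases Int.units_eq_one_or y.1.negOnePow with hy | hy <;>
  · simp only [hy, one_smul, neg_neg, Units.neg_smul, mul_neg]
    abel

/-- `[d, I_y] = -I_{δy} - zℒ_y`, in the signs of the module structure. -/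
theorem serI_psOp_one : T.serI ((psOp (redDGLA hm).toOp).homog [y]) =
    PowerSeries.X * T.serLie y - T.serD * T.serI y + y.1.negOnePow • (T.serI y * T.serD) := by
  have h₁ : hat T.sb₁ ((psOp (redDGLA hm).toOp).homog [y]) =
      y.1.negOnePow • (hat T.sb₁ y * PowerSeries.C T.eb) - PowerSeries.C T.eb * hat T.sb₁ y := by
    rw [hat_psOp_one, C_mul_hat, hat_mul_C, hat_smul, hat_sub, ← sub_eq_zero, hat_sub]
    exact hat_eq_zero _ fun n => by rw [sb₁_toOp_one, psCoeff_sign, sub_self]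
  have h₂ : hat T.sB₁ ((psOp (redDGLA hm).toOp).homog [y]) = hat T.sLie y -
      (PowerSeries.C T.eb * hat T.sB₁ y + PowerSeries.C T.eB * hat T.sb₁ y) +
      y.1.negOnePow • (hat T.sB₁ y * PowerSeries.C T.eb + hat T.sb₁ y * PowerSeries.C T.eB) := by
    simp only [hat_psOp_one, C_mul_hat, hat_mul_C, hat_add, hat_sub, hat_smul]
    rw [← sub_eq_zero, hat_sub]
    exact hat_eq_zero _ fun n => by rw [sB₁_toOp_one, psCoeff_sign, sub_self]
  have h₃ : PowerSeries.C T.eB * hat T.sB₁ y = 0 := by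
    rw [C_mul_hat]
    exact hat_eq_zero _ fun n => T.eB_sB₁ _
  have h₄ : hat T.sB₁ y * PowerSeries.C T.eB = 0 := by
    rw [hat_mul_C]
    exact hat_eq_zero _ fun n => T.sB₁_eB _
  simp only [serD, serLie, serI, add_mul, mul_add, mul_assoc, mul_X_mul]
  rw [h₁, h₂, h₃, h₄]
  rcases Int.units_eq_one_or y.1.negOnePow with hy | hy <;>
  · simp only [hy, one_smul, Units.neg_smul, mul_neg, mul_add, mul_sub, mul_zero]
    abel

theorem serLie_psOp_two : T.serLie ((psOp (redDGLA hm).toOp).homog [y, z]) =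
    -(((y.1 * z.1).negOnePow * z.1.negOnePow) • (T.serLie z * T.serLie y) +
      y.1.negOnePow • (T.serLie y * T.serLie z)) := by
  rw [serLie, serLie, serLie, hat_psOp_two _ _ T.isAdditive_sLie, hat_mul_hat z y,
    hat₂_swap y z, hat_mul_hat, hat₂_smul, hat₂_smul, hat₂_add, ← add_eq_zero_iff_eq_neg, hat₂_add]
  exact hat₂_eq_zero _ _ fun n k => by
    rw [sLie_toOp_two, psCoeff_sign, psCoeff_sign, psCoeff_sign_mul, neg_add_cancel]

/-- `[ℒ_y, I_z]` is `I_{[y,z]}` up to the homotopy `ρ_{y,z}` between the two. -/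
theorem serI_psOp_two : y.1.negOnePow • T.serI ((psOp (redDGLA hm).toOp).homog [y, z]) =
    y.1.negOnePow • (T.serLie y * T.serI z -
      T.serRho y ((psOp (redDGLA hm).toOp).homog [z])) -
    ((y.1 * z.1).negOnePow * y.1.negOnePow * z.1.negOnePow) • (T.serI z * T.serLie y) +
    T.serRho ((psOp (redDGLA hm).toOp).homog [y]) z - T.serD * T.serRho y z +
    (y.1.negOnePow * z.1.negOnePow) • (T.serRho y z * T.serD) := by
  have h₁ : y.1.negOnePow • hat T.sb₁ ((psOp (redDGLA hm).toOp).homog [y, z]) =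
      y.1.negOnePow • (hat T.sLie y * hat T.sb₁ z -
        hat₂ T.sRho y ((psOp (redDGLA hm).toOp).homog [z])) -
      ((y.1 * z.1).negOnePow * y.1.negOnePow * z.1.negOnePow) • (hat T.sb₁ z * hat T.sLie y) +
      hat₂ T.sRho ((psOp (redDGLA hm).toOp).homog [y]) z -
      PowerSeries.C T.eb * hat₂ T.sRho y z +
      (y.1.negOnePow * z.1.negOnePow) • (hat₂ T.sRho y z * PowerSeries.C T.eb) := by
    rw [hat_mul_hat z y, hat₂_swap y z]
    simp only [hat_psOp_two _ _ T.isAdditive_sb₁, hat_mul_hat, hat₂_psOp_one_right,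
      hat₂_psOp_one_left, C_mul_hat₂, hat₂_mul_C, hat₂_sub, hat₂_smul, hat₂_add]
    rw [← sub_eq_zero, hat₂_sub]
    exact hat₂_eq_zero _ _ fun n k => by
      have := T.sb₁_toOp_two (psCoeff y n) (psCoeff z k) hm
      rw [psCoeff_sign, psCoeff_sign, psCoeff_sign_mul] at this
      rw [this, sub_self]
  have h₂ : y.1.negOnePow • hat T.sB₁ ((psOp (redDGLA hm).toOp).homog [y, z]) =
      y.1.negOnePow • (hat T.sLie y * hat T.sB₁ z) -
      ((y.1 * z.1).negOnePow * y.1.negOnePow * z.1.negOnePow) • (hat T.sB₁ z * hat T.sLie y) -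
      PowerSeries.C T.eB * hat₂ T.sRho y z := by
    rw [hat_mul_hat z y, hat₂_swap y z]
    simp only [hat_psOp_two _ _ T.isAdditive_sB₁, hat_mul_hat, C_mul_hat₂, hat₂_sub, hat₂_smul]
    rw [← sub_eq_zero, hat₂_sub]
    exact hat₂_eq_zero _ _ fun n k => by
      have := T.sB₁_toOp_two (psCoeff y n) (psCoeff z k) hm
      rw [psCoeff_sign, psCoeff_sign, psCoeff_sign_mul] at this
      rw [this, sub_self]
  have h₃ : hat₂ T.sRho y z * PowerSeries.C T.eB = 0 := by
    rw [hat₂_mul_C]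
    exact hat₂_eq_zero _ _ fun n k => T.sRho_eB _ _
  simp only [serD, serLie, serI, serRho, add_mul, mul_add, mul_assoc, mul_X_mul]
  rw [h₃]
  rcases Int.units_eq_one_or y.1.negOnePow with hy | hy <;>
  rcases Int.units_eq_one_or z.1.negOnePow with hz | hz <;>
  rcases Int.units_eq_one_or (y.1 * z.1).negOnePow with hyz | hyz <;>
  · simp only [hy, hz, hyz, one_smul, neg_neg, Units.neg_smul, mul_neg,
      mul_one, mul_zero, add_zero, neg_eq_iff_eq_neg] at h₁ h₂ ⊢
    rw [h₁, h₂]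
    simp only [mul_neg, mul_sub]
    abel

/-- The identity for two inputs without `ε` and one with `ε`: `ρ` is compatible with the bracket. -/
theorem serLie_serRho :
    y.1.negOnePow • (T.serLie y * T.serRho z t) -
      (y.1.negOnePow * z.1.negOnePow) • T.serRho y ((psOp (redDGLA hm).toOp).homog [z, t]) +
    ((y.1 * z.1).negOnePow * z.1.negOnePow) • (T.serLie z * T.serRho y t -
      y.1.negOnePow • T.serRho z ((psOp (redDGLA hm).toOp).homog [y, t])) +
    T.serRho ((psOp (redDGLA hm).toOp).homog [y, z]) t -
    (y.1.negOnePow * (z.1 * t.1).negOnePow * z.1.negOnePow * t.1.negOnePow) •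
      (T.serRho y t * T.serLie z) -
    ((y.1 * z.1).negOnePow * (y.1 * t.1).negOnePow * y.1.negOnePow * z.1.negOnePow *
      t.1.negOnePow) • (T.serRho z t * T.serLie y) = 0 := by
  simp only [serLie, serRho]
  rw [hat_mul_hat₂ z y t, hat₃_swap₁₂ y z t, hat₂_psOp_two_right z y t T.isAdditive_sRho_right,
    hat₃_swap₁₂ y z t, hat₂_mul_hat y t z, hat₃_swap₂₃ y z t, hat₂_mul_hat z t y,
    hat₃_swap₂₃ z y t, hat₃_swap₁₂ y z t]
  simp only [hat₂_psOp_two_right _ _ _ T.isAdditive_sRho_right,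
    hat₂_psOp_two_left _ _ _ T.isAdditive_sRho_left, hat_mul_hat₂, hat₃_add, hat₃_sub, hat₃_smul]
  exact hat₃_eq_zero _ _ _ fun n k l => by
    have := T.sLie_sRho (psCoeff y n) (psCoeff z k) hm (psCoeff t l)
    simp only [psCoeff_sign, psCoeff_sign_mul] at this
    exact this

end ReducedOperators

end UnitalGradedQuiver

namespace UnitalGradedQuiver

namespace ReducedOperators

variable {R : Type u} [Ring R] {𝓡 : ℤ → AddSubgroup R} [GradedRing 𝓡] [IsGradedComm 𝓡]
  {A : UnitalGradedQuiver.{u, v, w} 𝓡} {m : A.cochains 1}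

/-! ### Homogeneous series of endomorphisms -/

variable (A) in
/-- The endomorphisms of degree `e` which commute with scalars in the graded sense. -/
def degEnd (e : ℤ) : AddSubgroup A.ChainEnd where
  carrier := {f | (∀ (d : ℤ), ∀ x ∈ A.chainDeg d, ChainEnd.toEnd A f x ∈ A.chainDeg (e + d)) ∧
    ∀ (i : ℤ) (r : 𝓡 i), f * eAct r = (i * e).negOnePow • (eAct r * f)}
  zero_mem' := ⟨fun d x _ => zero_mem _, fun i r => by rw [zero_mul, mul_zero, smul_zero]⟩
  add_mem' hf hg := ⟨fun d x hx => by
    rw [map_add]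
    exact add_mem (hf.1 d x hx) (hg.1 d x hx), fun i r => by
    rw [add_mul, mul_add, hf.2, hg.2, smul_add]⟩
  neg_mem' hf := ⟨fun d x hx => by
    rw [map_neg]
    exact neg_mem (hf.1 d x hx), fun i r => by
    rw [neg_mul, mul_neg, hf.2, smul_neg]⟩

variable (A) in
/-- The series of degree `e` of endomorphisms, where `z` has degree `2`. -/
def degSer (e : ℤ) : AddSubgroup (PowerSeries A.ChainEnd) where
  carrier := {P | ∀ n : ℕ, PowerSeries.coeff n P ∈ degEnd A (e - 2 * n)}
  zero_mem' := fun n => by rw [map_zero]; exact zero_mem _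
  add_mem' hP hQ := fun n => by rw [map_add]; exact add_mem (hP n) (hQ n)
  neg_mem' hP := fun n => by rw [map_neg]; exact neg_mem (hP n)

theorem C_mem_degSer {e : ℤ} {f : A.ChainEnd} (hf : f ∈ degEnd A e) :
    PowerSeries.C f ∈ degSer A e := fun n => by
  rw [PowerSeries.coeff_C]
  split_ifs with h
  · subst h
    simpa using hf
  · exact zero_mem _

theorem X_mul_mem_degSer {e e' : ℤ} {P : PowerSeries A.ChainEnd} (hP : P ∈ degSer A e)
    (h : e' = e + 2) : PowerSeries.X * P ∈ degSer A e' := fun n => by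
  cases n with
  | zero => rw [PowerSeries.coeff_zero_X_mul]; exact zero_mem _
  | succ n =>
    rw [PowerSeries.coeff_succ_X_mul, show e' - 2 * ((n + 1 : ℕ) : ℤ) = e - 2 * n by
      rw [h]; push_cast; ring]
    exact hP n

theorem hat_mem_degSer {f : A.redCochains.shift.Homog → A.ChainEnd} (k : ℤ)
    (hf : ∀ y, f y ∈ degEnd A (y.1 + k)) (y : (LPs A).Homog) : hat f y ∈ degSer A (y.1 + k) :=
  fun n => by
    have := hf (psCoeff y n)
    rw [show (psCoeff y n).1 + k = y.1 + k - 2 * n by simp only [psCoeff]; ring] at this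
    rwa [hat, PowerSeries.coeff_mk]

theorem hat₂_mem_degSer {g : A.redCochains.shift.Homog → A.redCochains.shift.Homog → A.ChainEnd}
    (k : ℤ) (hg : ∀ y z, g y z ∈ degEnd A (y.1 + z.1 + k)) (y z : (LPs A).Homog) :
    hat₂ g y z ∈ degSer A (y.1 + z.1 + k) := fun n => by
  rw [hat₂, PowerSeries.coeff_mk]
  refine sum_mem fun p hp => ?_
  have := hg (psCoeff y p.1) (psCoeff z p.2)
  rwa [show (psCoeff y p.1).1 + (psCoeff z p.2).1 + k = y.1 + z.1 + k - 2 * n by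
    simp only [psCoeff, ← mem_antidiagonal.1 hp]; push_cast; ring] at this

/-- Multiplication by a homogeneous scalar of `R[[z]]`, as a series of endomorphisms. -/
def serAct {i : ℤ} (r : (psRing (GrRing.ofGraded 𝓡)).deg i) : PowerSeries A.ChainEnd :=
  PowerSeries.mk fun n => eAct (𝓡 := 𝓡) (i := i - 2 * n) (psRingCoeff i n r)

theorem mul_serAct {e i : ℤ} {P : PowerSeries A.ChainEnd} (hP : P ∈ degSer A e)
    (r : (psRing (GrRing.ofGraded 𝓡)).deg i) :
    P * serAct r = (i * e).negOnePow • (serAct r * P) := by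
  ext n
  rw [Units.smul_def, map_zsmul, PowerSeries.coeff_mul, PowerSeries.coeff_mul,
    ← Finset.Nat.sum_antidiagonal_swap, Finset.smul_sum]
  refine Finset.sum_congr rfl fun p _ => ?_
  rw [serAct, Prod.fst_swap, Prod.snd_swap, PowerSeries.coeff_mk, ← Units.smul_def]
  exact ((hP p.2).2 _ _).trans (negOnePow_smul_congr (by push_cast; grind) rfl)

theorem hat_smul_left {f : A.redCochains.shift.Homog → A.ChainEnd} (hf : IsAdditive f) (k : ℤ)
    (h : ∀ {i d : ℤ} (r : 𝓡 i) (y : A.redCochains.shift.deg d),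
      f ⟨i + d, A.redCochains.shift.smul r y⟩ = (i * k).negOnePow • (eAct r * f ⟨d, y⟩))
    {i d : ℤ} (r : (psRing (GrRing.ofGraded 𝓡)).deg i) (y : (LPs A).deg d) :
    hat f ⟨i + d, (LPs A).smul r y⟩ = (i * k).negOnePow • (serAct r * hat f ⟨d, y⟩) := by
  ext n
  rw [Units.smul_def, map_zsmul, PowerSeries.coeff_mul, hat, PowerSeries.coeff_mk,
    hf.psCoeff_smul, Finset.smul_sum]
  refine Finset.sum_congr rfl fun p _ => (h _ _).trans ?_
  rw [serAct, hat, PowerSeries.coeff_mk, PowerSeries.coeff_mk, ← Units.smul_def]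
  exact negOnePow_smul_congr (by push_cast; grind) rfl

variable {g : A.redCochains.shift.Homog → A.redCochains.shift.Homog → A.ChainEnd}

theorem hat₂_smul_left (hg : ∀ z, IsAdditive fun y => g y z)
    (h : ∀ {i d : ℤ} (r : 𝓡 i) (y : A.redCochains.shift.deg d) (z),
      g ⟨i + d, A.redCochains.shift.smul r y⟩ z = eAct r * g ⟨d, y⟩ z)
    {i d : ℤ} (r : (psRing (GrRing.ofGraded 𝓡)).deg i) (y : (LPs A).deg d) (z : (LPs A).Homog) :
    hat₂ g ⟨i + d, (LPs A).smul r y⟩ z = serAct r * hat₂ g ⟨d, y⟩ z := by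
  ext n
  rw [PowerSeries.coeff_mul, hat₂, PowerSeries.coeff_mk]
  simp only [serAct, hat₂, PowerSeries.coeff_mk, Finset.mul_sum, (hg _).psCoeff_smul]
  refine (Finset.sum_congr rfl fun p _ => Finset.sum_congr rfl fun q _ => h _ _ _).trans ?_
  exact sum_antidiagonal_assoc (fun a b c => eAct (𝓡 := 𝓡) (i := i - 2 * a) (psRingCoeff i a r) *
    g (psCoeff ⟨d, y⟩ b) (psCoeff z c)) n

theorem hat₂_smul_right (hg : ∀ y, IsAdditive (g y))
    (h : ∀ {i d : ℤ} (r : 𝓡 i) (y : A.redCochains.shift.deg d) (z : A.redCochains.shift.Homog),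
      g z ⟨i + d, A.redCochains.shift.smul r y⟩ =
        (i * (z.1 + 1)).negOnePow • (eAct r * g z ⟨d, y⟩))
    {i d : ℤ} (r : (psRing (GrRing.ofGraded 𝓡)).deg i) (y : (LPs A).deg d) (z : (LPs A).Homog) :
    hat₂ g z ⟨i + d, (LPs A).smul r y⟩ =
      (i * (z.1 + 1)).negOnePow • (serAct r * hat₂ g z ⟨d, y⟩) := by
  ext n
  rw [Units.smul_def, map_zsmul, PowerSeries.coeff_mul, hat₂, PowerSeries.coeff_mk, Finset.smul_sum]
  simp only [serAct, hat₂, PowerSeries.coeff_mk, Finset.mul_sum, (hg _).psCoeff_smul,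
    Finset.smul_sum]
  rw [← sum_antidiagonal_swap₁₂ (fun a b c => ((i * (z.1 + 1)).negOnePow : ℤ) •
    (eAct (𝓡 := 𝓡) (i := i - 2 * a) (psRingCoeff i a r) * g (psCoeff z b) (psCoeff ⟨d, y⟩ c)))]
  refine Finset.sum_congr rfl fun p _ => Finset.sum_congr rfl fun q _ => (h _ _ _).trans ?_
  rw [← Units.smul_def]
  exact negOnePow_smul_congr (by simp only [psCoeff]; push_cast; grind) rfl

/-! ### The action of series on `CC_•(𝒜)[1][[z]]` -/

variable (A) in
/-- A series of endomorphisms of the reduced chains acts on the series of chains. -/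
def chainSeries : PowerSeries A.ChainEnd →+* AddMonoid.End (ℕ → A.ChainGroup) :=
  (seriesEnd A.ChainGroup).comp (PowerSeries.map (ChainEnd.toEnd A))

theorem chainSeries_apply (P : PowerSeries A.ChainEnd) (x : ℕ → A.ChainGroup) (n : ℕ) :
    chainSeries A P x n =
      ∑ p ∈ antidiagonal n, ChainEnd.toEnd A (PowerSeries.coeff p.1 P) (x p.2) := rfl

theorem chainSeries_add (P Q : PowerSeries A.ChainEnd) (x : ℕ → A.ChainGroup) :
    chainSeries A (P + Q) x = chainSeries A P x + chainSeries A Q x := by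
  rw [map_add]
  rfl

theorem chainSeries_C (f : A.ChainEnd) (x : ℕ → A.ChainGroup) :
    chainSeries A (PowerSeries.C f) x = fun n => ChainEnd.toEnd A f (x n) := by
  rw [chainSeries, RingHom.comp_apply, PowerSeries.map_C, seriesEnd_C]

theorem chainSeries_X_mul (P : PowerSeries A.ChainEnd) (x : ℕ → A.ChainGroup) :
    chainSeries A (PowerSeries.X * P) x = zmul (chainSeries A P x) := by
  rw [chainSeries, RingHom.comp_apply, map_mul, map_mul, PowerSeries.map_X]
  exact seriesEnd_X _

theorem chainSeries_mem {e d : ℤ} {P : PowerSeries A.ChainEnd} (hP : P ∈ degSer A e)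
    {x : ℕ → A.ChainGroup} (hx : ∀ n : ℕ, x n ∈ A.chainDeg (d - 2 * n)) (n : ℕ) :
    chainSeries A P x n ∈ A.chainDeg (e + d - 2 * n) := by
  rw [chainSeries_apply]
  refine sum_mem fun p hp => ?_
  have := (hP p.1).1 _ _ (hx p.2)
  rwa [show e - 2 * (p.1 : ℤ) + (d - 2 * p.2) = e + d - 2 * n by
    rw [← mem_antidiagonal.1 hp]; push_cast; ring] at this

theorem chainSeries_serAct {i : ℤ} (r : (psRing (GrRing.ofGraded 𝓡)).deg i)
    (x : ℕ → A.ChainGroup) :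
    chainSeries A (serAct r) x = (psMod A.redChains).act i r x := funext fun n => by
  rw [chainSeries_apply]
  refine Finset.sum_congr rfl fun p _ => ?_
  rw [serAct, PowerSeries.coeff_mk]
  rfl

theorem chainSeries_act {e i : ℤ} {P : PowerSeries A.ChainEnd} (hP : P ∈ degSer A e)
    (r : (psRing (GrRing.ofGraded 𝓡)).deg i) (x : ℕ → A.ChainGroup) :
    chainSeries A P ((psMod A.redChains).act i r x) =
      (i * e).negOnePow • (psMod A.redChains).act i r (chainSeries A P x) := by
  have := DFunLike.congr_fun (congrArg (chainSeries A) (mul_serAct hP r)) x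
  rw [map_mul, map_negOnePow_smul, map_mul] at this
  rw [← chainSeries_serAct, ← chainSeries_serAct]
  exact this

/-! ### Degrees of the operators -/

variable (T : ReducedOperators A m) (y z : A.redCochains.shift.Homog)

theorem mem_degEnd {n : ℤ} {F : ∀ {X Y : A.Ob}, A.Arr X Y → A.Path Y X → A.ChainGroup}
    (h : IsOperator n F) {f : A.ChainEnd}
    (hf : ∀ {X Y : A.Ob} (x₀ : A.Arr X Y) (t : A.Path Y X),
      ChainEnd.toEnd A f (cw x₀ t) = F x₀ t) : f ∈ degEnd A n :=
  ⟨fun _ _ hx => h.map_mem (f := ChainEnd.toEnd A f) hf hx,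
    fun _ r => AddMonoidHom.ext (h.map_chainAct (f := ChainEnd.toEnd A f) hf r)⟩

theorem eb_mem (hm : IsStrictlyUnitalCurved m) : T.eb ∈ degEnd A 1 :=
  mem_degEnd hm.isOperator_lie T.b_cw

theorem eB_mem : T.eB ∈ degEnd A (-1) :=
  mem_degEnd isOperator_connes T.B_cw

theorem sLie_mem : T.sLie y ∈ degEnd A (y.1 + 1) :=
  units_smul_mem _ (mem_degEnd (isOperator_lie y.2.2.2) (T.lie_cw (unshift y)))

theorem sb₁_mem (hm : IsStrictlyUnitalCurved m) : T.sb₁ y ∈ degEnd A (y.1 + 2) := by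
  rw [show y.1 + 2 = 1 + (y.1 + 1) by ring]
  exact units_smul_mem _
    (mem_degEnd (isOperator_rho hm.vanishesOnLongUnits y.2.2.2) (T.b₁_cw (unshift y)))

theorem sB₁_mem : T.sB₁ y ∈ degEnd A (y.1 + 0) := by
  rw [show y.1 + 0 = y.1 + 1 - 1 by ring]
  exact units_smul_mem _ (mem_degEnd (isOperator_connesOne y.2.2.2) (T.B₁_cw (unshift y)))

theorem sRho_mem : T.sRho y z ∈ degEnd A (y.1 + z.1 + 2) := by
  rw [show y.1 + z.1 + 2 = y.1 + 1 + (z.1 + 1) by ring]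
  exact units_smul_mem _ (mem_degEnd
    (isOperator_rho (vanishesOnLongUnits_of_reduced y.2.2.2) z.2.2.2)
    (T.rho_cw (unshift y) (unshift z)))

theorem serD_mem (hm : IsStrictlyUnitalCurved m) : T.serD ∈ degSer A 1 :=
  add_mem (C_mem_degSer (T.eb_mem hm)) (X_mul_mem_degSer (C_mem_degSer T.eB_mem) (by ring))

theorem serLie_mem (y : (LPs A).Homog) : T.serLie y ∈ degSer A (y.1 + 1) :=
  hat_mem_degSer 1 T.sLie_mem y

theorem serI_mem (hm : IsStrictlyUnitalCurved m) (y : (LPs A).Homog) :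
    T.serI y ∈ degSer A (y.1 + 2) :=
  add_mem (hat_mem_degSer 2 (fun y => T.sb₁_mem y hm) y)
    (X_mul_mem_degSer (hat_mem_degSer 0 T.sB₁_mem y) (by ring))

theorem serRho_mem (y z : (LPs A).Homog) : T.serRho y z ∈ degSer A (y.1 + z.1 + 2) :=
  hat₂_mem_degSer 2 T.sRho_mem y z

section Smul

variable {i d : ℤ} (r : (psRing (GrRing.ofGraded 𝓡)).deg i) (y : (LPs A).deg d)
  (z : (LPs A).Homog)

theorem serLie_smul : T.serLie ⟨i + d, (LPs A).smul r y⟩ = serAct r * T.serLie ⟨d, y⟩ := by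
  refine (hat_smul_left T.isAdditive_sLie 0 (fun r y => ?_) r y).trans ?_
  · rw [mul_zero, Int.negOnePow_zero, one_smul, sLie_smul]
  · rw [mul_zero, Int.negOnePow_zero, one_smul, serLie]

theorem serI_smul : T.serI ⟨i + d, (LPs A).smul r y⟩ =
    i.negOnePow • (serAct r * T.serI ⟨d, y⟩) := by
  have h₁ := hat_smul_left T.isAdditive_sb₁ 1 (fun r y => by rw [mul_one, sb₁_smul]) r y
  have h₂ := hat_smul_left T.isAdditive_sB₁ 1 (fun r y => by rw [mul_one, sB₁_smul]) r y
  rw [serI, h₁, h₂, serI, mul_one, mul_add, smul_add, mul_smul_comm, mul_X_mul]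

theorem serRho_smul_left : T.serRho ⟨i + d, (LPs A).smul r y⟩ z =
    serAct r * T.serRho ⟨d, y⟩ z :=
  hat₂_smul_left T.isAdditive_sRho_left (fun r y z => T.sRho_smul_left r y z) r y z

theorem serRho_smul_right : T.serRho z ⟨i + d, (LPs A).smul r y⟩ =
    (i * (z.1 + 1)).negOnePow • (serAct r * T.serRho z ⟨d, y⟩) :=
  hat₂_smul_right T.isAdditive_sRho_right (fun r y z => T.sRho_smul_right r y z) r y z

end Smul

end ReducedOperators

end UnitalGradedQuiver

namespace UnitalGradedQuiver

namespace ReducedOperators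

variable {R : Type u} [Ring R] {𝓡 : ℤ → AddSubgroup R} [GradedRing 𝓡] [IsGradedComm 𝓡]
  {A : UnitalGradedQuiver.{u, v, w} 𝓡} {m : A.cochains 1} (T : ReducedOperators A m)

/-! ### The operations on the chains over the cone -/

/-- The operations `ℓ^M̃_k(y₁, …, y_k | ·)` as series of endomorphisms of the chains. -/
def chS : List (cone A.redCochains.shift).Homog → PowerSeries A.ChainEnd
  | [] => -T.serD
  | [y] => T.serLie (cone.fst y) + T.serI (cone.snd y)
  | [y, z] => T.serRho (cone.fst y) (cone.snd z) +
      (y.1 * z.1).negOnePow • T.serRho (cone.fst z) (cone.snd y)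
  | _ => 0

theorem chS_nil : T.chS [] = -T.serD := rfl

theorem chS_one (y : (cone A.redCochains.shift).Homog) :
    T.chS [y] = T.serLie (cone.fst y) + T.serI (cone.snd y) := rfl

theorem chS_two (y z : (cone A.redCochains.shift).Homog) :
    T.chS [y, z] = T.serRho (cone.fst y) (cone.snd z) +
      (y.1 * z.1).negOnePow • T.serRho (cone.fst z) (cone.snd y) := rfl

theorem chS_three {l : List (cone A.redCochains.shift).Homog} (hl : 3 ≤ l.length) :
    T.chS l = 0 := by
  match l, hl with
  | _ :: _ :: _ :: _, _ => rfl

theorem chainSeries_serD (x : ℕ → A.ChainGroup) : chainSeries A T.serD x = T.d x := by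
  rw [serD, chainSeries_add, chainSeries_X_mul, chainSeries_C, chainSeries_C]
  rfl

theorem chainSeries_serLie (y : (LPs A).Homog) (x : ℕ → A.ChainGroup) :
    chainSeries A (T.serLie y) x = (ldeg y).negOnePow • T.lieZ y x := funext fun n => by
  change _ = (ldeg y).negOnePow • ∑ p ∈ antidiagonal n, T.lie (lCoeff y p.1) (x p.2)
  rw [chainSeries_apply, Finset.smul_sum]
  refine Finset.sum_congr rfl fun p _ => ?_
  rw [serLie, hat, PowerSeries.coeff_mk, sLie, map_negOnePow_smul]
  exact negOnePow_smul_congr (by simp only [psCoeff, ldeg]; push_cast; grind) rfl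

theorem chainSeries_serI (y : (LPs A).Homog) (x : ℕ → A.ChainGroup) :
    chainSeries A (T.serI y) x = (ldeg y + 1).negOnePow • T.I y x := by
  have e : ∀ f : A.redCochains.Homog → A.ChainEnd, chainSeries A
      (hat (fun y : A.redCochains.shift.Homog =>
        y.1.negOnePow • f (unshift y)) y) x = (ldeg y + 1).negOnePow •
        ext (fun φ => ChainEnd.toEnd A (f φ)) y x := fun f => funext fun n => by
    change _ = (ldeg y + 1).negOnePow • ∑ p ∈ antidiagonal n,
      ChainEnd.toEnd A (f (lCoeff y p.1)) (x p.2)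
    rw [chainSeries_apply, Finset.smul_sum]
    refine Finset.sum_congr rfl fun p _ => ?_
    rw [hat, PowerSeries.coeff_mk, map_negOnePow_smul]
    exact negOnePow_smul_congr (by simp only [psCoeff, ldeg]; push_cast; grind) rfl
  rw [serI, chainSeries_add, chainSeries_X_mul]
  refine (congrArg₂ (fun a b : ℕ → A.ChainGroup => a + zmul b) (e T.eb₁) (e T.eB₁)).trans
    (funext fun n => ?_)
  change (ldeg y + 1).negOnePow • ext T.b₁ y x n +
    zmul ((ldeg y + 1).negOnePow • ext T.B₁ y x) n =
      (ldeg y + 1).negOnePow • (ext T.b₁ y x n + zmul (ext T.B₁ y x) n)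
  rw [smul_add]
  cases n with
  | zero => exact congrArg (_ + ·) (smul_zero _).symm
  | succ n => rfl

theorem chainSeries_serRho (y z : (LPs A).Homog) (x : ℕ → A.ChainGroup) :
    chainSeries A (T.serRho y z) x = (ldeg y + ldeg z).negOnePow • T.rhoZ y z x :=
  funext fun n => by
    change _ = (ldeg y + ldeg z).negOnePow • ∑ p ∈ antidiagonal n, ∑ q ∈ antidiagonal p.2,
      T.rho (lCoeff y p.1) (lCoeff z q.1) (x q.2)
    rw [← sum_antidiagonal_assoc (fun a b c => T.rho (lCoeff y a) (lCoeff z b) (x c)),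
      chainSeries_apply, Finset.smul_sum]
    refine Finset.sum_congr rfl fun p _ => ?_
    rw [serRho, hat₂, PowerSeries.coeff_mk, map_sum, Finset.smul_sum]
    refine (AddMonoidHom.finsetSum_apply _ _ _).trans ?_
    refine Finset.sum_congr rfl fun q _ => ?_
    rw [sRho, map_negOnePow_smul]
    exact negOnePow_smul_congr (by simp only [psCoeff, ldeg]; push_cast; grind) rfl

/-- The operations of the statement, which are given by explicit sums over powers of `z`,
  act through
the series `chS`. -/
theorem chOp_eq (l : List (cone A.redCochains.shift).Homog) (x : ℕ → A.ChainGroup) :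
    T.chOp l x = chainSeries A (T.chS l) x := by
  match l with
  | [] =>
    rw [chS_nil, map_neg]
    exact congrArg Neg.neg (T.chainSeries_serD x).symm
  | [y] =>
    rw [chS_one, map_add]
    exact (congrArg₂ (· + ·) (T.chainSeries_serLie _ x) (T.chainSeries_serI _ x)).symm
  | [y, z] =>
    rw [chS_two, map_add, map_negOnePow_smul]
    exact (congrArg₂ (fun a b => a + (y.1 * z.1).negOnePow • b) (T.chainSeries_serRho _ _ x)
      (T.chainSeries_serRho _ _ x)).symm
  | _ :: _ :: _ :: _ => rw [T.chS_three (by simp), map_zero]; rfl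

/-! ### Symmetry, linearity and degree -/

theorem chS_mem (hm : IsStrictlyUnitalCurved m) (l : List (cone A.redCochains.shift).Homog) :
    T.chS l ∈ degSer A (sdeg l + 1) := by
  match l with
  | [] => rw [sdeg_nil, zero_add]; exact neg_mem (T.serD_mem hm)
  | [y] =>
    rw [sdeg_cons, sdeg_nil, add_zero]
    have := T.serI_mem hm (cone.snd y)
    rw [cone.snd_fst, show y.1 - 1 + 2 = y.1 + 1 by ring] at this
    exact add_mem (T.serLie_mem (cone.fst y)) this
  | [y, z] =>
    rw [sdeg_cons, sdeg_cons, sdeg_nil, add_zero]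
    have h₁ := T.serRho_mem (cone.fst y) (cone.snd z)
    have h₂ := T.serRho_mem (cone.fst z) (cone.snd y)
    rw [cone.snd_fst, cone.fst_fst, show y.1 + (z.1 - 1) + 2 = y.1 + z.1 + 1 by ring] at h₁
    rw [cone.snd_fst, cone.fst_fst, show z.1 + (y.1 - 1) + 2 = y.1 + z.1 + 1 by ring] at h₂
    exact add_mem h₁ (units_smul_mem _ h₂)
  | _ :: _ :: _ :: _ => exact zero_mem _

theorem chS_swap₂ (y z : (cone A.redCochains.shift).Homog) :
    T.chS [y, z] = (y.1 * z.1).negOnePow • T.chS [z, y] := by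
  rw [chS_two, chS_two, smul_add, mul_comm z.1, negOnePow_smul_self, add_comm]

theorem chS_swap (l l' : List (cone A.redCochains.shift).Homog)
    (y z : (cone A.redCochains.shift).Homog) :
    T.chS (l ++ y :: z :: l') = (y.1 * z.1).negOnePow • T.chS (l ++ z :: y :: l') := by
  match l, l' with
  | [], [] => exact T.chS_swap₂ y z
  | [], _ :: _ => rw [chS_three, chS_three, smul_zero] <;> simp
  | _ :: _, _ => rw [chS_three, chS_three, smul_zero] <;> simp <;> omega

theorem chS_two_add (z : (cone A.redCochains.shift).Homog) : IsAdditive fun y => T.chS [y, z] :=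
  fun d y y' => by
    refine (congrArg₂ (fun a b => a + (d * z.1).negOnePow • b)
      ((T.isAdditive_serRho_left (cone.snd z)).fst d y y')
      ((T.isAdditive_serRho_right (cone.fst z)).snd d y y')).trans ?_
    dsimp only
    rw [smul_add, chS_two, chS_two]
    abel

theorem chS_add (l l' : List (cone A.redCochains.shift).Homog) :
    IsAdditive fun y => T.chS (l ++ y :: l') := fun d y y' => by
  match l, l' with
  | [], [] =>
    refine (congrArg₂ (· + ·) (T.isAdditive_serLie.fst d y y')
      (T.isAdditive_serI.snd d y y')).trans (add_add_add_comm _ _ _ _)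
  | [], [z] => exact T.chS_two_add z d y y'
  | [z], [] =>
    simp only [List.cons_append, List.nil_append]
    have := T.chS_two_add z d y y'
    dsimp only at this
    rw [chS_swap₂, this, smul_add, T.chS_swap₂ z, T.chS_swap₂ z]
  | [], _ :: _ :: _ => dsimp only; rw [chS_three, chS_three, chS_three, add_zero] <;> simp
  | [_], _ :: _ => dsimp only; rw [chS_three, chS_three, chS_three, add_zero] <;> simp
  | _ :: _ :: _, _ =>
    dsimp only; rw [chS_three, chS_three, chS_three, add_zero] <;> simp <;> omega

section Smul

variable {i d : ℤ} (r : (psRing (GrRing.ofGraded 𝓡)).deg i) (y : (cone A.redCochains.shift).deg d)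

theorem chS_two_smul (z : (cone A.redCochains.shift).Homog) :
    T.chS [⟨i + d, (cone A.redCochains.shift).smul r y⟩, z] = serAct r * T.chS [⟨d, y⟩, z] := by
  rw [chS_two, chS_two, (T.isAdditive_serRho_right _).snd_smul r y, mul_add]
  refine congrArg₂ (· + ·) (T.serRho_smul_left r ⟨y.1.1, y.2.1⟩ _) ?_
  rw [serRho_smul_right, negOnePow_smul_smul, negOnePow_smul_smul, mul_smul_comm]
  exact negOnePow_smul_congr (by rw [cone.fst_fst]; push_cast; grind) rfl

theorem chS_smul (l l' : List (cone A.redCochains.shift).Homog) :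
    T.chS (l ++ ⟨i + d, (cone A.redCochains.shift).smul r y⟩ :: l') =
      (i * sdeg l).negOnePow • (serAct r * T.chS (l ++ ⟨d, y⟩ :: l')) := by
  match l, l' with
  | [], [] =>
    simp only [List.nil_append]
    rw [sdeg_nil, mul_zero, Int.negOnePow_zero, one_smul, chS_one, chS_one, mul_add,
      T.isAdditive_serI.snd_smul r y, serI_smul, negOnePow_smul_self]
    exact congrArg (· + _) (T.serLie_smul r ⟨y.1.1, y.2.1⟩)
  | [], [z] =>
    simp only [List.nil_append]
    rw [sdeg_nil, mul_zero, Int.negOnePow_zero, one_smul]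
    exact T.chS_two_smul r y z
  | [z], [] =>
    simp only [List.cons_append, List.nil_append]
    rw [chS_swap₂, chS_two_smul, T.chS_swap₂ z, mul_smul_comm, negOnePow_smul_smul]
    exact negOnePow_smul_congr (by rw [sdeg_cons, sdeg_nil]; push_cast; grind) rfl
  | [], _ :: _ :: _ => rw [chS_three, chS_three, mul_zero, smul_zero] <;> simp
  | [_], _ :: _ => rw [chS_three, chS_three, mul_zero, smul_zero] <;> simp
  | _ :: _ :: _, _ => rw [chS_three, chS_three, mul_zero, smul_zero] <;> simp <;> omega

end Smul

/-! ### The module structure -/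

variable (hm : IsStrictlyUnitalCurved m)

/-- The operations `ℓ^M̃_k` on the series of chains. -/
def chMod : ModOp (cone A.redCochains.shift) (psMod A.redChains).shift where
  toFun l x := chainSeries A (T.chS l) x.2.1
  mem l x n := by
    have := chainSeries_mem (T.chS_mem hm l) x.2.2 n
    rwa [show sdeg l + 1 + (x.1 + 1) = sdeg l + x.1 + 1 + 1 by ring] at this

theorem chMod_isHom : (T.chMod hm).IsHom where
  add l l' d y y' x := by
    change chainSeries A (T.chS _) x.2.1 = _
    have := T.chS_add l l' d y y'
    dsimp only at this
    rw [this, map_add]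
    rfl
  add_right l d x x' := map_add (chainSeries A (T.chS l)) x.1 x'.1
  smul l l' i d r y x := by
    change chainSeries A (T.chS _) x.2.1 = (i * (1 + sdeg l)).negOnePow • i.negOnePow •
      (psMod A.redChains).act i r (chainSeries A (T.chS _) x.2.1)
    rw [chS_smul, map_negOnePow_smul, map_mul, negOnePow_smul_smul, ← chainSeries_serAct]
    exact negOnePow_smul_congr (by push_cast; grind) rfl
  smul_right l i d r x := by
    change chainSeries A (T.chS l) (i.negOnePow • (psMod A.redChains).act i r x.1) =
      (i * (1 + sdeg l)).negOnePow • i.negOnePow •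
        (psMod A.redChains).act i r (chainSeries A (T.chS l) x.1)
    refine (map_negOnePow_smul (chainSeries A (T.chS l)) _ _).trans
      ((congrArg (i.negOnePow • ·) (chainSeries_act (T.chS_mem hm l) r x.1)).trans ?_)
    rw [negOnePow_smul_smul]
    refine (negOnePow_smul_smul i _ _).trans ?_
    exact negOnePow_smul_congr (by push_cast; grind) rfl
  swap l l' y y' x := by
    change chainSeries A (T.chS _) x.2.1 = _
    rw [chS_swap, map_negOnePow_smul]
    rfl

end ReducedOperators

end UnitalGradedQuiver

/-! ### Vanishing of the square of the coderivation -/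

theorem IsAdditive.homog_eq_zero {S : GrRing.{u}} {V : GrMod.{u, w} S} {G : Type*} [AddCommGroup G]
    {f : V.Homog → G} (hf : IsAdditive f) {ℓ : Op V} (h : ℓ.IsHom) (l l' : List V.Homog)
    {y : V.Homog} (hy : (y.2 : V.carrier) = 0) : f (ℓ.homog (l ++ y :: l')) = 0 :=
  hf.map_zero_of_eq ((h.isAdditive l l').map_zero_of_eq hy)

namespace UnitalGradedQuiver

namespace ReducedOperators

variable {R : Type u} [Ring R] {𝓡 : ℤ → AddSubgroup R} [GradedRing 𝓡] [IsGradedComm 𝓡]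
  {A : UnitalGradedQuiver.{u, v, w} 𝓡} {m : A.cochains 1} (T : ReducedOperators A m)
  [Algebra ℚ R] (hm : IsStrictlyUnitalCurved m) (y z t : (cone A.redCochains.shift).Homog)

theorem negOnePow_sub_one (a : ℤ) : (a - 1).negOnePow = -a.negOnePow := by
  rw [← Int.negOnePow_succ]; exact negOnePow_eq_of_zmod (by push_cast; grind)

theorem negOnePow_mul_sub_one (a b : ℤ) :
    (a * (b - 1)).negOnePow = (a * b).negOnePow * a.negOnePow := by
  rw [← Int.negOnePow_add]; exact negOnePow_eq_of_zmod (by push_cast; grind)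

theorem redDGLA_psOp_isHom : (psOp (redDGLA hm).toOp).IsHom :=
  psOp_isHom (redDGLA hm).toOp_isHom (redDGLA hm).toOp_three

theorem cone_one_fst : ((coneOp (redDGLA hm).toOp).homog [y]).1 = y.1 + 1 := by
  simp only [Op.homog, sdeg_cons, sdeg_nil, add_zero]

theorem cone_two_fst : ((coneOp (redDGLA hm).toOp).homog [y, z]).1 = y.1 + z.1 + 1 := by
  simp only [Op.homog, sdeg_cons, sdeg_nil, add_zero]

theorem chS_sq_nil (hm : IsStrictlyUnitalCurved m) : T.chS [] * T.chS [] = 0 := by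
  rw [chS_nil, neg_mul_neg, T.serD_serD hm]

theorem chS_sq_one : T.chS [] * T.chS [y] + T.chS [(coneOp (redDGLA hm).toOp).homog [y]] +
    y.1.negOnePow • (T.chS [y] * T.chS []) = 0 := by
  rw [chS_nil, chS_one, chS_one, T.isAdditive_serLie.fst_one, T.isAdditive_serI.snd_one,
    serLie_zHomog, serLie_psOp_one, serI_psOp_one]
  simp only [cone.fst_fst, cone.snd_fst, negOnePow_sub_one]
  rcases Int.units_eq_one_or y.1.negOnePow with hy | hy <;>
  · simp only [hy, one_smul, neg_neg, Units.neg_smul, mul_neg, neg_mul, mul_add, add_mul]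
    abel

/-- The identity on two inputs of which at most one has an `ε`-component. By graded symmetry that input
can be taken to be the last one. -/
theorem chS_sq_two (hy : ((cone.snd y).2 : (LPs A).carrier) = 0) :
    ((1 + y.1) * z.1).negOnePow •
      (T.chS [z] * T.chS [y] + T.chS [z, (coneOp (redDGLA hm).toOp).homog [y]]) +
    y.1.negOnePow • (T.chS [y] * T.chS [z] + T.chS [y, (coneOp (redDGLA hm).toOp).homog [z]]) +
    (T.chS [] * T.chS [y, z] + T.chS [(coneOp (redDGLA hm).toOp).homog [y, z]]) +
    (y.1 + z.1).negOnePow • (T.chS [y, z] * T.chS []) = 0 := by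
  have hI : T.serI (cone.snd y) = 0 := T.isAdditive_serI.map_zero_of_eq hy
  have hR : ∀ x, T.serRho x (cone.snd y) = 0 := fun x =>
    (T.isAdditive_serRho_right x).map_zero_of_eq hy
  have h₁ : ∀ x, T.serRho x (cone.snd ((coneOp (redDGLA hm).toOp).homog [y])) = 0 := fun x => by
    rw [(T.isAdditive_serRho_right x).snd_one, neg_eq_zero]
    exact (T.isAdditive_serRho_right x).homog_eq_zero (redDGLA_psOp_isHom hm) [] [] hy
  have h₂ : ∀ x, T.serRho (cone.fst ((coneOp (redDGLA hm).toOp).homog [y])) x =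
      T.serRho ((psOp (redDGLA hm).toOp).homog [cone.fst y]) x := fun x => by
    have hz : ((zHomog (cone.snd y)).2 : (LPs A).carrier) = 0 :=
      (congrArg (zmulHom A.redCochains.shift) hy).trans (map_zero _)
    rw [(T.isAdditive_serRho_left x).fst_one (ℓ := (redDGLA hm).toOp) y,
      (T.isAdditive_serRho_left x).map_zero_of_eq hz, add_zero]
  have h₃ : T.serI ((psOp (redDGLA hm).toOp).homog [cone.snd y, cone.fst z]) = 0 :=
    T.isAdditive_serI.homog_eq_zero (redDGLA_psOp_isHom hm) [] [cone.fst z] hy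
  have e₁ := T.serLie_psOp_two (cone.fst y) (cone.fst z) hm
  have e₂ := T.serI_psOp_two (cone.fst y) (cone.snd z) hm
  simp only [chS_nil, chS_one, chS_two, hI, hR, h₁, h₂, cone.fst_homog_two,
    T.isAdditive_serI.snd_two, h₃, (T.isAdditive_serRho_right _).snd_one, add_zero, zero_add,
    smul_zero, cone_one_fst]
  simp only [cone.fst_fst, cone.snd_fst, negOnePow_sub_one, negOnePow_mul_sub_one, mul_add,
    add_mul, mul_one, one_mul, Int.negOnePow_add, mul_comm z.1 y.1] at e₁ e₂ ⊢
  rw [e₁, e₂]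
  rcases Int.units_eq_one_or y.1.negOnePow with hy | hy <;>
  rcases Int.units_eq_one_or z.1.negOnePow with hz | hz <;>
  rcases Int.units_eq_one_or (y.1 * z.1).negOnePow with hyz | hyz <;>
  · simp only [hy, hz, hyz, one_smul, neg_neg, Units.neg_smul, mul_neg, neg_mul, mul_one]
    abel

/-- The identity on three inputs of which at most one, the last, has an `ε`-component. -/
theorem chS_sq_three (hy : ((cone.snd y).2 : (LPs A).carrier) = 0)
    (hz : ((cone.snd z).2 : (LPs A).carrier) = 0) :
    y.1.negOnePow •
      (T.chS [y] * T.chS [z, t] + T.chS [y, (coneOp (redDGLA hm).toOp).homog [z, t]]) +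
    ((1 + y.1) * z.1).negOnePow •
      (T.chS [z] * T.chS [y, t] + T.chS [z, (coneOp (redDGLA hm).toOp).homog [y, t]]) +
    ((1 + y.1 + z.1) * t.1).negOnePow •
      (T.chS [t] * T.chS [y, z] + T.chS [t, (coneOp (redDGLA hm).toOp).homog [y, z]]) +
    (y.1 + z.1).negOnePow • (T.chS [y, z] * T.chS [t]) +
    (y.1 + z.1 * t.1 + t.1).negOnePow • (T.chS [y, t] * T.chS [z]) +
    (y.1 * (z.1 + t.1) + z.1 + t.1).negOnePow • (T.chS [z, t] * T.chS [y]) = 0 := by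
  have hIy : T.serI (cone.snd y) = 0 := T.isAdditive_serI.map_zero_of_eq hy
  have hIz : T.serI (cone.snd z) = 0 := T.isAdditive_serI.map_zero_of_eq hz
  have hRy : ∀ x, T.serRho x (cone.snd y) = 0 := fun x =>
    (T.isAdditive_serRho_right x).map_zero_of_eq hy
  have hRz : ∀ x, T.serRho x (cone.snd z) = 0 := fun x =>
    (T.isAdditive_serRho_right x).map_zero_of_eq hz
  have h₁ : ∀ x s, T.serRho x ((psOp (redDGLA hm).toOp).homog [cone.snd y, s]) = 0 := fun x s =>
    (T.isAdditive_serRho_right x).homog_eq_zero (redDGLA_psOp_isHom hm) [] [s] hy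
  have h₂ : ∀ x s, T.serRho x ((psOp (redDGLA hm).toOp).homog [cone.snd z, s]) = 0 := fun x s =>
    (T.isAdditive_serRho_right x).homog_eq_zero (redDGLA_psOp_isHom hm) [] [s] hz
  have h₃ : ∀ x, T.serRho x ((psOp (redDGLA hm).toOp).homog [cone.fst y, cone.snd z]) = 0 :=
    fun x => (T.isAdditive_serRho_right x).homog_eq_zero (redDGLA_psOp_isHom hm) [cone.fst y] [] hz
  have e := T.serLie_serRho (cone.fst y) (cone.fst z) (cone.snd t) hm
  simp only [chS_one, chS_two, hIy, hIz, hRy, hRz, h₁, h₂, h₃, cone.fst_homog_two,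
    (T.isAdditive_serRho_right _).snd_two, add_zero, zero_add, smul_zero, mul_zero, zero_mul,
    neg_zero, cone_two_fst]
  simp only [cone.fst_fst, cone.snd_fst, negOnePow_sub_one, negOnePow_mul_sub_one, mul_add,
    add_mul, mul_one, one_mul, Int.negOnePow_add, mul_comm t.1 y.1,
    mul_comm t.1 z.1] at e ⊢
  refine Eq.trans ?_ e
  rcases Int.units_eq_one_or y.1.negOnePow with hy | hy <;>
  rcases Int.units_eq_one_or z.1.negOnePow with hz | hz <;>
  rcases Int.units_eq_one_or t.1.negOnePow with ht | ht <;>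
  rcases Int.units_eq_one_or (y.1 * z.1).negOnePow with hyz | hyz <;>
  rcases Int.units_eq_one_or (y.1 * t.1).negOnePow with hyt | hyt <;>
  rcases Int.units_eq_one_or (z.1 * t.1).negOnePow with hzt | hzt <;>
  · simp only [hy, hz, ht, hyz, hyt, hzt, one_smul, neg_neg, Units.neg_smul, mul_neg,
      mul_one]
    abel

/-! ### The square on series of chains -/

variable (A) in
/-- The value of a series of endomorphisms of the chains at a fixed series of chains. -/
def evalSeries (x : ℕ → A.ChainGroup) : PowerSeries A.ChainEnd →+ (ℕ → A.ChainGroup) :=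
  AddMonoidHom.mk' (fun P => chainSeries A P x) fun P Q => chainSeries_add P Q x

theorem evalSeries_mul (P Q : PowerSeries A.ChainEnd) (x : ℕ → A.ChainGroup) :
    evalSeries A x (P * Q) = chainSeries A P (chainSeries A Q x) := by
  change chainSeries A (P * Q) x = _
  rw [map_mul]
  rfl

section Square

variable (x : (psMod A.redChains).shift.Homog)

theorem ofOps_isHom :
    (GOp.ofOps (coneOp (redDGLA hm).toOp) (T.chMod hm)).IsHom :=
  GOp.isHom_ofOps (coneOp_isHom (redDGLA hm).toOp_isHom (redDGLA hm).toOp_three) (T.chMod_isHom hm)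

theorem sqW_nil : (GOp.ofOps (coneOp (redDGLA hm).toOp) (T.chMod hm)).sqW [] x = 0 := by
  have key := fun ξ : ℕ → A.ChainGroup => congrArg (evalSeries A ξ) (T.chS_sq_nil hm)
  simp only [evalSeries_mul, map_zero] at key
  exact key x.2.1

theorem sqW_one : (GOp.ofOps (coneOp (redDGLA hm).toOp) (T.chMod hm)).sqW [y] x = 0 := by
  have key := fun ξ : ℕ → A.ChainGroup => congrArg (evalSeries A ξ) (T.chS_sq_one hm y)
  simp only [map_add, map_negOnePow_smul, evalSeries_mul, map_zero] at key
  rw [(T.ofOps_isHom hm).sqW_one (coneOp (redDGLA hm).toOp).nil]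
  exact key x.2.1

theorem sqW_two (hy : ((cone.snd y).2 : (LPs A).carrier) = 0) :
    (GOp.ofOps (coneOp (redDGLA hm).toOp) (T.chMod hm)).sqW [y, z] x = 0 := by
  have key := fun ξ : ℕ → A.ChainGroup => congrArg (evalSeries A ξ) (T.chS_sq_two hm y z hy)
  simp only [map_add, map_negOnePow_smul, evalSeries_mul, map_zero] at key
  rw [(T.ofOps_isHom hm).sqW_two (coneOp (redDGLA hm).toOp).nil]
  exact key x.2.1

theorem chMod_three (l : List (cone A.redCochains.shift).Homog)
    (x : (psMod A.redChains).shift.Homog) (hl : 3 ≤ l.length) : (T.chMod hm).toFun l x = 0 := by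
  change chainSeries A (T.chS l) x.2.1 = (0 : ℕ → A.ChainGroup)
  rw [T.chS_three hl, map_zero]
  rfl

theorem sqW_three (hy : ((cone.snd y).2 : (LPs A).carrier) = 0)
    (hz : ((cone.snd z).2 : (LPs A).carrier) = 0) :
    (GOp.ofOps (coneOp (redDGLA hm).toOp) (T.chMod hm)).sqW [y, z, t] x = 0 := by
  have key := fun ξ : ℕ → A.ChainGroup => congrArg (evalSeries A ξ) (T.chS_sq_three hm y z t hy hz)
  simp only [map_add, map_negOnePow_smul, evalSeries_mul, map_zero] at key
  rw [(T.ofOps_isHom hm).sqW_three (coneOp (redDGLA hm).toOp).nil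
    (coneOp_three (redDGLA hm).toOp_three) (T.chMod_three hm)]
  exact key x.2.1

end Square

theorem epsWeight_eq_zero {y : (cone A.redCochains.shift).Homog} (h : GOp.epsWeight y = 0) :
    ((cone.snd y).2 : (LPs A).carrier) = 0 := by
  by_contra hy
  exact one_ne_zero ((if_neg hy).symm.trans h)

theorem chMod_eq_zero (l : List (cone A.redCochains.shift).Homog)
    (x : (psMod A.redChains).shift.Homog) (hl : 2 ≤ l.length)
    (hw : (l.map GOp.epsWeight).sum = 0) : (T.chMod hm).toFun l x = 0 := by
  match l, hl with
  | [y, z], _ =>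
    simp only [List.map_cons, List.map_nil, List.sum_cons, List.sum_nil, add_zero,
      Nat.add_eq_zero_iff] at hw
    change chainSeries A (T.chS [y, z]) x.2.1 = (0 : ℕ → A.ChainGroup)
    rw [chS_two, (T.isAdditive_serRho_right _).map_zero_of_eq (epsWeight_eq_zero hw.1),
      (T.isAdditive_serRho_right _).map_zero_of_eq (epsWeight_eq_zero hw.2), smul_zero, add_zero,
      map_zero]
    rfl
  | _ :: _ :: _ :: _, _ => exact T.chMod_three hm _ x (by simp)

/-- The square of the coderivation has no component with at most one `ε`. -/
theorem sqW_eq_zero (l : List (cone A.redCochains.shift).Homog)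
    (x : (psMod A.redChains).shift.Homog) (hw : (l.map GOp.epsWeight).sum ≤ 1) :
    (GOp.ofOps (coneOp (redDGLA hm).toOp) (T.chMod hm)).sqW l x = 0 := by
  have swap := (T.ofOps_isHom hm).sqW_swap (coneOp (redDGLA hm).toOp).nil
  match l with
  | [] => exact T.sqW_nil hm x
  | [y] => exact T.sqW_one hm y x
  | [y, z] =>
    simp only [List.map_cons, List.map_nil, List.sum_cons, List.sum_nil, add_zero] at hw
    by_cases hy : GOp.epsWeight y = 0
    · exact T.sqW_two hm y z x (epsWeight_eq_zero hy)
    · refine (swap [] [] y z x).trans ?_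
      exact (congrArg _ (T.sqW_two hm z y x (epsWeight_eq_zero (by omega)))).trans (smul_zero _)
  | [y, z, t] =>
    simp only [List.map_cons, List.map_nil, List.sum_cons, List.sum_nil, add_zero] at hw
    have key : ∀ y z t : (cone A.redCochains.shift).Homog, GOp.epsWeight y = 0 →
        GOp.epsWeight z = 0 →
        (GOp.ofOps (coneOp (redDGLA hm).toOp) (T.chMod hm)).sqW [y, z, t] x = 0 :=
      fun y z t hy hz => T.sqW_three hm y z t x (epsWeight_eq_zero hy) (epsWeight_eq_zero hz)
    have key' : ∀ y z t : (cone A.redCochains.shift).Homog, GOp.epsWeight y = 0 →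
        GOp.epsWeight t = 0 →
        (GOp.ofOps (coneOp (redDGLA hm).toOp) (T.chMod hm)).sqW [y, z, t] x = 0 :=
      fun y z t hy ht => (swap [y] [] z t x).trans
        ((congrArg _ (key y t z hy ht)).trans (smul_zero _))
    by_cases hy : GOp.epsWeight y = 0
    · by_cases hz : GOp.epsWeight z = 0
      · exact key y z t hy hz
      · exact key' y z t hy (by omega)
    · exact (swap [] [t] y z x).trans
        ((congrArg _ (key' z y t (by omega) (by omega))).trans (smul_zero _))
  | _ :: _ :: _ :: _ :: _ =>
    exact (T.ofOps_isHom hm).sqW_eq_zero_of_four_le (coneOp_three (redDGLA hm).toOp_three)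
      (T.chMod_three hm) GOp.epsWeight (T.chMod_eq_zero hm) _ (by simp) hw x

theorem chMod_isCHStructure : IsCHStructure (redDGLA hm).toOp (T.chMod hm) :=
  ⟨(redDGLA hm).toOp_isBinary.isLInfinityAlgebra, GOp.isLInfinityModuleMod_two
    (coneOp_isHom (redDGLA hm).toOp_isHom (redDGLA hm).toOp_three) (T.chMod_isHom hm)
    ((redDGLA hm).toOp_isBinary.coneOp.sqV_eq_zero (T.chMod_isHom hm)) (T.sqW_eq_zero hm)⟩

end ReducedOperators

end UnitalGradedQuiver

end CHStruct

end

/-- `ℒ`, `I`, `ρ` give a CH structure on `M̃ = CC_•(𝒜)[1][[z]]` (reduced) over the DGLA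
`L = CC^•(𝒜)[1]` (reduced). -/
theorem theorem6p8 {R : Type u} [Ring R] [Algebra ℚ R] (𝓡 : ℤ → AddSubgroup R) [GradedRing 𝓡]
    [IsGradedComm 𝓡] (A : UnitalGradedQuiver.{u, v, w} 𝓡) (m : A.cochains 1)
    (hm : UnitalGradedQuiver.IsStrictlyUnitalCurved m) :
    ∃ (G : DGLA A.redCochains) (T : UnitalGradedQuiver.ReducedOperators A m)
      (ℓM : ModOp (cone A.redCochains.shift) (psMod A.redChains).shift),
      (∀ (p : ℤ) (φ : A.redCochains.deg p),
        (G.diff p φ).1 = UnitalGradedQuiver.bracket m (UnitalGradedQuiver.incl φ)) ∧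
      (∀ (p q : ℤ) (φ : A.redCochains.deg p) (ψ : A.redCochains.deg q),
        (G.br p q φ ψ).1 =
          UnitalGradedQuiver.bracket (UnitalGradedQuiver.incl φ) (UnitalGradedQuiver.incl ψ)) ∧
      (∀ (l : List (cone A.redCochains.shift).Homog) (x : (psMod A.redChains).shift.Homog),
        ℓM.toFun l x = T.chOp l x.2.1) ∧
      IsCHStructure G.toOp ℓM :=
  ⟨UnitalGradedQuiver.redDGLA hm, UnitalGradedQuiver.redOps hm,
    (UnitalGradedQuiver.redOps hm).chMod hm, fun _ _ => rfl, fun _ _ _ _ => rfl,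
    fun l x => ((UnitalGradedQuiver.redOps hm).chOp_eq l x.2.1).symm,
    (UnitalGradedQuiver.redOps hm).chMod_isCHStructure hm⟩
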